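/- **Setting.** Let $\mathcal D$ be the dyadic intervals $[j2^k,(j+1)2^k)$, $j,k\in\mathbb Z$, let $c(I)$ be the center of $I$, and $\langle f,g\rangle=\int f\bar g\,dx$ for complex functions on $\mathbb R$. A differentiable function $\varphi$ is $(K,N)$-*adapted* to $I$ if $\|\varphi\|_2\le 1$ and $$|D^m\varphi(x)|\le K|I|^{-m-1/2}\Bigl(1+\tfrac{|x-c(I)|}{|I|}\Bigr)^{-N},\qquad m=0,1.$$ For $n\ge 3$ and functions $\varphi_{j,I}$, $1\le j\le n$, $I\in\mathcal D$, put $$L(f_1,\dots,f_n)=\sum_{I\in\mathcal D}|I|^{-n/2}\Bigl[\prod_{j=1}^n|\langle f_j,\varphi_{j,I}\rangle|\Bigr]\mathbf 1_I .$$ Let $h_I=|I|^{-1/2}(\mathbf 1_{I_-}-\mathbf 1_{I_+})$ be the Haar functions ($I_-$, $I_+$ the left and right halves of $I$) and $Sf=\bigl[\sum_I|\langle f,h_I\rangle|^2|I|^{-1}\mathbf 1_I\bigr]^{1/2}$. Besides $L^p$, consider the following spaces: * $H^1$, the real Hardy space with its atomic norm; and dyadic $H^1$, with norm $\|f\|_1+\|Sf\|_1$;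 * $BMO$, with seminorm $\sup_J|J|^{-1}\int_J|f-f_J|\,dx$ over all bounded intervals $J$, where $f_J$ is the mean of $f$ over $J$; and dyadic $BMO$, with seminorm $\sup_{J\in\mathcal D}\bigl[|J|^{-1}\sum_{I\in\mathcal D,\,I\subset J}|\langle f,h_I\rangle|^2\bigr]^{1/2}$ (both for locally integrable $f$). To each $j$ assign a space $X_j$, which is $L^{p_j}$ with $1\le p_j\le\infty$, one of the two Hardy spaces (then $p_j:=1$), or one of the two $BMO$ spaces (then $p_j:=\infty$). Let $\frac1s=\sum_{j=1}^n\frac1{p_j}$, and assume $0<s<\infty$. **Theorem.** (1) Suppose that no $X_j$ is dyadic $BMO$. There is an integer $N$, depending only on $n$ and the $X_j$, and for every $K$ a constant $C$, depending only on $n$, the $X_j$ and $K$, such that the following holds whenever each $\varphi_{j,I}$ is $(K,N)$-adapted to $I$, there are two distinct indices $j$ for which $\int\varphi_{j,I}=0$ for all $I$, and $\int\varphi_{j,I}=0$ for all $I$ also for each $j$ with $X_j=BMO$. For all $f_j\in X_j$, $$\|L(f_1,\dots,f_n)\|_{s}\le C\prod_{j=1}^n\|f_j\|_{X_j}\qquad\text{if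 no } X_j \text{ is } L^1,$$ $$\|L(f_1,\dots,f_n)\|_{s,\infty}=\sup_{t>0}t\,|\{L(f_1,\dots,f_n)>t\}|^{1/s}\le C\prod_{j=1}^n\|f_j\|_{X_j}\qquad\text{if some } X_j \text{ is } L^1.$$ In particular $L:\otimes_{j=1}^nL^1\to L^{1/n,\infty}$. (2) Suppose that no $X_j$ is dyadic $BMO$ and that some $X_j$ is $L^1$. Then the strong type inequality is not true in general: there are functions $\varphi_{j,I}$ with $\|\varphi_{j,I}\|_2=1$ and $\int\varphi_{j,I}=0$ for all $j$ and $I$ such that for every $N$ there is a $K$ for which every $\varphi_{j,I}$ is $(K,N)$-adapted to $I$, and for which $\|L(f_1,\dots,f_n)\|_{s}\le C\prod_j\|f_j\|_{X_j}$ for all $f_j\in X_j$ fails for every finite $C$. (3) Suppose that each $X_j$ is a Lebesgue space, dyadic $H^1$ or dyadic $BMO$. The two inequalities of (1) hold, with a constant $C$ depending only on $n$ and the $X_j$, if for each $j$ either $\varphi_{j,I}=h_I$ for all $I$ or $\varphi_{j,I}=|h_I|$ for all $I$, the first alternative occurring for at least two indices $j$ and for every $j$ with $X_j$ equal to dyadic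 $BMO$. -/

import Mathlib

open MeasureTheory Filter Topology
open scoped ENNReal NNReal

noncomputable section

namespace Paraproduct

/-- The dyadic interval `[index * 2 ^ scale, (index + 1) * 2 ^ scale)`. -/
structure DyadicInterval where
  scale : ℤ
  index : ℤ

namespace DyadicInterval

/-- The length `|I|`. -/
def length (I : DyadicInterval) : ℝ := (2 : ℝ) ^ I.scale

/-- The left end point of `I`. -/
def left (I : DyadicInterval) : ℝ := (I.index : ℝ) * I.length

/-- The center `c(I)`. -/
def center (I : DyadicInterval) : ℝ := I.left + I.length / 2

/-- `I` as a set of real numbers. -/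
def toSet (I : DyadicInterval) : Set ℝ := Set.Ico I.left (I.left + I.length)

end DyadicInterval

/-- The pairing `⟨f, g⟩ = ∫ f \bar g`. -/
def pairing (f g : ℝ → ℂ) : ℂ := ∫ x, f x * (starRingEnd ℂ) (g x)

/-- `φ` is `(K, N)`-adapted to `I`: its `L²` norm is at most one, and
`|D^m φ (x)| ≤ K |I|^(-m-1/2) (1 + |x - c(I)| / |I|)^(-N)` for `m = 0, 1`. -/
structure IsAdapted (K : ℝ) (N : ℕ) (I : DyadicInterval) (φ : ℝ → ℂ) : Prop where
  differentiable : Differentiable ℝ φ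
  l2_norm_le : eLpNorm φ 2 volume ≤ 1
  norm_le : ∀ x, ‖φ x‖ ≤
    K * I.length ^ (-(1 / 2 : ℝ)) * (1 + |x - I.center| / I.length) ^ (-(N : ℤ))
  norm_deriv_le : ∀ x, ‖deriv φ x‖ ≤
    K * I.length ^ (-(3 / 2 : ℝ)) * (1 + |x - I.center| / I.length) ^ (-(N : ℤ))

/-- All the functions of the family `(φ_I)` have integral zero. -/
def HasMeanZero (φ : DyadicInterval → ℝ → ℂ) : Prop := ∀ I, ∫ x, φ I x = 0

/-- The Haar function `h_I = |I|^(-1/2) (1_{I_-} - 1_{I_+})`. -/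
def haar (I : DyadicInterval) (x : ℝ) : ℂ :=
  ((I.length ^ (-(1 / 2 : ℝ)) : ℝ) : ℂ) *
    ((Set.Ico I.left I.center).indicator 1 x
      - (Set.Ico I.center (I.left + I.length)).indicator 1 x)

/-- The absolute value `|h_I|` of the Haar function. -/
def absHaar (I : DyadicInterval) (x : ℝ) : ℂ := ((‖haar I x‖ : ℝ) : ℂ)

/-- The sublinear operator
`L(f_1, …, f_n) = ∑_I |I|^(-n/2) (∏_j |⟨f_j, φ_{j,I}⟩|) 1_I`. -/
def sublinearOp {n : ℕ} (φ : Fin n → DyadicInterval → ℝ → ℂ) (f : Fin n → ℝ → ℂ)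
    (x : ℝ) : ℝ≥0∞ :=
  ∑' I : DyadicInterval, I.toSet.indicator
    (fun _ => ENNReal.ofReal
      (I.length ^ (-(n : ℝ) / 2) * ∏ j, ‖pairing (f j) (φ j I)‖)) x

/-- The weak norm `sup_t t |{g > t}|^(1/s)` of `L^{s,∞}`, for `0 < s < ∞`. -/
def weakNorm (g : ℝ → ℝ≥0∞) (s : ℝ≥0∞) : ℝ≥0∞ :=
  ⨆ t : ℝ≥0, (t : ℝ≥0∞) * (volume {x | (t : ℝ≥0∞) < g x}) ^ (1 / s.toReal)

/-- An atom: supported in a bounded interval `[u, v]`, bounded by `1 / (v - u)`,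
with integral zero. -/
def IsAtom (a : ℝ → ℂ) : Prop :=
  Measurable a ∧ ∃ u v : ℝ, u < v ∧ (∀ x, x ∉ Set.Icc u v → a x = 0) ∧
    (∀ x, ‖a x‖ ≤ 1 / (v - u)) ∧ ∫ x, a x = 0

/-- The atomic norm of the (classical) real Hardy space `H¹(ℝ)`: the infimum of `∑ |c_k|`
over the representations `f = ∑ c_k a_k`, convergent in `L¹`, with atoms `a_k`. -/
def hardyNorm (f : ℝ → ℂ) : ℝ≥0∞ :=
  ⨅ (c : ℕ → ℂ) (a : ℕ → ℝ → ℂ) (_ : ∀ k, IsAtom (a k))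
    (_ : Tendsto (fun m : ℕ => eLpNorm
      (fun x => f x - ∑ k ∈ Finset.range m, c k * a k x) 1 volume) atTop (𝓝 0)),
    ∑' k, ‖c k‖ₑ

/-- The dyadic square function `S f = (∑_I |⟨f, h_I⟩|² |I|⁻¹ 1_I)^(1/2)`. -/
def dyadicSquare (f : ℝ → ℂ) (x : ℝ) : ℝ≥0∞ :=
  (∑' I : DyadicInterval, I.toSet.indicator
    (fun _ => ‖pairing f (haar I)‖ₑ ^ 2 / ENNReal.ofReal I.length) x) ^ (1 / 2 : ℝ)

/-- The norm `‖f‖_1 + ‖S f‖_1` of dyadic `H¹`. -/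
def dyadicHardyNorm (f : ℝ → ℂ) : ℝ≥0∞ :=
  eLpNorm f 1 volume + eLpNorm (dyadicSquare f) 1 volume

/-- The (classical) `BMO` seminorm, a supremum over all bounded intervals. -/
def bmoNorm (f : ℝ → ℂ) : ℝ≥0∞ :=
  ⨆ (u : ℝ) (v : ℝ) (_ : u < v), (ENNReal.ofReal (v - u))⁻¹ *
    ∫⁻ x in Set.Icc u v, ‖f x - ⨍ y in Set.Icc u v, f y‖ₑ

/-- The dyadic `BMO` seminorm `sup_J (|J|⁻¹ ∑_{I ⊆ J} |⟨f, h_I⟩|²)^(1/2)`. -/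
def dyadicBMONorm (f : ℝ → ℂ) : ℝ≥0∞ :=
  ⨆ J : DyadicInterval, ((ENNReal.ofReal J.length)⁻¹ *
    ∑' I : {I : DyadicInterval // I.toSet ⊆ J.toSet},
      ‖pairing f (haar I.1)‖ₑ ^ 2) ^ (1 / 2 : ℝ)

/-- The function spaces which can stand in one of the slots of the operator. -/
inductive Space where
  | lebesgue (p : ℝ≥0∞)
  | hardy
  | dyadicHardy
  | bmo
  | dyadicBMO

namespace Space

/-- The exponent of a slot: `1` for the Hardy spaces and `∞` for the `BMO` spaces. -/
def exponent : Space → ℝ≥0∞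
  | lebesgue p => p
  | hardy => 1
  | dyadicHardy => 1
  | bmo => ∞
  | dyadicBMO => ∞

/-- The (semi)norm. -/
def norm : Space → (ℝ → ℂ) → ℝ≥0∞
  | lebesgue p, f => eLpNorm f p volume
  | hardy, f => hardyNorm f
  | dyadicHardy, f => dyadicHardyNorm f
  | bmo, f => bmoNorm f
  | dyadicBMO, f => dyadicBMONorm f

/-- Membership. -/
def Mem : Space → (ℝ → ℂ) → Prop
  | lebesgue p, f => MemLp f p volume
  | hardy, f => MemLp f 1 volume ∧ hardyNorm f < ∞
  | dyadicHardy, f => MemLp f 1 volume ∧ dyadicHardyNorm f < ∞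
  | bmo, f => LocallyIntegrable f volume ∧ bmoNorm f < ∞
  | dyadicBMO, f => LocallyIntegrable f volume ∧ dyadicBMONorm f < ∞

end Space

/-- The target exponent `s`, with `1/s = ∑_j 1/p_j`. -/
def targetExponent {n : ℕ} (X : Fin n → Space) : ℝ≥0∞ := (∑ j, (X j).exponent⁻¹)⁻¹

/-- The inequality for the operator built from `φ`, with constant `C`, on the product of the
spaces `X j`: of strong type if no slot is `L¹`, and of weak type if some slot is `L¹`. -/
def Bounds {n : ℕ} (φ : Fin n → DyadicInterval → ℝ → ℂ) (X : Fin n → Space) (C : ℝ≥0) : Prop :=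
  ∀ f : Fin n → ℝ → ℂ, (∀ j, (X j).Mem (f j)) →
    ((∀ j, X j ≠ .lebesgue 1) →
      eLpNorm (sublinearOp φ f) (targetExponent X) volume ≤ C * ∏ j, (X j).norm (f j)) ∧
    ((∃ j, X j = .lebesgue 1) →
      weakNorm (sublinearOp φ f) (targetExponent X) ≤ C * ∏ j, (X j).norm (f j))

end Paraproduct

end

open Paraproduct

open MeasureTheory Filter Topology
open scoped ENNReal NNReal

/-! Put one factor |I|^(-1/2) on each φ_{j,I}. Then L(f_1,…,f_n) = ∑_I (∏_j t_j(I)) 1_I, where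
t_j(I) is the modulus of a coefficient of f_j against an L¹-normalized function localized to I
(`sublinearOp_eq`). A function m_j is a majorant of t_j if t_j(I) ≤ m_j on I. It is a square
majorant if, for every I, the local square function (∑_{J ⊆ I} t_j(J)² 1_J)^(1/2) is at most m_j on
three quarters of I. Suppose that every slot has a majorant and that those of two slots a, b are
also square majorants. Let E(I) be the set where both local square functions of I are controlled. At
a point x, finitely many intervals with x ∈ I ∩ E(I) lie in the largest of them, and Cauchy–Schwarz
in the slots a, b at that interval gives ∑_I (∏_j t_j(I)) 1_{I ∩ E(I)} ≤ ∏_j m_j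
(`tsum_indicator_prod_le`).

Replacing I ∩ E(I) by I costs a constant in every L^q, 0 < q < ∞. The set E(I) fills half of I, and
a point of E(J) stays in E(I) for the smaller I that contain it. With the scales in decreasing
order, the increments of the q-th power of the partial sums are constant on the current intervals,
so half of their integral lives on E. At a fixed point the increments on E telescope, and an
elementary inequality lets most of the left side be absorbed
(`LargeNested.exists_lintegral_truncPow_le`). The argument uses no duality, hence q < 1 is allowed.
It also survives truncation at a height λ, which gives the weak type estimate. Together with
Hölder's inequality in strong or weak form (`exists_eLpNorm_le_of_isMajorant`,
`exists_weakBound_of_isMajorant`) it reduces the positive results to one linear statement per slot: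
the coefficients of f ∈ X_j have a (square) majorant of norm O(‖f‖) in L^{p_j}, or in weak L¹ if X_j
= L¹.

For L^p the majorant is a multiple of a maximal function. It is a square majorant because the square
function has weak type (1,1), by Calderón–Zygmund decomposition, and because this localizes
(`exists_volume_locSq_le`). For BMO the functions of integral zero allow a mean to be subtracted
first, and the majorant is constant. For dyadic BMO it is constant by Chebyshev's inequality. For
the Hardy spaces the majorant is the square function of the coefficients, or their supremum where no
square majorant is required. Its integral is estimated on atoms; for dyadic H¹ the atoms come from
grouping a Haar sum by the levels of its square function (`exists_lintegral_functional_haar_le`).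

The strong type fails with an L¹ slot because an approximate point mass at 0 has norm 1 in L¹, but
has coefficients of order 2^k on [0, 2^(-k)) for all k < m. In the other slots a function with
coefficients of order 2^(k/p_j) on these intervals has norm O(m^(1/p_j)). Then ‖L‖_s is at least of
order m^(1/s), while the product of the norms is O(m^(1/s - 1)) (`exists_not_strong_type`). -/

namespace Paraproduct

/-! ### Dyadic intervals: nesting, triples, sums over scales. -/

namespace DyadicInterval

/-- Dyadic intervals are indexed by pairs of integers. -/
def equivProd : ℤ × ℤ ≃ DyadicInterval where
  toFun p := ⟨p.1, p.2⟩
  invFun I := (I.scale, I.index)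
  left_inv _ := rfl
  right_inv _ := rfl

instance : Countable DyadicInterval := equivProd.symm.injective.countable

/-- The dyadic interval of scale `k` containing `x`. -/
noncomputable def containing (k : ℤ) (x : ℝ) : DyadicInterval := ⟨k, ⌊x / (2 : ℝ) ^ k⌋⟩

variable (I J : DyadicInterval)

lemma length_pos : 0 < I.length := zpow_pos two_pos _

@[simp] lemma length_containing (k : ℤ) (x : ℝ) : (containing k x).length = (2 : ℝ) ^ k := rfl

@[simp] lemma scale_containing (k : ℤ) (x : ℝ) : (containing k x).scale = k := rfl

lemma mem_toSet_iff {x : ℝ} : x ∈ I.toSet ↔ containing I.scale x = I := by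
  have h := I.length_pos
  obtain ⟨k, m⟩ := I
  simp only [toSet, left, Set.mem_Ico, containing, DyadicInterval.mk.injEq, true_and,
    Int.floor_eq_iff] at *
  simp only [length] at *
  rw [le_div_iff₀ h, div_lt_iff₀ h, add_mul, one_mul]

lemma mem_containing (k : ℤ) (x : ℝ) : x ∈ (containing k x).toSet :=
  (mem_toSet_iff _).2 rfl

lemma left_mem : I.left ∈ I.toSet := ⟨le_rfl, by linarith [I.length_pos]⟩

lemma center_mem : I.center ∈ I.toSet :=
  ⟨by unfold center; linarith [I.length_pos], by unfold center; linarith [I.length_pos]⟩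

@[simp] lemma measurableSet_toSet : MeasurableSet I.toSet := measurableSet_Ico

@[simp] lemma volume_toSet : volume I.toSet = ENNReal.ofReal I.length := by
  simp [toSet]

lemma containing_of_mem {x : ℝ} (hx : x ∈ I.toSet) : containing I.scale x = I :=
  (mem_toSet_iff _).1 hx

/-- The dyadic ancestors of a point are determined by the smaller ones. -/
lemma containing_eq_of_le {i k : ℤ} (hik : i ≤ k) {x y : ℝ}
    (h : containing i x = containing i y) : containing k x = containing k y := by
  -- The index at scale `k` is the integer quotient of the index at scale `i` by `2 ^ (k - i)`.
  have key : ∀ z : ℝ, ⌊z / (2 : ℝ) ^ k⌋ = ⌊z / (2 : ℝ) ^ i⌋ / ((2 ^ (k - i).toNat : ℕ) : ℤ) := by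
    intro z
    rw [← Int.floor_div_natCast]
    congr 1
    have : ((2 ^ (k - i).toNat : ℕ) : ℝ) = (2 : ℝ) ^ (k - i) := by
      push_cast
      rw [← zpow_natCast, Int.toNat_of_nonneg (by omega)]
    rw [this, div_div, ← zpow_add₀ two_ne_zero]
    congr 2
    omega
  simp only [containing, DyadicInterval.mk.injEq, true_and] at *
  rw [key, key, h]

/-- Two dyadic intervals which meet are nested. -/
lemma subset_of_mem_of_scale_le {I J : DyadicInterval} {x : ℝ} (hI : x ∈ I.toSet)
    (hJ : x ∈ J.toSet) (h : I.scale ≤ J.scale) : I.toSet ⊆ J.toSet := by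
  intro y hy
  rw [mem_toSet_iff] at *
  rw [← hJ]
  exact containing_eq_of_le h (by rw [hy, hI])

lemma length_le_iff {I J : DyadicInterval} : I.length ≤ J.length ↔ I.scale ≤ J.scale :=
  zpow_le_zpow_iff_right₀ one_lt_two

lemma length_le_of_subset {I J : DyadicInterval} (h : I.toSet ⊆ J.toSet) :
    I.length ≤ J.length := by
  have := measure_mono (μ := volume) h
  rw [volume_toSet, volume_toSet, ENNReal.ofReal_le_ofReal_iff J.length_pos.le] at this
  exact this

lemma scale_le_of_subset {I J : DyadicInterval} (h : I.toSet ⊆ J.toSet) :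
    I.scale ≤ J.scale := length_le_iff.1 (length_le_of_subset h)

lemma eq_of_mem_of_scale_eq {I J : DyadicInterval} {x : ℝ} (hI : x ∈ I.toSet)
    (hJ : x ∈ J.toSet) (h : I.scale = J.scale) : I = J := by
  rw [mem_toSet_iff] at *
  rw [← hI, ← hJ, h]

lemma containing_eq_of_mem {I : DyadicInterval} {x y : ℝ} (hx : x ∈ I.toSet) (hy : y ∈ I.toSet)
    {k : ℤ} (h : I.scale ≤ k) : containing k x = containing k y :=
  containing_eq_of_le h (by rw [containing_of_mem I hx, containing_of_mem I hy])

lemma subset_containing {I : DyadicInterval} {x : ℝ} (hx : x ∈ I.toSet) {k : ℤ}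
    (h : I.scale ≤ k) : I.toSet ⊆ (containing k x).toSet :=
  subset_of_mem_of_scale_le hx (mem_containing k x) h

/-- The triple of a dyadic interval. -/
def triple : Set ℝ := Set.Ico (I.left - I.length) (I.left + 2 * I.length)

lemma subset_triple : I.toSet ⊆ I.triple :=
  Set.Ico_subset_Ico (by linarith [I.length_pos]) (by linarith [I.length_pos])

@[simp] lemma measurableSet_triple : MeasurableSet I.triple := measurableSet_Ico

lemma volume_triple : volume I.triple = 3 * ENNReal.ofReal I.length := by
  rw [triple, Real.volume_Ico, show I.left + 2 * I.length - (I.left - I.length) = 3 * I.length by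
    ring, ENNReal.ofReal_mul (by norm_num)]
  norm_num

lemma left_le_of_subset {I J : DyadicInterval} (h : I.toSet ⊆ J.toSet) : J.left ≤ I.left :=
  (h I.left_mem).1

lemma right_le_of_subset {I J : DyadicInterval} (h : I.toSet ⊆ J.toSet) :
    I.left + I.length ≤ J.left + J.length := by
  have := (Set.Ico_subset_Ico_iff (a₁ := I.left) (b₁ := I.left + I.length)
    (by linarith [I.length_pos])).1 h
  exact this.2

lemma triple_subset_triple {I J : DyadicInterval} (h : I.toSet ⊆ J.toSet) :
    I.triple ⊆ J.triple :=
  Set.Ico_subset_Ico (by linarith [left_le_of_subset h, length_le_of_subset h])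
    (by linarith [right_le_of_subset h, length_le_of_subset h])

/-- A sum over dyadic intervals of multiples of indicators is a sum over scales. -/
lemma tsum_indicator_eq (c : DyadicInterval → ℝ≥0∞) (x : ℝ) :
    ∑' I : DyadicInterval, I.toSet.indicator (fun _ => c I) x = ∑' k : ℤ, c (containing k x) := by
  rw [← equivProd.tsum_eq]
  refine (ENNReal.tsum_prod (f := fun k m =>
    (⟨k, m⟩ : DyadicInterval).toSet.indicator (fun _ => c ⟨k, m⟩) x)).trans ?_
  refine tsum_congr fun k => ?_
  rw [tsum_eq_single ⌊x / (2 : ℝ) ^ k⌋]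
  · exact Set.indicator_of_mem (mem_containing k x) _
  · intro m hm
    refine Set.indicator_of_notMem (fun h => hm ?_) _
    have := (mem_toSet_iff _).1 h
    simp only [containing, DyadicInterval.mk.injEq, true_and] at this
    exact this.symm

/-- The integral over the line is the sum over the dyadic intervals of a given scale. -/
lemma lintegral_eq_tsum (k : ℤ) (h : ℝ → ℝ≥0∞) :
    ∫⁻ x, h x = ∑' m : ℤ, ∫⁻ x in (⟨k, m⟩ : DyadicInterval).toSet, h x := by
  rw [← lintegral_iUnion (fun m => measurableSet_toSet _), ← setLIntegral_univ]
  · congr 2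
    refine (Set.eq_univ_of_forall fun x => Set.mem_iUnion.2 ⟨⌊x / (2 : ℝ) ^ k⌋, ?_⟩).symm
    exact mem_containing k x
  · intro m m' hmm
    refine Set.disjoint_left.2 fun x hx hx' => hmm ?_
    have := eq_of_mem_of_scale_eq hx hx' rfl
    simpa using this

/-- If `h` is constant on the dyadic intervals of scale `k`, and `E` fills at least half of each
of them, then `∫ h ≤ 2 ∫_E h`. -/
lemma lintegral_le_two_mul_of_half {k : ℤ} {h : ℝ → ℝ≥0∞}
    (hh : ∀ x y, containing k x = containing k y → h x = h y) {E : Set ℝ} (hE : MeasurableSet E)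
    (hhalf : ∀ I : DyadicInterval, I.scale = k → volume I.toSet ≤ 2 * volume (E ∩ I.toSet)) :
    ∫⁻ x, h x ≤ 2 * ∫⁻ x in E, h x := by
  rw [← lintegral_indicator hE, lintegral_eq_tsum k, lintegral_eq_tsum k, ← ENNReal.tsum_mul_left]
  refine ENNReal.tsum_le_tsum fun m => ?_
  set I : DyadicInterval := ⟨k, m⟩
  have hc : ∀ x ∈ I.toSet, h x = h I.left := fun x hx =>
    hh _ _ (containing_eq_of_mem hx I.left_mem le_rfl)
  have hc' : ∀ x ∈ I.toSet, E.indicator h x = E.indicator (fun _ => h I.left) x := by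
    intro x hx
    by_cases hxE : x ∈ E <;> simp [hxE, hc x hx]
  rw [setLIntegral_congr_fun I.measurableSet_toSet hc,
    setLIntegral_congr_fun I.measurableSet_toSet hc', lintegral_indicator hE, setLIntegral_const,
    setLIntegral_const, Measure.restrict_apply hE]
  calc h I.left * volume I.toSet ≤ h I.left * (2 * volume (E ∩ I.toSet)) := by
        gcongr; exact hhalf I rfl
    _ = 2 * (h I.left * volume (E ∩ I.toSet)) := by ring

lemma measurable_containing_comp {α : Type*} [MeasurableSpace α] (k : ℤ)
    (c : DyadicInterval → α) : Measurable fun x => c (containing k x) := by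
  have : (fun x => c (containing k x)) = (fun m : ℤ => c ⟨k, m⟩) ∘ fun x : ℝ => ⌊x / (2 : ℝ) ^ k⌋ :=
    rfl
  rw [this]
  exact (measurable_of_countable _).comp (Int.measurable_floor.comp (measurable_id.div_const _))

end DyadicInterval

end Paraproduct

/-! ### Domination of a finite dyadic sum by its localization to large nested sets. -/

namespace Paraproduct

open DyadicInterval

/-- Since `P` is upward closed, it selects a final segment of the indices, and both sums telescope
over that segment from the same starting point. If `P` never holds the segment is empty and `i₀ =
L`. -/
lemma exists_stopping_index (u : ℕ → ℝ) (P : ℕ → Prop) [DecidablePred P]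
    (hP : ∀ i, P i → P (i + 1)) (ψ : ℝ → ℝ) (L : ℕ) :
    ∃ i₀ ≤ L, (∑ i ∈ Finset.range L, (if P i then
        ψ (∑ l ∈ Finset.range (i + 1), u l) - ψ (∑ l ∈ Finset.range i, u l) else 0)
      = ψ (∑ l ∈ Finset.range L, u l) - ψ (∑ l ∈ Finset.range i₀, u l)) ∧
      ∑ i ∈ Finset.range L, (if P i then u i else 0)
      = ∑ l ∈ Finset.range L, u l - ∑ l ∈ Finset.range i₀, u l := by
  induction L with
  | zero => exact ⟨0, le_rfl, by simp, by simp⟩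
  | succ L ih =>
    by_cases h : P L
    · obtain ⟨i₀, h0, h1, h2⟩ := ih
      refine ⟨i₀, by omega, ?_, ?_⟩
      · rw [Finset.sum_range_succ, h1, if_pos h]; ring
      · rw [Finset.sum_range_succ, h2, if_pos h, Finset.sum_range_succ]; ring
    · have hn : ∀ i ≤ L, ¬ P i := by
        intro i hi hPi
        refine h ?_
        exact Nat.le_induction (P := fun n _ => P n) hPi (fun n _ hn => hP n hn) L hi
      refine ⟨L + 1, le_rfl, ?_, ?_⟩
      · rw [sub_self]
        exact Finset.sum_eq_zero fun i hi => if_neg (hn i (by simpa [Nat.lt_succ_iff] using hi))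
      · rw [sub_self]
        exact Finset.sum_eq_zero fun i hi => if_neg (hn i (by simpa [Nat.lt_succ_iff] using hi))

/-- The truncated power `min(t, λ)^q`. -/
noncomputable def truncPow (lam q t : ℝ) : ℝ := (min t lam) ^ q

lemma truncPow_nonneg {lam q t : ℝ} (hl : 0 ≤ lam) (ht : 0 ≤ t) : 0 ≤ truncPow lam q t :=
  Real.rpow_nonneg (le_min ht hl) _

lemma truncPow_mono {lam q t t' : ℝ} (hl : 0 ≤ lam) (hq : 0 ≤ q) (ht : 0 ≤ t) (h : t ≤ t') :
    truncPow lam q t ≤ truncPow lam q t' :=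
  Real.rpow_le_rpow (le_min ht hl) (min_le_min_right _ h) hq

lemma truncPow_zero {lam q : ℝ} (hl : 0 ≤ lam) (hq : 0 < q) : truncPow lam q 0 = 0 := by
  rw [truncPow, min_eq_left hl, Real.zero_rpow hq.ne']

/-- Truncation preserves this half of homogeneity, which is all that the comparison of `F` with `F -
g` requires. -/
lemma truncPow_mul_le {lam q t a : ℝ} (ha : 0 ≤ a) (ha1 : a ≤ 1) (hl : 0 ≤ lam) (hq : 0 < q)
    (ht : 0 ≤ t) : a ^ q * truncPow lam q t ≤ truncPow lam q (a * t) := by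
  rw [truncPow, truncPow, ← Real.mul_rpow ha (le_min ht hl)]
  refine Real.rpow_le_rpow (mul_nonneg ha (le_min ht hl)) (le_min ?_ ?_) hq.le
  · gcongr; exact min_le_left _ _
  · calc a * min t lam ≤ 1 * lam := by gcongr; exact min_le_right _ _
      _ = lam := one_mul _

/-- Let `a ^ q = 3 / 4`. If `g ≤ (1 - a) F`, then `F - g ≥ a F` and the difference is at most a
quarter of the power of `F`. Otherwise `F` is at most `g / (1 - a)`, and the power of `g` dominates
up to `(1 - a) ^ (-q)`. The coefficient `1 / 4` leaves `1 / 2` after the factor 2 that is lost in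
passing to the large sets. -/
lemma exists_truncPow_sub_le {q : ℝ} (hq : 0 < q) : ∃ C : ℝ, 0 ≤ C ∧ ∀ lam F g : ℝ, 0 ≤ lam →
    0 ≤ g → g ≤ F → truncPow lam q F - truncPow lam q (F - g) ≤
      1 / 4 * truncPow lam q F + C * truncPow lam q g := by
  set a : ℝ := (3 / 4 : ℝ) ^ q⁻¹ with ha
  have ha0 : 0 < a := by positivity
  have ha1 : a < 1 := Real.rpow_lt_one (by norm_num) (by norm_num) (by positivity)
  have haq : a ^ q = 3 / 4 := by
    rw [ha, ← Real.rpow_mul (by norm_num), inv_mul_cancel₀ hq.ne', Real.rpow_one]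
  have hd : 0 < (1 - a) ^ q := Real.rpow_pos_of_pos (by linarith) _
  refine ⟨((1 - a) ^ q)⁻¹, by positivity, fun lam F g hl hg hgF => ?_⟩
  have hF := hg.trans hgF
  by_cases h : g ≤ (1 - a) * F
  · have h1 := truncPow_mul_le (t := F) ha0.le ha1.le hl hq hF
    have h2 := truncPow_mono (q := q) hl hq.le (mul_nonneg ha0.le hF)
      (show a * F ≤ F - g by linarith)
    have h3 : 0 ≤ ((1 - a) ^ q)⁻¹ * truncPow lam q g := by
      have := truncPow_nonneg (q := q) hl hg
      positivity
    rw [haq] at h1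
    linarith
  · push Not at h
    have h1 := truncPow_mul_le (t := F) (a := 1 - a) (by linarith) (by linarith) hl hq hF
    have h2 := truncPow_mono (q := q) hl hq.le (mul_nonneg (by linarith) hF) h.le
    have h3 : truncPow lam q F ≤ ((1 - a) ^ q)⁻¹ * truncPow lam q g := by
      rw [← div_eq_inv_mul, le_div_iff₀ hd]
      linarith
    have h4 := truncPow_nonneg (q := q) hl hF
    have h5 := truncPow_nonneg (q := q) hl (show 0 ≤ F - g by linarith)
    linarith

/-- The term `X / 2` on the right is subtracted from both sides, which is legitimate because `X` is
finite. -/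
lemma le_of_absorb {X Y : ℝ≥0∞} {C : ℝ} (hX : X ≠ ∞)
    (h : X ≤ 2 * (ENNReal.ofReal (1 / 4) * X + ENNReal.ofReal C * Y)) :
    X ≤ (4 * C.toNNReal : ℝ≥0) * Y := by
  have h4 : ENNReal.ofReal (1 / 4) = 4⁻¹ := by
    rw [one_div, ENNReal.ofReal_inv_of_pos (by norm_num)]; norm_num
  have h2 : (2 : ℝ≥0∞) * (4⁻¹ * X) = X / 2 := by
    rw [← mul_assoc, div_eq_mul_inv, mul_comm X]
    congr 1
    rw [show (4 : ℝ≥0∞) = 2 * 2 by norm_num, ENNReal.mul_inv (by simp) (by simp), ← mul_assoc,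
      ENNReal.mul_inv_cancel (by simp) (by simp), one_mul]
  rw [h4, mul_add, h2] at h
  have h3 : X / 2 ≤ 2 * (ENNReal.ofReal C * Y) := by
    refine ENNReal.le_of_add_le_add_left (a := X / 2) (ENNReal.div_ne_top hX (by simp)) ?_
    rwa [ENNReal.add_halves]
  calc X = 2 * (X / 2) := (ENNReal.mul_div_cancel (by simp) (by simp)).symm
    _ ≤ 2 * (2 * (ENNReal.ofReal C * Y)) := by gcongr
    _ = _ := by
      rw [← mul_assoc, ← mul_assoc]
      push_cast
      norm_num [ENNReal.ofReal]

/-- A nested family of large subsets of the dyadic intervals. -/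
structure LargeNested (E : DyadicInterval → Set ℝ) : Prop where
  measurable : ∀ I, MeasurableSet (E I)
  half : ∀ I : DyadicInterval, volume I.toSet ≤ 2 * volume (E I ∩ I.toSet)
  nested : ∀ (I J : DyadicInterval) (x : ℝ), x ∈ I.toSet → I.toSet ⊆ J.toSet → x ∈ E J → x ∈ E I

/-- Let `T i` be the sum over the `i` largest scales and `ψ` the truncated power. The increment `D
i` of `ψ ∘ T` is constant on the intervals of scale `m - i`, so its integral is at most twice its
integral over `E`. At a fixed point, nestedness makes the scales whose set `E` contains the point a
final segment. The increments there add up to `ψ F - ψ (F - g)`, where `F` is the full and `g` the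
localized sum, and `exists_truncPow_sub_le` allows `ψ F` to be absorbed. -/
lemma LargeNested.exists_lintegral_truncPow_le {q : ℝ} (hq : 0 < q) : ∃ C : ℝ≥0,
    ∀ {E : DyadicInterval → Set ℝ}, LargeNested E → ∀ (c : DyadicInterval → ℝ) (m : ℤ) (L : ℕ)
    (lam : ℝ) (_ : 0 ≤ lam) (_ : ∀ I, 0 ≤ c I) (S : Finset DyadicInterval)
    (_ : ∀ I, I ∉ S → c I = 0),
    ∫⁻ x, ENNReal.ofReal (truncPow lam q
        (∑ i ∈ Finset.range L, c (containing (m - i) x))) ≤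
      C * ∫⁻ x, ENNReal.ofReal (truncPow lam q (∑ i ∈ Finset.range L,
        (E (containing (m - i) x)).indicator (fun _ => c (containing (m - i) x)) x)) := by
  classical
  obtain ⟨C, hC, key⟩ := exists_truncPow_sub_le hq
  refine ⟨4 * C.toNNReal, fun {E} hE c m L lam hl hc S hS => ?_⟩
  set u : ℕ → ℝ → ℝ := fun i x => c (containing (m - i) x) with hu
  set T : ℕ → ℝ → ℝ := fun i x => ∑ l ∈ Finset.range i, u l x with hT
  set ψ := truncPow lam q with hψ
  set D : ℕ → ℝ → ℝ := fun i x => ψ (T (i + 1) x) - ψ (T i x) with hD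
  set E' : ℕ → Set ℝ := fun i => {x | x ∈ E (containing (m - i) x)} with hE'
  set G : ℝ → ℝ := fun x => ∑ i ∈ Finset.range L,
    (E (containing (m - i) x)).indicator (fun _ => u i x) x with hG
  have hu0 : ∀ i x, 0 ≤ u i x := fun i x => hc _
  have hT0 : ∀ i x, 0 ≤ T i x := fun i x => Finset.sum_nonneg fun l _ => hu0 l x
  have hTm : ∀ i x, T i x ≤ T (i + 1) x := fun i x => by
    simp only [hT, Finset.sum_range_succ]; linarith [hu0 i x]
  have hTmono : ∀ x, Monotone (fun i => T i x) := fun x => monotone_nat_of_le_succ fun i => hTm i x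
  have hD0 : ∀ i x, 0 ≤ D i x := fun i x =>
    sub_nonneg.2 (truncPow_mono hl hq.le (hT0 i x) (hTm i x))
  have hmeasE : ∀ i, MeasurableSet (E' i) := by
    intro i
    have : E' i = ⋃ j : ℤ, E ⟨m - i, j⟩ ∩ (⟨m - i, j⟩ : DyadicInterval).toSet := by
      ext x
      simp only [hE', Set.mem_ofPred_eq, Set.mem_iUnion, Set.mem_inter_iff]
      constructor
      · intro h
        exact ⟨_, h, mem_containing (m - i) x⟩
      · rintro ⟨j, h, hx⟩
        have := containing_of_mem _ hx
        simp only at this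
        rwa [this]
    rw [this]
    exact MeasurableSet.iUnion fun j => (hE.measurable _).inter (measurableSet_toSet _)
  have hmeasu : ∀ i, Measurable (u i) := fun i => measurable_containing_comp _ c
  have hmeasT : ∀ i, Measurable (T i) := fun i => Finset.measurable_fun_sum _ fun l _ => hmeasu l
  have hmeasψ : ∀ i, Measurable fun x => ψ (T i x) := fun i => by
    simp only [hψ, truncPow]
    exact ((hmeasT i).min measurable_const).pow_const _
  have hmeasD : ∀ i, Measurable (D i) := fun i => (hmeasψ _).sub (hmeasψ _)
  have hconst : ∀ (i : ℕ) (x y : ℝ), containing (m - i) x = containing (m - i) y →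
      ENNReal.ofReal (D i x) = ENNReal.ofReal (D i y) := by
    intro i x y hxy
    have h1 : ∀ l ≤ i, u l x = u l y := fun l hl => by
      simp only [hu]
      rw [containing_eq_of_le (by omega) hxy]
    have h2 : ∀ l ≤ i + 1, T l x = T l y := fun l hl =>
      Finset.sum_congr rfl fun l' hl' => h1 _ (by simp at hl'; omega)
    simp only [hD]
    rw [h2 _ le_rfl, h2 i (by omega)]
  have hhalf : ∀ i, ∫⁻ x, ENNReal.ofReal (D i x) ≤
      2 * ∫⁻ x, (E' i).indicator (fun x => ENNReal.ofReal (D i x)) x := by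
    intro i
    rw [lintegral_indicator (hmeasE i)]
    refine lintegral_le_two_mul_of_half (hconst i) (hmeasE i) fun I hI => ?_
    refine (hE.half I).trans (mul_le_mul' le_rfl (measure_mono fun x hx => ⟨?_, hx.2⟩))
    simp only [hE', Set.mem_ofPred_eq, ← hI, containing_of_mem _ hx.2]
    exact hx.1
  have htel : ∀ x, ψ (T L x) = ∑ i ∈ Finset.range L, D i x := by
    intro x
    rw [Finset.sum_range_sub (fun i => ψ (T i x))]
    simp [hT, hψ, truncPow_zero hl hq]
  have hsumle : ∀ x, ∑ i ∈ Finset.range L, (E' i).indicator (fun x => ENNReal.ofReal (D i x)) x ≤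
      ENNReal.ofReal (1 / 4) * ENNReal.ofReal (ψ (T L x)) +
        ENNReal.ofReal C * ENNReal.ofReal (ψ (G x)) := by
    intro x
    -- Scales decrease as `i` grows, so nestedness of `E` is upward closedness in `i`.
    obtain ⟨i₀, hi₀, h1, h2⟩ := exists_stopping_index (fun i => u i x) (fun i => x ∈ E' i)
      (fun i hi => hE.nested _ _ x (mem_containing _ _)
        (subset_containing (mem_containing _ _) (by simp; omega)) hi) ψ L
    have hGx : G x = T L x - T i₀ x := by
      rw [← h2]
      refine Finset.sum_congr rfl fun i _ => ?_
      simp only [Set.indicator, hE', Set.mem_ofPred_eq]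
    have hsum : ∑ i ∈ Finset.range L, (E' i).indicator (fun x => ENNReal.ofReal (D i x)) x
        = ENNReal.ofReal (∑ i ∈ Finset.range L, if x ∈ E' i then D i x else 0) := by
      rw [ENNReal.ofReal_sum_of_nonneg]
      · refine Finset.sum_congr rfl fun i _ => ?_
        by_cases h : x ∈ E' i <;> simp [h]
      · intro i _
        split_ifs
        exacts [hD0 i x, le_rfl]
    have hT1 : T i₀ x = T L x - G x := by rw [hGx]; ring
    have hG0 : 0 ≤ G x := by rw [hGx]; exact sub_nonneg.2 (hTmono x hi₀)
    have hGT : G x ≤ T L x := by rw [hGx]; linarith [hT0 i₀ x]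
    rw [hsum, ← ENNReal.ofReal_mul (by norm_num), ← ENNReal.ofReal_mul hC, ← ENNReal.ofReal_add]
    · refine ENNReal.ofReal_le_ofReal ?_
      have := key lam (T L x) (G x) hl hG0 hGT
      rw [← hT1] at this
      exact h1.le.trans this
    · have := truncPow_nonneg (q := q) hl (hT0 L x)
      positivity
    · have := truncPow_nonneg (q := q) hl hG0
      positivity
  -- Absorption needs a finite integral: the truncation bounds the integrand, and the finite set `S`
  -- bounds its support.
  have hfin : ∫⁻ x, ENNReal.ofReal (ψ (T L x)) ≠ ∞ := by
    set V : Set ℝ := ⋃ I ∈ S, I.toSet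
    have hV : volume V ≠ ∞ := by
      refine (lt_of_le_of_lt (measure_biUnion_finset_le _ _) ?_).ne
      exact ENNReal.sum_lt_top.2 fun I _ => by simp
    have hle : ∀ x, ENNReal.ofReal (ψ (T L x)) ≤ V.indicator (fun _ => ENNReal.ofReal (lam ^ q)) x := by
      intro x
      by_cases hx : x ∈ V
      · rw [Set.indicator_of_mem hx]
        exact ENNReal.ofReal_le_ofReal
          (Real.rpow_le_rpow (le_min (hT0 _ _) hl) (min_le_right _ _) hq.le)
      · have : T L x = 0 := Finset.sum_eq_zero fun i _ => hS _ fun h => hx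
          (Set.mem_biUnion h (mem_containing _ _))
        rw [this, hψ, truncPow_zero hl hq]
        simp
    refine ((lintegral_mono hle).trans_lt ?_).ne
    refine (lintegral_indicator_const_le _ _).trans_lt ?_
    exact ENNReal.mul_lt_top ENNReal.ofReal_lt_top hV.lt_top
  have hmain : ∫⁻ x, ENNReal.ofReal (ψ (T L x)) ≤
      2 * (ENNReal.ofReal (1 / 4) * (∫⁻ x, ENNReal.ofReal (ψ (T L x))) +
        ENNReal.ofReal C * ∫⁻ x, ENNReal.ofReal (ψ (G x))) := by
    calc ∫⁻ x, ENNReal.ofReal (ψ (T L x))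
        = ∫⁻ x, ∑ i ∈ Finset.range L, ENNReal.ofReal (D i x) := by
          refine lintegral_congr fun x => ?_
          rw [htel, ENNReal.ofReal_sum_of_nonneg fun i _ => hD0 i x]
      _ = ∑ i ∈ Finset.range L, ∫⁻ x, ENNReal.ofReal (D i x) :=
          lintegral_finsetSum _ fun i _ => (hmeasD i).ennreal_ofReal
      _ ≤ ∑ i ∈ Finset.range L,
          2 * ∫⁻ x, (E' i).indicator (fun x => ENNReal.ofReal (D i x)) x :=
          Finset.sum_le_sum fun i _ => hhalf i
      _ = 2 * ∫⁻ x, ∑ i ∈ Finset.range L, (E' i).indicator (fun x => ENNReal.ofReal (D i x)) x := by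
          rw [← Finset.mul_sum, lintegral_finsetSum _ fun i _ =>
            (hmeasD i).ennreal_ofReal.indicator (hmeasE i)]
      _ ≤ 2 * ∫⁻ x, (ENNReal.ofReal (1 / 4) * ENNReal.ofReal (ψ (T L x)) +
            ENNReal.ofReal C * ENNReal.ofReal (ψ (G x))) := by
          gcongr with x
          exact hsumle x
      _ = _ := by
          rw [lintegral_add_left ((hmeasψ L).ennreal_ofReal.const_mul _),
            lintegral_const_mul _ (hmeasψ L).ennreal_ofReal,
            lintegral_const_mul' _ _ ENNReal.ofReal_ne_top]
  exact le_of_absorb hfin hmain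

end Paraproduct

/-! ### Passage to infinite sums and removal of the truncation. -/

namespace Paraproduct

open DyadicInterval

lemma tsum_indicator_eq_sum_range {d : DyadicInterval → ℝ≥0∞} {m : ℤ} {L : ℕ}
    (h : ∀ I, d I ≠ 0 → I.scale ≤ m ∧ m - L < I.scale) (x : ℝ) :
    ∑' I : DyadicInterval, I.toSet.indicator (fun _ => d I) x =
      ∑ i ∈ Finset.range L, d (containing (m - i) x) := by
  rw [tsum_indicator_eq, tsum_eq_sum (s := (Finset.range L).image fun i : ℕ => m - (i : ℤ)),
    Finset.sum_image]
  · intro i _ j _ hij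
    simpa using hij
  · intro k hk
    by_contra h0
    obtain ⟨h1, h2⟩ := h _ h0
    rw [scale_containing] at h1 h2
    refine hk (Finset.mem_image.2 ⟨(m - k).toNat, ?_, ?_⟩)
    · rw [Finset.mem_range]; omega
    · omega

lemma ofReal_truncPow {lam : ℝ≥0} {q t : ℝ} (hq : 0 ≤ q) (ht : 0 ≤ t) :
    ENNReal.ofReal (truncPow lam q t) = (min (ENNReal.ofReal t) lam) ^ q := by
  rw [truncPow, ← ENNReal.ofReal_rpow_of_nonneg (le_min ht lam.coe_nonneg) hq,
    ENNReal.ofReal_min, ENNReal.ofReal_coe_nnreal]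

/-- The constant for finite subfamilies depends on `q` alone, and the localized sum of a subfamily
is at most the full localized sum. Truncated powers are continuous and increasing, so monotone
convergence over finite subfamilies gives the general case. -/
lemma LargeNested.exists_lintegral_min_rpow_le {q : ℝ} (hq : 0 < q) : ∃ C : ℝ≥0,
    ∀ {E : DyadicInterval → Set ℝ}, LargeNested E → ∀ (c : DyadicInterval → ℝ≥0∞)
    (_ : ∀ I, c I ≠ ∞) (lam : ℝ≥0),
    ∫⁻ x, (min (∑' I : DyadicInterval, I.toSet.indicator (fun _ => c I) x) lam) ^ q ≤
      C * ∫⁻ x, (min (∑' I : DyadicInterval,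
        I.toSet.indicator (fun _ => (E I).indicator (fun _ => c I) x) x) lam) ^ q := by
  classical
  obtain ⟨C, hC⟩ := LargeNested.exists_lintegral_truncPow_le hq
  refine ⟨C, fun {E} hE c hc lam => ?_⟩
  set G : ℝ → ℝ≥0∞ := fun x => ∑' I : DyadicInterval,
        I.toSet.indicator (fun _ => (E I).indicator (fun _ => c I) x) x with hG
  set F : Finset DyadicInterval → ℝ → ℝ≥0∞ := fun S x =>
    ∑ I ∈ S, I.toSet.indicator (fun _ => c I) x with hF
  have hfin : ∀ S : Finset DyadicInterval, ∫⁻ x, (min (F S x) lam) ^ q ≤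
      C * ∫⁻ x, (min (G x) lam) ^ q := by
    intro S
    obtain ⟨M, hM⟩ : ∃ M : ℕ, ∀ I ∈ S, |I.scale| ≤ M := by
      refine ⟨∑ I ∈ S, I.scale.natAbs, fun I hI => ?_⟩
      have := Finset.single_le_sum (f := fun I : DyadicInterval => I.scale.natAbs)
        (fun _ _ => Nat.zero_le _) hI
      rw [Int.abs_eq_natAbs]
      exact_mod_cast this
    set c' : DyadicInterval → ℝ := fun I => if I ∈ S then (c I).toReal else 0 with hc'
    have hc'0 : ∀ I, 0 ≤ c' I := fun I => by simp only [hc']; split_ifs <;> simp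
    have hc'S : ∀ I, I ∉ S → c' I = 0 := fun I hI => by simp [hc', hI]
    have hc'c : ∀ I, ENNReal.ofReal (c' I) = if I ∈ S then c I else 0 := fun I => by
      simp only [hc']
      split_ifs
      · exact ENNReal.ofReal_toReal (hc I)
      · simp
    -- The `2 * M + 1` scales are those from `M` down to `-M`.
    have hscale : ∀ I, I ∈ S → I.scale ≤ (M : ℤ) ∧ (M : ℤ) - (2 * M + 1 : ℕ) < I.scale := by
      intro I hI
      have := abs_le.1 (hM I hI)
      constructor <;> push_cast <;> omega
    have h1 : ∀ x, F S x = ENNReal.ofReal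
        (∑ i ∈ Finset.range (2 * M + 1), c' (containing ((M : ℤ) - i) x)) := by
      intro x
      rw [ENNReal.ofReal_sum_of_nonneg fun _ _ => hc'0 _,
        ← tsum_indicator_eq_sum_range (d := fun I => ENNReal.ofReal (c' I)), tsum_eq_sum (s := S)]
      · refine Finset.sum_congr rfl fun I hI => ?_
        rw [hc'c, if_pos hI]
      · intro I hI
        simp [hc'S I hI]
      · intro I hI
        refine hscale I ?_
        by_contra h
        simp [hc'S I h] at hI
    have h2 : ∀ x, ENNReal.ofReal (∑ i ∈ Finset.range (2 * M + 1),
        (E (containing ((M : ℤ) - i) x)).indicator (fun _ => c' (containing ((M : ℤ) - i) x)) x)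
        ≤ G x := by
      intro x
      rw [ENNReal.ofReal_sum_of_nonneg fun i _ => Set.indicator_nonneg (fun _ _ => hc'0 _) _]
      have : ∀ I, ENNReal.ofReal ((E I).indicator (fun _ => c' I) x) =
          (E I).indicator (fun _ => ENNReal.ofReal (c' I)) x := fun I => by
        by_cases h : x ∈ E I <;> simp [h]
      simp_rw [this]
      rw [← tsum_indicator_eq_sum_range
        (d := fun I => (E I).indicator (fun _ => ENNReal.ofReal (c' I)) x)]
      · refine ENNReal.tsum_le_tsum fun I => ?_
        refine Set.indicator_le_indicator (Set.indicator_le_indicator ?_)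
        rw [hc'c]
        split_ifs <;> simp
      · intro I hI
        refine hscale I ?_
        by_contra h
        simp [hc'S I h] at hI
    have := hC hE c' M (2 * M + 1) lam lam.coe_nonneg hc'0 S hc'S
    calc ∫⁻ x, (min (F S x) lam) ^ q
        = ∫⁻ x, ENNReal.ofReal (truncPow lam q
          (∑ i ∈ Finset.range (2 * M + 1), c' (containing ((M : ℤ) - i) x))) := by
          refine lintegral_congr fun x => ?_
          rw [ofReal_truncPow hq.le (Finset.sum_nonneg fun _ _ => hc'0 _), h1]
      _ ≤ _ := this
      _ ≤ C * ∫⁻ x, (min (G x) lam) ^ q := by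
          gcongr with x
          rw [ofReal_truncPow hq.le (Finset.sum_nonneg fun _ _ =>
            Set.indicator_nonneg (fun _ _ => hc'0 _) _)]
          gcongr
          exact h2 x
  have hmono : Monotone fun t : ℝ≥0∞ => (min t lam) ^ q := fun a b hab => by
    dsimp only; gcongr
  have hsup : ∀ x, (min (∑' I : DyadicInterval, I.toSet.indicator (fun _ => c I) x) lam) ^ q
      = ⨆ S : Finset DyadicInterval, (min (F S x) lam) ^ q := by
    intro x
    rw [ENNReal.tsum_eq_iSup_sum]
    refine Monotone.map_iSup_of_continuousAt (f := fun t : ℝ≥0∞ => (min t lam) ^ q) ?_ hmono ?_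
    · exact (ENNReal.continuous_rpow_const.comp (continuous_id.min continuous_const)).continuousAt
    · simp [hq]
  simp_rw [hsup]
  rw [lintegral_iSup_directed]
  · exact iSup_le hfin
  · intro S
    refine Measurable.aemeasurable ?_
    refine Measurable.pow_const (Measurable.min ?_ measurable_const) _
    exact Finset.measurable_fun_sum _ fun I _ => measurable_const.indicator I.measurableSet_toSet
  · intro S T
    refine ⟨S ∪ T, fun x => hmono ?_, fun x => hmono ?_⟩
    · exact Finset.sum_le_sum_of_subset Finset.subset_union_left
    · exact Finset.sum_le_sum_of_subset Finset.subset_union_right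

/-- The strong type form of the domination of a sum over dyadic intervals by its localization. -/
lemma LargeNested.exists_lintegral_rpow_le {q : ℝ} (hq : 0 < q) : ∃ C : ℝ≥0,
    ∀ {E : DyadicInterval → Set ℝ}, LargeNested E → ∀ (c : DyadicInterval → ℝ≥0∞)
    (_ : ∀ I, c I ≠ ∞) (g : ℝ → ℝ≥0∞) (_ : ∀ x, ∑' I : DyadicInterval,
        I.toSet.indicator (fun _ => (E I).indicator (fun _ => c I) x) x ≤ g x),
    ∫⁻ x, (∑' I : DyadicInterval, I.toSet.indicator (fun _ => c I) x) ^ q ≤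
      C * ∫⁻ x, g x ^ q := by
  obtain ⟨C, hC⟩ := LargeNested.exists_lintegral_min_rpow_le hq
  refine ⟨C, fun {E} hE c hc g hg => ?_⟩
  have hsup : ∀ t : ℝ≥0∞, t ^ q = ⨆ n : ℕ, (min t ((n : ℝ≥0) : ℝ≥0∞)) ^ q := by
    intro t
    have : t = ⨆ n : ℕ, min t ((n : ℝ≥0) : ℝ≥0∞) := by
      refine le_antisymm ?_ (iSup_le fun n => min_le_left _ _)
      refine le_of_forall_lt fun a ha => ?_
      obtain ⟨n, hn⟩ := ENNReal.exists_nat_gt (ha.trans_le le_top).ne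
      exact lt_of_lt_of_le (lt_min ha (by simpa using hn)) (le_iSup (fun n : ℕ =>
        min t ((n : ℝ≥0) : ℝ≥0∞)) n)
    conv_lhs => rw [this]
    exact Monotone.map_iSup_of_continuousAt (f := fun t : ℝ≥0∞ => t ^ q)
      ENNReal.continuous_rpow_const.continuousAt (fun a b h => by dsimp only; gcongr) (by simp [hq])
  simp_rw [fun x => hsup (∑' I : DyadicInterval, I.toSet.indicator (fun _ => c I) x)]
  rw [lintegral_iSup]
  · refine iSup_le fun n => (hC hE c hc n).trans ?_
    gcongr with x
    exact (min_le_left _ _).trans (hg x)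
  · intro n
    refine Measurable.pow_const (Measurable.min ?_ measurable_const) _
    exact Measurable.tsum fun I => measurable_const.indicator I.measurableSet_toSet
  · intro a b hab x
    dsimp only
    gcongr

/-- A normalized form of the weak `L^p` bound: `|{g > A τ^(1/p)}| ≤ 1/τ` for all `τ > 0`. -/
def WeakBound (g : ℝ → ℝ≥0∞) (p : ℝ≥0∞) (A : ℝ≥0∞) : Prop :=
  ∀ τ : ℝ≥0, 0 < τ → volume {x | A * (τ : ℝ≥0∞) ^ (1 / p.toReal) < g x} ≤ (τ : ℝ≥0∞)⁻¹

end Paraproduct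

/-! ### Hölder's inequality for products, in strong and in weak form. -/

namespace Paraproduct

open DyadicInterval

/-- Infinite exponents need no separate treatment here: `∞.toReal = 0` and `1 / 0 = 0` agree with
`∞⁻¹ = 0`. -/
lemma one_div_toReal_eq_sum {n : ℕ} {p : Fin n → ℝ≥0∞} (hp : ∀ j, 1 ≤ p j) :
    1 / ((∑ j, (p j)⁻¹)⁻¹).toReal = ∑ j, 1 / (p j).toReal := by
  rw [ENNReal.toReal_inv, one_div, inv_inv, ENNReal.toReal_sum]
  · simp [ENNReal.toReal_inv]
  · intro j _
    exact ENNReal.inv_ne_top.2 (zero_lt_one.trans_le (hp j)).ne'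

lemma targetExp_ne_zero {n : ℕ} {p : Fin n → ℝ≥0∞} (hp : ∀ j, 1 ≤ p j) :
    (∑ j, (p j)⁻¹)⁻¹ ≠ 0 := by
  rw [ENNReal.inv_ne_zero]
  exact (ENNReal.sum_lt_top.2 fun j _ =>
    (ENNReal.inv_ne_top.2 (zero_lt_one.trans_le (hp j)).ne').lt_top).ne

/-- Hölder's inequality for finitely many functions. -/
lemma eLpNorm_prod_le_prod {n : ℕ} (g : Fin n → ℝ → ℝ≥0∞) (hg : ∀ j, Measurable (g j))
    {p : Fin n → ℝ≥0∞} (hp : ∀ j, 1 ≤ p j) {s : ℝ≥0∞} (hs : s = (∑ j, (p j)⁻¹)⁻¹)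
    (hs' : s ≠ ∞) :
    eLpNorm (fun x => ∏ j, g j x) s volume ≤ ∏ j, eLpNorm (g j) (p j) volume := by
  classical
  have hs0 : s ≠ 0 := hs ▸ targetExp_ne_zero hp
  have hsr : 0 < s.toReal := ENNReal.toReal_pos hs0 hs'
  have hp0 : ∀ j, p j ≠ 0 := fun j => (zero_lt_one.trans_le (hp j)).ne'
  have hsum : ∑ j, 1 / (p j).toReal = 1 / s.toReal := by rw [hs, one_div_toReal_eq_sum hp]
  -- Factors with infinite exponent are replaced by their essential suprema and leave the integral;
  -- only the slots in `T` enter Hölder's inequality.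
  set T : Finset (Fin n) := Finset.univ.filter fun j => p j ≠ ∞ with hT
  have hsumT : ∑ j ∈ T, s.toReal / (p j).toReal = 1 := by
    have : ∑ j ∈ T, 1 / (p j).toReal = 1 / s.toReal := by
      rw [← hsum]
      refine Finset.sum_subset (Finset.subset_univ _) fun j _ hj => ?_
      have : p j = ∞ := by simpa [hT] using hj
      simp [this]
    calc ∑ j ∈ T, s.toReal / (p j).toReal = s.toReal * ∑ j ∈ T, 1 / (p j).toReal := by
          rw [Finset.mul_sum]; exact Finset.sum_congr rfl fun j _ => by ring
      _ = 1 := by rw [this]; field_simp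
  rw [eLpNorm_eq_lintegral_rpow_enorm_toReal hs0 hs']
  simp only [enorm_eq_self]
  have hinf : ∀ᵐ x, ∀ j, p j = ∞ → g j x ≤ eLpNorm (g j) (p j) volume := by
    rw [ae_all_iff]
    intro j
    by_cases h : p j = ∞
    · have := ae_le_eLpNormEssSup (f := g j) (μ := volume)
      filter_upwards [this] with x hx _
      rw [h, eLpNorm_exponent_top]
      exact hx
    · exact Eventually.of_forall fun x hx => absurd hx h
  have hsplit : ∀ G : Fin n → ℝ≥0∞, ∏ j, G j = (∏ j ∈ T, G j) * ∏ j ∈ Tᶜ, G j := fun G =>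
    (Finset.prod_mul_prod_compl T G).symm
  have key : ∫⁻ x, (∏ j, g j x) ^ s.toReal ≤ (∏ j, eLpNorm (g j) (p j) volume) ^ s.toReal := by
    calc ∫⁻ x, (∏ j, g j x) ^ s.toReal
        ≤ ∫⁻ x, (∏ j ∈ T, (g j x ^ (p j).toReal) ^ (s.toReal / (p j).toReal)) *
            (∏ j ∈ Tᶜ, eLpNorm (g j) (p j) volume) ^ s.toReal := by
          refine lintegral_mono_ae ?_
          filter_upwards [hinf] with x hx
          rw [hsplit, ENNReal.mul_rpow_of_nonneg _ _ hsr.le]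
          refine mul_le_mul' (le_of_eq ?_) ?_
          · rw [← ENNReal.prod_rpow_of_nonneg hsr.le]
            refine Finset.prod_congr rfl fun j hj => ?_
            have hj' : p j ≠ ∞ := by simpa [hT] using hj
            have : 0 < (p j).toReal := ENNReal.toReal_pos (hp0 j) hj'
            rw [← ENNReal.rpow_mul]
            congr 1
            field_simp
          · gcongr with j hj
            exact hx j (by simpa [hT] using hj)
      _ = (∫⁻ x, (∏ j ∈ T, (g j x ^ (p j).toReal) ^ (s.toReal / (p j).toReal))) *
            (∏ j ∈ Tᶜ, eLpNorm (g j) (p j) volume) ^ s.toReal := by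
          rw [lintegral_mul_const]
          exact Finset.measurable_fun_prod _ fun j _ => ((hg j).pow_const _).pow_const _
      _ ≤ (∏ j ∈ T, (∫⁻ x, g j x ^ (p j).toReal) ^ (s.toReal / (p j).toReal)) *
            (∏ j ∈ Tᶜ, eLpNorm (g j) (p j) volume) ^ s.toReal := by
          gcongr
          exact ENNReal.lintegral_prod_norm_pow_le T
            (fun j _ => ((hg j).pow_const _).aemeasurable) hsumT fun j _ => by positivity
      _ = (∏ j, eLpNorm (g j) (p j) volume) ^ s.toReal := by
          rw [hsplit, ENNReal.mul_rpow_of_nonneg _ _ hsr.le]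
          congr 1
          rw [← ENNReal.prod_rpow_of_nonneg hsr.le]
          refine Finset.prod_congr rfl fun j hj => ?_
          have hj' : p j ≠ ∞ := by simpa [hT] using hj
          rw [eLpNorm_eq_lintegral_rpow_enorm_toReal (hp0 j) hj', ← ENNReal.rpow_mul]
          simp only [enorm_eq_self]
          congr 1
          ring
  calc (∫⁻ x, (∏ j, g j x) ^ s.toReal) ^ (1 / s.toReal)
      ≤ ((∏ j, eLpNorm (g j) (p j) volume) ^ s.toReal) ^ (1 / s.toReal) := by gcongr
    _ = _ := by rw [← ENNReal.rpow_mul, mul_one_div_cancel hsr.ne', ENNReal.rpow_one]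

lemma prod_rpow_eq_rpow_sum {ι : Type*} {a : ℝ≥0∞} (h0 : a ≠ 0) (h : a ≠ ∞) (e : ι → ℝ)
    (S : Finset ι) : ∏ j ∈ S, a ^ e j = a ^ ∑ j ∈ S, e j := by
  classical
  induction S using Finset.induction_on with
  | empty => simp
  | insert i S hi ih => rw [Finset.prod_insert hi, Finset.sum_insert hi, ih, ENNReal.rpow_add _ _ h0 h]

/-- Where the product is larger than claimed, some factor exceeds its own bound at the parameter `n
* τ`. Each of these `n` exceptional sets has measure at most `1 / (n τ)`, and they add up to `1 /
τ`. -/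
lemma WeakBound.prod {n : ℕ} (hn : 0 < n) {g : Fin n → ℝ → ℝ≥0∞} {p A : Fin n → ℝ≥0∞}
    (hp : ∀ j, 1 ≤ p j) (h : ∀ j, WeakBound (g j) (p j) (A j)) {s : ℝ≥0∞}
    (hs : s = (∑ j, (p j)⁻¹)⁻¹) :
    WeakBound (fun x => ∏ j, g j x) s ((n : ℝ≥0∞) ^ (1 / s.toReal) * ∏ j, A j) := by
  intro τ hτ
  have hnτ : 0 < (n : ℝ≥0) * τ := mul_pos (by exact_mod_cast hn) hτ
  have hsub : {x | (n : ℝ≥0∞) ^ (1 / s.toReal) * (∏ j, A j) * (τ : ℝ≥0∞) ^ (1 / s.toReal) <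
      ∏ j, g j x} ⊆ ⋃ j, {x | A j * (((n : ℝ≥0) * τ : ℝ≥0) : ℝ≥0∞) ^ (1 / (p j).toReal) < g j x} := by
    intro x hx
    simp only [Set.mem_iUnion, Set.mem_ofPred_eq] at *
    by_contra hcon
    push Not at hcon
    refine absurd hx (not_lt.2 ?_)
    calc ∏ j, g j x ≤ ∏ j, A j * (((n : ℝ≥0) * τ : ℝ≥0) : ℝ≥0∞) ^ (1 / (p j).toReal) :=
          Finset.prod_le_prod' fun j _ => hcon j
      _ = (∏ j, A j) * (((n : ℝ≥0) * τ : ℝ≥0) : ℝ≥0∞) ^ (1 / s.toReal) := by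
          rw [Finset.prod_mul_distrib, hs, one_div_toReal_eq_sum hp]
          congr 1
          have : ((((n : ℝ≥0) * τ : ℝ≥0) : ℝ≥0∞)) ≠ 0 := by exact_mod_cast hnτ.ne'
          exact prod_rpow_eq_rpow_sum this ENNReal.coe_ne_top _ _
      _ = _ := by
          rw [ENNReal.coe_mul, ENNReal.mul_rpow_of_nonneg _ _ (by positivity)]
          push_cast
          ring
  refine (measure_mono hsub).trans ((measure_iUnion_le _).trans ?_)
  rw [tsum_fintype]
  calc ∑ j, volume {x | A j * (((n : ℝ≥0) * τ : ℝ≥0) : ℝ≥0∞) ^ (1 / (p j).toReal) < g j x}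
      ≤ ∑ _j : Fin n, ((((n : ℝ≥0) * τ : ℝ≥0) : ℝ≥0∞))⁻¹ := Finset.sum_le_sum fun j _ => h j _ hnτ
    _ = (τ : ℝ≥0∞)⁻¹ := by
        rw [Finset.sum_const, Finset.card_univ, Fintype.card_fin, nsmul_eq_mul, ENNReal.coe_mul,
          ENNReal.mul_inv (by simp) (by simp), ← mul_assoc]
        push_cast
        rw [ENNReal.mul_inv_cancel (by simp; omega) (by simp), one_mul]

/-- This is the substitution `t = A τ ^ (1 / s)`, which requires `A` to be neither zero nor
infinite. -/
lemma weakNorm_le_of_weakBound {g : ℝ → ℝ≥0∞} {s A : ℝ≥0∞} (hs0 : s ≠ 0) (hs : s ≠ ∞)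
    (hA0 : A ≠ 0) (hA : A ≠ ∞) (h : WeakBound g s A) : weakNorm g s ≤ A := by
  have hsr : 0 < s.toReal := ENNReal.toReal_pos hs0 hs
  refine iSup_le fun t => ?_
  rcases eq_or_ne t 0 with rfl | ht
  · simp
  lift A to ℝ≥0 using hA
  have hA0' : A ≠ 0 := by exact_mod_cast hA0
  set τ : ℝ≥0 := (t / A) ^ s.toReal with hτ
  have hτ0 : 0 < τ := NNReal.rpow_pos (by positivity)
  have h1 : (A : ℝ≥0∞) * (τ : ℝ≥0∞) ^ (1 / s.toReal) = t := by
    rw [← ENNReal.coe_rpow_of_nonneg _ (by positivity), ← ENNReal.coe_mul]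
    congr 1
    rw [hτ, ← NNReal.rpow_mul, mul_one_div_cancel hsr.ne', NNReal.rpow_one]
    field_simp
  have h2 := h τ hτ0
  rw [h1] at h2
  calc (t : ℝ≥0∞) * volume {x | (t : ℝ≥0∞) < g x} ^ (1 / s.toReal)
      ≤ (t : ℝ≥0∞) * ((τ : ℝ≥0∞)⁻¹) ^ (1 / s.toReal) := by gcongr
    _ = A := by
        rw [← ENNReal.coe_inv hτ0.ne', ← ENNReal.coe_rpow_of_nonneg _ (by positivity),
          ← ENNReal.coe_mul]
        congr 1
        rw [hτ, NNReal.inv_rpow, ← NNReal.rpow_mul, mul_one_div_cancel hsr.ne', NNReal.rpow_one]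
        field_simp

lemma weakBound_of_eLpNorm_le {g : ℝ → ℝ≥0∞} (hg : Measurable g) {p A : ℝ≥0∞} (hp : 1 ≤ p)
    (hA0 : A ≠ 0) (hA : A ≠ ∞) (h : eLpNorm g p volume ≤ A) : WeakBound g p A := by
  intro τ hτ
  have hp0 : p ≠ 0 := (zero_lt_one.trans_le hp).ne'
  by_cases hpt : p = ∞
  · subst hpt
    -- The exponent of `τ` is `1 / 0 = 0`, so the level is `A` itself and the set above it is null.
    simp only [ENNReal.toReal_top, div_zero, ENNReal.rpow_zero, mul_one]
    rw [eLpNorm_exponent_top] at h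
    have : ∀ᵐ x, g x ≤ A := by
      filter_upwards [ae_le_eLpNormEssSup (f := g) (μ := volume)] with x hx
      exact (le_of_eq_of_le (enorm_eq_self _).symm hx).trans h
    have h0 : volume {x | A < g x} = 0 := by
      rw [ae_iff] at this
      simpa using this
    rw [h0]
    exact zero_le
  · have hpr : 0 < p.toReal := ENNReal.toReal_pos hp0 hpt
    have hτ' : (τ : ℝ≥0∞) ≠ 0 := by exact_mod_cast hτ.ne'
    have h1 := mul_meas_ge_le_pow_eLpNorm' (μ := volume) hp0 hpt hg.aestronglyMeasurable
      (A * (τ : ℝ≥0∞) ^ (1 / p.toReal))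
    simp only [enorm_eq_self] at h1
    rw [ENNReal.mul_rpow_of_nonneg _ _ hpr.le, ← ENNReal.rpow_mul, one_div_mul_cancel hpr.ne',
      ENNReal.rpow_one] at h1
    have h2 : A ^ p.toReal * (τ * volume {x | A * (τ : ℝ≥0∞) ^ (1 / p.toReal) < g x}) ≤
        A ^ p.toReal * 1 := by
      rw [← mul_assoc, mul_one]
      refine le_trans ?_ (h1.trans (by gcongr))
      gcongr
      exact le_of_lt
    have h3 := (ENNReal.mul_le_mul_iff_right (a := A ^ p.toReal) (by simp [hA0, hA])
      (by simp [hA, hpr.le])).1 h2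
    rwa [ENNReal.le_inv_iff_mul_le, mul_comm]

end Paraproduct

/-! ### Majorants, square majorants and the multilinear estimates. -/

namespace Paraproduct

open DyadicInterval

open scoped Classical in
/-- The square of the square function of the sequence `t`, localized to `I`. -/
noncomputable def locSq (t : DyadicInterval → ℝ≥0∞) (I : DyadicInterval) (x : ℝ) : ℝ≥0∞ :=
  ∑' J : DyadicInterval, J.toSet.indicator (fun _ => if J.toSet ⊆ I.toSet then t J ^ 2 else 0) x

lemma measurable_locSq (t : DyadicInterval → ℝ≥0∞) (I : DyadicInterval) :
    Measurable (locSq t I) :=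
  Measurable.tsum fun J => measurable_const.indicator J.measurableSet_toSet

lemma locSq_mono {t : DyadicInterval → ℝ≥0∞} {I J : DyadicInterval} (h : I.toSet ⊆ J.toSet)
    (x : ℝ) : locSq t I x ≤ locSq t J x := by
  refine ENNReal.tsum_le_tsum fun K => Set.indicator_le_indicator ?_
  by_cases hK : K.toSet ⊆ I.toSet
  · rw [if_pos hK, if_pos (hK.trans h)]
  · rw [if_neg hK]; exact zero_le

lemma sum_sq_le_locSq (t : DyadicInterval → ℝ≥0∞) {I : DyadicInterval} {x : ℝ}
    {S : Finset DyadicInterval} (hx : ∀ J ∈ S, x ∈ J.toSet) (hS : ∀ J ∈ S, J.toSet ⊆ I.toSet) :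
    ∑ J ∈ S, t J ^ 2 ≤ locSq t I x := by
  refine le_trans (le_of_eq ?_) (ENNReal.sum_le_tsum S)
  refine Finset.sum_congr rfl fun J hJ => ?_
  rw [Set.indicator_of_mem (hx J hJ), if_pos (hS J hJ)]

/-- The sequence `t` is dominated pointwise by the function `m`. -/
structure IsMajorant (t : DyadicInterval → ℝ≥0∞) (m : ℝ → ℝ≥0∞) : Prop where
  measurable : Measurable m
  le : ∀ I : DyadicInterval, ∀ x ∈ I.toSet, t I ≤ m x

/-- The local square functions of the sequence `t` are dominated by the function `m` on large
parts of the dyadic intervals. -/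
def IsSquareMajorant (t : DyadicInterval → ℝ≥0∞) (m : ℝ → ℝ≥0∞) : Prop :=
  ∀ I : DyadicInterval, 4 * volume (I.toSet ∩ {x | m x ^ 2 < locSq t I x}) ≤ volume I.toSet

section Combine

variable {n : ℕ} {t : Fin n → DyadicInterval → ℝ≥0∞} {m : Fin n → ℝ → ℝ≥0∞} {a b : Fin n}

/-- The two exceptional sets fill at most a quarter of `I` each, so half of `I` remains. The
condition passes to subintervals because the local square function decreases with the interval while
the majorants do not depend on it. -/
lemma largeNested_of_isSquareMajorant {ta tb : DyadicInterval → ℝ≥0∞} {ma mb : ℝ → ℝ≥0∞}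
    (hma : Measurable ma) (hmb : Measurable mb)
    (ha : IsSquareMajorant ta ma) (hb : IsSquareMajorant tb mb) :
    LargeNested fun I => {x | locSq ta I x ≤ ma x ^ 2} ∩ {x | locSq tb I x ≤ mb x ^ 2} where
  measurable I := (measurableSet_le (measurable_locSq _ _) (hma.pow_const 2)).inter
    (measurableSet_le (measurable_locSq _ _) (hmb.pow_const 2))
  half I := by
    set E := {x | locSq ta I x ≤ ma x ^ 2} ∩ {x | locSq tb I x ≤ mb x ^ 2}
    have hsub : I.toSet ⊆ (E ∩ I.toSet) ∪ ((I.toSet ∩ {x | ma x ^ 2 < locSq ta I x}) ∪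
        (I.toSet ∩ {x | mb x ^ 2 < locSq tb I x})) := by
      intro x hx
      by_cases h1 : locSq ta I x ≤ ma x ^ 2
      · by_cases h2 : locSq tb I x ≤ mb x ^ 2
        · exact Or.inl ⟨⟨h1, h2⟩, hx⟩
        · exact Or.inr (Or.inr ⟨hx, not_le.1 h2⟩)
      · exact Or.inr (Or.inl ⟨hx, not_le.1 h1⟩)
    have h1 := (measure_mono (μ := volume) hsub).trans ((measure_union_le _ _).trans
      (add_le_add_right (measure_union_le _ _) _))
    have ha' := ha I
    have hb' := hb I
    have hfin : volume I.toSet ≠ ∞ := by simp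
    set A := volume (I.toSet ∩ {x | ma x ^ 2 < locSq ta I x})
    set B := volume (I.toSet ∩ {x | mb x ^ 2 < locSq tb I x})
    set V := volume I.toSet
    set W := volume (E ∩ I.toSet)
    have h2 : 2 * V + 2 * V ≤ 2 * V + 4 * W := by
      calc 2 * V + 2 * V = 4 * V := by ring
        _ ≤ 4 * (W + (A + B)) := by gcongr
        _ = 4 * A + 4 * B + 4 * W := by ring
        _ ≤ V + V + 4 * W := by gcongr
        _ = 2 * V + 4 * W := by ring
    have h3 := ENNReal.le_of_add_le_add_left (ENNReal.mul_ne_top (by simp) hfin) h2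
    have h4 : 2 * V ≤ 2 * (2 * W) := by rw [← mul_assoc]; norm_num; exact h3
    exact (ENNReal.mul_le_mul_iff_right (by simp) (by simp)).1 h4
  nested I J x _ hIJ hx := ⟨(locSq_mono hIJ x).trans hx.1, (locSq_mono hIJ x).trans hx.2⟩

lemma sum_mul_le_of_sq {S : Finset DyadicInterval} {u v : DyadicInterval → ℝ≥0∞} {A B : ℝ≥0∞}
    (hu : ∑ I ∈ S, u I ^ 2 ≤ A ^ 2) (hv : ∑ I ∈ S, v I ^ 2 ≤ B ^ 2) :
    ∑ I ∈ S, u I * v I ≤ A * B := by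
  have h := ENNReal.inner_le_Lp_mul_Lq S u v Real.HolderConjugate.two_two
  have hs : ∀ X : ℝ≥0∞, (X ^ 2) ^ (1 / 2 : ℝ) = X := fun X => by
    rw [← ENNReal.rpow_natCast, ← ENNReal.rpow_mul]; norm_num
  refine h.trans (mul_le_mul' ?_ ?_)
  · rw [← hs A]
    gcongr
    simpa [ENNReal.rpow_two] using hu
  · rw [← hs B]
    gcongr
    simpa [ENNReal.rpow_two] using hv

/-- Intervals that contain `x` and have `x` in their good set form a chain; a finite part of it lies
in its largest member `I₀`. Since `x` is good for `I₀`, the squares of `t a` and of `t b` over that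
part have sums at most `m a x ^ 2` and `m b x ^ 2`. Cauchy–Schwarz handles these two factors, and
the others are replaced by their majorants before summing. -/
lemma tsum_indicator_prod_le (hab : a ≠ b) (hm : ∀ j, IsMajorant (t j) (m j)) (x : ℝ) :
    ∑' I : DyadicInterval, I.toSet.indicator (fun _ =>
      ({x | locSq (t a) I x ≤ m a x ^ 2} ∩ {x | locSq (t b) I x ≤ m b x ^ 2}).indicator
        (fun _ => ∏ j, t j I) x) x ≤ ∏ j, m j x := by
  classical
  rw [ENNReal.tsum_eq_iSup_sum]
  refine iSup_le fun S => ?_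
  set P : DyadicInterval → Prop := fun I => x ∈ I.toSet ∧
    locSq (t a) I x ≤ m a x ^ 2 ∧ locSq (t b) I x ≤ m b x ^ 2 with hP
  have h1 : ∑ I ∈ S, I.toSet.indicator (fun _ =>
      ({x | locSq (t a) I x ≤ m a x ^ 2} ∩ {x | locSq (t b) I x ≤ m b x ^ 2}).indicator
        (fun _ => ∏ j, t j I) x) x = ∑ I ∈ S.filter P, ∏ j, t j I := by
    rw [Finset.sum_filter]
    refine Finset.sum_congr rfl fun I _ => ?_
    by_cases hx : x ∈ I.toSet
    · by_cases h1 : locSq (t a) I x ≤ m a x ^ 2 <;> by_cases h2 : locSq (t b) I x ≤ m b x ^ 2 <;>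
        simp [hx, h1, h2]
    · simp [hx]
  rw [h1]
  rcases (S.filter P).eq_empty_or_nonempty with he | hne
  · rw [he]; simp
  obtain ⟨I₀, hI₀, hmax⟩ := Finset.exists_max_image _ (fun I : DyadicInterval => I.scale) hne
  have hP' : ∀ I ∈ S.filter P, P I := fun I hI => (Finset.mem_filter.1 hI).2
  have hsub : ∀ I ∈ S.filter P, I.toSet ⊆ I₀.toSet := fun I hI =>
    subset_of_mem_of_scale_le (hP' I hI).1 (hP' I₀ hI₀).1 (hmax I hI)
  have hprod : ∀ G : Fin n → ℝ≥0∞, ∏ j, G j = G a * G b * ∏ j ∈ {a, b}ᶜ, G j := fun G => by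
    rw [← Finset.prod_pair hab, Finset.prod_mul_prod_compl]
  calc ∑ I ∈ S.filter P, ∏ j, t j I
      ≤ ∑ I ∈ S.filter P, t a I * t b I * ∏ j ∈ {a, b}ᶜ, m j x := by
        refine Finset.sum_le_sum fun I hI => ?_
        rw [hprod]
        gcongr with j
        exact (hm j).le I x (hP' I hI).1
    _ = (∑ I ∈ S.filter P, t a I * t b I) * ∏ j ∈ {a, b}ᶜ, m j x := by rw [Finset.sum_mul]
    _ ≤ m a x * m b x * ∏ j ∈ {a, b}ᶜ, m j x := by
        gcongr
        exact sum_mul_le_of_sq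
          ((sum_sq_le_locSq _ (fun I hI => (hP' I hI).1) hsub).trans (hP' I₀ hI₀).2.1)
          ((sum_sq_le_locSq _ (fun I hI => (hP' I hI).1) hsub).trans (hP' I₀ hI₀).2.2)
    _ = ∏ j, m j x := (hprod fun j => m j x).symm

end Combine

/-- The strong type estimate for a sum over dyadic intervals of products, from majorants. -/
lemma exists_eLpNorm_le_of_isMajorant {n : ℕ} {p : Fin n → ℝ≥0∞} (hp : ∀ j, 1 ≤ p j)
    {s : ℝ≥0∞} (hs : s = (∑ j, (p j)⁻¹)⁻¹) (hs' : s ≠ ∞) : ∃ C : ℝ≥0,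
    ∀ (t : Fin n → DyadicInterval → ℝ≥0∞) (m : Fin n → ℝ → ℝ≥0∞) (a b : Fin n), a ≠ b →
      (∀ j I, t j I ≠ ∞) → (∀ j, IsMajorant (t j) (m j)) →
      IsSquareMajorant (t a) (m a) → IsSquareMajorant (t b) (m b) →
      eLpNorm (fun x => ∑' I : DyadicInterval, I.toSet.indicator (fun _ => ∏ j, t j I) x) s volume
        ≤ C * ∏ j, eLpNorm (m j) (p j) volume := by
  have hs0 : s ≠ 0 := hs ▸ targetExp_ne_zero hp
  have hsr : 0 < s.toReal := ENNReal.toReal_pos hs0 hs'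
  obtain ⟨C, hC⟩ := LargeNested.exists_lintegral_rpow_le hsr
  refine ⟨C ^ (1 / s.toReal), fun t m a b hab ht hm ha hb => ?_⟩
  have h1 := hC (largeNested_of_isSquareMajorant (hm a).measurable (hm b).measurable ha hb)
    (fun I => ∏ j, t j I) (fun I => ENNReal.prod_ne_top fun j _ => ht j I) _
    (tsum_indicator_prod_le hab hm)
  have h2 := eLpNorm_prod_le_prod m (fun j => (hm j).measurable) hp hs hs'
  rw [eLpNorm_eq_lintegral_rpow_enorm_toReal hs0 hs'] at h2 ⊢
  simp only [enorm_eq_self] at h2 ⊢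
  calc _ ≤ (C * ∫⁻ x, (∏ j, m j x) ^ s.toReal) ^ (1 / s.toReal) := by gcongr
    _ ≤ _ := by
      rw [ENNReal.mul_rpow_of_nonneg _ _ (by positivity), ENNReal.coe_rpow_of_nonneg _ (by positivity)]
      gcongr

/-- One term suffices, the first `k` with `λ 2 ^ (-k - 1) < g`. The left side is then at most `(λ 2
^ (-k)) ^ 2`, by the truncation if `k = 0` and by minimality of `k` otherwise. -/
lemma tsum_min_sq_le {lam : ℝ≥0} {g : ℝ≥0∞} :
    (min g lam) ^ (2 : ℝ) ≤ ∑' k : ℕ, if (lam : ℝ≥0∞) * (2⁻¹ : ℝ≥0∞) ^ (k + 1) < g then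
      ((lam : ℝ≥0∞) * (2⁻¹ : ℝ≥0∞) ^ k) ^ 2 else 0 := by
  classical
  rw [ENNReal.rpow_two]
  rcases eq_or_ne g 0 with rfl | hg
  · simp
  have hex : ∃ k : ℕ, (lam : ℝ≥0∞) * (2⁻¹ : ℝ≥0∞) ^ (k + 1) < g := by
    have : Tendsto (fun k : ℕ => (lam : ℝ≥0∞) * (2⁻¹ : ℝ≥0∞) ^ k) atTop (𝓝 ((lam : ℝ≥0∞) * 0)) :=
      ENNReal.Tendsto.const_mul (ENNReal.tendsto_pow_atTop_nhds_zero_of_lt_one (by simp))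
        (Or.inr (by simp))
    rw [mul_zero] at this
    have h2 := ((tendsto_add_atTop_iff_nat 1).2 this).eventually (gt_mem_nhds (pos_iff_ne_zero.2 hg))
    exact h2.exists
  set k := Nat.find hex
  have hk : (lam : ℝ≥0∞) * (2⁻¹ : ℝ≥0∞) ^ (k + 1) < g := Nat.find_spec hex
  refine le_trans ?_ (ENNReal.le_tsum k)
  rw [if_pos hk]
  gcongr
  rcases Nat.eq_zero_or_pos k with h0 | h0
  · rw [h0]; simp
  · have := Nat.find_min hex (m := k - 1) (by omega)
    rw [Nat.sub_add_cancel h0] at this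
    exact (min_le_left _ _).trans (not_lt.1 this)

/-- The weak type estimate for a sum over dyadic intervals of products, from majorants. -/
lemma exists_weakBound_of_isMajorant {n : ℕ} (hn : 0 < n) {p : Fin n → ℝ≥0∞} (hp : ∀ j, 1 ≤ p j)
    {s : ℝ≥0∞} (hs : s = (∑ j, (p j)⁻¹)⁻¹) (hs1 : s ≤ 1) : ∃ C : ℝ≥0, 0 < C ∧
    ∀ (t : Fin n → DyadicInterval → ℝ≥0∞) (m : Fin n → ℝ → ℝ≥0∞) (a b : Fin n), a ≠ b →
      (∀ j I, t j I ≠ ∞) → (∀ j, IsMajorant (t j) (m j)) →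
      IsSquareMajorant (t a) (m a) → IsSquareMajorant (t b) (m b) →
      ∀ A : Fin n → ℝ≥0∞, (∀ j, A j ≠ 0) → (∀ j, A j ≠ ∞) → (∀ j, WeakBound (m j) (p j) (A j)) →
      WeakBound (fun x => ∑' I : DyadicInterval, I.toSet.indicator (fun _ => ∏ j, t j I) x) s
        (C * ∏ j, A j) := by
  have hs' : s ≠ ∞ := (hs1.trans_lt ENNReal.one_lt_top).ne
  have hs0 : s ≠ 0 := hs ▸ targetExp_ne_zero hp
  have hsr : 0 < s.toReal := ENNReal.toReal_pos hs0 hs'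
  have hsr1 : s.toReal ≤ 1 := ENNReal.toReal_mono ENNReal.one_ne_top hs1
  -- The exponent 2 exceeds `s ≤ 1`, so the level sets of `∏ m j` below the truncation height
  -- contribute a convergent geometric series. Chebyshev's inequality at that height then gives the
  -- weak bound.
  obtain ⟨C, hC⟩ := LargeNested.exists_lintegral_min_rpow_le (q := 2) two_pos
  -- The Chebyshev bound at parameter `D τ` is `4 C / (D τ)`, and `4 C ≤ D` turns it into `1 / τ`.
  set D : ℝ≥0 := 8 * (C + 1) with hD
  have hD0 : 0 < D := by positivity
  refine ⟨(n : ℝ≥0) ^ (1 / s.toReal) * D ^ (1 / s.toReal), by positivity,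
    fun t m a b hab ht hm ha hb A hA0 hA hw => ?_⟩
  set g : ℝ → ℝ≥0∞ := fun x => ∏ j, m j x with hg
  have hgm : Measurable g := Finset.measurable_fun_prod _ fun j _ => (hm j).measurable
  set B : ℝ≥0∞ := (n : ℝ≥0∞) ^ (1 / s.toReal) * ∏ j, A j with hB
  have hBtop : B ≠ ∞ := ENNReal.mul_ne_top (ENNReal.rpow_ne_top_of_nonneg (by positivity) (by simp))
    (ENNReal.prod_ne_top fun j _ => hA j)
  have hB0 : B ≠ 0 := by
    refine mul_ne_zero ?_ (Finset.prod_ne_zero_iff.2 fun j _ => hA0 j)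
    simp [hn.ne']
  have hgw : WeakBound g s B := WeakBound.prod hn hp hw hs
  intro τ hτ
  set F : ℝ → ℝ≥0∞ := fun x =>
    ∑' I : DyadicInterval, I.toSet.indicator (fun _ => ∏ j, t j I) x with hF
  have hFm : Measurable F := Measurable.tsum fun I =>
    measurable_const.indicator I.measurableSet_toSet
  set σ : ℝ≥0 := D * τ with hσ
  have hσ0 : 0 < σ := mul_pos hD0 hτ
  have hlamtop : B * (σ : ℝ≥0∞) ^ (1 / s.toReal) ≠ ∞ :=
    ENNReal.mul_ne_top hBtop (ENNReal.rpow_ne_top_of_nonneg (by positivity) (by simp))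
  obtain ⟨lam, hlam⟩ : ∃ lam : ℝ≥0, (lam : ℝ≥0∞) = B * (σ : ℝ≥0∞) ^ (1 / s.toReal) :=
    ⟨_, ENNReal.coe_toNNReal hlamtop⟩
  have hlam0 : (lam : ℝ≥0∞) ≠ 0 := by
    rw [hlam]
    refine mul_ne_zero hB0 ?_
    have : (σ : ℝ≥0∞) ≠ 0 := by exact_mod_cast hσ0.ne'
    simp [this]
  have hlevel : ∀ k : ℕ, volume {x | (lam : ℝ≥0∞) * (2⁻¹ : ℝ≥0∞) ^ k < g x} ≤
      (2 : ℝ≥0∞) ^ k * (σ : ℝ≥0∞)⁻¹ := by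
    intro k
    have h1 := hgw (σ * (2⁻¹ : ℝ≥0) ^ k) (by positivity)
    have h2 : B * (((σ * (2⁻¹ : ℝ≥0) ^ k : ℝ≥0)) : ℝ≥0∞) ^ (1 / s.toReal) ≤
        (lam : ℝ≥0∞) * (2⁻¹ : ℝ≥0∞) ^ k := by
      rw [hlam, ENNReal.coe_mul, ENNReal.mul_rpow_of_nonneg _ _ (by positivity),
        ← mul_assoc]
      refine mul_le_mul' le_rfl ?_
      have : ((((2⁻¹ : ℝ≥0) ^ k : ℝ≥0)) : ℝ≥0∞) = (2⁻¹ : ℝ≥0∞) ^ k := by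
        rw [ENNReal.coe_pow, ENNReal.coe_inv two_ne_zero]; rfl
      rw [this]
      -- Here `s ≤ 1` enters: raising `2 ^ (-k)` to the power `1 / s` does not increase it.
      refine (ENNReal.rpow_le_rpow_of_exponent_ge (z := 1) (pow_le_one₀ zero_le (by simp)) ?_).trans_eq
        (by simp)
      rw [le_div_iff₀ hsr]; linarith
    refine (measure_mono fun x hx => lt_of_le_of_lt h2 hx).trans (h1.trans (le_of_eq ?_))
    rw [ENNReal.coe_mul, ENNReal.mul_inv (by simp) (by simp), mul_comm]
    congr 1
    rw [ENNReal.coe_pow, ENNReal.coe_inv two_ne_zero, ENNReal.inv_pow, inv_inv]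
    rfl
  have hint : ∫⁻ x, (min (g x) lam) ^ (2 : ℝ) ≤ 4 * ((lam : ℝ≥0∞) ^ 2 * (σ : ℝ≥0∞)⁻¹) := by
    calc ∫⁻ x, (min (g x) lam) ^ (2 : ℝ)
        ≤ ∫⁻ x, ∑' k : ℕ, {x | (lam : ℝ≥0∞) * (2⁻¹ : ℝ≥0∞) ^ (k + 1) < g x}.indicator
            (fun _ => ((lam : ℝ≥0∞) * (2⁻¹ : ℝ≥0∞) ^ k) ^ 2) x := by
          refine lintegral_mono fun x => tsum_min_sq_le.trans (le_of_eq ?_)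
          exact tsum_congr fun k => by simp [Set.indicator]
      _ = ∑' k : ℕ, ((lam : ℝ≥0∞) * (2⁻¹ : ℝ≥0∞) ^ k) ^ 2 *
            volume {x | (lam : ℝ≥0∞) * (2⁻¹ : ℝ≥0∞) ^ (k + 1) < g x} := by
          rw [lintegral_tsum]
          · refine tsum_congr fun k => ?_
            rw [lintegral_indicator_const (measurableSet_lt measurable_const hgm)]
          · exact fun k => (measurable_const.indicator
              (measurableSet_lt measurable_const hgm)).aemeasurable
      _ ≤ ∑' k : ℕ, (2 * ((lam : ℝ≥0∞) ^ 2 * (σ : ℝ≥0∞)⁻¹)) * (2⁻¹ : ℝ≥0∞) ^ k := by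
          refine ENNReal.tsum_le_tsum fun k => ?_
          calc _ ≤ ((lam : ℝ≥0∞) * (2⁻¹ : ℝ≥0∞) ^ k) ^ 2 * ((2 : ℝ≥0∞) ^ (k + 1) * (σ : ℝ≥0∞)⁻¹) := by
                gcongr; exact hlevel (k + 1)
            _ = (2 * ((lam : ℝ≥0∞) ^ 2 * (σ : ℝ≥0∞)⁻¹)) * (2⁻¹ : ℝ≥0∞) ^ k *
                  ((2⁻¹ : ℝ≥0∞) ^ k * 2 ^ k) := by ring
            _ = _ := by
                rw [← mul_pow, ENNReal.inv_mul_cancel (by simp) (by simp), one_pow, mul_one]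
      _ = 4 * ((lam : ℝ≥0∞) ^ 2 * (σ : ℝ≥0∞)⁻¹) := by
          rw [ENNReal.tsum_mul_left, ENNReal.tsum_geometric, ENNReal.one_sub_inv_two, inv_inv]
          ring
  have hbig := hC (largeNested_of_isSquareMajorant (hm a).measurable (hm b).measurable ha hb)
    (fun I => ∏ j, t j I) (fun I => ENNReal.prod_ne_top fun j _ => ht j I) lam
  have hbig2 : ∫⁻ x, (min (F x) lam) ^ (2 : ℝ) ≤ C * (4 * ((lam : ℝ≥0∞) ^ 2 * (σ : ℝ≥0∞)⁻¹)) := by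
    refine hbig.trans ?_
    gcongr
    refine le_trans ?_ hint
    gcongr with x
    exact tsum_indicator_prod_le hab hm x
  have hcheb : (lam : ℝ≥0∞) ^ 2 * volume {x | (lam : ℝ≥0∞) < F x} ≤
      (lam : ℝ≥0∞) ^ 2 * (C * 4 * (σ : ℝ≥0∞)⁻¹) := by
    calc (lam : ℝ≥0∞) ^ 2 * volume {x | (lam : ℝ≥0∞) < F x}
        ≤ (lam : ℝ≥0∞) ^ 2 * volume {x | (lam : ℝ≥0∞) ^ 2 ≤ (min (F x) lam) ^ (2 : ℝ)} := by
          gcongr with x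
          intro hx
          rw [ENNReal.rpow_two, min_eq_right hx.le]
      _ ≤ ∫⁻ x, (min (F x) lam) ^ (2 : ℝ) :=
          mul_meas_ge_le_lintegral ((hFm.min measurable_const).pow_const _) _
      _ ≤ _ := hbig2.trans (le_of_eq (by ring))
  have h3 := (ENNReal.mul_le_mul_iff_right (by simpa using hlam0) (by simp)).1 hcheb
  have h4 : ((((n : ℝ≥0) ^ (1 / s.toReal) * D ^ (1 / s.toReal) : ℝ≥0)) : ℝ≥0∞) * (∏ j, A j) *
      (τ : ℝ≥0∞) ^ (1 / s.toReal) = lam := by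
    rw [hlam, hB, hσ, ENNReal.coe_mul, ENNReal.coe_mul, ENNReal.mul_rpow_of_nonneg _ _ (by positivity),
      ENNReal.coe_rpow_of_nonneg _ (by positivity), ENNReal.coe_rpow_of_nonneg _ (by positivity)]
    push_cast
    ring
  rw [h4]
  refine h3.trans ?_
  rw [hσ, ENNReal.coe_mul, ENNReal.mul_inv (by simp) (by simp), ← mul_assoc]
  conv_rhs => rw [← one_mul (τ : ℝ≥0∞)⁻¹]
  gcongr
  rw [← div_eq_mul_inv]
  refine ENNReal.div_le_of_le_mul ?_
  rw [one_mul, hD]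
  have : C * 4 ≤ 8 * (C + 1) := by
    rw [← NNReal.coe_le_coe]; push_cast; nlinarith [C.coe_nonneg]
  exact_mod_cast this

end Paraproduct

/-! ### Decaying weights and a maximal function over dyadic triples. -/

namespace Paraproduct

namespace DyadicInterval

/-- The weight `(1 + |x - c(I)| / |I|)⁻¹`. -/
noncomputable def dec (I : DyadicInterval) (x : ℝ) : ℝ := (1 + |x - I.center| / I.length)⁻¹

variable (I : DyadicInterval)

lemma dec_denom_pos (x : ℝ) : 0 < 1 + |x - I.center| / I.length := by
  have := I.length_pos
  positivity

lemma dec_pos (x : ℝ) : 0 < I.dec x := inv_pos.2 (I.dec_denom_pos x)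

lemma dec_le_one (x : ℝ) : I.dec x ≤ 1 := by
  have := I.length_pos
  exact inv_le_one_of_one_le₀ (le_add_of_nonneg_right (by positivity))

lemma measurable_dec : Measurable I.dec := by
  unfold dec
  fun_prop

lemma abs_sub_center_le (x : ℝ) : |x - I.center| ≤ I.length * (I.dec x)⁻¹ := by
  have h := I.length_pos
  rw [dec, inv_inv, mul_add, mul_one, mul_div_cancel₀ _ h.ne']
  linarith

lemma dec_le_div {x r : ℝ} (hr : 0 < r) (h : r ≤ |x - I.center|) : I.dec x ≤ I.length / r := by
  have hl := I.length_pos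
  rw [dec, inv_le_comm₀ (I.dec_denom_pos x) (by positivity), inv_div]
  have : r / I.length ≤ |x - I.center| / I.length := by gcongr
  linarith

lemma dec_le_two_mul {x y : ℝ} (h : |x - y| ≤ I.length) : I.dec x ≤ 2 * I.dec y := by
  have hl := I.length_pos
  have h1 : |y - I.center| / I.length ≤ |x - I.center| / I.length + 1 := by
    rw [div_add_one hl.ne']
    gcongr
    have := abs_sub_le y x I.center
    rw [abs_sub_comm y x] at this
    linarith
  rw [dec, dec, ← div_eq_mul_inv, le_div_iff₀ (I.dec_denom_pos y), ← div_eq_inv_mul,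
    div_le_iff₀ (I.dec_denom_pos x)]
  have : 0 ≤ |x - I.center| / I.length := by positivity
  linarith

lemma abs_sub_le_of_mem {x y : ℝ} (hx : x ∈ I.toSet) (hy : y ∈ I.toSet) : |x - y| ≤ I.length := by
  rw [abs_le]
  constructor <;> linarith [hx.1, hx.2, hy.1, hy.2]

lemma abs_sub_center_le_half {x : ℝ} (hx : x ∈ I.toSet) : |x - I.center| ≤ I.length / 2 := by
  rw [abs_le, center]
  constructor <;> linarith [hx.1, hx.2]

lemma center_eq : I.center = (I.index + 1 / 2) * I.length := by
  rw [center, left]; ring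

end DyadicInterval

open DyadicInterval

lemma summable_int_inv_sq : Summable fun m : ℤ => (((1 : ℝ) + |(m : ℝ)|) ^ 2)⁻¹ := by
  have h : Summable fun n : ℕ => (((1 : ℝ) + n) ^ 2)⁻¹ := by
    have := (summable_nat_add_iff 1).2 (Real.summable_nat_pow_inv.2 (one_lt_two))
    refine this.congr fun n => ?_
    push_cast
    rw [add_comm]
  refine Summable.of_nat_of_neg ?_ ?_
  · simpa using h
  · simpa using h

/-- The weights of the dyadic intervals of a given scale have bounded sum at each point. -/
lemma exists_tsum_dec_sq_le : ∃ C : ℝ≥0, ∀ (k : ℤ) (x : ℝ),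
    ∑' m : ℤ, ENNReal.ofReal ((⟨k, m⟩ : DyadicInterval).dec x ^ 2) ≤ C := by
  set S : ℝ := ∑' m : ℤ, 4 * (((1 : ℝ) + |(m : ℝ)|) ^ 2)⁻¹ with hS
  refine ⟨S.toNNReal, fun k x => ?_⟩
  have hsum : Summable fun m : ℤ => 4 * (((1 : ℝ) + |(m : ℝ)|) ^ 2)⁻¹ :=
    summable_int_inv_sq.mul_left 4
  set m₀ := ⌊x / (2 : ℝ) ^ k⌋
  have hpt : ∀ m : ℤ, (⟨k, m⟩ : DyadicInterval).dec x ^ 2 ≤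
      4 * (((1 : ℝ) + |((m - m₀ : ℤ) : ℝ)|) ^ 2)⁻¹ := by
    intro m
    set I : DyadicInterval := ⟨k, m⟩ with hI
    have hl := I.length_pos
    have hle : I.length = (2 : ℝ) ^ k := rfl
    have h1 : |((m - m₀ : ℤ) : ℝ)| ≤ |x - I.center| / I.length + 1 / 2 := by
      have h2 : |x - I.center| / I.length = |x / (2 : ℝ) ^ k - (m + 1 / 2)| := by
        rw [center_eq, ← abs_of_pos hl, ← abs_div, abs_of_pos hl, sub_div,
          mul_div_cancel_right₀ _ hl.ne', hle]
      rw [h2]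
      have h3 := Int.floor_le (x / (2 : ℝ) ^ k)
      have h4 := Int.lt_floor_add_one (x / (2 : ℝ) ^ k)
      have h5 := abs_sub_le (m₀ + 1 / 2 : ℝ) (x / (2 : ℝ) ^ k) (m + 1 / 2)
      have h6 : |(m₀ + 1 / 2 : ℝ) - x / (2 : ℝ) ^ k| ≤ 1 / 2 := by
        rw [abs_le]; constructor <;> simp only [m₀] <;> linarith
      have h7 : |((m - m₀ : ℤ) : ℝ)| = |(m₀ + 1 / 2 : ℝ) - (m + 1 / 2)| := by
        rw [abs_sub_comm]; push_cast; congr 1; ring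
      rw [h7]; linarith
    have h2 : I.dec x ≤ 2 * (1 + |((m - m₀ : ℤ) : ℝ)|)⁻¹ := by
      rw [dec, ← div_eq_mul_inv, inv_le_comm₀ (I.dec_denom_pos x) (by positivity), inv_div,
        div_le_iff₀ two_pos]
      have : 0 ≤ |x - I.center| / I.length := by positivity
      linarith
    calc I.dec x ^ 2 ≤ (2 * (1 + |((m - m₀ : ℤ) : ℝ)|)⁻¹) ^ 2 :=
          pow_le_pow_left₀ (I.dec_pos x).le h2 2
      _ = _ := by rw [mul_pow, inv_pow]; norm_num
  calc ∑' m : ℤ, ENNReal.ofReal ((⟨k, m⟩ : DyadicInterval).dec x ^ 2)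
      ≤ ∑' m : ℤ, ENNReal.ofReal (4 * (((1 : ℝ) + |((m - m₀ : ℤ) : ℝ)|) ^ 2)⁻¹) :=
        ENNReal.tsum_le_tsum fun m => ENNReal.ofReal_le_ofReal (hpt m)
    _ = ∑' m : ℤ, ENNReal.ofReal (4 * (((1 : ℝ) + |(m : ℝ)|) ^ 2)⁻¹) :=
        (Equiv.subRight m₀).tsum_eq (fun m : ℤ =>
          ENNReal.ofReal (4 * (((1 : ℝ) + |(m : ℝ)|) ^ 2)⁻¹))
    _ = ENNReal.ofReal S := (ENNReal.ofReal_tsum_of_nonneg (fun m => by positivity) hsum).symm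
    _ = _ := rfl

/-- On an interval `J` of the length of `I`, the weight of `I` is at most twice its value at the
center of `J`, and that value is symmetric in `I` and `J`. The integral is thus reduced to the sum
of the weights of all translates at one point. -/
lemma exists_lintegral_dec_sq_le : ∃ C : ℝ≥0, ∀ I : DyadicInterval,
    ∫⁻ x, ENNReal.ofReal (I.dec x ^ 2) ≤ C * ENNReal.ofReal I.length := by
  obtain ⟨C, hC⟩ := exists_tsum_dec_sq_le
  refine ⟨4 * C, fun I => ?_⟩
  rw [lintegral_eq_tsum I.scale]
  calc ∑' m : ℤ, ∫⁻ x in (⟨I.scale, m⟩ : DyadicInterval).toSet, ENNReal.ofReal (I.dec x ^ 2)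
      ≤ ∑' m : ℤ, 4 * ENNReal.ofReal ((⟨I.scale, m⟩ : DyadicInterval).dec I.center ^ 2) *
          ENNReal.ofReal I.length := by
        refine ENNReal.tsum_le_tsum fun m => ?_
        set J : DyadicInterval := ⟨I.scale, m⟩ with hJ
        have hJl : J.length = I.length := rfl
        rw [← hJl, ← volume_toSet, ← setLIntegral_const]
        refine setLIntegral_mono measurable_const fun x hx => ?_
        have h1 : I.dec x ≤ 2 * J.dec I.center := by
          have h2 : I.dec J.center = J.dec I.center := by
            rw [dec, dec, hJl, abs_sub_comm]
          rw [← h2]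
          exact I.dec_le_two_mul (by rw [← hJl]; exact J.abs_sub_le_of_mem hx J.center_mem)
        calc ENNReal.ofReal (I.dec x ^ 2) ≤ ENNReal.ofReal ((2 * J.dec I.center) ^ 2) :=
              ENNReal.ofReal_le_ofReal (pow_le_pow_left₀ (I.dec_pos x).le h1 2)
          _ = 4 * ENNReal.ofReal (J.dec I.center ^ 2) := by
              rw [mul_pow, ENNReal.ofReal_mul (by norm_num)]; norm_num
    _ ≤ _ := by
        rw [ENNReal.tsum_mul_right, ENNReal.tsum_mul_left]
        push_cast
        gcongr
        exact hC _ _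

/-- The mean of `h` over a dyadic interval. -/
noncomputable def avg (h : ℝ → ℝ≥0∞) (J : DyadicInterval) : ℝ≥0∞ :=
  (ENNReal.ofReal J.length)⁻¹ * ∫⁻ x in J.toSet, h x

/-- The mean of `h` with respect to the weight `dec J ^ 2`. -/
noncomputable def wavg (h : ℝ → ℝ≥0∞) (J : DyadicInterval) : ℝ≥0∞ :=
  (ENNReal.ofReal J.length)⁻¹ * ∫⁻ x, h x * ENNReal.ofReal (J.dec x ^ 2)

/-- A maximal function built from the triples of dyadic intervals. -/
noncomputable def maxFn (h : ℝ → ℝ≥0∞) (x : ℝ) : ℝ≥0∞ :=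
  ⨆ J : DyadicInterval, J.triple.indicator (fun _ => avg h J) x

lemma ofReal_length_ne_zero (I : DyadicInterval) : ENNReal.ofReal I.length ≠ 0 := by
  simp [I.length_pos]

lemma measurable_maxFn (h : ℝ → ℝ≥0∞) : Measurable (maxFn h) :=
  Measurable.iSup fun J => measurable_const.indicator J.measurableSet_triple

lemma avg_le_maxFn (h : ℝ → ℝ≥0∞) {J : DyadicInterval} {x : ℝ} (hx : x ∈ J.triple) :
    avg h J ≤ maxFn h x := by
  refine le_trans ?_ (le_iSup _ J)
  rw [Set.indicator_of_mem hx]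

lemma setLIntegral_le_maxFn (h : ℝ → ℝ≥0∞) {J : DyadicInterval} {x : ℝ} (hx : x ∈ J.triple) :
    ∫⁻ y in J.toSet, h y ≤ ENNReal.ofReal J.length * maxFn h x := by
  have := avg_le_maxFn h hx
  rw [avg, ENNReal.inv_mul_le_iff (ofReal_length_ne_zero J) ENNReal.ofReal_ne_top] at this
  exact this

lemma triple_subset_union (J : DyadicInterval) :
    J.triple ⊆ ((⟨J.scale, J.index - 1⟩ : DyadicInterval).toSet ∪ J.toSet) ∪
      (⟨J.scale, J.index + 1⟩ : DyadicInterval).toSet := by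
  intro x hx
  have hx1 := hx.1
  have hx2 := hx.2
  by_cases h1 : x < J.left
  · refine Or.inl (Or.inl ⟨?_, ?_⟩)
    · simp only [left, length] at *; push_cast; linarith
    · simp only [left, length] at *; push_cast; linarith
  · by_cases h2 : x < J.left + J.length
    · exact Or.inl (Or.inr ⟨not_lt.1 h1, h2⟩)
    · refine Or.inr ⟨?_, ?_⟩
      · simp only [left, length] at *; push_cast; linarith
      · simp only [left, length] at *; push_cast; linarith

/-- The triple of `J` consists of `J` and its two neighbours. The point `x` lies in the triple of
each of the three, which is the reason for building the maximal function from triples. -/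
lemma setLIntegral_triple_le (h : ℝ → ℝ≥0∞) {J : DyadicInterval} {x : ℝ} (hx : x ∈ J.toSet) :
    ∫⁻ y in J.triple, h y ≤ 3 * (ENNReal.ofReal J.length * maxFn h x) := by
  have hx1 := hx.1
  have hx2 := hx.2
  have hl := J.length_pos
  have h1 : x ∈ (⟨J.scale, J.index - 1⟩ : DyadicInterval).triple := by
    constructor <;> simp only [left, length] at * <;> push_cast <;> linarith
  have h2 : x ∈ (⟨J.scale, J.index + 1⟩ : DyadicInterval).triple := by
    constructor <;> simp only [left, length] at * <;> push_cast <;> linarith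
  calc ∫⁻ y in J.triple, h y
      ≤ (∫⁻ y in (⟨J.scale, J.index - 1⟩ : DyadicInterval).toSet, h y) + (∫⁻ y in J.toSet, h y) +
          ∫⁻ y in (⟨J.scale, J.index + 1⟩ : DyadicInterval).toSet, h y := by
        refine (lintegral_mono_set (triple_subset_union J)).trans ?_
        refine (lintegral_union_le _ _ _).trans ?_
        gcongr
        exact lintegral_union_le _ _ _
    _ ≤ ENNReal.ofReal J.length * maxFn h x + ENNReal.ofReal J.length * maxFn h x +
          ENNReal.ofReal J.length * maxFn h x :=
        add_le_add (add_le_add (setLIntegral_le_maxFn h h1)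
          (setLIntegral_le_maxFn h (J.subset_triple hx))) (setLIntegral_le_maxFn h h2)
    _ = _ := by ring

/-- One term is enough, the first `k` for which the triple of the ancestor at scale `I.scale + k`
contains `y`. If `k > 0`, the preceding triple misses `y`, so `y` is at distance at least `2 ^ (k -
1) |I|` from the center. -/
lemma dec_sq_le_tsum (I : DyadicInterval) (y : ℝ) :
    ENNReal.ofReal (I.dec y ^ 2) ≤ ∑' k : ℕ,
      (containing (I.scale + k) I.center).triple.indicator (fun _ => 4 * (4⁻¹ : ℝ≥0∞) ^ k) y := by
  classical
  have hl := I.length_pos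
  have hlen : ∀ k : ℕ, (containing (I.scale + k) I.center).length = I.length * 2 ^ k := fun k => by
    rw [length_containing, zpow_add₀ two_ne_zero, zpow_natCast]; rfl
  have hfar : ∀ k : ℕ, y ∉ (containing (I.scale + k) I.center).triple →
      I.length * 2 ^ k ≤ |y - I.center| := by
    intro k hk
    by_contra hcon
    push Not at hcon
    rw [← hlen k, abs_lt] at hcon
    have h1 := mem_containing (I.scale + k) I.center
    exact hk ⟨by linarith [h1.1], by linarith [h1.2]⟩
  have hex : ∃ k : ℕ, y ∈ (containing (I.scale + k) I.center).triple := by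
    by_contra hcon
    push Not at hcon
    obtain ⟨k, hk⟩ := pow_unbounded_of_one_lt (|y - I.center| / I.length) one_lt_two
    have := hfar k (hcon k)
    rw [div_lt_iff₀ hl] at hk
    linarith
  set k := Nat.find hex
  have hk := Nat.find_spec hex
  refine le_trans ?_ (ENNReal.le_tsum k)
  rw [Set.indicator_of_mem hk]
  have h4 : (4 : ℝ≥0∞) * (4⁻¹ : ℝ≥0∞) ^ k = ENNReal.ofReal (4 * (4⁻¹ : ℝ) ^ k) := by
    rw [ENNReal.ofReal_mul (by norm_num), ENNReal.ofReal_pow (by norm_num),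
      ENNReal.ofReal_inv_of_pos (by norm_num)]
    norm_num
  rw [h4]
  refine ENNReal.ofReal_le_ofReal ?_
  rcases Nat.eq_zero_or_pos k with h0 | h0
  · rw [h0]
    have := pow_le_one₀ (I.dec_pos y).le (I.dec_le_one y) (n := 2)
    linarith
  · obtain ⟨j, hj⟩ : ∃ j, k = j + 1 := ⟨k - 1, by omega⟩
    have := I.dec_le_div (by positivity) (hfar j (Nat.find_min hex (m := j) (by omega)))
    rw [div_mul_cancel_left₀ hl.ne'] at this
    calc I.dec y ^ 2 ≤ ((2 ^ j)⁻¹) ^ 2 := pow_le_pow_left₀ (I.dec_pos y).le this 2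
      _ = 4 * (4⁻¹ : ℝ) ^ k := by
        rw [hj, pow_succ (4⁻¹ : ℝ), ← inv_pow, ← pow_mul, mul_comm j 2, pow_mul]
        norm_num
        ring

/-- The weighted means are controlled by the maximal function. -/
lemma wavg_le_maxFn (h : ℝ → ℝ≥0∞) (hh : AEMeasurable h) {I : DyadicInterval} {x : ℝ}
    (hx : x ∈ I.toSet) : wavg h I ≤ 24 * maxFn h x := by
  rw [wavg, ENNReal.inv_mul_le_iff (ofReal_length_ne_zero I) ENNReal.ofReal_ne_top]
  calc ∫⁻ y, h y * ENNReal.ofReal (I.dec y ^ 2)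
      ≤ ∫⁻ y, ∑' k : ℕ, (containing (I.scale + k) I.center).triple.indicator
          (fun y => 4 * (4⁻¹ : ℝ≥0∞) ^ k * h y) y := by
        refine lintegral_mono fun y => ?_
        refine (mul_le_mul' le_rfl (dec_sq_le_tsum I y)).trans (le_of_eq ?_)
        rw [← ENNReal.tsum_mul_left]
        refine tsum_congr fun k => ?_
        by_cases hy : y ∈ (containing (I.scale + k) I.center).triple
        · simp only [Set.indicator_of_mem hy]; ring
        · simp [Set.indicator_of_notMem hy]
    _ = ∑' k : ℕ, 4 * (4⁻¹ : ℝ≥0∞) ^ k *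
          ∫⁻ y in (containing (I.scale + k) I.center).triple, h y := by
        rw [lintegral_tsum]
        · refine tsum_congr fun k => ?_
          rw [lintegral_indicator (measurableSet_triple _), lintegral_const_mul'']
          exact hh.restrict
        · intro k
          exact (hh.const_mul _).indicator (measurableSet_triple _)
    -- The integral over the `k`-th triple is at most `3 · 2 ^ k |I|` times the maximal function, so
    -- `4 · 4 ^ (-k)` leaves `12 · 2 ^ (-k)`, with sum 24.
    _ ≤ ∑' k : ℕ, 12 * (ENNReal.ofReal I.length * maxFn h x) * (2⁻¹ : ℝ≥0∞) ^ k := by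
        refine ENNReal.tsum_le_tsum fun k => ?_
        have hmem : x ∈ (containing (I.scale + k) I.center).toSet :=
          subset_containing I.center_mem (by omega) hx
        have hlen : ENNReal.ofReal (containing (I.scale + k) I.center).length =
            ENNReal.ofReal I.length * 2 ^ k := by
          rw [length_containing, zpow_add₀ two_ne_zero, zpow_natCast,
            ENNReal.ofReal_mul (by positivity), ENNReal.ofReal_pow (by norm_num)]
          norm_num [length]
        have h24 : (4⁻¹ : ℝ≥0∞) ^ k * 2 ^ k = (2⁻¹ : ℝ≥0∞) ^ k := by
          rw [← mul_pow]
          congr 1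
          rw [show (4 : ℝ≥0∞) = 2 * 2 by norm_num, ENNReal.mul_inv (by simp) (by simp), mul_assoc,
            ENNReal.inv_mul_cancel (by simp) (by simp), mul_one]
        calc 4 * (4⁻¹ : ℝ≥0∞) ^ k * ∫⁻ y in (containing (I.scale + k) I.center).triple, h y
            ≤ 4 * (4⁻¹ : ℝ≥0∞) ^ k * (3 * (ENNReal.ofReal I.length * 2 ^ k * maxFn h x)) := by
              gcongr
              rw [← hlen]
              exact setLIntegral_triple_le h hmem
          _ = 12 * (ENNReal.ofReal I.length * maxFn h x) * ((4⁻¹ : ℝ≥0∞) ^ k * 2 ^ k) := by ring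
          _ = _ := by rw [h24]
    _ = ENNReal.ofReal I.length * (24 * maxFn h x) := by
        rw [ENNReal.tsum_mul_left, ENNReal.tsum_geometric, ENNReal.one_sub_inv_two, inv_inv]
        ring

/-! ### Maximal bad intervals and the weak type of the maximal function. -/

section Stopping

/-- The dyadic interval `J` is maximal among those on which `h` has mean larger than `lam`. -/
structure IsMaxBad (h : ℝ → ℝ≥0∞) (lam : ℝ≥0∞) (J : DyadicInterval) : Prop where
  lt : lam * ENNReal.ofReal J.length < ∫⁻ x in J.toSet, h x
  maximal : ∀ J' : DyadicInterval, J.toSet ⊆ J'.toSet →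
    lam * ENNReal.ofReal J'.length < ∫⁻ x in J'.toSet, h x → J' = J

variable {h : ℝ → ℝ≥0∞} {lam : ℝ≥0∞}

/-- A bad interval has length less than `(∫ h) / λ`, so the scales of the bad ancestors of `J` are
bounded above and a largest one exists. -/
lemma exists_isMaxBad (hfin : ∫⁻ x, h x ≠ ∞) (hlam : lam ≠ 0) {J : DyadicInterval}
    (hJ : lam * ENNReal.ofReal J.length < ∫⁻ x in J.toSet, h x) :
    ∃ J', IsMaxBad h lam J' ∧ J.toSet ⊆ J'.toSet := by
  set P : Set ℕ := {k | lam * ENNReal.ofReal (containing (J.scale + k) J.left).length <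
    ∫⁻ x in (containing (J.scale + k) J.left).toSet, h x} with hP
  have hlen : ∀ k : ℕ, ENNReal.ofReal (containing (J.scale + k) J.left).length =
      ENNReal.ofReal J.length * 2 ^ k := fun k => by
    rw [length_containing, zpow_add₀ two_ne_zero, zpow_natCast,
      ENNReal.ofReal_mul (by positivity), ENNReal.ofReal_pow (by norm_num)]
    norm_num [length]
  have h0 : 0 ∈ P := by
    simp only [hP, Set.mem_ofPred_eq, Nat.cast_zero, add_zero]
    rw [containing_of_mem J J.left_mem]
    exact hJ
  have hbdd : BddAbove P := by
    have hX : (∫⁻ x, h x) / (lam * ENNReal.ofReal J.length) ≠ ∞ :=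
      ENNReal.div_ne_top hfin (mul_ne_zero hlam (ofReal_length_ne_zero J))
    obtain ⟨N, hN⟩ := ENNReal.exists_nat_gt hX
    refine ⟨N, fun k hk => ?_⟩
    by_contra hcon
    push Not at hcon
    have h1 : lam * (ENNReal.ofReal J.length * 2 ^ k) < ∫⁻ x, h x := by
      rw [← hlen]
      exact lt_of_lt_of_le hk (setLIntegral_le_lintegral _ _)
    have h2 : (2 : ℝ≥0∞) ^ k ≤ (∫⁻ x, h x) / (lam * ENNReal.ofReal J.length) := by
      have hlt : lam ≠ ∞ := by
        rintro rfl
        rw [ENNReal.top_mul (ofReal_length_ne_zero J)] at hJ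
        exact not_top_lt hJ
      rw [ENNReal.le_div_iff_mul_le (Or.inl (mul_ne_zero hlam (ofReal_length_ne_zero J)))
        (Or.inl (ENNReal.mul_ne_top hlt ENNReal.ofReal_ne_top))]
      exact le_trans (le_of_eq (by ring)) h1.le
    have h3 : ((k : ℕ) : ℝ≥0∞) ≤ 2 ^ k := by exact_mod_cast Nat.lt_two_pow_self.le
    have h4 : ((N : ℕ) : ℝ≥0∞) < k := by exact_mod_cast hcon
    exact absurd (h4.trans_le (h3.trans h2)) (not_lt.2 hN.le)
  set K := sSup P
  have hK : K ∈ P := Nat.sSup_mem ⟨0, h0⟩ hbdd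
  refine ⟨containing (J.scale + K) J.left, ⟨hK, fun J' hsub hJ' => ?_⟩,
    subset_containing J.left_mem (by omega)⟩
  have hs : J.scale + K ≤ J'.scale := scale_le_of_subset hsub
  have hmem : J.left ∈ J'.toSet := hsub (mem_containing _ _)
  have heq : containing (J.scale + (J'.scale - J.scale).toNat) J.left = J' := by
    rw [Int.toNat_of_nonneg (by omega), add_sub_cancel]
    exact containing_of_mem _ hmem
  have : (J'.scale - J.scale).toNat ∈ P := by
    simp only [hP, Set.mem_ofPred_eq]
    rw [heq]
    exact hJ'
  have := le_csSup hbdd this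
  refine (eq_of_mem_of_scale_eq (mem_containing _ _) hmem ?_).symm
  rw [scale_containing]
  simp only [K]
  omega

lemma IsMaxBad.eq_of_mem {J J' : DyadicInterval} (hJ : IsMaxBad h lam J)
    (hJ' : IsMaxBad h lam J') {x : ℝ} (hx : x ∈ J.toSet) (hx' : x ∈ J'.toSet) : J = J' := by
  rcases le_total J.scale J'.scale with hs | hs
  · exact (hJ.maximal J' (subset_of_mem_of_scale_le hx hx' hs) hJ'.lt).symm
  · exact hJ'.maximal J (subset_of_mem_of_scale_le hx' hx hs) hJ.lt

lemma pairwise_disjoint_isMaxBad : Pairwise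
    (Function.onFun Disjoint fun J : {J : DyadicInterval // IsMaxBad h lam J} => J.1.toSet) :=
  fun J J' hne => Set.disjoint_left.2 fun _ hx hx' =>
    hne (Subtype.ext (J.2.eq_of_mem J'.2 hx hx'))

lemma tsum_isMaxBad_le : lam * ∑' J : {J : DyadicInterval // IsMaxBad h lam J},
    ENNReal.ofReal J.1.length ≤ ∫⁻ x, h x := by
  rw [← ENNReal.tsum_mul_left]
  calc ∑' J : {J : DyadicInterval // IsMaxBad h lam J}, lam * ENNReal.ofReal J.1.length
      ≤ ∑' J : {J : DyadicInterval // IsMaxBad h lam J}, ∫⁻ x in J.1.toSet, h x :=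
        ENNReal.tsum_le_tsum fun J => J.2.lt.le
    _ = ∫⁻ x in ⋃ J : {J : DyadicInterval // IsMaxBad h lam J}, J.1.toSet, h x :=
        (lintegral_iUnion (fun J => J.1.measurableSet_toSet) pairwise_disjoint_isMaxBad _).symm
    _ ≤ _ := setLIntegral_le_lintegral _ _

/-- The union of the triples of the maximal bad intervals. -/
def badSet (h : ℝ → ℝ≥0∞) (lam : ℝ≥0∞) : Set ℝ :=
  ⋃ J : {J : DyadicInterval // IsMaxBad h lam J}, J.1.triple

lemma measurableSet_badSet : MeasurableSet (badSet h lam) :=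
  MeasurableSet.iUnion fun J => J.1.measurableSet_triple

lemma volume_badSet_le : lam * volume (badSet h lam) ≤ 3 * ∫⁻ x, h x := by
  calc lam * volume (badSet h lam)
      ≤ lam * ∑' J : {J : DyadicInterval // IsMaxBad h lam J}, volume J.1.triple := by
        gcongr; exact measure_iUnion_le _
    _ = 3 * (lam * ∑' J : {J : DyadicInterval // IsMaxBad h lam J}, ENNReal.ofReal J.1.length) := by
        simp_rw [volume_triple, ENNReal.tsum_mul_left]; ring
    _ ≤ _ := by gcongr; exact tsum_isMaxBad_le

/-- The weak type estimate for the maximal function. -/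
lemma mul_volume_maxFn_le (h : ℝ → ℝ≥0∞) (lam : ℝ≥0∞) :
    lam * volume {x | lam < maxFn h x} ≤ 3 * ∫⁻ x, h x := by
  by_cases hfin : ∫⁻ x, h x = ∞
  · rw [hfin]; simp
  rcases eq_or_ne lam 0 with rfl | hlam
  · simp
  refine le_trans ?_ (volume_badSet_le (lam := lam))
  gcongr
  intro x hx
  obtain ⟨J, hJ⟩ := lt_iSup_iff.1 (show lam < maxFn h x from hx)
  have hxJ : x ∈ J.triple := by
    by_contra hcon
    rw [Set.indicator_of_notMem hcon] at hJ
    exact not_lt_zero hJ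
  rw [Set.indicator_of_mem hxJ, avg, mul_comm, ← div_eq_mul_inv, ENNReal.lt_div_iff_mul_lt
    (Or.inl (ofReal_length_ne_zero J)) (Or.inl ENNReal.ofReal_ne_top)] at hJ
  -- Triples increase with their intervals, so `x` also lies in the triple of a maximal bad
  -- interval.
  obtain ⟨J', hJ', hsub⟩ := exists_isMaxBad hfin hlam hJ
  exact Set.mem_iUnion.2 ⟨⟨J', hJ'⟩, triple_subset_triple hsub hxJ⟩

end Stopping

end Paraproduct

/-! ### The maximal function on L^p for p > 1. -/

namespace Paraproduct

open DyadicInterval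

lemma maxFn_mono {h h' : ℝ → ℝ≥0∞} (hh : ∀ x, h x ≤ h' x) (x : ℝ) : maxFn h x ≤ maxFn h' x := by
  refine iSup_mono fun J => Set.indicator_le_indicator ?_
  unfold avg
  gcongr with y
  exact hh y

lemma avg_const_add_le {h : ℝ → ℝ≥0∞} (c : ℝ≥0∞) (J : DyadicInterval) :
    avg (fun x => c + h x) J ≤ c + avg h J := by
  unfold avg
  rw [lintegral_add_left measurable_const, setLIntegral_const, volume_toSet, mul_add, mul_comm c,
    ← mul_assoc, ENNReal.inv_mul_cancel (ofReal_length_ne_zero J) ENNReal.ofReal_ne_top, one_mul]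

lemma maxFn_const_add_le {h : ℝ → ℝ≥0∞} (c : ℝ≥0∞) (x : ℝ) :
    maxFn (fun x => c + h x) x ≤ c + maxFn h x := by
  refine iSup_le fun J => ?_
  by_cases hx : x ∈ J.triple
  · rw [Set.indicator_of_mem hx]
    exact (avg_const_add_le c J).trans (by gcongr; exact avg_le_maxFn h hx)
  · rw [Set.indicator_of_notMem hx]; exact zero_le

/-- The part of `h` below `lam` adds at most `lam` to the maximal function. The weak type estimate
is needed only for the part above `lam`, as in Marcinkiewicz interpolation. -/
lemma mul_volume_maxFn_le' {h : ℝ → ℝ≥0∞} (lam : ℝ≥0∞) :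
    lam * volume {x | lam + lam < maxFn h x} ≤ 3 * ∫⁻ x, {x | lam < h x}.indicator h x := by
  refine le_trans ?_ (mul_volume_maxFn_le _ lam)
  by_cases hlt : lam = ∞
  · simp [hlt]
  refine mul_le_mul' le_rfl (measure_mono fun x hx => ?_)
  have h1 : maxFn h x ≤ lam + maxFn ({x | lam < h x}.indicator h) x := by
    refine le_trans (maxFn_mono (fun y => ?_) x) (maxFn_const_add_le lam x)
    by_cases hy : lam < h y
    · rw [Set.indicator_of_mem (by exact hy)]; exact le_add_self
    · exact (not_lt.1 hy).trans le_self_add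
  exact lt_of_add_lt_add_left (lt_of_lt_of_le hx h1)

lemma exists_two_rpow_mem {g : ℝ≥0∞} (h0 : g ≠ 0) (h : g ≠ ∞) :
    ∃ k : ℤ, (2 : ℝ≥0∞) ^ (k : ℝ) < g ∧ g ≤ (2 : ℝ≥0∞) ^ ((k : ℝ) + 1) := by
  obtain ⟨k, hk⟩ := ENNReal.exists_mem_Ioc_zpow (x := g) (y := 2) h0 h (by norm_num) (by simp)
  refine ⟨k, ?_, ?_⟩
  · rw [ENNReal.rpow_intCast]; exact hk.1
  · have : ((k : ℝ) + 1) = ((k + 1 : ℤ) : ℝ) := by push_cast; rfl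
    rw [this, ENNReal.rpow_intCast]; exact hk.2

/-- Layer cake in powers of two: the term with `2 ^ k < g ≤ 2 ^ (k + 1)` suffices. For `g = ∞` the
terms with `k ≥ 0` are all at least one, and the sum diverges. -/
lemma rpow_le_tsum_levels {p : ℝ} (hp : 0 < p) (g : ℝ≥0∞) :
    g ^ p ≤ ∑' k : ℤ, if (2 : ℝ≥0∞) ^ (k : ℝ) < g then (2 : ℝ≥0∞) ^ (((k : ℝ) + 1) * p) else 0 := by
  rcases eq_or_ne g 0 with rfl | h0
  · simp [hp]
  rcases eq_or_ne g ∞ with rfl | htop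
  · have h1 : ∑' k : ℤ, (if (2 : ℝ≥0∞) ^ (k : ℝ) < ∞ then
        (2 : ℝ≥0∞) ^ (((k : ℝ) + 1) * p) else 0) = ∞ := by
      refine top_unique ?_
      refine (ENNReal.tsum_const_eq_top_of_ne_zero (α := ℕ) (c := 1) one_ne_zero).symm.le.trans ?_
      refine le_trans ?_ (ENNReal.tsum_comp_le_tsum_of_injective (f := fun n : ℕ => (n : ℤ))
        Nat.cast_injective _)
      refine ENNReal.tsum_le_tsum fun n => ?_
      rw [if_pos]
      · refine ENNReal.one_le_rpow (by norm_num) ?_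
        push_cast; positivity
      · exact (ENNReal.rpow_ne_top_of_nonneg (x := 2) (y := ((n : ℤ) : ℝ)) (by simp)
          ENNReal.ofNat_ne_top).lt_top
    rw [h1]; exact le_top
  · obtain ⟨k, hk1, hk2⟩ := exists_two_rpow_mem h0 htop
    refine le_trans ?_ (ENNReal.le_tsum k)
    rw [if_pos hk1, ENNReal.rpow_mul]
    gcongr

/-- The condition on `k` cuts the series off two steps above the binary order of `g`. Because `p >
1`, it is a geometric series dominated by its largest term. -/
lemma exists_tsum_levels_le {p : ℝ} (hp : 1 < p) : ∃ C : ℝ≥0, 0 < C ∧ ∀ g : ℝ≥0∞,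
    ∑' k : ℤ, (if (2 : ℝ≥0∞) ^ ((k : ℝ) - 1) < g then
      (2 : ℝ≥0∞) ^ ((k : ℝ) * (p - 1)) * g else 0) ≤ C * g ^ p := by
  set r : ℝ≥0∞ := (2 : ℝ≥0∞) ^ (-(p - 1)) with hr
  have hr1 : r < 1 := ENNReal.rpow_lt_one_of_one_lt_of_neg (by norm_num) (by linarith)
  have hSne : (1 - r)⁻¹ ≠ ∞ := ENNReal.inv_ne_top.2 (tsub_pos_of_lt hr1).ne'
  have hCne : (4 : ℝ≥0∞) ^ (p - 1) * (1 - r)⁻¹ ≠ ∞ :=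
    ENNReal.mul_ne_top (ENNReal.rpow_ne_top_of_nonneg (by linarith) (by simp)) hSne
  refine ⟨((4 : ℝ≥0∞) ^ (p - 1) * (1 - r)⁻¹).toNNReal + 1, by positivity, fun g => ?_⟩
  rw [ENNReal.coe_add, ENNReal.coe_toNNReal hCne]
  rcases eq_or_ne g 0 with rfl | h0
  · simp
  rcases eq_or_ne g ∞ with rfl | htop
  · rw [ENNReal.top_rpow_of_pos (by linarith), ENNReal.mul_top]
    · exact le_top
    · simp
  obtain ⟨k₀, hk1, hk2⟩ := exists_two_rpow_mem h0 htop
  calc ∑' k : ℤ, (if (2 : ℝ≥0∞) ^ ((k : ℝ) - 1) < g then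
          (2 : ℝ≥0∞) ^ ((k : ℝ) * (p - 1)) * g else 0)
      = ∑' j : ℕ, (if (2 : ℝ≥0∞) ^ (((k₀ + 1 - j : ℤ) : ℝ)) < g then
          (2 : ℝ≥0∞) ^ (((k₀ + 2 - j : ℤ) : ℝ) * (p - 1)) * g else 0) := by
        have hinj : Function.Injective fun j : ℕ => k₀ + 2 - (j : ℤ) := fun i j hij => by
          simpa using hij
        rw [← hinj.tsum_eq]
        · refine tsum_congr fun j => ?_
          have : (((k₀ + 2 - j : ℤ) : ℝ)) - 1 = ((k₀ + 1 - j : ℤ) : ℝ) := by push_cast; ring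
          rw [this]
        · intro k hk
          rw [Function.mem_support] at hk
          have hlt : (2 : ℝ≥0∞) ^ ((k : ℝ) - 1) < g := by
            by_contra hcon
            simp [hcon] at hk
          have hlt2 := hlt.trans_le hk2
          have : k ≤ k₀ + 2 := by
            by_contra hcon
            refine absurd hlt2 (not_lt.2 ?_)
            refine ENNReal.rpow_le_rpow_of_exponent_le (by norm_num) ?_
            have : ((k₀ + 2 + 1 : ℤ) : ℝ) ≤ k := by exact_mod_cast (by omega : k₀ + 2 + 1 ≤ k)
            push_cast at this
            linarith
          exact ⟨(k₀ + 2 - k).toNat, by simp only []; omega⟩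
    _ ≤ ∑' j : ℕ, ((4 : ℝ≥0∞) ^ (p - 1) * g ^ (p - 1) * g) * r ^ j := by
        refine ENNReal.tsum_le_tsum fun j => ?_
        have h1 : (2 : ℝ≥0∞) ^ (((k₀ + 2 - j : ℤ) : ℝ) * (p - 1)) * g ≤
            ((4 : ℝ≥0∞) ^ (p - 1) * g ^ (p - 1) * g) * r ^ j := by
          have h2 : (2 : ℝ≥0∞) ^ (((k₀ + 2 - j : ℤ) : ℝ) * (p - 1)) =
              (4 : ℝ≥0∞) ^ (p - 1) * ((2 : ℝ≥0∞) ^ (k₀ : ℝ)) ^ (p - 1) * r ^ j := by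
            rw [hr, ← ENNReal.rpow_natCast, ← ENNReal.rpow_mul, ← ENNReal.rpow_mul,
              show (4 : ℝ≥0∞) = (2 : ℝ≥0∞) ^ (2 : ℝ) by norm_num, ← ENNReal.rpow_mul,
              ← ENNReal.rpow_add _ _ (by simp) (by simp),
              ← ENNReal.rpow_add _ _ (by simp) (by simp)]
            congr 1
            push_cast
            ring
          rw [h2]
          have h3 : ((2 : ℝ≥0∞) ^ (k₀ : ℝ)) ^ (p - 1) ≤ g ^ (p - 1) :=
            ENNReal.rpow_le_rpow hk1.le (by linarith)
          calc _ = (4 : ℝ≥0∞) ^ (p - 1) * ((2 : ℝ≥0∞) ^ (k₀ : ℝ)) ^ (p - 1) * g * r ^ j := by ring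
            _ ≤ _ := by gcongr
        split_ifs
        · exact h1
        · exact zero_le
    _ = ((4 : ℝ≥0∞) ^ (p - 1) * (1 - r)⁻¹) * g ^ p := by
        rw [ENNReal.tsum_mul_left, ENNReal.tsum_geometric]
        have : g ^ p = g ^ (p - 1) * g := by
          conv_rhs => rw [← ENNReal.rpow_one g, ← ENNReal.rpow_mul, one_mul,
            ← ENNReal.rpow_add _ _ h0 htop]
          congr 1; ring
        rw [this]; ring
    _ ≤ _ := by gcongr; exact le_self_add

/-- The strong type estimate for the maximal function. -/
lemma exists_lintegral_maxFn_rpow_le {p : ℝ} (hp : 1 < p) : ∃ C : ℝ≥0, ∀ h : ℝ → ℝ≥0∞,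
    Measurable h → ∫⁻ x, maxFn h x ^ p ≤ C * ∫⁻ x, h x ^ p := by
  obtain ⟨C, hC0, hC⟩ := exists_tsum_levels_le hp
  have hp0 : 0 < p := by linarith
  have hDne : (6 : ℝ≥0∞) * 2 ^ p ≠ ∞ := ENNReal.mul_ne_top (by simp)
    (ENNReal.rpow_ne_top_of_nonneg hp0.le (by simp))
  refine ⟨(6 * (2 : ℝ≥0∞) ^ p).toNNReal * C, fun h hh => ?_⟩
  rw [ENNReal.coe_mul, ENNReal.coe_toNNReal hDne]
  have hlev : ∀ k : ℤ, volume {x | (2 : ℝ≥0∞) ^ (k : ℝ) < maxFn h x} ≤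
      6 * (2 : ℝ≥0∞) ^ (-(k : ℝ)) *
        ∫⁻ x, {x | (2 : ℝ≥0∞) ^ ((k : ℝ) - 1) < h x}.indicator h x := by
    intro k
    have h1 := mul_volume_maxFn_le' (h := h) ((2 : ℝ≥0∞) ^ ((k : ℝ) - 1))
    have h2 : (2 : ℝ≥0∞) ^ ((k : ℝ) - 1) + (2 : ℝ≥0∞) ^ ((k : ℝ) - 1) = (2 : ℝ≥0∞) ^ (k : ℝ) := by
      rw [← two_mul]
      conv_lhs => rw [← ENNReal.rpow_one 2, ← ENNReal.rpow_mul, one_mul,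
        ← ENNReal.rpow_add _ _ (by simp) (by simp)]
      congr 1; ring
    rw [h2] at h1
    have h3 : (2 * (2 : ℝ≥0∞) ^ (-(k : ℝ))) * (2 : ℝ≥0∞) ^ ((k : ℝ) - 1) = 1 := by
      conv_lhs => enter [1, 1]; rw [← ENNReal.rpow_one 2]
      rw [← ENNReal.rpow_add _ _ (by simp) (by simp), ← ENNReal.rpow_add _ _ (by simp) (by simp)]
      rw [show (1 : ℝ) + -(k : ℝ) + ((k : ℝ) - 1) = 0 by ring, ENNReal.rpow_zero]
    calc volume {x | (2 : ℝ≥0∞) ^ (k : ℝ) < maxFn h x}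
        = (2 * (2 : ℝ≥0∞) ^ (-(k : ℝ))) * ((2 : ℝ≥0∞) ^ ((k : ℝ) - 1) *
            volume {x | (2 : ℝ≥0∞) ^ (k : ℝ) < maxFn h x}) := by rw [← mul_assoc, h3, one_mul]
      _ ≤ (2 * (2 : ℝ≥0∞) ^ (-(k : ℝ))) *
            (3 * ∫⁻ x, {x | (2 : ℝ≥0∞) ^ ((k : ℝ) - 1) < h x}.indicator h x) := by gcongr
      _ = _ := by ring
  have hset : ∀ k : ℤ, MeasurableSet {x | (2 : ℝ≥0∞) ^ ((k : ℝ) - 1) < h x} := fun k =>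
    measurableSet_lt measurable_const hh
  calc ∫⁻ x, maxFn h x ^ p
      ≤ ∫⁻ x, ∑' k : ℤ, {x | (2 : ℝ≥0∞) ^ (k : ℝ) < maxFn h x}.indicator
          (fun _ => (2 : ℝ≥0∞) ^ (((k : ℝ) + 1) * p)) x := by
        refine lintegral_mono fun x => (rpow_le_tsum_levels hp0 _).trans (le_of_eq ?_)
        exact tsum_congr fun k => by simp [Set.indicator]
    _ = ∑' k : ℤ, (2 : ℝ≥0∞) ^ (((k : ℝ) + 1) * p) *
          volume {x | (2 : ℝ≥0∞) ^ (k : ℝ) < maxFn h x} := by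
        have hm : ∀ k : ℤ, MeasurableSet {x | (2 : ℝ≥0∞) ^ (k : ℝ) < maxFn h x} := fun k =>
          measurableSet_lt measurable_const (measurable_maxFn h)
        rw [lintegral_tsum fun k => (measurable_const.indicator (hm k)).aemeasurable]
        exact tsum_congr fun k => lintegral_indicator_const (hm k) _
    _ ≤ ∑' k : ℤ, (6 * (2 : ℝ≥0∞) ^ p) * ((2 : ℝ≥0∞) ^ ((k : ℝ) * (p - 1)) *
          ∫⁻ x, {x | (2 : ℝ≥0∞) ^ ((k : ℝ) - 1) < h x}.indicator h x) := by
        refine ENNReal.tsum_le_tsum fun k => ?_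
        calc _ ≤ (2 : ℝ≥0∞) ^ (((k : ℝ) + 1) * p) * (6 * (2 : ℝ≥0∞) ^ (-(k : ℝ)) *
                ∫⁻ x, {x | (2 : ℝ≥0∞) ^ ((k : ℝ) - 1) < h x}.indicator h x) := by
              gcongr; exact hlev k
          _ = 6 * ((2 : ℝ≥0∞) ^ (((k : ℝ) + 1) * p) * (2 : ℝ≥0∞) ^ (-(k : ℝ))) *
                ∫⁻ x, {x | (2 : ℝ≥0∞) ^ ((k : ℝ) - 1) < h x}.indicator h x := by ring
          _ = 6 * ((2 : ℝ≥0∞) ^ p * (2 : ℝ≥0∞) ^ ((k : ℝ) * (p - 1))) *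
                ∫⁻ x, {x | (2 : ℝ≥0∞) ^ ((k : ℝ) - 1) < h x}.indicator h x := by
              rw [← ENNReal.rpow_add _ _ (by simp) (by simp),
                ← ENNReal.rpow_add _ _ (by simp) (by simp),
                show ((k : ℝ) + 1) * p + -(k : ℝ) = p + (k : ℝ) * (p - 1) by ring]
          _ = _ := by ring
    _ = (6 * (2 : ℝ≥0∞) ^ p) * ∫⁻ x, ∑' k : ℤ, (if (2 : ℝ≥0∞) ^ ((k : ℝ) - 1) < h x then
          (2 : ℝ≥0∞) ^ ((k : ℝ) * (p - 1)) * h x else 0) := by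
        rw [ENNReal.tsum_mul_left, lintegral_tsum]
        · congr 1
          refine tsum_congr fun k => ?_
          rw [← lintegral_const_mul _ (hh.indicator (hset k))]
          refine lintegral_congr fun x => ?_
          by_cases hx : (2 : ℝ≥0∞) ^ ((k : ℝ) - 1) < h x <;> simp [Set.indicator, hx]
        · exact fun k => (Measurable.ite (hset k) (hh.const_mul _) measurable_const).aemeasurable
    _ ≤ (6 * (2 : ℝ≥0∞) ^ p) * ∫⁻ x, C * h x ^ p := by
        gcongr with x
        exact hC _
    _ = _ := by rw [lintegral_const_mul _ (hh.pow_const _)]; ring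

lemma maxFn_le_of_ae_le {h : ℝ → ℝ≥0∞} {A : ℝ≥0∞} (hA : ∀ᵐ x, h x ≤ A) (x : ℝ) :
    maxFn h x ≤ A := by
  refine iSup_le fun J => ?_
  refine Set.indicator_apply_le' (fun _ => ?_) fun _ => zero_le
  rw [avg, ENNReal.inv_mul_le_iff (ofReal_length_ne_zero J) ENNReal.ofReal_ne_top, mul_comm,
    ← volume_toSet, ← setLIntegral_const]
  exact lintegral_mono_ae (ae_restrict_of_ae hA)

lemma maxFn_congr_ae {h h' : ℝ → ℝ≥0∞} (hh : h =ᵐ[volume] h') (x : ℝ) :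
    maxFn h x = maxFn h' x := by
  unfold maxFn avg
  congr! 5 with J y
  exact lintegral_congr_ae (ae_restrict_of_ae hh)

end Paraproduct

/-! ### Good families of functions and their off-diagonal decay. -/

namespace Paraproduct

open DyadicInterval

lemma tsum_eq_tsum_scale (a : DyadicInterval → ℝ≥0∞) :
    ∑' I, a I = ∑' k : ℤ, ∑' m : ℤ, a ⟨k, m⟩ := by
  rw [← equivProd.tsum_eq]
  exact ENNReal.tsum_prod (f := fun k m => a ⟨k, m⟩)

/-- The terms decay geometrically on both sides of the scale with `2 ^ k` comparable to `r`;
shifting `k` makes the bound independent of `r`. -/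
lemma exists_tsum_min_le : ∃ C : ℝ≥0, ∀ r : ℝ, 0 < r →
    ∑' k : ℤ, ENNReal.ofReal (min (r / 2 ^ k) (2 ^ k / r)) ≤ C := by
  have hs : Summable fun k : ℤ => 2 * (2⁻¹ : ℝ) ^ k.natAbs := by
    refine Summable.mul_left 2 (Summable.of_nat_of_neg ?_ ?_)
    · simpa using summable_geometric_of_lt_one (r := (2⁻¹ : ℝ)) (by norm_num) (by norm_num)
    · simpa using summable_geometric_of_lt_one (r := (2⁻¹ : ℝ)) (by norm_num) (by norm_num)
  refine ⟨(∑' k : ℤ, 2 * (2⁻¹ : ℝ) ^ k.natAbs).toNNReal, fun r hr => ?_⟩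
  obtain ⟨k₀, hk1, hk2⟩ := exists_mem_Ico_zpow hr (one_lt_two (α := ℝ))
  have hpt : ∀ k : ℤ, min (r / 2 ^ k) (2 ^ k / r) ≤ 2 * (2⁻¹ : ℝ) ^ (k - k₀).natAbs := by
    intro k
    rcases le_total k₀ k with h | h
    · refine (min_le_left _ _).trans ?_
      rw [div_le_iff₀ (by positivity)]
      refine hk2.le.trans (le_of_eq ?_)
      have : (2 : ℝ) ^ k = 2 ^ (k - k₀).natAbs * 2 ^ k₀ := by
        rw [← zpow_natCast, ← zpow_add₀ two_ne_zero]; congr 1; omega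
      rw [this, zpow_add_one₀ two_ne_zero, inv_pow]
      field_simp
    · refine (min_le_right _ _).trans ?_
      rw [div_le_iff₀ hr]
      have : (2 : ℝ) ^ k = (2⁻¹ : ℝ) ^ (k - k₀).natAbs * 2 ^ k₀ := by
        rw [inv_pow, ← zpow_natCast, ← zpow_neg, ← zpow_add₀ two_ne_zero]; congr 1; omega
      rw [this]
      have h3 : (0 : ℝ) < 2⁻¹ ^ (k - k₀).natAbs := by positivity
      nlinarith
  calc ∑' k : ℤ, ENNReal.ofReal (min (r / 2 ^ k) (2 ^ k / r))
      ≤ ∑' k : ℤ, ENNReal.ofReal (2 * (2⁻¹ : ℝ) ^ (k - k₀).natAbs) :=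
        ENNReal.tsum_le_tsum fun k => ENNReal.ofReal_le_ofReal (hpt k)
    _ = ∑' k : ℤ, ENNReal.ofReal (2 * (2⁻¹ : ℝ) ^ k.natAbs) :=
        (Equiv.subRight k₀).tsum_eq (fun k : ℤ => ENNReal.ofReal (2 * (2⁻¹ : ℝ) ^ k.natAbs))
    _ = _ := (ENNReal.ofReal_tsum_of_nonneg (fun _ => by positivity) hs).symm

/-- The sequence of the absolute values of the coefficients `⟨f, ψ_I⟩`. -/
noncomputable def coef (f : ℝ → ℂ) (ψ : DyadicInterval → ℝ → ℂ) (I : DyadicInterval) : ℝ≥0∞ :=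
  ‖pairing f (ψ I)‖ₑ

lemma coef_ne_top (f : ℝ → ℂ) (ψ : DyadicInterval → ℝ → ℂ) (I : DyadicInterval) :
    coef f ψ I ≠ ∞ := enorm_ne_top

/-- Families of functions, normalized in `L¹`, which are localized to the dyadic intervals and
vary little on small dyadic intervals. -/
structure GoodFamily (K : ℝ) (ψ : DyadicInterval → ℝ → ℂ) : Prop where
  nonneg : 0 ≤ K
  measurable : ∀ I, Measurable (ψ I)
  size : ∀ I x, ‖ψ I x‖ ≤ K / I.length * I.dec x ^ 3
  regular : ∀ I J : DyadicInterval, J.length ≤ I.length → ∀ x ∈ J.toSet, ∀ y ∈ J.toSet,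
    ‖ψ I x - ψ I y‖ ≤ K * J.length / I.length ^ 2 * I.dec x ^ 2

/-- The square function of the family is bounded on `L²`. -/
def SquareBounded (B : ℝ≥0) (ψ : DyadicInterval → ℝ → ℂ) : Prop :=
  ∀ f : ℝ → ℂ, MemLp f 2 volume →
    ∑' I : DyadicInterval, ENNReal.ofReal I.length * coef f ψ I ^ 2 ≤ B * ∫⁻ x, ‖f x‖ₑ ^ 2

/-- The almost orthogonality of a family. -/
def AlmostOrthogonal (K : ℝ) (ψ : DyadicInterval → ℝ → ℂ) : Prop :=
  ∀ I J : DyadicInterval, J.length ≤ I.length →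
    ‖pairing (ψ J) (ψ I)‖ ≤ K * J.length / I.length ^ 2 * I.dec J.center ^ 2

section Basic

variable {K : ℝ} {ψ : DyadicInterval → ℝ → ℂ}

lemma GoodFamily.size' (h : GoodFamily K ψ) (I : DyadicInterval) (x : ℝ) :
    ‖ψ I x‖ ≤ K / I.length * I.dec x ^ 2 := by
  refine (h.size I x).trans ?_
  have := h.nonneg
  have := I.length_pos
  gcongr _ * ?_
  exact pow_le_pow_of_le_one (I.dec_pos x).le (I.dec_le_one x) (by norm_num)

lemma GoodFamily.bounded (h : GoodFamily K ψ) (I : DyadicInterval) (x : ℝ) :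
    ‖ψ I x‖ ≤ K / I.length := by
  refine (h.size I x).trans ?_
  have := h.nonneg
  have := I.length_pos
  exact mul_le_of_le_one_right (by positivity) (pow_le_one₀ (I.dec_pos x).le (I.dec_le_one x))

lemma integrable_dec_sq (I : DyadicInterval) : Integrable fun x => I.dec x ^ 2 := by
  obtain ⟨C, hC⟩ := exists_lintegral_dec_sq_le
  refine ⟨(I.measurable_dec.pow_const 2).aestronglyMeasurable, ?_⟩
  rw [hasFiniteIntegral_iff_ofReal (Eventually.of_forall fun x => by positivity)]
  exact (hC I).trans_lt (ENNReal.mul_lt_top (by simp) (by simp))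

lemma GoodFamily.integrable (h : GoodFamily K ψ) (I : DyadicInterval) : Integrable (ψ I) :=
  ((integrable_dec_sq I).const_mul (K / I.length)).mono' (h.measurable I).aestronglyMeasurable
    (Eventually.of_forall fun x => h.size' I x)

lemma GoodFamily.memLp_two (h : GoodFamily K ψ) (I : DyadicInterval) : MemLp (ψ I) 2 volume := by
  refine MemLp.of_le_mul (c := K / I.length) (g := fun x => (I.dec x : ℝ)) ?_
    (h.measurable I).aestronglyMeasurable (Eventually.of_forall fun x => ?_)
  · rw [memLp_two_iff_integrable_sq I.measurable_dec.aestronglyMeasurable]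
    exact integrable_dec_sq I
  · refine (h.size I x).trans ?_
    rw [Real.norm_of_nonneg (I.dec_pos x).le]
    have := h.nonneg
    have := I.length_pos
    gcongr _ * ?_
    exact pow_le_of_le_one (I.dec_pos x).le (I.dec_le_one x) (by norm_num)

lemma enorm_mul_conj (a b : ℂ) : ‖a * (starRingEnd ℂ) b‖ₑ = ‖a‖ₑ * ‖b‖ₑ := by
  rw [enorm_mul, RCLike.enorm_conj]

lemma enorm_pairing_le (f g : ℝ → ℂ) : ‖pairing f g‖ₑ ≤ ∫⁻ x, ‖f x‖ₑ * ‖g x‖ₑ := by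
  refine (enorm_integral_le_lintegral_enorm _).trans (le_of_eq ?_)
  simp_rw [enorm_mul_conj]

lemma enorm_le_ofReal {z : ℂ} {r : ℝ} (h : ‖z‖ ≤ r) : ‖z‖ₑ ≤ ENNReal.ofReal r := by
  rw [← ofReal_norm]
  exact ENNReal.ofReal_le_ofReal h

lemma GoodFamily.coef_le_wavg (h : GoodFamily K ψ) (f : ℝ → ℂ) (I : DyadicInterval) :
    coef f ψ I ≤ ENNReal.ofReal K * wavg (fun x => ‖f x‖ₑ) I := by
  have hl := I.length_pos
  refine (enorm_pairing_le _ _).trans ?_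
  calc ∫⁻ x, ‖f x‖ₑ * ‖ψ I x‖ₑ
      ≤ ∫⁻ x, ENNReal.ofReal (K / I.length) * (‖f x‖ₑ * ENNReal.ofReal (I.dec x ^ 2)) := by
        refine lintegral_mono fun x => ?_
        refine (mul_le_mul' le_rfl (enorm_le_ofReal (h.size' I x))).trans (le_of_eq ?_)
        rw [ENNReal.ofReal_mul (div_nonneg h.nonneg hl.le)]
        ring
    _ = _ := by
        rw [lintegral_const_mul' _ _ ENNReal.ofReal_ne_top, wavg, ENNReal.ofReal_div_of_pos hl,
          div_eq_mul_inv, mul_assoc]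

lemma GoodFamily.integrable_mul_conj (h : GoodFamily K ψ) {f : ℝ → ℂ} (hf : Integrable f)
    (I : DyadicInterval) : Integrable fun x => f x * (starRingEnd ℂ) (ψ I x) := by
  refine hf.mul_bdd (c := K / I.length) ?_ (Eventually.of_forall fun x => ?_)
  · exact (RCLike.continuous_conj.measurable.comp (h.measurable I)).aestronglyMeasurable
  · rw [RCLike.norm_conj]; exact h.bounded I x

end Basic

/-- The functions of the family vary little on the set `Q` of diameter `r`. -/
def RegularOn (K : ℝ) (ψ : DyadicInterval → ℝ → ℂ) (Q : Set ℝ) (r : ℝ) : Prop :=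
  ∀ I : DyadicInterval, r ≤ I.length → ∀ x ∈ Q, ∀ y ∈ Q,
    ‖ψ I x - ψ I y‖ ≤ K * r / I.length ^ 2 * I.dec x ^ 2

lemma GoodFamily.regularOn {K : ℝ} {ψ : DyadicInterval → ℝ → ℂ} (h : GoodFamily K ψ)
    (J : DyadicInterval) : RegularOn K ψ J.toSet J.length :=
  fun I hI => h.regular I J hI

/-- Away from the support, the coefficients of a function of integral zero are small. -/
lemma exists_offDiagonal (K : ℝ) : ∃ C : ℝ≥0, ∀ ψ : DyadicInterval → ℝ → ℂ, GoodFamily K ψ →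
    ∀ (u r : ℝ) (Q : Set ℝ), 0 < r → Q ⊆ Set.Icc u (u + r) → RegularOn K ψ Q r →
    ∀ b : ℝ → ℂ, Integrable b → (∀ x, x ∉ Q → b x = 0) → ∫ x, b x = 0 →
    ∑' I : DyadicInterval, coef b ψ I * volume (I.toSet \ Set.Icc (u - r) (u + 2 * r)) ≤
      C * ∫⁻ x, ‖b x‖ₑ := by
  obtain ⟨C₁, hC₁⟩ := exists_tsum_min_le
  obtain ⟨C₂, hC₂⟩ := exists_tsum_dec_sq_le
  refine ⟨(2 * K).toNNReal * (C₁ * C₂), fun ψ hψ u r Q hr hQ hreg b hb hb0 hbint => ?_⟩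
  have hK := hψ.nonneg
  rcases Q.eq_empty_or_nonempty with rfl | ⟨x₀, hx₀⟩
  · have hb' : b = fun _ => 0 := funext fun x => hb0 x (by simp)
    simp [coef, pairing, hb']
  set W : DyadicInterval → ℝ → ℝ≥0∞ := fun I x => ENNReal.ofReal (2 * K) *
    (ENNReal.ofReal (min (r / I.length) (I.length / r)) * ENNReal.ofReal (I.dec x ^ 2)) with hW
  have hterm : ∀ I : DyadicInterval, coef b ψ I * volume (I.toSet \ Set.Icc (u - r) (u + 2 * r)) ≤
      ∫⁻ x, ‖b x‖ₑ * W I x := by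
    intro I
    have hl := I.length_pos
    by_cases hne : (I.toSet \ Set.Icc (u - r) (u + 2 * r)).Nonempty
    swap
    · rw [Set.not_nonempty_iff_eq_empty.1 hne]; simp
    have hpt : ∀ (z : ℂ) (x : ℝ), x ∈ Q → ‖z‖ ≤ 2 * K *
        (min (r / I.length) (I.length / r) * I.dec x ^ 2) / I.length →
        ‖z‖ₑ * ENNReal.ofReal I.length ≤ W I x := by
      intro z x _ hz
      rw [← ofReal_norm, ← ENNReal.ofReal_mul (norm_nonneg _), hW]
      simp only
      rw [← ENNReal.ofReal_mul (by positivity), ← ENNReal.ofReal_mul (by positivity)]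
      refine ENNReal.ofReal_le_ofReal ?_
      rwa [le_div_iff₀ hl] at hz
    have hvol : volume (I.toSet \ Set.Icc (u - r) (u + 2 * r)) ≤ ENNReal.ofReal I.length := by
      rw [← volume_toSet]; exact measure_mono Set.sdiff_subset
    refine (mul_le_mul' le_rfl hvol).trans ?_
    -- For long intervals, the integral zero of `b` and the regularity of the family give the factor
    -- `r / |I|`. A short interval that leaves the enlarged one has its center at distance at least
    -- `r / 2` from every point of `Q`, and one of the three powers of the weight gives `|I| / r`.
    -- In both cases two powers remain for the sum over translates.
    rcases le_or_gt r I.length with hrI | hrI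
    · have hp : pairing b (ψ I) = ∫ x, b x * (starRingEnd ℂ) (ψ I x - ψ I x₀) := by
        simp_rw [map_sub, mul_sub]
        rw [integral_sub (hψ.integrable_mul_conj hb I) (hb.mul_const _), integral_mul_const, hbint,
          zero_mul, sub_zero]
        rfl
      have h1 : coef b ψ I ≤ ∫⁻ x, ‖b x‖ₑ * ‖ψ I x - ψ I x₀‖ₑ := by
        rw [coef, hp]
        refine (enorm_integral_le_lintegral_enorm _).trans (le_of_eq ?_)
        simp_rw [enorm_mul_conj]
      refine (mul_le_mul' h1 le_rfl).trans ?_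
      rw [← lintegral_mul_const' _ _ ENNReal.ofReal_ne_top]
      refine lintegral_mono fun x => ?_
      by_cases hx : x ∈ Q
      · rw [mul_assoc]
        gcongr
        refine hpt _ x hx ((hreg I hrI x hx x₀ hx₀).trans ?_)
        have hmin : min (r / I.length) (I.length / r) = r / I.length := by
          refine min_eq_left ?_
          have h1 : r / I.length ≤ 1 := (div_le_one hl).2 hrI
          have h2 : 1 ≤ I.length / r := (one_le_div hr).2 hrI
          linarith
        rw [hmin]
        have : 0 ≤ K * r / I.length ^ 2 * I.dec x ^ 2 := by positivity
        calc K * r / I.length ^ 2 * I.dec x ^ 2 ≤ 2 * (K * r / I.length ^ 2 * I.dec x ^ 2) := by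
              linarith
          _ = _ := by field_simp
      · simp [hb0 x hx]
    · refine (mul_le_mul' (enorm_pairing_le _ _) le_rfl).trans ?_
      rw [← lintegral_mul_const' _ _ ENNReal.ofReal_ne_top]
      refine lintegral_mono fun x => ?_
      by_cases hx : x ∈ Q
      · rw [mul_assoc]
        gcongr
        refine hpt _ x hx ((hψ.size I x).trans ?_)
        obtain ⟨y, hyI, hyQ⟩ := hne
        have hfar : r / 2 ≤ |x - I.center| := by
          have h1 := I.abs_sub_center_le_half hyI
          have h2 := hQ hx
          have h3 : r ≤ |x - y| := by
            by_contra hcon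
            push Not at hcon
            rw [abs_lt] at hcon
            exact hyQ ⟨by linarith [h2.1, h2.2], by linarith [h2.1, h2.2]⟩
          have h4 := abs_sub_le x I.center y
          rw [abs_sub_comm I.center y] at h4
          linarith
        have hdec := I.dec_le_div (by positivity) hfar
        have hmin : min (r / I.length) (I.length / r) = I.length / r := by
          refine min_eq_right ?_
          have h1 : I.length / r ≤ 1 := (div_le_one hr).2 hrI.le
          have h2 : 1 ≤ r / I.length := (one_le_div hl).2 hrI.le
          linarith
        rw [hmin]
        have hd := (I.dec_pos x).le
        calc K / I.length * I.dec x ^ 3 = K / I.length * I.dec x ^ 2 * I.dec x := by ring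
          _ ≤ K / I.length * I.dec x ^ 2 * (I.length / (r / 2)) := by gcongr
          _ = _ := by field_simp
      · simp [hb0 x hx]
  have hWm : ∀ I, Measurable (W I) := fun I =>
    (((I.measurable_dec.pow_const 2).ennreal_ofReal).const_mul _).const_mul _
  calc ∑' I : DyadicInterval, coef b ψ I * volume (I.toSet \ Set.Icc (u - r) (u + 2 * r))
      ≤ ∑' I : DyadicInterval, ∫⁻ x, ‖b x‖ₑ * W I x := ENNReal.tsum_le_tsum hterm
    _ = ∫⁻ x, ‖b x‖ₑ * ∑' I : DyadicInterval, W I x := by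
        simp_rw [← ENNReal.tsum_mul_left]
        exact (lintegral_tsum (f := fun I x => ‖b x‖ₑ * W I x)
          fun I => hb.1.enorm.mul (hWm I).aemeasurable).symm
    _ ≤ ∫⁻ x, ‖b x‖ₑ * (((2 * K).toNNReal * (C₁ * C₂) : ℝ≥0)) := by
        gcongr with x
        simp only [hW]
        rw [ENNReal.tsum_mul_left, tsum_eq_tsum_scale]
        push_cast
        refine mul_le_mul' le_rfl ?_
        calc ∑' k : ℤ, ∑' m : ℤ, ENNReal.ofReal (min (r / (⟨k, m⟩ : DyadicInterval).length)
                ((⟨k, m⟩ : DyadicInterval).length / r)) *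
                ENNReal.ofReal ((⟨k, m⟩ : DyadicInterval).dec x ^ 2)
            ≤ ∑' k : ℤ, ENNReal.ofReal (min (r / 2 ^ k) (2 ^ k / r)) * C₂ := by
              refine ENNReal.tsum_le_tsum fun k => ?_
              simp only [length]
              rw [ENNReal.tsum_mul_left]
              gcongr
              exact hC₂ k x
          _ ≤ C₁ * C₂ := by
              rw [ENNReal.tsum_mul_right]
              gcongr
              exact hC₁ r hr
    _ = _ := by rw [lintegral_mul_const' _ _ ENNReal.coe_ne_top, mul_comm]

/-! ### Schur's test in a Hilbert space. -/

section L2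

variable {H ι : Type*} [NormedAddCommGroup H] [InnerProductSpace ℂ H]

/-- Schur's test: expand the square, use `2 |c i| |c j| ≤ |c i| ^ 2 + |c j| ^ 2`, and bound the
weighted row sums of the symmetric matrix `‖⟨v i, v j⟩‖`. -/
lemma norm_sq_sum_le (v : ι → H) (w : ι → ℝ) (hw : ∀ i, 0 ≤ w i) (S : Finset ι) {A : ℝ}
    (hA : ∀ i ∈ S, ∑ j ∈ S, w j * ‖inner ℂ (v i) (v j)‖ ≤ A) (c : ι → ℂ) :
    ‖∑ i ∈ S, ((w i : ℂ) * c i) • v i‖ ^ 2 ≤ A * ∑ i ∈ S, w i * ‖c i‖ ^ 2 := by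
  have h0 : ‖∑ i ∈ S, ((w i : ℂ) * c i) • v i‖ ^ 2 =
      RCLike.re (inner ℂ (∑ i ∈ S, ((w i : ℂ) * c i) • v i) (∑ i ∈ S, ((w i : ℂ) * c i) • v i)) :=
    norm_sq_eq_re_inner (𝕜 := ℂ) _
  rw [h0]
  refine (RCLike.re_le_norm _).trans ?_
  rw [sum_inner]
  simp_rw [inner_sum, inner_smul_left, inner_smul_right]
  refine (norm_sum_le _ _).trans ((Finset.sum_le_sum fun i _ => norm_sum_le _ _).trans ?_)
  have hterm : ∀ i j, ‖(starRingEnd ℂ) ((w i : ℂ) * c i) * ((w j : ℂ) * c j *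
      inner ℂ (v i) (v j))‖ ≤
      (w i * w j * ‖inner ℂ (v i) (v j)‖) * ((‖c i‖ ^ 2 + ‖c j‖ ^ 2) / 2) := by
    intro i j
    rw [norm_mul, RCLike.norm_conj, norm_mul, norm_mul, norm_mul, Complex.norm_real,
      Complex.norm_real, Real.norm_of_nonneg (hw i), Real.norm_of_nonneg (hw j)]
    have h1 : ‖c i‖ * ‖c j‖ ≤ (‖c i‖ ^ 2 + ‖c j‖ ^ 2) / 2 := by
      nlinarith [sq_nonneg (‖c i‖ - ‖c j‖)]
    have h2 : 0 ≤ w i * w j * ‖inner ℂ (v i) (v j)‖ :=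
      mul_nonneg (mul_nonneg (hw i) (hw j)) (norm_nonneg _)
    calc _ = (w i * w j * ‖inner ℂ (v i) (v j)‖) * (‖c i‖ * ‖c j‖) := by ring
      _ ≤ _ := by gcongr
  refine (Finset.sum_le_sum fun i _ => Finset.sum_le_sum fun j _ => hterm i j).trans ?_
  have hsym : ∑ i ∈ S, ∑ j ∈ S, (w i * w j * ‖inner ℂ (v i) (v j)‖) * (‖c j‖ ^ 2) =
      ∑ i ∈ S, ∑ j ∈ S, (w i * w j * ‖inner ℂ (v i) (v j)‖) * (‖c i‖ ^ 2) := by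
    rw [Finset.sum_comm]
    refine Finset.sum_congr rfl fun i _ => Finset.sum_congr rfl fun j _ => ?_
    rw [norm_inner_symm]; ring
  have hsplit : ∑ i ∈ S, ∑ j ∈ S, (w i * w j * ‖inner ℂ (v i) (v j)‖) *
      ((‖c i‖ ^ 2 + ‖c j‖ ^ 2) / 2) =
      ∑ i ∈ S, ∑ j ∈ S, (w i * w j * ‖inner ℂ (v i) (v j)‖) * (‖c i‖ ^ 2) := by
    have : ∑ i ∈ S, ∑ j ∈ S, (w i * w j * ‖inner ℂ (v i) (v j)‖) *
        ((‖c i‖ ^ 2 + ‖c j‖ ^ 2) / 2) =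
        (∑ i ∈ S, ∑ j ∈ S, (w i * w j * ‖inner ℂ (v i) (v j)‖) * (‖c i‖ ^ 2) +
          ∑ i ∈ S, ∑ j ∈ S, (w i * w j * ‖inner ℂ (v i) (v j)‖) * (‖c j‖ ^ 2)) / 2 := by
      rw [← Finset.sum_add_distrib, Finset.sum_div]
      refine Finset.sum_congr rfl fun i _ => ?_
      rw [← Finset.sum_add_distrib, Finset.sum_div]
      exact Finset.sum_congr rfl fun j _ => by ring
    rw [this, hsym]; ring
  rw [hsplit, Finset.mul_sum]
  refine Finset.sum_le_sum fun i hi => ?_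
  calc ∑ j ∈ S, (w i * w j * ‖inner ℂ (v i) (v j)‖) * (‖c i‖ ^ 2)
      = (∑ j ∈ S, w j * ‖inner ℂ (v i) (v j)‖) * (w i * ‖c i‖ ^ 2) := by
        rw [Finset.sum_mul]; exact Finset.sum_congr rfl fun j _ => by ring
    _ ≤ A * (w i * ‖c i‖ ^ 2) := by
        have := hw i
        gcongr
        exact hA i hi

/-- The dual of the preceding bound. For `y = ∑ w i ⟨v i, x⟩ v i` the left side `X` equals `⟨y, x⟩`,
while `‖y‖ ^ 2 ≤ A X`; dividing by `X` gives the claim. -/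
lemma sum_norm_inner_sq_le (v : ι → H) (w : ι → ℝ) (hw : ∀ i, 0 ≤ w i) (S : Finset ι) {A : ℝ} (hA0 : 0 ≤ A)
    (hA : ∀ i ∈ S, ∑ j ∈ S, w j * ‖inner ℂ (v i) (v j)‖ ≤ A) (x : H) :
    ∑ i ∈ S, w i * ‖inner ℂ (v i) x‖ ^ 2 ≤ A * ‖x‖ ^ 2 := by
  set X := ∑ i ∈ S, w i * ‖inner ℂ (v i) x‖ ^ 2 with hX
  have hX0 : 0 ≤ X := Finset.sum_nonneg fun i _ => mul_nonneg (hw i) (sq_nonneg _)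
  set y := ∑ i ∈ S, ((w i : ℂ) * inner ℂ (v i) x) • v i with hy
  have h1 : ‖y‖ ^ 2 ≤ A * X := norm_sq_sum_le v w hw S hA _
  have h2 : inner ℂ y x = (X : ℂ) := by
    rw [hy, sum_inner, hX]
    push_cast
    refine Finset.sum_congr rfl fun i _ => ?_
    rw [inner_smul_left, map_mul, Complex.conj_ofReal, mul_assoc, RCLike.conj_mul]
    rfl
  have h3 : X ≤ ‖y‖ * ‖x‖ := by
    have := norm_inner_le_norm (𝕜 := ℂ) y x
    rw [h2, Complex.norm_real, Real.norm_of_nonneg hX0] at this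
    exact this
  rcases eq_or_lt_of_le hX0 with h | h
  · rw [← h]; positivity
  · have h4 : X * X ≤ (A * ‖x‖ ^ 2) * X := by
      calc X * X ≤ (‖y‖ * ‖x‖) * (‖y‖ * ‖x‖) := by gcongr
        _ = ‖y‖ ^ 2 * ‖x‖ ^ 2 := by ring
        _ ≤ (A * X) * ‖x‖ ^ 2 := by gcongr
        _ = _ := by ring
    exact le_of_mul_le_mul_right h4 h

end L2

end Paraproduct

/-! ### Square functions of almost orthogonal families; Lebesgue differentiation. -/

namespace Paraproduct

open DyadicInterval

lemma norm_pairing_comm (f g : ℝ → ℂ) : ‖pairing f g‖ = ‖pairing g f‖ := by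
  have : pairing f g = (starRingEnd ℂ) (pairing g f) := by
    rw [pairing, pairing, ← integral_conj]
    congr 1
    ext x
    rw [map_mul, RCLike.conj_conj, mul_comm]
  rw [this, RCLike.norm_conj]

/-- These are the row sums for Schur's test, with weights `|J|`. At a scale with `|J| ≤ |I|`, the
values of the weight of `I` at the centers of `J` are compared with its integral; at a larger scale,
the weights of all `J` at the center of `I` have bounded sum. Either way the scale contributes `min
(|I| / |J|, |J| / |I|)` up to a constant. -/
lemma exists_tsum_almostOrthogonal_le (K : ℝ) : ∃ A : ℝ≥0, ∀ ψ : DyadicInterval → ℝ → ℂ,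
    AlmostOrthogonal K ψ → ∀ I, ∑' J : DyadicInterval,
      ENNReal.ofReal J.length * ENNReal.ofReal ‖pairing (ψ J) (ψ I)‖ ≤ A := by
  obtain ⟨C₁, hC₁⟩ := exists_tsum_min_le
  obtain ⟨C₂, hC₂⟩ := exists_tsum_dec_sq_le
  obtain ⟨C₃, hC₃⟩ := exists_lintegral_dec_sq_le
  refine ⟨K.toNNReal * (C₁ * (C₂ + 4 * C₃)), fun ψ hψ I => ?_⟩
  have hl := I.length_pos
  rw [tsum_eq_tsum_scale]
  have hscale : ∀ k : ℤ, ∑' m : ℤ, ENNReal.ofReal (⟨k, m⟩ : DyadicInterval).length *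
      ENNReal.ofReal ‖pairing (ψ ⟨k, m⟩) (ψ I)‖ ≤
      ENNReal.ofReal K * (ENNReal.ofReal (min (I.length / 2 ^ k) (2 ^ k / I.length)) *
        (C₂ + 4 * C₃)) := by
    intro k
    have hk : (0 : ℝ) < 2 ^ k := by positivity
    rcases le_or_gt ((2 : ℝ) ^ k) I.length with h | h
    · have hmin : min (I.length / 2 ^ k) (2 ^ k / I.length) = 2 ^ k / I.length := by
        refine min_eq_right ?_
        have h1 : 2 ^ k / I.length ≤ 1 := (div_le_one hl).2 h
        have h2 : 1 ≤ I.length / 2 ^ k := (one_le_div hk).2 h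
        linarith
      have hpt : ∀ m : ℤ, ENNReal.ofReal (⟨k, m⟩ : DyadicInterval).length *
          ENNReal.ofReal ‖pairing (ψ ⟨k, m⟩) (ψ I)‖ ≤
          (ENNReal.ofReal K * ENNReal.ofReal (2 ^ k / I.length)) * (4 * (ENNReal.ofReal I.length)⁻¹ *
            ∫⁻ x in (⟨k, m⟩ : DyadicInterval).toSet, ENNReal.ofReal (I.dec x ^ 2)) := by
        intro m
        set J : DyadicInterval := ⟨k, m⟩ with hJ
        have hJl : J.length = 2 ^ k := rfl
        have hJI : J.length ≤ I.length := by rw [hJl]; exact h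
        have h1 : ENNReal.ofReal (I.dec J.center ^ 2) * ENNReal.ofReal J.length ≤
            4 * ∫⁻ x in J.toSet, ENNReal.ofReal (I.dec x ^ 2) := by
          rw [← J.volume_toSet, ← setLIntegral_const, ← lintegral_const_mul _
            (I.measurable_dec.pow_const 2).ennreal_ofReal]
          refine setLIntegral_mono ((I.measurable_dec.pow_const 2).ennreal_ofReal.const_mul _)
            fun x hx => ?_
          have h2 : I.dec J.center ≤ 2 * I.dec x :=
            I.dec_le_two_mul ((J.abs_sub_le_of_mem J.center_mem hx).trans hJI)
          calc ENNReal.ofReal (I.dec J.center ^ 2) ≤ ENNReal.ofReal ((2 * I.dec x) ^ 2) :=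
                ENNReal.ofReal_le_ofReal (pow_le_pow_left₀ (I.dec_pos _).le h2 2)
            _ = 4 * ENNReal.ofReal (I.dec x ^ 2) := by
                rw [mul_pow, ENNReal.ofReal_mul (by norm_num)]; norm_num
        have h2 : ENNReal.ofReal ‖pairing (ψ J) (ψ I)‖ ≤ ENNReal.ofReal K *
            ENNReal.ofReal (2 ^ k / I.length) * ((ENNReal.ofReal I.length)⁻¹ *
              ENNReal.ofReal (I.dec J.center ^ 2)) := by
          rw [← ENNReal.ofReal_inv_of_pos hl, ← ENNReal.ofReal_mul' (by positivity),
            ← ENNReal.ofReal_mul' (by positivity), ← ENNReal.ofReal_mul' (by positivity)]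
          refine ENNReal.ofReal_le_ofReal ((hψ I J hJI).trans (le_of_eq ?_))
          rw [hJl]
          field_simp
        calc _ ≤ ENNReal.ofReal J.length * (ENNReal.ofReal K *
              ENNReal.ofReal (2 ^ k / I.length) * ((ENNReal.ofReal I.length)⁻¹ *
              ENNReal.ofReal (I.dec J.center ^ 2))) := by gcongr
          _ = (ENNReal.ofReal K * ENNReal.ofReal (2 ^ k / I.length)) *
              ((ENNReal.ofReal I.length)⁻¹ *
              (ENNReal.ofReal (I.dec J.center ^ 2) * ENNReal.ofReal J.length)) := by ring
          _ ≤ (ENNReal.ofReal K * ENNReal.ofReal (2 ^ k / I.length)) *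
              ((ENNReal.ofReal I.length)⁻¹ *
              (4 * ∫⁻ x in J.toSet, ENNReal.ofReal (I.dec x ^ 2))) := by gcongr
          _ = _ := by ring
      refine (ENNReal.tsum_le_tsum hpt).trans ?_
      rw [ENNReal.tsum_mul_left, ENNReal.tsum_mul_left, ← lintegral_eq_tsum, hmin, mul_assoc]
      gcongr
      calc 4 * (ENNReal.ofReal I.length)⁻¹ * ∫⁻ x, ENNReal.ofReal (I.dec x ^ 2)
          ≤ 4 * (ENNReal.ofReal I.length)⁻¹ * (C₃ * ENNReal.ofReal I.length) := by
            gcongr; exact hC₃ I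
        _ = 4 * C₃ * ((ENNReal.ofReal I.length)⁻¹ * ENNReal.ofReal I.length) := by ring
        _ = 4 * C₃ := by
            rw [ENNReal.inv_mul_cancel (ofReal_length_ne_zero I) ENNReal.ofReal_ne_top, mul_one]
        _ ≤ C₂ + 4 * C₃ := le_add_self
    · have hmin : min (I.length / 2 ^ k) (2 ^ k / I.length) = I.length / 2 ^ k := by
        refine min_eq_left ?_
        have h1 : I.length / 2 ^ k ≤ 1 := (div_le_one hk).2 h.le
        have h2 : 1 ≤ 2 ^ k / I.length := (one_le_div hl).2 h.le
        linarith
      have hpt : ∀ m : ℤ, ENNReal.ofReal (⟨k, m⟩ : DyadicInterval).length *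
          ENNReal.ofReal ‖pairing (ψ ⟨k, m⟩) (ψ I)‖ ≤
          (ENNReal.ofReal K * ENNReal.ofReal (I.length / 2 ^ k)) *
            ENNReal.ofReal ((⟨k, m⟩ : DyadicInterval).dec I.center ^ 2) := by
        intro m
        set J : DyadicInterval := ⟨k, m⟩ with hJ
        have hJl : J.length = 2 ^ k := rfl
        have hJI : I.length ≤ J.length := by rw [hJl]; exact h.le
        rw [← ENNReal.ofReal_mul J.length_pos.le, ← ENNReal.ofReal_mul' (by positivity),
          ← ENNReal.ofReal_mul' (by positivity)]
        refine ENNReal.ofReal_le_ofReal ?_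
        have := hψ J I hJI
        rw [norm_pairing_comm] at this
        have hJ0 := J.length_pos
        calc J.length * ‖pairing (ψ J) (ψ I)‖
            ≤ J.length * (K * I.length / J.length ^ 2 * J.dec I.center ^ 2) := by gcongr
          _ = _ := by rw [hJl]; field_simp
      refine (ENNReal.tsum_le_tsum hpt).trans ?_
      rw [ENNReal.tsum_mul_left, hmin, mul_assoc]
      gcongr
      exact (hC₂ k _).trans le_self_add
  refine (ENNReal.tsum_le_tsum hscale).trans ?_
  rw [ENNReal.tsum_mul_left, ENNReal.tsum_mul_right]
  push_cast
  refine mul_le_mul' le_rfl (mul_le_mul' (hC₁ _ hl) le_rfl)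

section

variable {ψ : DyadicInterval → ℝ → ℂ} {A : ℝ≥0}

lemma inner_toLp (f g : ℝ → ℂ) (hf : MemLp f 2 volume) (hg : MemLp g 2 volume) :
    inner ℂ (hg.toLp g) (hf.toLp f) = pairing f g := by
  rw [L2.inner_def, pairing]
  refine integral_congr_ae ?_
  filter_upwards [hf.coeFn_toLp, hg.coeFn_toLp] with x hx hy
  rw [hx, hy]
  rfl

lemma sum_mul_norm_inner_le (h2 : ∀ I, MemLp (ψ I) 2 volume)
    (hA : ∀ I, ∑' J : DyadicInterval,
      ENNReal.ofReal J.length * ENNReal.ofReal ‖pairing (ψ J) (ψ I)‖ ≤ A)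
    (S : Finset DyadicInterval) (I : DyadicInterval) :
    ∑ J ∈ S, J.length * ‖inner ℂ ((h2 I).toLp (ψ I)) ((h2 J).toLp (ψ J))‖ ≤ A := by
  have h1 := (ENNReal.sum_le_tsum S).trans (hA I)
  simp_rw [inner_toLp]
  rw [← ENNReal.ofReal_coe_nnreal] at h1
  simp_rw [← ENNReal.ofReal_mul (length_pos _).le] at h1
  rw [← ENNReal.ofReal_sum_of_nonneg] at h1
  · exact (ENNReal.ofReal_le_ofReal_iff A.coe_nonneg).1 h1
  · intro J _
    have := J.length_pos
    positivity

lemma enorm_sq_toLp {f : ℝ → ℂ} (hf : MemLp f 2 volume) :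
    ENNReal.ofReal (‖hf.toLp f‖ ^ 2) = ∫⁻ x, ‖f x‖ₑ ^ 2 := by
  rw [Lp.norm_toLp, ENNReal.ofReal_pow ENNReal.toReal_nonneg, ENNReal.ofReal_toReal hf.2.ne,
    eLpNorm_eq_lintegral_rpow_enorm_toReal (by simp) (by simp), ← ENNReal.rpow_natCast,
    ← ENNReal.rpow_mul]
  simp

lemma squareBounded_of_tsum_le (h2 : ∀ I, MemLp (ψ I) 2 volume)
    (hA : ∀ I, ∑' J : DyadicInterval,
      ENNReal.ofReal J.length * ENNReal.ofReal ‖pairing (ψ J) (ψ I)‖ ≤ A) :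
    SquareBounded A ψ := by
  intro f hf
  rw [ENNReal.tsum_eq_iSup_sum]
  refine iSup_le fun S => ?_
  have h := sum_norm_inner_sq_le (fun I => (h2 I).toLp (ψ I)) (fun I : DyadicInterval => I.length)
    (fun I => I.length_pos.le) S A.coe_nonneg (fun I _ => sum_mul_norm_inner_le h2 hA S I)
    (hf.toLp f)
  simp_rw [inner_toLp] at h
  have h' := ENNReal.ofReal_le_ofReal h
  rw [ENNReal.ofReal_mul A.coe_nonneg, enorm_sq_toLp, ENNReal.ofReal_coe_nnreal,
    ENNReal.ofReal_sum_of_nonneg] at h'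
  · refine le_trans (le_of_eq (Finset.sum_congr rfl fun I _ => ?_)) h'
    rw [ENNReal.ofReal_mul I.length_pos.le, ENNReal.ofReal_pow (norm_nonneg _), ofReal_norm]
    rfl
  · intro I _
    have := I.length_pos
    positivity

/-- The dual form of the boundedness of the square function, for finite sums. -/
lemma lintegral_sum_sq_le (h2 : ∀ I, MemLp (ψ I) 2 volume)
    (hA : ∀ I, ∑' J : DyadicInterval,
      ENNReal.ofReal J.length * ENNReal.ofReal ‖pairing (ψ J) (ψ I)‖ ≤ A)
    (S : Finset DyadicInterval) (c : DyadicInterval → ℂ) :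
    ∫⁻ x, ‖∑ I ∈ S, ((I.length : ℂ) * c I) * ψ I x‖ₑ ^ 2 ≤
      A * ∑ I ∈ S, ENNReal.ofReal I.length * ‖c I‖ₑ ^ 2 := by
  have h := norm_sq_sum_le (fun I => (h2 I).toLp (ψ I)) (fun I : DyadicInterval => I.length)
    (fun I => I.length_pos.le) S (fun I _ => sum_mul_norm_inner_le h2 hA S I) c
  have hm : MemLp (fun x => ∑ I ∈ S, ((I.length : ℂ) * c I) * ψ I x) 2 volume :=
    memLp_finsetSum _ fun I _ => (h2 I).const_mul _
  have heq : hm.toLp _ = ∑ I ∈ S, ((I.length : ℂ) * c I) • (h2 I).toLp (ψ I) := by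
    rw [Lp.ext_iff]
    refine hm.coeFn_toLp.trans ?_
    have h3 : ∀ᵐ x, ∀ I ∈ S, ((((I.length : ℂ) * c I) • (h2 I).toLp (ψ I) : Lp ℂ 2 volume) : ℝ → ℂ) x
        = ((I.length : ℂ) * c I) * ψ I x := by
      refine (ae_ball_iff S.countable_toSet).2 fun I _ => ?_
      filter_upwards [Lp.coeFn_smul ((I.length : ℂ) * c I) ((h2 I).toLp (ψ I)),
        (h2 I).coeFn_toLp] with x hx hy
      rw [hx, Pi.smul_apply, hy, smul_eq_mul]
    filter_upwards [h3, Lp.coeFn_finsetSum S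
      (fun I => ((I.length : ℂ) * c I) • (h2 I).toLp (ψ I))] with x hx hy
    rw [hy, Finset.sum_apply]
    exact Finset.sum_congr rfl fun I hI => (hx I hI).symm
  rw [← heq] at h
  have h' := ENNReal.ofReal_le_ofReal h
  rw [ENNReal.ofReal_mul A.coe_nonneg, enorm_sq_toLp, ENNReal.ofReal_coe_nnreal,
    ENNReal.ofReal_sum_of_nonneg] at h'
  · refine h'.trans (le_of_eq ?_)
    congr 1
    refine Finset.sum_congr rfl fun I _ => ?_
    rw [ENNReal.ofReal_mul I.length_pos.le, ENNReal.ofReal_pow (norm_nonneg _), ofReal_norm]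
  · intro I _
    have := I.length_pos
    positivity

end

/-- Lebesgue differentiation along dyadic intervals. -/
lemma ae_le_of_forall_avg_le {f : ℝ → ℂ} (hf : Integrable f) (lam : ℝ≥0) :
    ∀ᵐ x, (∀ J : DyadicInterval, x ∈ J.toSet →
      ∫⁻ y in J.toSet, ‖f y‖ₑ ≤ lam * ENNReal.ofReal J.length) → ‖f x‖ ≤ lam := by
  -- The differentiation theorem allows balls that are not centered at `x`; closed balls that agree
  -- with the dyadic intervals around `x` up to an end point are admissible.
  have h := IsUnifLocDoublingMeasure.ae_tendsto_average (μ := (volume : Measure ℝ))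
    hf.norm.locallyIntegrable 1
  filter_upwards [h] with x hx hJ
  set J : ℕ → DyadicInterval := fun n => containing (-(n : ℤ)) x with hJdef
  have hlen : ∀ n, (J n).length = (2⁻¹ : ℝ) ^ n := fun n => by
    simp only [hJdef, length_containing]; rw [zpow_neg, zpow_natCast, inv_pow]
  have hδ : Tendsto (fun n => (J n).length / 2) atTop (𝓝[>] 0) := by
    refine tendsto_nhdsWithin_iff.2 ⟨?_, Eventually.of_forall fun n => ?_⟩
    · simp_rw [hlen]
      have := (tendsto_pow_atTop_nhds_zero_of_lt_one (r := (2⁻¹ : ℝ)) (by norm_num)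
        (by norm_num)).div_const 2
      simpa using this
    · exact half_pos (J n).length_pos
  have ht := hx (fun n => (J n).center) (fun n => (J n).length / 2) hδ
    (Eventually.of_forall fun n => by
      rw [one_mul, Metric.mem_closedBall, Real.dist_eq]
      exact (J n).abs_sub_center_le_half (mem_containing _ _))
  refine le_of_tendsto ht (Eventually.of_forall fun n => ?_)
  have hl := (J n).length_pos
  have hset : Metric.closedBall (J n).center ((J n).length / 2) =
      Set.Icc (J n).left ((J n).left + (J n).length) := by
    rw [Real.closedBall_eq_Icc]
    congr 1 <;> simp only [center] <;> ring
  rw [hset, setAverage_eq, measureReal_def, Real.volume_Icc, add_sub_cancel_left,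
    ENNReal.toReal_ofReal hl.le, integral_Icc_eq_integral_Ico, smul_eq_mul,
    inv_mul_le_iff₀ hl]
  have h1 := hJ (J n) (mem_containing _ _)
  rw [← ENNReal.ofReal_coe_nnreal, ← ENNReal.ofReal_mul lam.coe_nonneg,
    ← ofReal_integral_norm_eq_lintegral_enorm hf.integrableOn,
    ENNReal.ofReal_le_ofReal_iff (by positivity)] at h1
  rw [mul_comm]
  exact h1

end Paraproduct

/-! ### Calderón–Zygmund decomposition and weak type (1,1) of the square function. -/

namespace Paraproduct

open DyadicInterval

/-- The square of the square function of a sequence indexed by the dyadic intervals. -/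
noncomputable def fullSq (t : DyadicInterval → ℝ≥0∞) (x : ℝ) : ℝ≥0∞ :=
  ∑' I : DyadicInterval, I.toSet.indicator (fun _ => t I ^ 2) x

/-- The sum of a sequence over the dyadic intervals which contain a point. -/
noncomputable def fullSum (t : DyadicInterval → ℝ≥0∞) (x : ℝ) : ℝ≥0∞ :=
  ∑' I : DyadicInterval, I.toSet.indicator (fun _ => t I) x

lemma measurable_fullSq (t : DyadicInterval → ℝ≥0∞) : Measurable (fullSq t) :=
  Measurable.tsum fun J => measurable_const.indicator J.measurableSet_toSet

lemma measurable_fullSum (t : DyadicInterval → ℝ≥0∞) : Measurable (fullSum t) :=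
  Measurable.tsum fun J => measurable_const.indicator J.measurableSet_toSet

lemma ENNReal.tsum_sq_le {ι : Type*} (a : ι → ℝ≥0∞) : ∑' i, a i ^ 2 ≤ (∑' i, a i) ^ 2 := by
  rw [sq (∑' i, a i), ← ENNReal.tsum_mul_left]
  refine ENNReal.tsum_le_tsum fun i => ?_
  rw [sq]
  gcongr
  exact ENNReal.le_tsum i

lemma indicator_sq (s : Set ℝ) (a : ℝ≥0∞) (x : ℝ) :
    s.indicator (fun _ => a ^ 2) x = (s.indicator (fun _ => a) x) ^ 2 := by
  by_cases hx : x ∈ s <;> simp [hx]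

/-- An ℓ² norm is at most the ℓ¹ norm. The latter is additive, so away from the bad set it can be
integrated term by term. -/
lemma fullSq_le_fullSum_sq (t : DyadicInterval → ℝ≥0∞) (x : ℝ) : fullSq t x ≤ fullSum t x ^ 2 := by
  simp only [fullSq, fullSum, indicator_sq]
  exact ENNReal.tsum_sq_le _

lemma ENNReal.add_sq_le (a b : ℝ≥0∞) : (a + b) ^ 2 ≤ 2 * (a ^ 2 + b ^ 2) := by
  have := ENNReal.rpow_add_le_mul_rpow_add_rpow a b (p := 2) (by norm_num)
  norm_num at this
  exact this

lemma fullSq_le_of_le_add {t t' t'' : DyadicInterval → ℝ≥0∞} (h : ∀ I, t I ≤ t' I + t'' I)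
    (x : ℝ) : fullSq t x ≤ 2 * (fullSq t' x + fullSq t'' x) := by
  unfold fullSq
  rw [← ENNReal.tsum_add, ← ENNReal.tsum_mul_left]
  refine ENNReal.tsum_le_tsum fun I => ?_
  by_cases hx : x ∈ I.toSet
  · simp only [Set.indicator_of_mem hx]
    exact (pow_le_pow_left' (h I) 2).trans (ENNReal.add_sq_le _ _)
  · simp [hx]

lemma lintegral_fullSq (t : DyadicInterval → ℝ≥0∞) :
    ∫⁻ x, fullSq t x = ∑' I : DyadicInterval, ENNReal.ofReal I.length * t I ^ 2 := by
  unfold fullSq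
  rw [lintegral_tsum fun I => (measurable_const.indicator I.measurableSet_toSet).aemeasurable]
  refine tsum_congr fun I => ?_
  rw [lintegral_indicator_const I.measurableSet_toSet, volume_toSet, mul_comm]

lemma setLIntegral_fullSum (t : DyadicInterval → ℝ≥0∞) {E : Set ℝ} :
    ∫⁻ x in Eᶜ, fullSum t x = ∑' I : DyadicInterval, t I * volume (I.toSet \ E) := by
  unfold fullSum
  rw [lintegral_tsum fun I => (measurable_const.indicator I.measurableSet_toSet).aemeasurable]
  refine tsum_congr fun I => ?_
  rw [lintegral_indicator_const I.measurableSet_toSet,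
    Measure.restrict_apply I.measurableSet_toSet]
  rfl

lemma coef_le_add {ψ : DyadicInterval → ℝ → ℂ} {f g b : ℝ → ℂ} (hf : ∀ x, f x = g x + b x)
    (I : DyadicInterval) (hg : Integrable fun x => g x * (starRingEnd ℂ) (ψ I x))
    (hb : Integrable fun x => b x * (starRingEnd ℂ) (ψ I x)) :
    coef f ψ I ≤ coef g ψ I + coef b ψ I := by
  have : pairing f (ψ I) = pairing g (ψ I) + pairing b (ψ I) := by
    unfold pairing
    rw [← integral_add hg hb]
    simp_rw [hf, add_mul]
  unfold coef
  rw [this]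
  exact enorm_add_le _ _

section CalderonZygmund

variable {f : ℝ → ℂ} {lam : ℝ≥0}

open scoped Classical in
/-- The good part of the Calderón–Zygmund decomposition. -/
noncomputable def goodPart (f : ℝ → ℂ) (lam : ℝ≥0) (x : ℝ) : ℂ :=
  if h : ∃ J : DyadicInterval, IsMaxBad (fun x => ‖f x‖ₑ) lam J ∧ x ∈ J.toSet then
    ((h.choose.length : ℝ)⁻¹ : ℂ) * ∫ y in h.choose.toSet, f y else f x

lemma goodPart_of_mem {J : DyadicInterval} (hJ : IsMaxBad (fun x => ‖f x‖ₑ) lam J) {x : ℝ}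
    (hx : x ∈ J.toSet) : goodPart f lam x = ((J.length : ℝ)⁻¹ : ℂ) * ∫ y in J.toSet, f y := by
  have h : ∃ J : DyadicInterval, IsMaxBad (fun x => ‖f x‖ₑ) lam J ∧ x ∈ J.toSet := ⟨J, hJ, hx⟩
  rw [goodPart, dif_pos h, h.choose_spec.1.eq_of_mem hJ h.choose_spec.2 hx]

lemma goodPart_of_notMem {x : ℝ} (hx : ∀ J, IsMaxBad (fun x => ‖f x‖ₑ) lam J → x ∉ J.toSet) :
    goodPart f lam x = f x :=
  dif_neg fun ⟨J, hJ, hxJ⟩ => hx J hJ hxJ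

/-- The union of the maximal bad intervals. -/
def maxBadUnion (f : ℝ → ℂ) (lam : ℝ≥0) : Set ℝ :=
  ⋃ J : {J : DyadicInterval // IsMaxBad (fun x => ‖f x‖ₑ) lam J}, J.1.toSet

lemma measurableSet_maxBadUnion : MeasurableSet (maxBadUnion f lam) :=
  MeasurableSet.iUnion fun J => J.1.measurableSet_toSet

lemma goodPart_of_notMem_union {x : ℝ} (hx : x ∉ maxBadUnion f lam) : goodPart f lam x = f x :=
  goodPart_of_notMem fun J hJ hxJ => hx (Set.mem_iUnion.2 ⟨⟨J, hJ⟩, hxJ⟩)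

lemma aestronglyMeasurable_goodPart (hf : Integrable f) :
    AEStronglyMeasurable (goodPart f lam) volume := by
  rw [← Measure.restrict_univ (μ := (volume : Measure ℝ)),
    ← Set.union_compl_self (maxBadUnion f lam), aestronglyMeasurable_union_iff]
  constructor
  · unfold maxBadUnion
    rw [aestronglyMeasurable_iUnion_iff]
    intro J
    refine AEStronglyMeasurable.congr (f := fun _ =>
      ((J.1.length : ℝ)⁻¹ : ℂ) * ∫ y in J.1.toSet, f y) aestronglyMeasurable_const ?_
    filter_upwards [ae_restrict_mem J.1.measurableSet_toSet] with x hx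
    exact (goodPart_of_mem J.2 hx).symm
  · refine AEStronglyMeasurable.congr (hf.1.restrict (s := (maxBadUnion f lam)ᶜ)) ?_
    filter_upwards [ae_restrict_mem measurableSet_maxBadUnion.compl] with x hx
    exact (goodPart_of_notMem_union hx).symm

/-- The parent of a maximal bad interval is not bad and has twice the length, which bounds the mean
by `2 * lam`. At a point outside these intervals no dyadic interval containing it is bad, and
differentiation bounds `f` by `lam`. -/
lemma norm_goodPart_le (hf : Integrable f) (hlam : 0 < lam) :
    ∀ᵐ x, ‖goodPart f lam x‖ ≤ 2 * lam := by
  have hfin : ∫⁻ x, ‖f x‖ₑ ≠ ∞ := hf.2.ne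
  filter_upwards [ae_le_of_forall_avg_le hf lam] with x hx
  by_cases h : ∃ J : DyadicInterval, IsMaxBad (fun x => ‖f x‖ₑ) lam J ∧ x ∈ J.toSet
  · obtain ⟨J, hJ, hxJ⟩ := h
    rw [goodPart_of_mem hJ hxJ]
    have hl := J.length_pos
    set P := containing (J.scale + 1) J.left with hP
    have hsub : J.toSet ⊆ P.toSet := subset_containing J.left_mem (by omega)
    have hPl : P.length = 2 * J.length := by
      rw [hP, length_containing, zpow_add_one₀ two_ne_zero, mul_comm]; rfl
    have hnot : ∫⁻ y in P.toSet, ‖f y‖ₑ ≤ lam * ENNReal.ofReal P.length := by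
      by_contra hcon
      have := hJ.maximal P hsub (not_le.1 hcon)
      rw [← this] at hl
      rw [this] at hPl
      linarith [J.length_pos]
    have h1 : ‖∫ y in J.toSet, f y‖ₑ ≤ lam * ENNReal.ofReal (2 * J.length) := by
      rw [← hPl]
      exact (enorm_integral_le_lintegral_enorm _).trans ((lintegral_mono_set hsub).trans hnot)
    rw [← ofReal_norm, ← ENNReal.ofReal_coe_nnreal, ← ENNReal.ofReal_mul lam.coe_nonneg,
      ENNReal.ofReal_le_ofReal_iff (by positivity)] at h1
    rw [norm_mul, norm_inv, Complex.norm_real, Real.norm_of_nonneg hl.le, inv_mul_le_iff₀ hl]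
    linarith
  · push Not at h
    rw [goodPart_of_notMem h]
    refine (hx fun J hJ => ?_).trans (by have := lam.coe_nonneg; linarith)
    by_contra hcon
    obtain ⟨J', hJ', hsub⟩ := exists_isMaxBad hfin (by exact_mod_cast hlam.ne') (not_le.1 hcon)
    exact h J' hJ' (hsub hJ)

/-- Averaging over disjoint intervals does not increase the L¹ norm. -/
lemma lintegral_goodPart_le : ∫⁻ x, ‖goodPart f lam x‖ₑ ≤ ∫⁻ x, ‖f x‖ₑ := by
  rw [← lintegral_add_compl (fun x => ‖goodPart f lam x‖ₑ) (measurableSet_maxBadUnion (f := f)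
    (lam := lam)), ← lintegral_add_compl (fun x => ‖f x‖ₑ) (measurableSet_maxBadUnion (f := f)
    (lam := lam))]
  gcongr ?_ + ?_
  · unfold maxBadUnion
    rw [lintegral_iUnion (fun J => J.1.measurableSet_toSet) pairwise_disjoint_isMaxBad,
      lintegral_iUnion (fun J => J.1.measurableSet_toSet) pairwise_disjoint_isMaxBad]
    refine ENNReal.tsum_le_tsum fun J => ?_
    have hl := J.1.length_pos
    rw [setLIntegral_congr_fun J.1.measurableSet_toSet
      (g := fun _ => ‖((J.1.length : ℝ)⁻¹ : ℂ) * ∫ y in J.1.toSet, f y‖ₑ)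
      fun x hx => by rw [goodPart_of_mem J.2 hx], setLIntegral_const, volume_toSet, enorm_mul]
    have : ‖((J.1.length : ℝ)⁻¹ : ℂ)‖ₑ = (ENNReal.ofReal J.1.length)⁻¹ := by
      rw [← ofReal_norm, norm_inv, Complex.norm_real, Real.norm_of_nonneg hl.le,
        ENNReal.ofReal_inv_of_pos hl]
    rw [this, mul_comm, ← mul_assoc, ENNReal.mul_inv_cancel (ofReal_length_ne_zero _)
      ENNReal.ofReal_ne_top, one_mul]
    exact enorm_integral_le_lintegral_enorm _
  · refine le_of_eq (setLIntegral_congr_fun measurableSet_maxBadUnion.compl fun x hx => ?_)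
    rw [goodPart_of_notMem_union hx]

lemma lintegral_goodPart_sq_le (hf : Integrable f) (hlam : 0 < lam) :
    ∫⁻ x, ‖goodPart f lam x‖ₑ ^ 2 ≤ 2 * lam * ∫⁻ x, ‖f x‖ₑ := by
  calc ∫⁻ x, ‖goodPart f lam x‖ₑ ^ 2 ≤ ∫⁻ x, (2 * lam) * ‖goodPart f lam x‖ₑ := by
        refine lintegral_mono_ae ?_
        filter_upwards [norm_goodPart_le hf hlam] with x hx
        rw [sq]
        gcongr
        refine (enorm_le_ofReal hx).trans (le_of_eq ?_)
        rw [ENNReal.ofReal_mul two_pos.le, ENNReal.ofReal_coe_nnreal]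
        norm_num
    _ ≤ _ := by
        rw [lintegral_const_mul' _ _ (ENNReal.mul_ne_top (by simp) (by simp))]
        exact mul_le_mul' le_rfl lintegral_goodPart_le

lemma integrable_goodPart (hf : Integrable f) : Integrable (goodPart f lam) :=
  ⟨aestronglyMeasurable_goodPart hf, lintegral_goodPart_le.trans_lt hf.2⟩

lemma memLp_goodPart (hf : Integrable f) (hlam : 0 < lam) : MemLp (goodPart f lam) 2 volume := by
  refine ⟨aestronglyMeasurable_goodPart hf, ?_⟩
  rw [eLpNorm_lt_top_iff_lintegral_rpow_enorm_lt_top (by simp) (by simp)]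
  simp only [ENNReal.toReal_ofNat, ENNReal.rpow_two]
  exact (lintegral_goodPart_sq_le hf hlam).trans_lt
    (ENNReal.mul_lt_top (ENNReal.mul_lt_top (by simp) (by simp)) hf.2)

end CalderonZygmund

lemma volume_toSet_diff_triple_le (I J : DyadicInterval) : volume (I.toSet \ J.triple) ≤
    volume (I.toSet \ Set.Icc (J.left - J.length) (J.left + 2 * J.length)) := by
  calc volume (I.toSet \ J.triple) ≤ volume ((I.toSet \ Set.Icc (J.left - J.length)
        (J.left + 2 * J.length)) ∪ {J.left + 2 * J.length}) := by
        refine measure_mono fun x hx => ?_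
        by_cases h : x = J.left + 2 * J.length
        · exact Or.inr h
        · refine Or.inl ⟨hx.1, fun hx' => hx.2 ⟨hx'.1, lt_of_le_of_ne hx'.2 h⟩⟩
    _ ≤ _ := by
        refine (measure_union_le _ _).trans ?_
        simp

lemma lt_fullSum_of_sq_lt {t : DyadicInterval → ℝ≥0∞} {x : ℝ} {a : ℝ≥0∞}
    (h : a ^ 2 < fullSq t x) : a < fullSum t x := by
  by_contra hcon
  exact absurd (h.trans_le (fullSq_le_fullSum_sq t x)) (not_lt.2 (pow_le_pow_left' (not_lt.1 hcon) 2))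

/-- The weak type estimate for the square function of a good family. -/
lemma exists_weak_type_fullSq (K : ℝ) (B : ℝ≥0) : ∃ C : ℝ≥0, ∀ ψ : DyadicInterval → ℝ → ℂ,
    GoodFamily K ψ → SquareBounded B ψ → ∀ f : ℝ → ℂ, Integrable f → ∀ lam : ℝ≥0, 0 < lam →
    lam * volume {x | 4 * (lam : ℝ≥0∞) ^ 2 < fullSq (coef f ψ) x} ≤ C * ∫⁻ x, ‖f x‖ₑ := by
  obtain ⟨C, hC⟩ := exists_offDiagonal K
  refine ⟨2 * B + (3 + C * 2), fun ψ hψ hB f hf lam hlam => ?_⟩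
  have hlam' : (lam : ℝ≥0∞) ≠ 0 := by exact_mod_cast hlam.ne'
  set g := goodPart f lam with hg
  set b : ℝ → ℂ := fun x => f x - g x with hb
  have hgi : Integrable g := integrable_goodPart hf
  have hbi : Integrable b := hf.sub hgi
  set 𝓑 := {J : DyadicInterval // IsMaxBad (fun x => ‖f x‖ₑ) lam J}
  -- By `(a + b) ^ 2 ≤ 2 (a ^ 2 + b ^ 2)`, one of the square functions of `g` and `b` must exceed
  -- `lam`. Off the triples of the bad intervals, that of `b` is replaced by the larger ℓ¹ sum.
  have hsplit : {x | 4 * (lam : ℝ≥0∞) ^ 2 < fullSq (coef f ψ) x} ⊆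
      {x | (lam : ℝ≥0∞) ^ 2 ≤ fullSq (coef g ψ) x} ∪
        (badSet (fun x => ‖f x‖ₑ) lam ∪
          {x | (lam : ℝ≥0∞) ≤ (badSet (fun x => ‖f x‖ₑ) lam)ᶜ.indicator (fullSum (coef b ψ)) x}) := by
    intro x hx
    by_cases h1 : (lam : ℝ≥0∞) ^ 2 ≤ fullSq (coef g ψ) x
    · exact Or.inl h1
    refine Or.inr ?_
    by_cases h2 : x ∈ badSet (fun x => ‖f x‖ₑ) lam
    · exact Or.inl h2
    refine Or.inr ?_
    have h3 : fullSq (coef f ψ) x ≤ 2 * (fullSq (coef g ψ) x + fullSq (coef b ψ) x) :=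
      fullSq_le_of_le_add (fun I => coef_le_add (fun x => by simp [hb]) I
        (hψ.integrable_mul_conj hgi I) (hψ.integrable_mul_conj hbi I)) x
    have h4 : (lam : ℝ≥0∞) ^ 2 < fullSq (coef b ψ) x := by
      by_contra hcon
      push Not at h1 hcon
      have hx' : 4 * (lam : ℝ≥0∞) ^ 2 < fullSq (coef f ψ) x := hx
      refine absurd (hx'.trans_le h3) (not_lt.2 ?_)
      calc _ ≤ 2 * ((lam : ℝ≥0∞) ^ 2 + (lam : ℝ≥0∞) ^ 2) := by gcongr
        _ = _ := by ring
    show (lam : ℝ≥0∞) ≤ _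
    rw [Set.indicator_of_mem (by exact h2)]
    exact (lt_fullSum_of_sq_lt h4).le
  -- The square function is bounded on L² and the square of the good part has integral at most `2
  -- lam ∫ |f|`; one factor `lam` cancels in Chebyshev's inequality.
  have hgood : lam * volume {x | (lam : ℝ≥0∞) ^ 2 ≤ fullSq (coef g ψ) x} ≤
      2 * B * ∫⁻ x, ‖f x‖ₑ := by
    have h1 : (lam : ℝ≥0∞) ^ 2 * volume {x | (lam : ℝ≥0∞) ^ 2 ≤ fullSq (coef g ψ) x} ≤
        B * (2 * lam * ∫⁻ x, ‖f x‖ₑ) := by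
      refine (mul_meas_ge_le_lintegral (measurable_fullSq _) _).trans ?_
      rw [lintegral_fullSq]
      refine (hB g (memLp_goodPart hf hlam)).trans ?_
      gcongr
      exact lintegral_goodPart_sq_le hf hlam
    refine (ENNReal.mul_le_mul_iff_right hlam' ENNReal.coe_ne_top).1 ?_
    calc _ = (lam : ℝ≥0∞) ^ 2 * volume {x | (lam : ℝ≥0∞) ^ 2 ≤ fullSq (coef g ψ) x} := by ring
      _ ≤ _ := h1
      _ = _ := by ring
  -- The pieces of `b` on the disjoint bad intervals have pairings with `ψ I` that sum to that of
  -- `b`, since the product of `b` with the conjugate of `ψ I` is integrable.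
  have hbJ : ∀ I, coef b ψ I ≤ ∑' J : 𝓑, coef (J.1.toSet.indicator b) ψ I := by
    intro I
    have hbI := hψ.integrable_mul_conj hbi I
    have h1 : HasSum (fun J : 𝓑 => ∫ x in J.1.toSet, b x * (starRingEnd ℂ) (ψ I x))
        (∫ x in ⋃ J : 𝓑, J.1.toSet, b x * (starRingEnd ℂ) (ψ I x)) :=
      hasSum_integral_iUnion (fun J => J.1.measurableSet_toSet) pairwise_disjoint_isMaxBad
        hbI.integrableOn
    have h2 : ∫ x in ⋃ J : 𝓑, J.1.toSet, b x * (starRingEnd ℂ) (ψ I x) = pairing b (ψ I) := by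
      rw [setIntegral_eq_integral_of_forall_compl_eq_zero]
      · rfl
      · intro x hx
        have : b x = 0 := by
          simp only [hb, hg]
          rw [goodPart_of_notMem_union hx, sub_self]
        rw [this, zero_mul]
    have h3 : ∀ J : 𝓑, ∫ x in J.1.toSet, b x * (starRingEnd ℂ) (ψ I x) =
        pairing (J.1.toSet.indicator b) (ψ I) := by
      intro J
      rw [pairing, ← integral_indicator J.1.measurableSet_toSet]
      congr 1
      ext x
      by_cases hx : x ∈ J.1.toSet <;> simp [hx]
    unfold coef
    rw [← h2, ← h1.tsum_eq]
    simp_rw [h3]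
    exact enorm_tsum_le_tsum_enorm
  -- The mean of `f` was subtracted on `J`, so each piece has integral zero and the off-diagonal
  -- estimate applies outside the triple.
  have hoff : ∀ J : 𝓑, ∑' I : DyadicInterval, coef (J.1.toSet.indicator b) ψ I *
      volume (I.toSet \ J.1.triple) ≤ C * ∫⁻ x in J.1.toSet, ‖b x‖ₑ := by
    intro J
    have hl := J.1.length_pos
    have h0 : ∫ x, J.1.toSet.indicator b x = 0 := by
      rw [integral_indicator J.1.measurableSet_toSet]
      simp only [hb]
      rw [integral_sub hf.integrableOn hgi.integrableOn,
        setIntegral_congr_fun (f := g) (g := fun _ => ((J.1.length : ℝ)⁻¹ : ℂ) *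
          ∫ y in J.1.toSet, f y) J.1.measurableSet_toSet fun x hx => goodPart_of_mem J.2 hx,
        setIntegral_const, measureReal_def, volume_toSet, ENNReal.toReal_ofReal hl.le,
        Complex.real_smul, ← mul_assoc, mul_inv_cancel₀ (by exact_mod_cast hl.ne'), one_mul, sub_self]
    have h1 := hC ψ hψ J.1.left J.1.length J.1.toSet hl Set.Ico_subset_Icc_self (hψ.regularOn J.1)
      (J.1.toSet.indicator b) (hbi.indicator J.1.measurableSet_toSet)
      (fun x hx => Set.indicator_of_notMem hx _) h0
    have h2 : ∫⁻ x, ‖J.1.toSet.indicator b x‖ₑ = ∫⁻ x in J.1.toSet, ‖b x‖ₑ := by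
      rw [← lintegral_indicator J.1.measurableSet_toSet]
      refine lintegral_congr fun x => ?_
      by_cases hx : x ∈ J.1.toSet <;> simp [hx]
    rw [h2] at h1
    refine le_trans (ENNReal.tsum_le_tsum fun I => ?_) h1
    exact mul_le_mul' le_rfl (volume_toSet_diff_triple_le I J.1)
  have hbad : lam * volume {x | (lam : ℝ≥0∞) ≤
      (badSet (fun x => ‖f x‖ₑ) lam)ᶜ.indicator (fullSum (coef b ψ)) x} ≤
      C * 2 * ∫⁻ x, ‖f x‖ₑ := by
    have hm := (measurableSet_badSet (h := fun x => ‖f x‖ₑ) (lam := (lam : ℝ≥0∞))).compl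
    refine (mul_meas_ge_le_lintegral ((measurable_fullSum _).indicator hm) _).trans ?_
    rw [lintegral_indicator hm, setLIntegral_fullSum]
    calc ∑' I : DyadicInterval, coef b ψ I * volume (I.toSet \ badSet (fun x => ‖f x‖ₑ) lam)
        ≤ ∑' I : DyadicInterval, ∑' J : 𝓑, coef (J.1.toSet.indicator b) ψ I *
            volume (I.toSet \ J.1.triple) := by
          refine ENNReal.tsum_le_tsum fun I => ?_
          refine (mul_le_mul' (hbJ I) le_rfl).trans ?_
          rw [← ENNReal.tsum_mul_right]
          refine ENNReal.tsum_le_tsum fun J => ?_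
          gcongr
          exact Set.subset_iUnion (fun J : 𝓑 => J.1.triple) J
      _ = ∑' J : 𝓑, ∑' I : DyadicInterval, coef (J.1.toSet.indicator b) ψ I *
            volume (I.toSet \ J.1.triple) := ENNReal.tsum_comm
      _ ≤ ∑' J : 𝓑, C * ∫⁻ x in J.1.toSet, ‖b x‖ₑ := ENNReal.tsum_le_tsum hoff
      _ = C * ∫⁻ x in ⋃ J : 𝓑, J.1.toSet, ‖b x‖ₑ := by
          rw [ENNReal.tsum_mul_left, lintegral_iUnion (fun J => J.1.measurableSet_toSet)
            pairwise_disjoint_isMaxBad]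
      _ ≤ C * ∫⁻ x, (‖f x‖ₑ + ‖g x‖ₑ) := by
          exact mul_le_mul' le_rfl ((setLIntegral_le_lintegral _ _).trans
            (lintegral_mono fun x => enorm_sub_le))
      _ ≤ C * ((∫⁻ x, ‖f x‖ₑ) + ∫⁻ x, ‖f x‖ₑ) := by
          rw [lintegral_add_left' hf.1.enorm]
          exact mul_le_mul' le_rfl (add_le_add le_rfl lintegral_goodPart_le)
      _ = _ := by ring
  calc lam * volume {x | 4 * (lam : ℝ≥0∞) ^ 2 < fullSq (coef f ψ) x}
      ≤ lam * (volume {x | (lam : ℝ≥0∞) ^ 2 ≤ fullSq (coef g ψ) x} +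
          (volume (badSet (fun x => ‖f x‖ₑ) lam) + volume {x | (lam : ℝ≥0∞) ≤
            (badSet (fun x => ‖f x‖ₑ) lam)ᶜ.indicator (fullSum (coef b ψ)) x})) := by
        gcongr
        exact (measure_mono hsplit).trans ((measure_union_le _ _).trans
          (add_le_add le_rfl (measure_union_le _ _)))
    _ = lam * volume {x | (lam : ℝ≥0∞) ^ 2 ≤ fullSq (coef g ψ) x} +
          (lam * volume (badSet (fun x => ‖f x‖ₑ) lam) + lam * volume {x | (lam : ℝ≥0∞) ≤
            (badSet (fun x => ‖f x‖ₑ) lam)ᶜ.indicator (fullSum (coef b ψ)) x}) := by ring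
    _ ≤ 2 * B * (∫⁻ x, ‖f x‖ₑ) + (3 * (∫⁻ x, ‖f x‖ₑ) + C * 2 * ∫⁻ x, ‖f x‖ₑ) :=
        add_le_add hgood (add_le_add volume_badSet_le hbad)
    _ = _ := by push_cast; ring

end Paraproduct

/-! ### Localization of the square function to a dyadic interval. -/

namespace Paraproduct

open DyadicInterval

namespace DyadicInterval

variable {I J : DyadicInterval}

lemma abs_center_sub_center_le (h : I.toSet ⊆ J.toSet) (x : ℝ) :
    |x - J.center| ≤ |x - I.center| + J.length / 2 := by
  have h1 := J.abs_sub_center_le_half (h I.center_mem)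
  have h2 := abs_sub_le x I.center J.center
  linarith

lemma dec_le_of_subset (h : I.toSet ⊆ J.toSet) (x : ℝ) : I.dec x ≤ 3 / 2 * J.dec x := by
  have hI := I.length_pos
  have hJ := J.length_pos
  have hIJ := length_le_of_subset h
  have h1 := abs_center_sub_center_le h x
  have h2 : |x - I.center| / J.length ≤ |x - I.center| / I.length := by gcongr
  have h3 : |x - J.center| / J.length ≤ |x - I.center| / J.length + 1 / 2 := by
    rw [div_add_div _ _ hJ.ne' two_ne_zero, div_le_div_iff₀ hJ (by positivity)]
    nlinarith
  have h4 : 0 ≤ |x - I.center| / I.length := by positivity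
  rw [dec, dec, ← div_eq_mul_inv, le_div_iff₀ (J.dec_denom_pos x), ← div_eq_inv_mul,
    div_le_iff₀ (I.dec_denom_pos x)]
  linarith

/-- Outside the triple of `J` the distance to the center of `I` is at least `|J|`, which makes the
weight of `I` smaller than that of `J` by a factor of order `|I| / |J|`. -/
lemma dec_le_of_notMem_triple (h : I.toSet ⊆ J.toSet) {x : ℝ} (hx : x ∉ J.triple) :
    I.dec x ≤ 5 / 2 * (I.length / J.length) * J.dec x := by
  have hI := I.length_pos
  have hJ := J.length_pos
  have h1 := abs_center_sub_center_le h x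
  have hfar : J.length ≤ |x - I.center| := by
    have hc := h I.center_mem
    by_contra hcon
    push Not at hcon
    rw [abs_lt] at hcon
    exact hx ⟨by linarith [hc.1, hc.2], by linarith [hc.1, hc.2]⟩
  have h2 : 0 < |x - I.center| := hJ.trans_le hfar
  refine (I.dec_le_div h2 le_rfl).trans ?_
  rw [dec, ← div_eq_mul_inv, le_div_iff₀ (J.dec_denom_pos x)]
  rw [show I.length / |x - I.center| * (1 + |x - J.center| / J.length) =
    I.length / J.length * ((J.length + |x - J.center|) / |x - I.center|) by field_simp, mul_comm (5 / 2)]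
  refine mul_le_mul_of_nonneg_left ?_ (by positivity)
  rw [div_le_iff₀ h2]
  linarith

lemma le_dec_of_mem_triple {x : ℝ} (hx : x ∈ J.triple) : 2 / 5 ≤ J.dec x := by
  have hJ := J.length_pos
  have : |x - J.center| ≤ 3 / 2 * J.length := by
    rw [abs_le, center]
    constructor <;> linarith [hx.1, hx.2]
  rw [dec, ← one_div, le_div_iff₀ (J.dec_denom_pos x)]
  have h2 : |x - J.center| / J.length ≤ 3 / 2 := by rwa [div_le_iff₀ hJ]
  linarith

end DyadicInterval

lemma lintegral_mul_dec_sq (h : ℝ → ℝ≥0∞) (J : DyadicInterval) :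
    ∫⁻ x, h x * ENNReal.ofReal (J.dec x ^ 2) = ENNReal.ofReal J.length * wavg h J := by
  rw [wavg, ← mul_assoc, ENNReal.mul_inv_cancel (ofReal_length_ne_zero J) ENNReal.ofReal_ne_top,
    one_mul]

/-- The weight is at least `2 / 5` on the triple, and `7 * (2 / 5) ^ 2 ≥ 1`. -/
lemma setLIntegral_triple_le_wavg (h : ℝ → ℝ≥0∞) (J : DyadicInterval) :
    ∫⁻ x in J.triple, h x ≤ 7 * (ENNReal.ofReal J.length * wavg h J) := by
  rw [← lintegral_mul_dec_sq, ← lintegral_const_mul' _ _ (by simp)]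
  rw [← lintegral_indicator J.measurableSet_triple]
  refine lintegral_mono fun x => ?_
  by_cases hx : x ∈ J.triple
  · rw [Set.indicator_of_mem hx]
    have h1 : (1 : ℝ) ≤ 7 * J.dec x ^ 2 := by nlinarith [le_dec_of_mem_triple hx]
    calc h x = h x * ENNReal.ofReal 1 := by simp
      _ ≤ h x * ENNReal.ofReal (7 * J.dec x ^ 2) := by gcongr
      _ = _ := by rw [ENNReal.ofReal_mul (by norm_num)]; norm_num; ring
  · simp [hx]

lemma lintegral_mul_dec_sq_le (h : ℝ → ℝ≥0∞) {I J : DyadicInterval} (hIJ : I.toSet ⊆ J.toSet) :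
    ∫⁻ x, h x * ENNReal.ofReal (I.dec x ^ 2) ≤ 3 * ∫⁻ x, h x * ENNReal.ofReal (J.dec x ^ 2) := by
  rw [← lintegral_const_mul' _ _ (by simp)]
  refine lintegral_mono fun x => ?_
  have h1 : I.dec x ^ 2 ≤ 3 * J.dec x ^ 2 := by
    nlinarith [dec_le_of_subset hIJ x, I.dec_pos x, J.dec_pos x]
  calc h x * ENNReal.ofReal (I.dec x ^ 2) ≤ h x * ENNReal.ofReal (3 * J.dec x ^ 2) := by gcongr
    _ = _ := by rw [ENNReal.ofReal_mul (by norm_num)]; norm_num; ring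

section

variable {K : ℝ} {ψ : DyadicInterval → ℝ → ℂ}

lemma GoodFamily.integrable_mul_conj_of_lintegral (h : GoodFamily K ψ) {f : ℝ → ℂ}
    (hf : AEStronglyMeasurable f volume) {I : DyadicInterval}
    (hI : ∫⁻ x, ‖f x‖ₑ * ENNReal.ofReal (I.dec x ^ 2) ≠ ∞) :
    Integrable fun x => f x * (starRingEnd ℂ) (ψ I x) := by
  have hl := I.length_pos
  refine ⟨hf.mul (RCLike.continuous_conj.measurable.comp (h.measurable I)).aestronglyMeasurable, ?_⟩
  have : ∫⁻ x, ‖f x‖ₑ * ENNReal.ofReal (I.dec x ^ 2) * ENNReal.ofReal (K / I.length) < ∞ := by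
    rw [lintegral_mul_const' _ _ ENNReal.ofReal_ne_top]
    exact ENNReal.mul_lt_top hI.lt_top ENNReal.ofReal_lt_top
  refine lt_of_le_of_lt (lintegral_mono fun x => ?_) this
  rw [enorm_mul_conj, mul_assoc]
  gcongr
  refine (enorm_le_ofReal (h.size' I x)).trans (le_of_eq ?_)
  rw [mul_comm, ENNReal.ofReal_mul (by positivity)]

/-- With `q = |I| / |J|`, three powers of decay give at least `q ^ 2` times two powers of the weight
of `J`. Since `1 / |I| = 1 / (q |J|)`, one power of `q` survives, which makes the coefficients
summable over the scales below `J`. The constant 16 bounds `(5 / 2) ^ 3`. -/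
lemma GoodFamily.coef_indicator_compl_triple_le (h : GoodFamily K ψ) (f : ℝ → ℂ)
    {I J : DyadicInterval} (hIJ : I.toSet ⊆ J.toSet) :
    coef (J.tripleᶜ.indicator f) ψ I ≤ ENNReal.ofReal (16 * K) * wavg (fun x => ‖f x‖ₑ) J *
      ENNReal.ofReal (I.length / J.length) := by
  have hI := I.length_pos
  have hJ := J.length_pos
  have hK := h.nonneg
  have hle := length_le_of_subset hIJ
  refine (enorm_pairing_le _ _).trans ?_
  calc ∫⁻ x, ‖J.tripleᶜ.indicator f x‖ₑ * ‖ψ I x‖ₑ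
      ≤ ∫⁻ x, ENNReal.ofReal (16 * K * (I.length / J.length) / J.length) *
          (‖f x‖ₑ * ENNReal.ofReal (J.dec x ^ 2)) := by
        refine lintegral_mono fun x => ?_
        by_cases hx : x ∈ J.triple
        · simp [hx]
        · rw [Set.indicator_of_mem (by exact hx)]
          have hb : ‖ψ I x‖ ≤ 16 * K * (I.length / J.length) / J.length * J.dec x ^ 2 := by
            refine (h.size I x).trans ?_
            have h1 := dec_le_of_notMem_triple hIJ hx
            have h2 := (I.dec_pos x).le
            have h3 := (J.dec_pos x).le
            have h4 := J.dec_le_one x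
            set q := I.length / J.length with hq
            have hq0 : 0 ≤ q := by positivity
            have hq1 : q ≤ 1 := (div_le_one hJ).2 hle
            have hIq : I.length = q * J.length := by rw [hq]; field_simp
            have h5 : I.dec x ^ 3 ≤ 16 * (q ^ 2 * J.dec x ^ 2) := by
              calc I.dec x ^ 3 ≤ (5 / 2 * q * J.dec x) ^ 3 := by gcongr
                _ = 125 / 8 * (q ^ 2 * J.dec x ^ 2) * (q * J.dec x) := by ring
                _ ≤ 125 / 8 * (q ^ 2 * J.dec x ^ 2) * 1 := by
                    gcongr
                    exact mul_le_one₀ hq1 h3 h4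
                _ ≤ _ := by nlinarith [mul_nonneg (sq_nonneg q) (sq_nonneg (J.dec x))]
            have hqpos : 0 < q := by positivity
            calc K / I.length * I.dec x ^ 3 ≤ K / I.length * (16 * (q ^ 2 * J.dec x ^ 2)) := by
                  gcongr
              _ = _ := by rw [hIq]; field_simp
          calc ‖f x‖ₑ * ‖ψ I x‖ₑ ≤ ‖f x‖ₑ *
                ENNReal.ofReal (16 * K * (I.length / J.length) / J.length * J.dec x ^ 2) := by
                gcongr
                exact enorm_le_ofReal hb
            _ = _ := by
                rw [ENNReal.ofReal_mul (by positivity)]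
                ring
    _ = _ := by
        rw [lintegral_const_mul' _ _ ENNReal.ofReal_ne_top, wavg, ENNReal.ofReal_div_of_pos hJ,
          ENNReal.ofReal_mul (by positivity), div_eq_mul_inv]
        ring

/-- The local square function is dominated by a weighted mean on a large part of the interval. -/
lemma exists_volume_locSq_le (K : ℝ) (B : ℝ≥0) : ∃ R : ℝ≥0, ∀ ψ : DyadicInterval → ℝ → ℂ,
    GoodFamily K ψ → SquareBounded B ψ → ∀ f : ℝ → ℂ, AEStronglyMeasurable f volume →
    ∀ J : DyadicInterval, 4 * volume (J.toSet ∩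
      {x | (R * wavg (fun x => ‖f x‖ₑ) J) ^ 2 < locSq (coef f ψ) J x}) ≤ volume J.toSet := by
  obtain ⟨C, hC⟩ := exists_weak_type_fullSq K B
  obtain ⟨C₁, hC₁⟩ := exists_tsum_min_le
  -- The part of `f` in the triple has integral at most `7 |J| W`. The weak type estimate at level
  -- `E W` then leaves an exceptional set of measure at most `7 C |J| / E ≤ |J| / 4`; the summand 1
  -- keeps the level positive.
  set E : ℝ≥0 := 28 * C + 1 with hE
  set D : ℝ≥0 := (16 * K).toNNReal with hD
  refine ⟨3 * E + 2 * D * (1 + C₁), fun ψ hψ hB f hf J => ?_⟩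
  set R : ℝ≥0 := 3 * E + 2 * D * (1 + C₁) with hR
  have hRE : (0 : ℝ≥0) < R := by rw [hR]; positivity
  have hR2 : 2 * (4 * E ^ 2 + D ^ 2 * C₁) ≤ R ^ 2 := by
    rw [hR, ← NNReal.coe_le_coe]
    push_cast
    have h1 : (0 : ℝ) ≤ E := E.2
    have h2 : (0 : ℝ) ≤ D := D.2
    have h3 : (0 : ℝ) ≤ C₁ := C₁.2
    nlinarith [sq_nonneg (E : ℝ), mul_nonneg h1 h2, mul_nonneg (mul_nonneg h1 h2) h3,
      mul_nonneg (sq_nonneg (D : ℝ)) h3, mul_nonneg (sq_nonneg (D : ℝ)) (sq_nonneg (C₁ : ℝ)),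
      sq_nonneg (D : ℝ)]
  set W := wavg (fun x => ‖f x‖ₑ) J with hW
  by_cases hWtop : W = ∞
  · rw [hWtop, ENNReal.mul_top (by exact_mod_cast hRE.ne')]
    simp
  have hfJ : ∫⁻ x, ‖f x‖ₑ * ENNReal.ofReal (J.dec x ^ 2) ≠ ∞ := by
    rw [lintegral_mul_dec_sq]
    exact ENNReal.mul_ne_top ENNReal.ofReal_ne_top hWtop
  set f₁ := J.triple.indicator f with hf₁
  set f₂ := J.tripleᶜ.indicator f with hf₂
  have hff : ∀ x, f x = f₁ x + f₂ x := fun x => (Set.indicator_self_add_compl_apply _ f x).symm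
  have hint : ∫⁻ x, ‖f₁ x‖ₑ ≤ 7 * (ENNReal.ofReal J.length * W) := by
    refine le_trans (le_of_eq ?_) (setLIntegral_triple_le_wavg _ J)
    rw [← lintegral_indicator J.measurableSet_triple]
    refine lintegral_congr fun x => ?_
    by_cases hx : x ∈ J.triple <;> simp [hf₁, hx]
  have hf₁i : Integrable f₁ := ⟨hf.indicator J.measurableSet_triple, hint.trans_lt
    (ENNReal.mul_lt_top (by simp) (ENNReal.mul_lt_top (by simp) (lt_top_iff_ne_top.2 hWtop)))⟩
  have hf₂m : AEStronglyMeasurable f₂ volume := hf.indicator J.measurableSet_triple.compl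
  have hadd : ∀ I : DyadicInterval, I.toSet ⊆ J.toSet →
      coef f ψ I ≤ coef f₁ ψ I + coef f₂ ψ I := by
    intro I hIJ
    refine coef_le_add hff I (hψ.integrable_mul_conj hf₁i I)
      (hψ.integrable_mul_conj_of_lintegral hf₂m (ne_top_of_le_ne_top ?_ ((lintegral_mono
        fun x => mul_le_mul' ?_ le_rfl).trans (lintegral_mul_dec_sq_le (fun x => ‖f x‖ₑ) hIJ))))
    · exact ENNReal.mul_ne_top (by simp) hfJ
    · exact enorm_indicator_le_enorm_self f x
  -- The weak type estimate needs a positive level; if `W = 0`, all coefficients below `J` vanish.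
  rcases eq_or_ne W 0 with hW0 | hW0
  · have hzero : ∀ I : DyadicInterval, I.toSet ⊆ J.toSet → coef f ψ I = 0 := by
      intro I hIJ
      have h1 := hψ.coef_le_wavg f I
      have h2 : wavg (fun x => ‖f x‖ₑ) I = 0 := by
        have h3 := lintegral_mul_dec_sq_le (fun x => ‖f x‖ₑ) hIJ
        rw [lintegral_mul_dec_sq _ J, ← hW, hW0, mul_zero, mul_zero] at h3
        rw [wavg, le_antisymm h3 zero_le, mul_zero]
      rw [h2, mul_zero] at h1
      exact le_antisymm h1 zero_le
    have : ∀ x, locSq (coef f ψ) J x = 0 := by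
      intro x
      refine ENNReal.tsum_eq_zero.2 fun I => ?_
      by_cases hIJ : I.toSet ⊆ J.toSet
      · simp [hIJ, hzero I hIJ]
      · simp [hIJ]
    simp [this]
  -- The part outside the triple is controlled at every point: one interval per scale, with squared
  -- ratios `(|I| / |J|) ^ 2` that are summable.
  have htail : ∀ x, locSq (coef f₂ ψ) J x ≤ (D * W) ^ 2 * C₁ := by
    intro x
    rw [locSq, tsum_indicator_eq]
    refine le_trans (ENNReal.tsum_le_tsum fun k => ?_)
      (le_of_eq_of_le ENNReal.tsum_mul_left (mul_le_mul' le_rfl (hC₁ J.length J.length_pos)))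
    split_ifs with hsub
    · have hle := length_le_of_subset hsub
      rw [length_containing] at hle
      have hJ := J.length_pos
      refine (pow_le_pow_left' (hψ.coef_indicator_compl_triple_le f hsub) 2).trans ?_
      rw [mul_pow]
      refine mul_le_mul' le_rfl ?_
      rw [length_containing, ← ENNReal.ofReal_pow (by positivity)]
      refine ENNReal.ofReal_le_ofReal ?_
      have h1 : (2 : ℝ) ^ k / J.length ≤ 1 := (div_le_one hJ).2 hle
      have h2 : 1 ≤ J.length / (2 : ℝ) ^ k := (one_le_div (by positivity)).2 hle
      have h3 : 0 ≤ (2 : ℝ) ^ k / J.length := by positivity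
      rw [le_min_iff]
      constructor <;> nlinarith
    · exact zero_le
  have hsub : J.toSet ∩ {x | (R * W) ^ 2 < locSq (coef f ψ) J x} ⊆
      {x | 4 * (E * W) ^ 2 < fullSq (coef f₁ ψ) x} := by
    rintro x ⟨-, hx⟩
    have hx : (R * W) ^ 2 < locSq (coef f ψ) J x := hx
    show 4 * (E * W) ^ 2 < fullSq (coef f₁ ψ) x
    by_contra hcon
    push Not at hcon
    have h1 : locSq (coef f ψ) J x ≤ 2 * (fullSq (coef f₁ ψ) x + locSq (coef f₂ ψ) J x) := by
      unfold locSq fullSq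
      rw [← ENNReal.tsum_add, ← ENNReal.tsum_mul_left]
      refine ENNReal.tsum_le_tsum fun I => ?_
      by_cases hxI : x ∈ I.toSet
      · simp only [Set.indicator_of_mem hxI]
        split_ifs with hIJ
        · exact (pow_le_pow_left' (hadd I hIJ) 2).trans (ENNReal.add_sq_le _ _)
        · exact zero_le
      · simp [hxI]
    refine absurd hx (not_lt.2 (h1.trans ?_))
    calc 2 * (fullSq (coef f₁ ψ) x + locSq (coef f₂ ψ) J x)
        ≤ 2 * (4 * (E * W) ^ 2 + (D * W) ^ 2 * C₁) := by
          gcongr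
          exact htail x
      _ = ((2 * (4 * E ^ 2 + D ^ 2 * C₁) : ℝ≥0) : ℝ≥0∞) * W ^ 2 := by push_cast; ring
      _ ≤ ((R ^ 2 : ℝ≥0) : ℝ≥0∞) * W ^ 2 := by gcongr
      _ = _ := by push_cast; ring
  clear_value W
  lift W to ℝ≥0 using hWtop
  have hEW : 0 < E * W := mul_pos (by rw [hE]; positivity) (pos_iff_ne_zero.2 (by exact_mod_cast hW0))
  have hweak := hC ψ hψ hB f₁ hf₁i (E * W) hEW
  rw [volume_toSet]
  have hEW0 : ((E * W : ℝ≥0) : ℝ≥0∞) ≠ 0 := by exact_mod_cast hEW.ne'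
  refine (ENNReal.mul_le_mul_iff_right hEW0 ENNReal.coe_ne_top).1 ?_
  calc ((E * W : ℝ≥0) : ℝ≥0∞) * (4 * volume (J.toSet ∩ {x | (R * W) ^ 2 < locSq (coef f ψ) J x}))
      = 4 * (((E * W : ℝ≥0) : ℝ≥0∞) *
          volume (J.toSet ∩ {x | (R * W) ^ 2 < locSq (coef f ψ) J x})) := by ring
    _ ≤ 4 * (((E * W : ℝ≥0) : ℝ≥0∞) *
          volume {x | 4 * ((E * W : ℝ≥0) : ℝ≥0∞) ^ 2 < fullSq (coef f₁ ψ) x}) := by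
        refine mul_le_mul' le_rfl (mul_le_mul' le_rfl (measure_mono ?_))
        rw [ENNReal.coe_mul]
        exact hsub
    _ ≤ 4 * (C * (7 * (ENNReal.ofReal J.length * W))) := by
        refine mul_le_mul' le_rfl (hweak.trans ?_)
        gcongr
    _ = ((28 * C : ℝ≥0) : ℝ≥0∞) * W * ENNReal.ofReal J.length := by push_cast; ring
    _ ≤ _ := by
        rw [ENNReal.coe_mul]
        have hCE : 28 * C ≤ E := by rw [hE]; exact le_self_add
        exact mul_le_mul' (mul_le_mul' (ENNReal.coe_le_coe.2 hCE) le_rfl) le_rfl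

end

end Paraproduct

/-! ### Majorants for Lebesgue spaces. -/

namespace Paraproduct

open DyadicInterval

/-- The sequence `t` has a majorant, which is a square majorant if `sq` holds, of norm at most `N`
in `L^p`. -/
def Majorized (t : DyadicInterval → ℝ≥0∞) (sq : Prop) (p N : ℝ≥0∞) : Prop :=
  ∃ m, IsMajorant t m ∧ (sq → IsSquareMajorant t m) ∧ eLpNorm m p volume ≤ N

/-- The sequence `t` has a majorant, which is a square majorant if `sq` holds, with a weak bound. -/
def WeakMajorized (t : DyadicInterval → ℝ≥0∞) (sq : Prop) (p N : ℝ≥0∞) : Prop :=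
  ∃ m, IsMajorant t m ∧ (sq → IsSquareMajorant t m) ∧ WeakBound m p N

lemma Majorized.weak {t : DyadicInterval → ℝ≥0∞} {sq : Prop} {p N : ℝ≥0∞}
    (h : Majorized t sq p N) (hp : 1 ≤ p) (hN0 : N ≠ 0) (hN : N ≠ ∞) : WeakMajorized t sq p N := by
  obtain ⟨m, h1, h2, h3⟩ := h
  exact ⟨m, h1, h2, weakBound_of_eLpNorm_le h1.measurable hp hN0 hN h3⟩

lemma Majorized.mono {t : DyadicInterval → ℝ≥0∞} {sq : Prop} {p N N' : ℝ≥0∞}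
    (h : Majorized t sq p N) (hN : N ≤ N') : Majorized t sq p N' := by
  obtain ⟨m, h1, h2, h3⟩ := h
  exact ⟨m, h1, h2, h3.trans hN⟩

section Lebesgue

lemma isSquareMajorant_of_le {t : DyadicInterval → ℝ≥0∞} {m : ℝ → ℝ≥0∞}
    {a : DyadicInterval → ℝ≥0∞}
    (h : ∀ J : DyadicInterval, 4 * volume (J.toSet ∩ {x | a J ^ 2 < locSq t J x}) ≤ volume J.toSet)
    (ha : ∀ J : DyadicInterval, ∀ x ∈ J.toSet, a J ≤ m x) : IsSquareMajorant t m := by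
  intro J
  refine le_trans (mul_le_mul' le_rfl (measure_mono ?_)) (h J)
  rintro x ⟨hx, hx'⟩
  exact ⟨hx, lt_of_le_of_lt (pow_le_pow_left' (ha J x hx) 2) hx'⟩

/-- The coefficient at `I` and the bound for the local square function of `I` are both multiples of
the same weighted mean. This mean is at most 24 times the maximal function throughout `I`, so one
function serves both purposes. -/
lemma exists_maxFn_majorant (K : ℝ) (B : ℝ≥0) : ∃ R : ℝ≥0, 0 < R ∧
    ∀ ψ : DyadicInterval → ℝ → ℂ, GoodFamily K ψ → ∀ f : ℝ → ℂ, AEStronglyMeasurable f volume →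
      IsMajorant (coef f ψ) (fun x => R * maxFn (fun x => ‖f x‖ₑ) x) ∧
      (SquareBounded B ψ →
        IsSquareMajorant (coef f ψ) (fun x => R * maxFn (fun x => ‖f x‖ₑ) x)) := by
  obtain ⟨R, hR⟩ := exists_volume_locSq_le K B
  refine ⟨(K.toNNReal + R + 1) * 24, by positivity, fun ψ hψ f hf => ⟨⟨?_, ?_⟩, fun hB => ?_⟩⟩
  · exact (measurable_maxFn _).const_mul _
  · intro I x hx
    refine (hψ.coef_le_wavg f I).trans ((mul_le_mul' le_rfl (wavg_le_maxFn _ hf.enorm hx)).trans ?_)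
    rw [← mul_assoc]
    push_cast
    gcongr
    exact le_add_right le_self_add
  · refine isSquareMajorant_of_le (hR ψ hψ hB f hf) fun J x hx => ?_
    refine (mul_le_mul' le_rfl (wavg_le_maxFn _ hf.enorm hx)).trans ?_
    rw [← mul_assoc]
    push_cast
    gcongr
    exact le_add_right le_add_self

lemma exists_eLpNorm_maxFn_le {p : ℝ≥0∞} (hp : 1 < p) : ∃ C : ℝ≥0, ∀ f : ℝ → ℂ,
    AEStronglyMeasurable f volume →
    eLpNorm (maxFn fun x => ‖f x‖ₑ) p volume ≤ C * eLpNorm f p volume := by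
  by_cases hpt : p = ∞
  · subst hpt
    refine ⟨1, fun f hf => ?_⟩
    rw [ENNReal.coe_one, one_mul, eLpNorm_exponent_top, eLpNorm_exponent_top]
    refine essSup_le_of_ae_le _ (Eventually.of_forall fun x => ?_)
    exact maxFn_le_of_ae_le (enorm_ae_le_eLpNormEssSup f volume) x
  · have hp1 : 1 < p.toReal := by
      rw [← ENNReal.toReal_one]
      exact (ENNReal.toReal_lt_toReal (by simp) hpt).2 hp
    have hp0 : 0 < p.toReal := by linarith
    obtain ⟨C, hC⟩ := exists_lintegral_maxFn_rpow_le hp1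
    refine ⟨C ^ (1 / p.toReal), fun f hf => ?_⟩
    have hp00 : p ≠ 0 := (zero_lt_one.trans hp).ne'
    rw [eLpNorm_eq_lintegral_rpow_enorm_toReal hp00 hpt,
      eLpNorm_eq_lintegral_rpow_enorm_toReal hp00 hpt,
      ENNReal.coe_rpow_of_nonneg _ (by positivity), ← ENNReal.mul_rpow_of_nonneg _ _ (by positivity)]
    refine ENNReal.rpow_le_rpow ?_ (by positivity)
    have hae : (fun x => ‖f x‖ₑ) =ᵐ[volume] fun x => ‖hf.mk f x‖ₑ := by
      filter_upwards [hf.ae_eq_mk] with x hx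
      rw [hx]
    calc ∫⁻ x, ‖maxFn (fun x => ‖f x‖ₑ) x‖ₑ ^ p.toReal
        = ∫⁻ x, maxFn (fun x => ‖hf.mk f x‖ₑ) x ^ p.toReal := by
          refine lintegral_congr fun x => ?_
          rw [maxFn_congr_ae hae]
          rfl
      _ ≤ C * ∫⁻ x, ‖hf.mk f x‖ₑ ^ p.toReal :=
          hC _ hf.stronglyMeasurable_mk.measurable.enorm
      _ = _ := by
          congr 1
          refine lintegral_congr_ae ?_
          filter_upwards [hae] with x hx
          rw [hx]

lemma exists_majorized_lebesgue (K : ℝ) (B : ℝ≥0) {p : ℝ≥0∞} (hp : 1 < p) : ∃ C : ℝ≥0,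
    ∀ ψ : DyadicInterval → ℝ → ℂ, GoodFamily K ψ → ∀ f : ℝ → ℂ, AEStronglyMeasurable f volume →
      Majorized (coef f ψ) (SquareBounded B ψ) p (C * eLpNorm f p volume) := by
  obtain ⟨R, -, hR⟩ := exists_maxFn_majorant K B
  obtain ⟨C, hC⟩ := exists_eLpNorm_maxFn_le hp
  refine ⟨R * C, fun ψ hψ f hf => ⟨_, (hR ψ hψ f hf).1, (hR ψ hψ f hf).2, ?_⟩⟩
  have := eLpNorm_le_nnreal_smul_eLpNorm_of_ae_le_mul' (μ := (volume : Measure ℝ)) (c := R)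
    (f := fun x => R * maxFn (fun x => ‖f x‖ₑ) x) (g := maxFn fun x => ‖f x‖ₑ)
    (Eventually.of_forall fun x => le_rfl) p
  refine this.trans ?_
  rw [ENNReal.smul_def, smul_eq_mul, ENNReal.coe_mul, mul_assoc]
  exact mul_le_mul' le_rfl (hC f hf)

/-- Here the maximal function has only weak type. The bound `N` is free, nonzero and finite so that
the later passage to a weak norm is possible; functions of norm zero are reached there by a limit.
-/
lemma exists_weakMajorized_one (K : ℝ) (B : ℝ≥0) : ∃ C : ℝ≥0,
    ∀ ψ : DyadicInterval → ℝ → ℂ, GoodFamily K ψ → ∀ f : ℝ → ℂ, AEStronglyMeasurable f volume →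
      ∀ N, C * eLpNorm f 1 volume ≤ N → N ≠ 0 → N ≠ ∞ →
      WeakMajorized (coef f ψ) (SquareBounded B ψ) 1 N := by
  obtain ⟨R, hR0, hR⟩ := exists_maxFn_majorant K B
  refine ⟨R * 3, fun ψ hψ f hf N hN hN0 hNt => ⟨_, (hR ψ hψ f hf).1, (hR ψ hψ f hf).2, ?_⟩⟩
  intro τ hτ
  have hτ0 : (τ : ℝ≥0∞) ≠ 0 := by exact_mod_cast hτ.ne'
  have hRt : (R : ℝ≥0∞) ≠ 0 := by exact_mod_cast hR0.ne'
  have h1 := mul_volume_maxFn_le (fun x => ‖f x‖ₑ) ((R : ℝ≥0∞)⁻¹ * (N * τ))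
  have hset : {x | N * (τ : ℝ≥0∞) ^ (1 / (1 : ℝ≥0∞).toReal) < R * maxFn (fun x => ‖f x‖ₑ) x} ⊆
      {x | (R : ℝ≥0∞)⁻¹ * (N * τ) < maxFn (fun x => ‖f x‖ₑ) x} := by
    intro x hx
    have hx : N * (τ : ℝ≥0∞) ^ (1 / (1 : ℝ≥0∞).toReal) < R * maxFn (fun x => ‖f x‖ₑ) x := hx
    show (R : ℝ≥0∞)⁻¹ * (N * τ) < maxFn (fun x => ‖f x‖ₑ) x
    simp only [ENNReal.toReal_one, div_one, ENNReal.rpow_one] at hx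
    rwa [← ENNReal.div_eq_inv_mul, ENNReal.div_lt_iff (Or.inl hRt) (Or.inl ENNReal.coe_ne_top),
      mul_comm _ (R : ℝ≥0∞)]
  refine (measure_mono hset).trans ?_
  rw [ENNReal.le_inv_iff_mul_le]
  refine (ENNReal.mul_le_mul_iff_right hN0 hNt).1 ?_
  rw [eLpNorm_one_eq_lintegral_enorm] at hN
  generalize volume {x | (R : ℝ≥0∞)⁻¹ * (N * τ) < maxFn (fun x => ‖f x‖ₑ) x} = V at h1 ⊢
  calc N * (V * τ) = (R * (R : ℝ≥0∞)⁻¹) * (N * (V * τ)) := by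
        rw [ENNReal.mul_inv_cancel hRt ENNReal.coe_ne_top, one_mul]
    _ = R * ((R : ℝ≥0∞)⁻¹ * (N * τ) * V) := by ring
    _ ≤ R * (3 * ∫⁻ x, ‖f x‖ₑ) := mul_le_mul' le_rfl h1
    _ = ((R * 3 : ℝ≥0) : ℝ≥0∞) * ∫⁻ x, ‖f x‖ₑ := by push_cast; ring
    _ ≤ N * 1 := by rwa [mul_one]

end Lebesgue

/-! ### Constant majorants from a Carleson condition. -/

section DyadicBMO

/-- The hypothesis says that the local square function has squared integral at most `b ^ 2 |J|` over
`J`. By Chebyshev it exceeds `2 b` on at most a quarter of `J`. The single term `I = J` bounds `t J`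
itself. -/
lemma majorized_of_tsum_le {t : DyadicInterval → ℝ≥0∞} {b : ℝ≥0∞} (sq : Prop)
    (h : ∀ J : DyadicInterval, ∑' I : {I : DyadicInterval // I.toSet ⊆ J.toSet},
      ENNReal.ofReal I.1.length * t I.1 ^ 2 ≤ ENNReal.ofReal J.length * b ^ 2) :
    Majorized t sq ∞ (2 * b) := by
  refine ⟨fun _ => 2 * b, ⟨measurable_const, fun I x _ => ?_⟩, fun _ J => ?_, ?_⟩
  · have h1 := (ENNReal.le_tsum (⟨I, subset_rfl⟩ : {I' : DyadicInterval // I'.toSet ⊆ I.toSet})).trans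
      (h I)
    have h2 := (ENNReal.mul_le_mul_iff_right (ofReal_length_ne_zero I) ENNReal.ofReal_ne_top).1 h1
    have h3 : t I ≤ b := (ENNReal.pow_le_pow_left_iff two_ne_zero).1 h2
    exact h3.trans (le_mul_of_one_le_left' (by norm_num))
  · have h1 : ∫⁻ x in J.toSet, locSq t J x ≤ ENNReal.ofReal J.length * b ^ 2 := by
      refine le_trans ?_ (le_of_eq_of_le (tsum_subtype {I : DyadicInterval | I.toSet ⊆ J.toSet}
          (fun I => ENNReal.ofReal I.length * t I ^ 2)).symm (h J))
      unfold locSq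
      rw [lintegral_tsum fun I => (measurable_const.indicator I.measurableSet_toSet).aemeasurable]
      refine ENNReal.tsum_le_tsum fun I => ?_
      rw [lintegral_indicator_const I.measurableSet_toSet,
        Measure.restrict_apply I.measurableSet_toSet]
      by_cases hIJ : I.toSet ⊆ J.toSet
      · rw [if_pos hIJ, Set.indicator_of_mem (by exact hIJ), mul_comm, ← volume_toSet]
        exact mul_le_mul' (measure_mono Set.inter_subset_left) le_rfl
      · simp [hIJ]
    rcases eq_or_ne b 0 with rfl | hb0
    · have h2 : ∫⁻ x in J.toSet, locSq t J x = 0 := by simpa using h1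
      rw [lintegral_eq_zero_iff (measurable_locSq t J), EventuallyEq,
        ae_restrict_iff' J.measurableSet_toSet] at h2
      have h3 : volume (J.toSet ∩ {x | (2 * 0 : ℝ≥0∞) ^ 2 < locSq t J x}) = 0 := by
        refine measure_mono_null ?_ (ae_iff.1 h2)
        rintro x ⟨hx, hx'⟩ hcon
        have hx' : (2 * 0 : ℝ≥0∞) ^ 2 < locSq t J x := hx'
        rw [hcon hx] at hx'
        simp at hx'
      rw [h3]
      simp
    · by_cases hbt : b = ∞
      · subst hbt; simp
      have h2 := (mul_meas_ge_le_lintegral (μ := volume.restrict J.toSet) (measurable_locSq t J)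
        ((2 * b) ^ 2)).trans h1
      have h3 : volume (J.toSet ∩ {x | (2 * b) ^ 2 < locSq t J x}) ≤
          (volume.restrict J.toSet) {x | (2 * b) ^ 2 ≤ locSq t J x} := by
        rw [Measure.restrict_apply (measurableSet_le measurable_const (measurable_locSq t J))]
        exact measure_mono fun x hx => ⟨le_of_lt (show (2 * b) ^ 2 < _ from hx.2), hx.1⟩
      have hb2 : b ^ 2 ≠ 0 := pow_ne_zero 2 hb0
      have hb3 : b ^ 2 ≠ ∞ := ENNReal.pow_ne_top hbt
      refine (ENNReal.mul_le_mul_iff_right hb2 hb3).1 ?_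
      calc b ^ 2 * (4 * volume (J.toSet ∩ {x | (2 * b) ^ 2 < locSq t J x}))
          = (2 * b) ^ 2 * volume (J.toSet ∩ {x | (2 * b) ^ 2 < locSq t J x}) := by ring
        _ ≤ (2 * b) ^ 2 * (volume.restrict J.toSet) {x | (2 * b) ^ 2 ≤ locSq t J x} :=
            mul_le_mul' le_rfl h3
        _ ≤ _ := h2
        _ = _ := by rw [volume_toSet, mul_comm]
  · rw [eLpNorm_exponent_top]
    exact essSup_le_of_ae_le _ (Eventually.of_forall fun x => le_rfl)

end DyadicBMO

/-! ### Constant majorants for BMO. -/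

section BMO

variable {f : ℝ → ℂ}

lemma coef_sub_const {ψ : DyadicInterval → ℝ → ℂ} (hψ : ∀ I, Integrable (ψ I))
    (h0 : ∀ I, ∫ x, ψ I x = 0) (f : ℝ → ℂ) (c : ℂ) : coef (fun x => f x - c) ψ = coef f ψ := by
  funext I
  have hc : Integrable fun x => c * (starRingEnd ℂ) (ψ I x) :=
    ((RCLike.conjCLE (K := ℂ)).toContinuousLinearMap.integrable_comp (hψ I)).const_mul c
  have hc0 : ∫ x, c * (starRingEnd ℂ) (ψ I x) = 0 := by
    rw [integral_const_mul, integral_conj, h0, map_zero, mul_zero]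
  unfold coef pairing
  simp_rw [sub_mul]
  -- If the product with `f` is not integrable, neither is the product with `f - c`, and both
  -- integrals have the default value 0.
  by_cases hi : Integrable fun x => f x * (starRingEnd ℂ) (ψ I x)
  · rw [integral_sub hi hc, hc0, sub_zero]
  · rw [integral_undef hi, integral_undef]
    intro hcon
    refine hi ((hcon.add hc).congr (Eventually.of_forall fun x => ?_))
    simp

lemma setLIntegral_sub_mean_le (f : ℝ → ℂ) {u v : ℝ} (huv : u < v) :
    ∫⁻ x in Set.Icc u v, ‖f x - ⨍ y in Set.Icc u v, f y‖ₑ ≤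
      ENNReal.ofReal (v - u) * bmoNorm f := by
  have h := le_iSup_of_le (f := fun u => ⨆ (v : ℝ) (_ : u < v), (ENNReal.ofReal (v - u))⁻¹ *
    ∫⁻ x in Set.Icc u v, ‖f x - ⨍ y in Set.Icc u v, f y‖ₑ) u
    (le_iSup₂_of_le v huv le_rfl)
  rw [ENNReal.inv_mul_le_iff (by simp [huv]) ENNReal.ofReal_ne_top] at h
  exact h

lemma enorm_mean_sub_le (hf : LocallyIntegrable f) {u v : ℝ} (huv : u < v) (c : ℂ) :
    ‖(⨍ y in Set.Icc u v, f y) - c‖ₑ ≤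
      (ENNReal.ofReal (v - u))⁻¹ * ∫⁻ x in Set.Icc u v, ‖f x - c‖ₑ := by
  have hfi : IntegrableOn f (Set.Icc u v) := hf.integrableOn_isCompact isCompact_Icc
  have hvol : volume.real (Set.Icc u v) = v - u := by
    rw [measureReal_def, Real.volume_Icc, ENNReal.toReal_ofReal (by linarith)]
  have hpos : 0 < v - u := by linarith
  have h1 : (⨍ y in Set.Icc u v, f y) - c = ((v - u : ℝ) : ℂ)⁻¹ * ∫ x in Set.Icc u v, (f x - c) := by
    rw [integral_sub hfi (integrableOn_const (by simp)), setIntegral_const, setAverage_eq, hvol,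
      mul_sub, Complex.real_smul, Complex.real_smul, Complex.ofReal_inv, ← mul_assoc,
      inv_mul_cancel₀ (by exact_mod_cast hpos.ne'), one_mul]
  rw [h1, enorm_mul]
  have h2 : ‖((v - u : ℝ) : ℂ)⁻¹‖ₑ = (ENNReal.ofReal (v - u))⁻¹ := by
    rw [← ofReal_norm, norm_inv, Complex.norm_real, Real.norm_of_nonneg hpos.le,
      ENNReal.ofReal_inv_of_pos hpos]
  rw [h2]
  exact mul_le_mul' le_rfl (enorm_integral_le_lintegral_enorm _)

/-- The analogue of `dec_sq_le_tsum` for centered intervals, whose successive means can be compared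
through the BMO seminorm. -/
lemma dec_sq_le_tsum_Icc (I : DyadicInterval) (y : ℝ) :
    ENNReal.ofReal (I.dec y ^ 2) ≤ ∑' k : ℕ,
      (Set.Icc (I.center - 2 ^ k * I.length) (I.center + 2 ^ k * I.length)).indicator
        (fun _ => 4 * (4⁻¹ : ℝ≥0∞) ^ k) y := by
  classical
  have hl := I.length_pos
  have hfar : ∀ k : ℕ, y ∉ Set.Icc (I.center - 2 ^ k * I.length) (I.center + 2 ^ k * I.length) →
      I.length * 2 ^ k ≤ |y - I.center| := by
    intro k hk
    by_contra hcon
    push Not at hcon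
    rw [abs_lt] at hcon
    exact hk ⟨by linarith, by linarith⟩
  have hex : ∃ k : ℕ, y ∈ Set.Icc (I.center - 2 ^ k * I.length) (I.center + 2 ^ k * I.length) := by
    by_contra hcon
    push Not at hcon
    obtain ⟨k, hk⟩ := pow_unbounded_of_one_lt (|y - I.center| / I.length) one_lt_two
    have := hfar k (hcon k)
    rw [div_lt_iff₀ hl] at hk
    linarith
  set k := Nat.find hex
  have hk := Nat.find_spec hex
  refine le_trans ?_ (ENNReal.le_tsum k)
  rw [Set.indicator_of_mem hk]
  have h4 : (4 : ℝ≥0∞) * (4⁻¹ : ℝ≥0∞) ^ k = ENNReal.ofReal (4 * (4⁻¹ : ℝ) ^ k) := by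
    rw [ENNReal.ofReal_mul (by norm_num), ENNReal.ofReal_pow (by norm_num),
      ENNReal.ofReal_inv_of_pos (by norm_num)]
    norm_num
  rw [h4]
  refine ENNReal.ofReal_le_ofReal ?_
  rcases Nat.eq_zero_or_pos k with h0 | h0
  · rw [h0]
    have := pow_le_one₀ (I.dec_pos y).le (I.dec_le_one y) (n := 2)
    linarith
  · obtain ⟨j, hj⟩ : ∃ j, k = j + 1 := ⟨k - 1, by omega⟩
    have := I.dec_le_div (by positivity) (hfar j (Nat.find_min hex (m := j) (by omega)))
    rw [div_mul_cancel_left₀ hl.ne'] at this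
    calc I.dec y ^ 2 ≤ ((2 ^ j)⁻¹) ^ 2 := pow_le_pow_left₀ (I.dec_pos y).le this 2
      _ = 4 * (4⁻¹ : ℝ) ^ k := by
        rw [hj, pow_succ (4⁻¹ : ℝ), ← inv_pow, ← pow_mul, mul_comm j 2, pow_mul]
        norm_num
        ring

/-- The mean of `f` over the interval with center `c(J)` and radius `2 ^ k |J|`. -/
noncomputable def dilatedMean (f : ℝ → ℂ) (J : DyadicInterval) (k : ℕ) : ℂ :=
  ⨍ y in Set.Icc (J.center - 2 ^ k * J.length) (J.center + 2 ^ k * J.length), f y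

/-- Each interval is half of the next one, so consecutive means differ by at most twice the
seminorm; the differences add up along the chain. -/
lemma enorm_dilatedMean_sub_le (hf : LocallyIntegrable f) (J : DyadicInterval) (k : ℕ) :
    ‖dilatedMean f J k - dilatedMean f J 0‖ₑ ≤ 2 * k * bmoNorm f := by
  have hl := J.length_pos
  induction k with
  | zero => simp
  | succ k ih =>
    have hlt : ∀ k : ℕ, J.center - 2 ^ k * J.length < J.center + 2 ^ k * J.length := fun k => by
      have : (0 : ℝ) < 2 ^ k * J.length := by positivity
      linarith
    have h1 := enorm_mean_sub_le hf (hlt k) (dilatedMean f J (k + 1))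
    have h2 := setLIntegral_sub_mean_le f (hlt (k + 1))
    have hstep : ‖dilatedMean f J (k + 1) - dilatedMean f J k‖ₑ ≤ 2 * bmoNorm f := by
      rw [← enorm_neg, neg_sub]
      refine h1.trans ?_
      rw [ENNReal.inv_mul_le_iff (ENNReal.ofReal_pos.2 (sub_pos.2 (hlt k))).ne'
        ENNReal.ofReal_ne_top]
      refine (lintegral_mono_set (Set.Icc_subset_Icc ?_ ?_)).trans (h2.trans (le_of_eq ?_))
      · rw [pow_succ]; nlinarith [show (0 : ℝ) < 2 ^ k * J.length by positivity]
      · rw [pow_succ]; nlinarith [show (0 : ℝ) < 2 ^ k * J.length by positivity]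
      · rw [← mul_assoc, show J.center + 2 ^ (k + 1) * J.length - (J.center - 2 ^ (k + 1) * J.length)
          = (J.center + 2 ^ k * J.length - (J.center - 2 ^ k * J.length)) * 2 by rw [pow_succ]; ring,
          ENNReal.ofReal_mul (by linarith [hlt k])]
        norm_num
    calc ‖dilatedMean f J (k + 1) - dilatedMean f J 0‖ₑ
        = ‖(dilatedMean f J (k + 1) - dilatedMean f J k) +
            (dilatedMean f J k - dilatedMean f J 0)‖ₑ := by rw [sub_add_sub_cancel]
      _ ≤ 2 * bmoNorm f + 2 * k * bmoNorm f := (enorm_add_le _ _).trans (add_le_add hstep ih)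
      _ = _ := by push_cast; ring

/-- Over the `k`-th dilate the integral of `|f - c|` is at most `(2 · 2 ^ k)(1 + 2 k)` times `|J|`
and the seminorm, where `c` is the mean at `k = 0`. The weight `4 · 4 ^ (-k)` makes this summable.
Replacing the growth by `8 · 3 ^ k` keeps the series geometric, with sum `4 · 8 · 4 = 128`. -/
lemma wavg_sub_dilatedMean_le (hf : LocallyIntegrable f) (J : DyadicInterval) :
    wavg (fun x => ‖f x - dilatedMean f J 0‖ₑ) J ≤ 128 * bmoNorm f := by
  have hl := J.length_pos
  have hlt : ∀ k : ℕ, J.center - 2 ^ k * J.length < J.center + 2 ^ k * J.length := fun k => by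
    have : (0 : ℝ) < 2 ^ k * J.length := by positivity
    linarith
  have hm : AEMeasurable (fun x => ‖f x - dilatedMean f J 0‖ₑ) volume :=
    (hf.aestronglyMeasurable.sub aestronglyMeasurable_const).enorm
  set Q : ℕ → Set ℝ := fun k =>
    Set.Icc (J.center - 2 ^ k * J.length) (J.center + 2 ^ k * J.length) with hQ
  have hint : ∀ k : ℕ, ∫⁻ x in Q k, ‖f x - dilatedMean f J 0‖ₑ ≤
      ENNReal.ofReal J.length * (bmoNorm f * (8 * 3 ^ k)) := by
    intro k
    have hlen : ENNReal.ofReal (J.center + 2 ^ k * J.length - (J.center - 2 ^ k * J.length)) =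
        ENNReal.ofReal J.length * (2 * 2 ^ k) := by
      rw [show J.center + 2 ^ k * J.length - (J.center - 2 ^ k * J.length) =
        J.length * (2 * 2 ^ k) by ring, ENNReal.ofReal_mul hl.le, ENNReal.ofReal_mul (by norm_num),
        ENNReal.ofReal_pow (by norm_num)]
      norm_num
    have hnat : (2 * 2 ^ k) * (1 + 2 * k) ≤ 8 * 3 ^ k := by
      have : 2 ^ k * (1 + 2 * k) ≤ 4 * 3 ^ k := by
        have h : 2 ^ k * (4 + 2 * k) ≤ 4 * 3 ^ k := by
          clear hlen
          induction k with
          | zero => norm_num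
          | succ k ih =>
            have h2 : 2 ^ k * 4 ≤ 4 * 3 ^ k := by
              have := Nat.pow_le_pow_left (show 2 ≤ 3 by norm_num) k
              omega
            calc 2 ^ (k + 1) * (4 + 2 * (k + 1)) = 2 * (2 ^ k * (4 + 2 * k)) + 2 ^ k * 4 := by ring
              _ ≤ 2 * (4 * 3 ^ k) + 4 * 3 ^ k := by linarith
              _ = _ := by ring
        refine le_trans ?_ h
        gcongr
        omega
      calc _ = 2 * (2 ^ k * (1 + 2 * k)) := by ring
        _ ≤ 2 * (4 * 3 ^ k) := by omega
        _ = _ := by ring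
    calc ∫⁻ x in Q k, ‖f x - dilatedMean f J 0‖ₑ
        ≤ ∫⁻ x in Q k, (‖f x - dilatedMean f J k‖ₑ + 2 * k * bmoNorm f) := by
          refine lintegral_mono fun x => ?_
          calc ‖f x - dilatedMean f J 0‖ₑ = ‖(f x - dilatedMean f J k) +
                (dilatedMean f J k - dilatedMean f J 0)‖ₑ := by rw [sub_add_sub_cancel]
            _ ≤ _ := (enorm_add_le _ _).trans
                (add_le_add le_rfl (enorm_dilatedMean_sub_le hf J k))
      _ = (∫⁻ x in Q k, ‖f x - dilatedMean f J k‖ₑ) +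
            2 * k * bmoNorm f * (ENNReal.ofReal J.length * (2 * 2 ^ k)) := by
          rw [lintegral_add_right _ measurable_const, setLIntegral_const, Real.volume_Icc, hlen]
      _ ≤ ENNReal.ofReal J.length * (2 * 2 ^ k) * bmoNorm f +
            2 * k * bmoNorm f * (ENNReal.ofReal J.length * (2 * 2 ^ k)) := by
          refine add_le_add ?_ le_rfl
          rw [← hlen]
          exact setLIntegral_sub_mean_le f (hlt k)
      _ = ENNReal.ofReal J.length * (bmoNorm f * (((2 * 2 ^ k) * (1 + 2 * k) : ℕ) : ℝ≥0∞)) := by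
          push_cast; ring
      _ ≤ ENNReal.ofReal J.length * (bmoNorm f * ((8 * 3 ^ k : ℕ) : ℝ≥0∞)) := by
          gcongr
      _ = _ := by push_cast; rfl
  rw [wavg, ENNReal.inv_mul_le_iff (ofReal_length_ne_zero J) ENNReal.ofReal_ne_top]
  calc ∫⁻ x, ‖f x - dilatedMean f J 0‖ₑ * ENNReal.ofReal (J.dec x ^ 2)
      ≤ ∫⁻ x, ∑' k : ℕ, (Q k).indicator
          (fun x => 4 * (4⁻¹ : ℝ≥0∞) ^ k * ‖f x - dilatedMean f J 0‖ₑ) x := by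
        refine lintegral_mono fun x => ?_
        refine (mul_le_mul' le_rfl (dec_sq_le_tsum_Icc J x)).trans (le_of_eq ?_)
        rw [← ENNReal.tsum_mul_left]
        refine tsum_congr fun k => ?_
        by_cases hx : x ∈ Q k
        · rw [Set.indicator_of_mem hx, Set.indicator_of_mem hx, mul_comm]
        · rw [Set.indicator_of_notMem hx, Set.indicator_of_notMem hx, mul_zero]
    _ = ∑' k : ℕ, 4 * (4⁻¹ : ℝ≥0∞) ^ k * ∫⁻ x in Q k, ‖f x - dilatedMean f J 0‖ₑ := by
        rw [lintegral_tsum fun k => (hm.const_mul _).indicator measurableSet_Icc]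
        refine tsum_congr fun k => ?_
        rw [lintegral_indicator measurableSet_Icc, lintegral_const_mul'']
        exact hm.restrict
    _ ≤ ∑' k : ℕ, 4 * (4⁻¹ : ℝ≥0∞) ^ k *
          (ENNReal.ofReal J.length * (bmoNorm f * (8 * 3 ^ k))) :=
        ENNReal.tsum_le_tsum fun k => mul_le_mul' le_rfl (hint k)
    _ = ∑' k : ℕ, (ENNReal.ofReal J.length * (bmoNorm f * 32)) * (4⁻¹ * 3 : ℝ≥0∞) ^ k := by
        refine tsum_congr fun k => ?_
        rw [mul_pow]; ring
    _ = ENNReal.ofReal J.length * (bmoNorm f * 32) * 4 := by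
        rw [ENNReal.tsum_mul_left, ENNReal.tsum_geometric]
        congr 1
        have : (4⁻¹ * 3 : ℝ≥0∞) = ENNReal.ofReal (3 / 4) := by
          rw [ENNReal.ofReal_div_of_pos (by norm_num), mul_comm, ENNReal.div_eq_inv_mul, mul_comm]
          norm_num
        rw [this, ← ENNReal.ofReal_one, ← ENNReal.ofReal_sub _ (by norm_num),
          ← ENNReal.ofReal_inv_of_pos (by norm_num)]
        norm_num
    _ = _ := by ring

/-- Since the functions have integral zero, a mean of `f` adapted to `J` may be subtracted without
changing any coefficient. The weighted mean over `J` that controls the coefficients and the local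
square function is then bounded by the seminorm, uniformly in `J`. -/
lemma exists_majorized_bmo (K : ℝ) (B : ℝ≥0) : ∃ C : ℝ≥0,
    ∀ ψ : DyadicInterval → ℝ → ℂ, GoodFamily K ψ → (∀ I, ∫ x, ψ I x = 0) →
      ∀ f : ℝ → ℂ, LocallyIntegrable f →
      Majorized (coef f ψ) (SquareBounded B ψ) ∞ (C * bmoNorm f) := by
  obtain ⟨R, hR⟩ := exists_volume_locSq_le K B
  refine ⟨(K.toNNReal + R) * 128, fun ψ hψ h0 f hf =>
    ⟨fun _ => ((K.toNNReal + R) * 128 : ℝ≥0) * bmoNorm f, ⟨measurable_const, fun I x _ => ?_⟩,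
      fun hB => ?_, ?_⟩⟩
  · rw [← coef_sub_const hψ.integrable h0 f (dilatedMean f I 0)]
    refine (hψ.coef_le_wavg _ I).trans
      ((mul_le_mul' le_rfl (wavg_sub_dilatedMean_le hf I)).trans ?_)
    rw [← mul_assoc]
    push_cast
    gcongr
    exact le_self_add
  · refine isSquareMajorant_of_le (a := fun J => R * wavg (fun x => ‖f x - dilatedMean f J 0‖ₑ) J)
      (fun J => ?_) fun J x hx => ?_
    · have := hR ψ hψ hB (fun x => f x - dilatedMean f J 0)
        (hf.aestronglyMeasurable.sub aestronglyMeasurable_const) J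
      rwa [coef_sub_const hψ.integrable h0] at this
    · refine (mul_le_mul' le_rfl (wavg_sub_dilatedMean_le hf J)).trans ?_
      rw [← mul_assoc]
      push_cast
      gcongr
      exact le_add_self
  · rw [eLpNorm_exponent_top]
    exact essSup_le_of_ae_le _ (Eventually.of_forall fun x => le_rfl)

end BMO

end Paraproduct

/-! ### Functionals of the coefficients, atoms and the real Hardy space. -/

namespace Paraproduct

open DyadicInterval

/-- The properties shared by the square function and the maximal function of a sequence. -/
structure SlotFunctional (Φ : (DyadicInterval → ℝ≥0∞) → ℝ → ℝ≥0∞) : Prop where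
  measurable : ∀ t, Measurable (Φ t)
  mono : ∀ {t t' : DyadicInterval → ℝ≥0∞}, (∀ I, t I ≤ t' I) → ∀ x, Φ t x ≤ Φ t' x
  tsum_le : ∀ {ι : Type} (t : ι → DyadicInterval → ℝ≥0∞) (x : ℝ),
    Φ (fun I => ∑' k, t k I) x ≤ ∑' k, Φ (t k) x
  le_liminf : ∀ {t : ℕ → DyadicInterval → ℝ≥0∞} {s : DyadicInterval → ℝ≥0∞},
    (∀ I, Tendsto (fun m => t m I) atTop (𝓝 (s I))) →
      ∀ x, Φ s x ≤ liminf (fun m => Φ (t m) x) atTop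
  le_fullSum : ∀ t x, Φ t x ≤ fullSum t x

/-- The functional is bounded on `L²` when it is applied to the coefficients of a family. -/
def L2Bounded (B : ℝ≥0) (Φ : (DyadicInterval → ℝ≥0∞) → ℝ → ℝ≥0∞)
    (ψ : DyadicInterval → ℝ → ℂ) : Prop :=
  ∀ f : ℝ → ℂ, MemLp f 2 volume → ∫⁻ x, Φ (coef f ψ) x ^ 2 ≤ B * ∫⁻ x, ‖f x‖ₑ ^ 2

/-- The square function of a sequence. -/
noncomputable def squareFn (t : DyadicInterval → ℝ≥0∞) (x : ℝ) : ℝ≥0∞ := fullSq t x ^ (1 / 2 : ℝ)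

/-- The maximal function of a sequence. -/
noncomputable def supFn (t : DyadicInterval → ℝ≥0∞) (x : ℝ) : ℝ≥0∞ :=
  ⨆ I : DyadicInterval, I.toSet.indicator (fun _ => t I) x

lemma ENNReal.rpow_half_sq (a : ℝ≥0∞) : (a ^ (1 / 2 : ℝ)) ^ 2 = a := by
  rw [← ENNReal.rpow_natCast, ← ENNReal.rpow_mul]
  norm_num

lemma ENNReal.sq_rpow_half (a : ℝ≥0∞) : (a ^ 2) ^ (1 / 2 : ℝ) = a := by
  rw [← ENNReal.rpow_natCast, ← ENNReal.rpow_mul]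
  norm_num

lemma squareFn_sq (t : DyadicInterval → ℝ≥0∞) (x : ℝ) : squareFn t x ^ 2 = fullSq t x :=
  ENNReal.rpow_half_sq _

lemma squareFn_le_iff {t : DyadicInterval → ℝ≥0∞} {x : ℝ} {a : ℝ≥0∞} :
    squareFn t x ≤ a ↔ fullSq t x ≤ a ^ 2 := by
  rw [← squareFn_sq, ENNReal.pow_le_pow_left_iff two_ne_zero]

lemma tsum_mul_le_of_sq {ι : Type*} {u v : ι → ℝ≥0∞} {A B : ℝ≥0∞}
    (hu : ∑' i, u i ^ 2 ≤ A ^ 2) (hv : ∑' i, v i ^ 2 ≤ B ^ 2) : ∑' i, u i * v i ≤ A * B := by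
  rw [ENNReal.tsum_eq_iSup_sum]
  refine iSup_le fun S => ?_
  have h := ENNReal.inner_le_Lp_mul_Lq S u v Real.HolderConjugate.two_two
  refine h.trans (mul_le_mul' ?_ ?_)
  · rw [← ENNReal.sq_rpow_half A]
    refine ENNReal.rpow_le_rpow ?_ (by norm_num)
    simp only [ENNReal.rpow_two]
    exact (ENNReal.sum_le_tsum S).trans hu
  · rw [← ENNReal.sq_rpow_half B]
    refine ENNReal.rpow_le_rpow ?_ (by norm_num)
    simp only [ENNReal.rpow_two]
    exact (ENNReal.sum_le_tsum S).trans hv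

lemma indicator_tsum {ι : Type*} (s : Set ℝ) (a : ι → ℝ≥0∞) (x : ℝ) :
    s.indicator (fun _ => ∑' k, a k) x = ∑' k, s.indicator (fun _ => a k) x := by
  by_cases hx : x ∈ s <;> simp [hx]

lemma tendsto_indicator {s : Set ℝ} {a : ℕ → ℝ≥0∞} {b : ℝ≥0∞} (h : Tendsto a atTop (𝓝 b)) (x : ℝ) :
    Tendsto (fun m => s.indicator (fun _ => a m) x) atTop (𝓝 (s.indicator (fun _ => b) x)) := by
  by_cases hx : x ∈ s
  · simpa [hx] using h
  · simp [hx]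

/-- Countable subadditivity is Minkowski's inequality in ℓ²: the square of the sum is expanded and
Cauchy–Schwarz is applied to each pair. Lower semicontinuity holds because finite partial sums
depend continuously on the sequence. -/
lemma slotFunctional_squareFn : SlotFunctional squareFn where
  measurable t := (measurable_fullSq t).pow_const _
  mono h x := by
    refine ENNReal.rpow_le_rpow (ENNReal.tsum_le_tsum fun I => ?_) (by norm_num)
    exact Set.indicator_le_indicator (pow_le_pow_left' (h I) 2)
  tsum_le t x := by
    rw [squareFn_le_iff]
    unfold fullSq
    simp only [indicator_sq, indicator_tsum]
    calc ∑' I : DyadicInterval, (∑' k, I.toSet.indicator (fun _ => t k I) x) ^ 2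
        = ∑' k, ∑' l, ∑' I : DyadicInterval, I.toSet.indicator (fun _ => t k I) x *
            I.toSet.indicator (fun _ => t l I) x := by
          refine Eq.trans (tsum_congr fun I => ?_) (ENNReal.tsum_comm.trans
            (tsum_congr fun k => ENNReal.tsum_comm))
          rw [sq, ← ENNReal.tsum_mul_right]
          exact tsum_congr fun k => ENNReal.tsum_mul_left.symm
      _ ≤ ∑' k, ∑' l, squareFn (t k) x * squareFn (t l) x := by
          refine ENNReal.tsum_le_tsum fun k => ENNReal.tsum_le_tsum fun l => ?_
          refine tsum_mul_le_of_sq ?_ ?_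
          · rw [squareFn_sq]; simp only [fullSq, indicator_sq]; exact le_rfl
          · rw [squareFn_sq]; simp only [fullSq, indicator_sq]; exact le_rfl
      _ = (∑' k, squareFn (t k) x) ^ 2 := by
          simp_rw [ENNReal.tsum_mul_left, ENNReal.tsum_mul_right, sq]
  le_liminf {t s} h x := by
    rw [squareFn_le_iff, fullSq, ENNReal.tsum_eq_iSup_sum]
    refine iSup_le fun S => ?_
    rw [← ENNReal.rpow_half_sq (∑ I ∈ S, _)]
    refine pow_le_pow_left' ?_ 2
    have h1 : Tendsto (fun m => (∑ I ∈ S, I.toSet.indicator (fun _ => t m I ^ 2) x) ^ (1 / 2 : ℝ))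
        atTop (𝓝 ((∑ I ∈ S, I.toSet.indicator (fun _ => s I ^ 2) x) ^ (1 / 2 : ℝ))) :=
      ((ENNReal.continuous_rpow_const).tendsto _).comp (tendsto_finsetSum S fun I _ =>
        tendsto_indicator (((ENNReal.continuous_pow 2).tendsto _).comp (h I)) x)
    rw [← h1.liminf_eq]
    refine liminf_le_liminf (Eventually.of_forall fun m => ?_)
    exact ENNReal.rpow_le_rpow (ENNReal.sum_le_tsum S) (by norm_num)
  le_fullSum t x := by
    rw [squareFn_le_iff]
    exact fullSq_le_fullSum_sq t x

lemma slotFunctional_supFn : SlotFunctional supFn where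
  measurable t := Measurable.iSup fun I => measurable_const.indicator I.measurableSet_toSet
  mono h x := iSup_mono fun I => Set.indicator_le_indicator (h I)
  tsum_le t x := by
    refine iSup_le fun I => ?_
    rw [indicator_tsum]
    exact ENNReal.tsum_le_tsum fun k =>
      le_iSup (fun I : DyadicInterval => I.toSet.indicator (fun _ => t k I) x) I
  le_liminf {t s} h x := by
    refine iSup_le fun I => ?_
    rw [← (tendsto_indicator (h I) x).liminf_eq]
    exact liminf_le_liminf (Eventually.of_forall fun m =>
      le_iSup (fun I : DyadicInterval => I.toSet.indicator (fun _ => t m I) x) I)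
  le_fullSum t x := iSup_le fun I =>
    ENNReal.le_tsum (f := fun I : DyadicInterval => I.toSet.indicator (fun _ => t I) x) I

lemma isMajorant_supFn (t : DyadicInterval → ℝ≥0∞) : IsMajorant t (supFn t) where
  measurable := slotFunctional_supFn.measurable t
  le I x hx := by
    refine le_trans ?_ (le_iSup _ I)
    rw [Set.indicator_of_mem hx]

lemma isMajorant_squareFn (t : DyadicInterval → ℝ≥0∞) : IsMajorant t (squareFn t) where
  measurable := slotFunctional_squareFn.measurable t
  le I x hx := by
    rw [← ENNReal.pow_le_pow_left_iff two_ne_zero, squareFn_sq]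
    refine le_trans ?_ (ENNReal.le_tsum I)
    rw [Set.indicator_of_mem hx]

lemma isSquareMajorant_squareFn (t : DyadicInterval → ℝ≥0∞) : IsSquareMajorant t (squareFn t) := by
  intro I
  have : {x | squareFn t x ^ 2 < locSq t I x} = ∅ := by
    refine Set.eq_empty_iff_forall_notMem.2 fun x hx => ?_
    have hx : squareFn t x ^ 2 < locSq t I x := hx
    rw [squareFn_sq] at hx
    refine absurd hx (not_lt.2 (ENNReal.tsum_le_tsum fun J => Set.indicator_le_indicator ?_))
    split_ifs <;> simp
  rw [this]
  simp

/-- If the family is square bounded, the square function of `t` serves as majorant and square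
majorant. Otherwise only a majorant is required, and the supremum of `t` over the intervals at a
point is one, bounded on L² by the maximal theorem. Estimates on atoms can therefore be made once,
for an arbitrary `SlotFunctional` bounded on L². -/
lemma exists_majorized_of_functional (K : ℝ) (B : ℝ≥0) : ∃ B' : ℝ≥0,
    ∀ ψ : DyadicInterval → ℝ → ℂ, GoodFamily K ψ → ∀ (t : DyadicInterval → ℝ≥0∞) (N : ℝ≥0∞),
      (∀ Φ, SlotFunctional Φ → L2Bounded B' Φ ψ → ∫⁻ x, Φ t x ≤ N) →
      Majorized t (SquareBounded B ψ) 1 N := by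
  obtain ⟨R, -, hR⟩ := exists_maxFn_majorant K 0
  obtain ⟨C, hC⟩ := exists_eLpNorm_maxFn_le (p := 2) (by norm_num)
  have heL : ∀ g : ℝ → ℝ≥0∞, eLpNorm g 2 volume ^ 2 = ∫⁻ x, g x ^ 2 := by
    intro g
    rw [eLpNorm_eq_lintegral_rpow_enorm_toReal (by simp) (by simp)]
    simp only [ENNReal.toReal_ofNat, enorm_eq_self, ENNReal.rpow_two]
    exact ENNReal.rpow_half_sq _
  have heL' : ∀ f : ℝ → ℂ, eLpNorm f 2 volume ^ 2 = ∫⁻ x, ‖f x‖ₑ ^ 2 := by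
    intro g
    rw [eLpNorm_eq_lintegral_rpow_enorm_toReal (by simp) (by simp)]
    simp only [ENNReal.toReal_ofNat, ENNReal.rpow_two]
    exact ENNReal.rpow_half_sq _
  refine ⟨max B ((R * C) ^ 2), fun ψ hψ t N h => ?_⟩
  by_cases hB : SquareBounded B ψ
  · refine ⟨squareFn t, isMajorant_squareFn t, fun _ => isSquareMajorant_squareFn t, ?_⟩
    rw [eLpNorm_one_eq_lintegral_enorm]
    refine h _ slotFunctional_squareFn fun f hf => ?_
    simp_rw [squareFn_sq]
    rw [lintegral_fullSq]
    refine (hB f hf).trans ?_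
    gcongr
    exact le_max_left _ _
  · refine ⟨supFn t, isMajorant_supFn t, fun hB' => absurd hB' hB, ?_⟩
    rw [eLpNorm_one_eq_lintegral_enorm]
    refine h _ slotFunctional_supFn fun f hf => ?_
    have hle : ∀ x, supFn (coef f ψ) x ≤ R * maxFn (fun x => ‖f x‖ₑ) x := by
      intro x
      refine iSup_le fun I => Set.indicator_apply_le' (fun hx => ?_) fun _ => zero_le
      exact (hR ψ hψ f hf.1).1.le I x hx
    calc ∫⁻ x, supFn (coef f ψ) x ^ 2 ≤ ∫⁻ x, (R : ℝ≥0∞) ^ 2 * maxFn (fun x => ‖f x‖ₑ) x ^ 2 := by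
          refine lintegral_mono fun x => ?_
          rw [← mul_pow]
          exact pow_le_pow_left' (hle x) 2
      _ = (R : ℝ≥0∞) ^ 2 * eLpNorm (maxFn fun x => ‖f x‖ₑ) 2 volume ^ 2 := by
          rw [lintegral_const_mul' _ _ (ENNReal.pow_ne_top ENNReal.coe_ne_top), heL]
      _ ≤ (R : ℝ≥0∞) ^ 2 * (C * eLpNorm f 2 volume) ^ 2 :=
          mul_le_mul' le_rfl (pow_le_pow_left' (hC f hf.1) 2)
      _ = (((R * C) ^ 2 : ℝ≥0) : ℝ≥0∞) * ∫⁻ x, ‖f x‖ₑ ^ 2 := by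
          rw [mul_pow, heL']; push_cast; ring
      _ ≤ _ := by
          gcongr
          exact le_max_right _ _

lemma setLIntegral_sq_le {g : ℝ → ℝ≥0∞} (hg : AEMeasurable g) (E : Set ℝ) :
    (∫⁻ x in E, g x) ^ 2 ≤ volume E * ∫⁻ x in E, g x ^ 2 := by
  have h := ENNReal.lintegral_mul_le_Lp_mul_Lq (volume.restrict E) Real.HolderConjugate.two_two
    hg.restrict (aemeasurable_const (b := (1 : ℝ≥0∞)))
  simp only [Pi.mul_apply, mul_one, ENNReal.rpow_two, one_pow, lintegral_const, one_mul,
    Measure.restrict_apply MeasurableSet.univ, Set.univ_inter] at h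
  refine (pow_le_pow_left' h 2).trans (le_of_eq ?_)
  rw [mul_pow, ENNReal.rpow_half_sq, ENNReal.rpow_half_sq, mul_comm]

/-- The functionals are integrable on square integrable functions of integral zero which are
supported in an interval. -/
lemma exists_lintegral_functional_le (K : ℝ) (B : ℝ≥0) : ∃ C : ℝ≥0,
    ∀ ψ : DyadicInterval → ℝ → ℂ, GoodFamily K ψ → ∀ Φ, SlotFunctional Φ → L2Bounded B Φ ψ →
    ∀ (u r : ℝ) (Q : Set ℝ), 0 < r → Q ⊆ Set.Icc u (u + r) → RegularOn K ψ Q r →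
    ∀ b : ℝ → ℂ, MemLp b 2 volume → (∀ x, x ∉ Q → b x = 0) → ∫ x, b x = 0 →
    ∀ A : ℝ≥0∞, A ≠ ∞ → ENNReal.ofReal r * ∫⁻ x, ‖b x‖ₑ ^ 2 ≤ A ^ 2 →
    ∫⁻ x, Φ (coef b ψ) x ≤ C * A := by
  obtain ⟨C, hC⟩ := exists_offDiagonal K
  refine ⟨(1 + 3 * B) + C, fun ψ hψ Φ hΦ hB u r Q hr hQ hreg b hb hb0 hbint A hA hbA => ?_⟩
  set E := Set.Icc (u - r) (u + 2 * r) with hE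
  have hEvol : volume E = 3 * ENNReal.ofReal r := by
    rw [hE, Real.volume_Icc, show u + 2 * r - (u - r) = 3 * r by ring,
      ENNReal.ofReal_mul (by norm_num)]
    norm_num
  have hb1 : ∫⁻ x, ‖b x‖ₑ ≤ A := by
    rw [← ENNReal.pow_le_pow_left_iff two_ne_zero]
    have h1 : ∫⁻ x, ‖b x‖ₑ = ∫⁻ x in Set.Icc u (u + r), ‖b x‖ₑ := by
      refine (setLIntegral_eq_of_support_subset fun x hx => ?_).symm
      by_contra hcon
      exact hx (by simp [hb0 x fun hxQ => hcon (hQ hxQ)])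
    rw [h1]
    refine (setLIntegral_sq_le hb.1.enorm _).trans (le_trans ?_ hbA)
    rw [Real.volume_Icc, add_sub_cancel_left]
    exact mul_le_mul' le_rfl (setLIntegral_le_lintegral _ _)
  have hbi : Integrable b := ⟨hb.1, hb1.trans_lt hA.lt_top⟩
  rw [← lintegral_add_compl _ (measurableSet_Icc (a := u - r) (b := u + 2 * r)), ← hE]
  push_cast
  rw [add_mul]
  -- On the tripled interval, Cauchy–Schwarz and the L² bound suffice. Outside it the functional is
  -- below the ℓ¹ sum, to which the off-diagonal estimate applies.
  refine add_le_add ?_ ?_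
  · rw [← ENNReal.pow_le_pow_left_iff two_ne_zero]
    refine (setLIntegral_sq_le (hΦ.measurable _).aemeasurable _).trans ?_
    calc volume E * ∫⁻ x in E, Φ (coef b ψ) x ^ 2
        ≤ 3 * ENNReal.ofReal r * (B * ∫⁻ x, ‖b x‖ₑ ^ 2) := by
          rw [hEvol]
          exact mul_le_mul' le_rfl ((setLIntegral_le_lintegral _ _).trans (hB b hb))
      _ = 3 * B * (ENNReal.ofReal r * ∫⁻ x, ‖b x‖ₑ ^ 2) := by ring
      _ ≤ 3 * B * A ^ 2 := mul_le_mul' le_rfl hbA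
      _ ≤ (1 + 3 * B) ^ 2 * A ^ 2 := by
          refine mul_le_mul' ?_ le_rfl
          calc (3 * B : ℝ≥0∞) ≤ 1 + 3 * B := le_add_self
            _ ≤ _ := le_self_pow le_self_add two_ne_zero
      _ = _ := by ring
  · refine (lintegral_mono fun x => hΦ.le_fullSum _ x).trans ?_
    rw [setLIntegral_fullSum]
    exact (hC ψ hψ u r Q hr hQ hreg b hbi hb0 hbint).trans (mul_le_mul' le_rfl hb1)

section Hardy

variable {K : ℝ} {ψ : DyadicInterval → ℝ → ℂ}

lemma GoodFamily.enorm_pairing_le_lintegral (hψ : GoodFamily K ψ) (g : ℝ → ℂ) (I : DyadicInterval) :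
    ‖pairing g (ψ I)‖ₑ ≤ ENNReal.ofReal (K / I.length) * ∫⁻ x, ‖g x‖ₑ := by
  refine (enorm_pairing_le _ _).trans ?_
  rw [← lintegral_const_mul' _ _ ENNReal.ofReal_ne_top]
  refine lintegral_mono fun x => ?_
  rw [mul_comm]
  exact mul_le_mul' (enorm_le_ofReal (hψ.bounded I x)) le_rfl

lemma IsAtom.integrable {a : ℝ → ℂ} (ha : IsAtom a) : Integrable a := by
  obtain ⟨hm, u, v, huv, h0, hb, -⟩ := ha
  refine Measure.integrableOn_of_bounded (s := Set.Icc u v) (M := 1 / (v - u)) (by simp)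
    hm.aestronglyMeasurable (Eventually.of_forall hb) |>.integrable_of_forall_notMem_eq_zero h0

/-- Each `ψ I` is bounded, so its coefficient is continuous in L¹ and the triangle inequality passes
to the limit of the partial sums. -/
lemma GoodFamily.coef_le_tsum_of_tendsto (hψ : GoodFamily K ψ) {f : ℝ → ℂ} (hf : Integrable f)
    {b : ℕ → ℝ → ℂ} (hb : ∀ k, Integrable (b k))
    (h : Tendsto (fun m : ℕ => eLpNorm (fun x => f x - ∑ k ∈ Finset.range m, b k x) 1 volume)
      atTop (𝓝 0)) (I : DyadicInterval) : coef f ψ I ≤ ∑' k, coef (b k) ψ I := by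
  have h1 : ∀ m : ℕ, coef f ψ I ≤ ENNReal.ofReal (K / I.length) *
      eLpNorm (fun x => f x - ∑ k ∈ Finset.range m, b k x) 1 volume + ∑' k, coef (b k) ψ I := by
    intro m
    have hs : Integrable fun x => ∑ k ∈ Finset.range m, b k x :=
      integrable_finsetSum _ fun k _ => hb k
    refine (coef_le_add (g := fun x => f x - ∑ k ∈ Finset.range m, b k x)
      (b := fun x => ∑ k ∈ Finset.range m, b k x) (fun x => by simp) I
      (hψ.integrable_mul_conj (hf.sub hs) I) (hψ.integrable_mul_conj hs I)).trans ?_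
    refine add_le_add ?_ ?_
    · rw [eLpNorm_one_eq_lintegral_enorm]
      exact hψ.enorm_pairing_le_lintegral _ I
    · refine le_trans ?_ (ENNReal.sum_le_tsum (Finset.range m))
      have : pairing (fun x => ∑ k ∈ Finset.range m, b k x) (ψ I) =
          ∑ k ∈ Finset.range m, pairing (b k) (ψ I) := by
        unfold pairing
        rw [← integral_finsetSum _ fun k _ => hψ.integrable_mul_conj (hb k) I]
        simp_rw [Finset.sum_mul]
      rw [coef, this]
      exact enorm_sum_le _ _
  have h2 : Tendsto (fun m : ℕ => ENNReal.ofReal (K / I.length) *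
      eLpNorm (fun x => f x - ∑ k ∈ Finset.range m, b k x) 1 volume + ∑' k, coef (b k) ψ I) atTop
      (𝓝 (ENNReal.ofReal (K / I.length) * 0 + ∑' k, coef (b k) ψ I)) :=
    (ENNReal.Tendsto.const_mul h (Or.inr ENNReal.ofReal_ne_top)).add tendsto_const_nhds
  rw [mul_zero, zero_add] at h2
  exact ge_of_tendsto' h2 h1

/-- An atom on an interval of length `r` has squared L² norm at most `1 / r`, so the functional of
its coefficients has bounded integral, and countable subadditivity sums the atoms. The atoms live on
arbitrary intervals, so regularity is required on all of these and not only on dyadic ones. -/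
lemma exists_majorized_hardy (K : ℝ) (B : ℝ≥0) : ∃ C : ℝ≥0,
    ∀ ψ : DyadicInterval → ℝ → ℂ, GoodFamily K ψ →
      (∀ u r : ℝ, RegularOn K ψ (Set.Icc u (u + r)) r) → ∀ f : ℝ → ℂ, Integrable f →
      Majorized (coef f ψ) (SquareBounded B ψ) 1 (C * hardyNorm f) := by
  obtain ⟨B', hB'⟩ := exists_majorized_of_functional K B
  obtain ⟨C, hC⟩ := exists_lintegral_functional_le K B'
  refine ⟨C + 1, fun ψ hψ hreg f hf => hB' ψ hψ _ _ fun Φ hΦ hL2 => ?_⟩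
  have hC0 : ((C + 1 : ℝ≥0) : ℝ≥0∞) ≠ 0 := by
    exact ENNReal.coe_ne_zero.2 (by positivity)
  -- The nonzero constant `C + 1` is moved to the left so that the infimum defining the norm stands
  -- alone on the right.
  rw [mul_comm, ← ENNReal.div_le_iff hC0 ENNReal.coe_ne_top]
  refine le_iInf fun c => le_iInf fun a => le_iInf fun ha => le_iInf fun hlim => ?_
  rw [ENNReal.div_le_iff hC0 ENNReal.coe_ne_top]
  have hatom : ∀ k, ∫⁻ x, Φ (coef (fun x => c k * a k x) ψ) x ≤ C * ‖c k‖ₑ := by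
    intro k
    obtain ⟨hm, u, v, huv, h0, hb, hint⟩ := ha k
    have hr : 0 < v - u := by linarith
    have huv' : u + (v - u) = v := by ring
    have h2 : ∫⁻ x, ‖c k * a k x‖ₑ ^ 2 ≤
        ‖c k‖ₑ ^ 2 * (ENNReal.ofReal (v - u))⁻¹ := by
      rw [← setLIntegral_eq_of_support_subset (s := Set.Icc u v)]
      · calc ∫⁻ x in Set.Icc u v, ‖c k * a k x‖ₑ ^ 2
            ≤ ∫⁻ x in Set.Icc u v, ‖c k‖ₑ ^ 2 * (ENNReal.ofReal (v - u))⁻¹ ^ 2 := by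
              refine lintegral_mono fun x => ?_
              rw [← mul_pow, enorm_mul]
              refine pow_le_pow_left' (mul_le_mul' le_rfl ?_) 2
              rw [← ENNReal.ofReal_inv_of_pos hr, ← one_div]
              exact enorm_le_ofReal (hb x)
          _ = _ := by
              rw [setLIntegral_const, Real.volume_Icc, mul_assoc, sq (ENNReal.ofReal (v - u))⁻¹,
                mul_assoc, ENNReal.inv_mul_cancel (by simpa using huv) ENNReal.ofReal_ne_top,
                mul_one]
      · intro x hx
        by_contra hcon
        exact hx (by simp [h0 x hcon])
    refine hC ψ hψ Φ hΦ hL2 u (v - u) (Set.Icc u v) hr (by rw [huv']) ?_ _ ?_ ?_ ?_ _ enorm_ne_top ?_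
    · have := hreg u (v - u)
      rwa [huv'] at this
    · refine ⟨(hm.const_mul (c k)).aestronglyMeasurable, ?_⟩
      rw [eLpNorm_lt_top_iff_lintegral_rpow_enorm_lt_top (by simp) (by simp)]
      simp only [ENNReal.toReal_ofNat, ENNReal.rpow_two]
      exact h2.trans_lt (ENNReal.mul_lt_top (by simp) (by simpa using huv))
    · intro x hx
      rw [h0 x hx, mul_zero]
    · rw [integral_const_mul, hint, mul_zero]
    · refine (mul_le_mul' le_rfl h2).trans (le_of_eq ?_)
      rw [mul_left_comm, ENNReal.mul_inv_cancel (by simpa using huv) ENNReal.ofReal_ne_top, mul_one]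
  calc ∫⁻ x, Φ (coef f ψ) x ≤ ∫⁻ x, ∑' k, Φ (coef (fun x => c k * a k x) ψ) x := by
        refine lintegral_mono fun x => le_trans (hΦ.mono (fun I => ?_) x) (hΦ.tsum_le _ x)
        exact hψ.coef_le_tsum_of_tendsto hf (fun k => (ha k).integrable.const_mul (c k)) hlim I
    _ = ∑' k, ∫⁻ x, Φ (coef (fun x => c k * a k x) ψ) x :=
        lintegral_tsum fun k => (hΦ.measurable _).aemeasurable
    _ ≤ ∑' k, C * ‖c k‖ₑ := ENNReal.tsum_le_tsum hatom
    _ ≤ _ := by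
        rw [ENNReal.tsum_mul_left, mul_comm]
        gcongr
        exact le_self_add

end Hardy

end Paraproduct

/-! ### The Haar functions as a good family. -/

namespace Paraproduct

open DyadicInterval

namespace DyadicInterval

/-- The left half of a dyadic interval. -/
def leftHalf (I : DyadicInterval) : DyadicInterval := ⟨I.scale - 1, 2 * I.index⟩

/-- The right half of a dyadic interval. -/
def rightHalf (I : DyadicInterval) : DyadicInterval := ⟨I.scale - 1, 2 * I.index + 1⟩

variable (I : DyadicInterval)

lemma length_leftHalf : I.leftHalf.length = I.length / 2 := by
  simp only [length, leftHalf]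
  rw [zpow_sub_one₀ two_ne_zero]; ring

lemma length_rightHalf : I.rightHalf.length = I.length / 2 := I.length_leftHalf

lemma left_leftHalf : I.leftHalf.left = I.left := by
  rw [left, length_leftHalf, left, leftHalf]
  push_cast
  ring

lemma left_rightHalf : I.rightHalf.left = I.center := by
  rw [left, length_rightHalf, center, left, rightHalf]
  push_cast
  ring

lemma toSet_leftHalf : I.leftHalf.toSet = Set.Ico I.left I.center := by
  rw [toSet, left_leftHalf, length_leftHalf, center]

lemma toSet_rightHalf : I.rightHalf.toSet = Set.Ico I.center (I.left + I.length) := by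
  rw [toSet, left_rightHalf, length_rightHalf, center]
  congr 1
  ring

lemma leftHalf_union_rightHalf : I.leftHalf.toSet ∪ I.rightHalf.toSet = I.toSet := by
  rw [toSet_leftHalf, toSet_rightHalf, toSet, center]
  exact Set.Ico_union_Ico_eq_Ico (by linarith [I.length_pos]) (by linarith [I.length_pos])

lemma disjoint_halves : Disjoint I.leftHalf.toSet I.rightHalf.toSet := by
  rw [toSet_leftHalf, toSet_rightHalf]
  exact Set.Ico_disjoint_Ico_same

lemma leftHalf_subset : I.leftHalf.toSet ⊆ I.toSet :=
  I.leftHalf_union_rightHalf ▸ Set.subset_union_left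

lemma rightHalf_subset : I.rightHalf.toSet ⊆ I.toSet :=
  I.leftHalf_union_rightHalf ▸ Set.subset_union_right

end DyadicInterval

/-- The multiple `|I|^(-1/2) φ_I` of a family. -/
noncomputable def normalized (φ : DyadicInterval → ℝ → ℂ) (I : DyadicInterval) (x : ℝ) : ℂ :=
  ((I.length ^ (-(1 / 2 : ℝ)) : ℝ) : ℂ) * φ I x

lemma normalized_haar_apply (I : DyadicInterval) (x : ℝ) : normalized haar I x =
    ((I.length)⁻¹ : ℝ) * (I.leftHalf.toSet.indicator 1 x - I.rightHalf.toSet.indicator 1 x) := by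
  have h : I.length ^ (-(1 / 2 : ℝ)) * I.length ^ (-(1 / 2 : ℝ)) = (I.length)⁻¹ := by
    rw [← Real.rpow_add I.length_pos]
    norm_num
    exact Real.rpow_neg_one _
  rw [normalized, haar, ← mul_assoc, ← Complex.ofReal_mul, h, toSet_leftHalf, toSet_rightHalf]

lemma normalized_haar_of_mem_left {I : DyadicInterval} {x : ℝ} (hx : x ∈ I.leftHalf.toSet) :
    normalized haar I x = ((I.length)⁻¹ : ℝ) := by
  rw [normalized_haar_apply, Set.indicator_of_mem hx,
    Set.indicator_of_notMem (Set.disjoint_left.1 I.disjoint_halves hx)]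
  simp

lemma normalized_haar_of_mem_right {I : DyadicInterval} {x : ℝ} (hx : x ∈ I.rightHalf.toSet) :
    normalized haar I x = -((I.length)⁻¹ : ℝ) := by
  rw [normalized_haar_apply, Set.indicator_of_mem hx,
    Set.indicator_of_notMem (Set.disjoint_right.1 I.disjoint_halves hx)]
  simp

lemma normalized_haar_of_notMem {I : DyadicInterval} {x : ℝ} (hx : x ∉ I.toSet) :
    normalized haar I x = 0 := by
  rw [normalized_haar_apply, Set.indicator_of_notMem fun h => hx (I.leftHalf_subset h),
    Set.indicator_of_notMem fun h => hx (I.rightHalf_subset h)]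
  simp

lemma measurable_normalized_haar (I : DyadicInterval) : Measurable (normalized haar I) := by
  have : normalized haar I = fun x => (((I.length)⁻¹ : ℝ) : ℂ) *
      (I.leftHalf.toSet.indicator 1 x - I.rightHalf.toSet.indicator 1 x) :=
    funext (normalized_haar_apply I)
  rw [this]
  exact ((measurable_one.indicator (measurableSet_toSet _)).sub
    (measurable_one.indicator (measurableSet_toSet _))).const_mul _

lemma norm_normalized_haar_of_mem {I : DyadicInterval} {x : ℝ} (hx : x ∈ I.toSet) :
    ‖normalized haar I x‖ = (I.length)⁻¹ := by
  have hl := I.length_pos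
  rw [← I.leftHalf_union_rightHalf] at hx
  rcases hx with hx | hx
  · rw [normalized_haar_of_mem_left hx, Complex.norm_real, Real.norm_of_nonneg (by positivity)]
  · rw [normalized_haar_of_mem_right hx, norm_neg, Complex.norm_real,
      Real.norm_of_nonneg (by positivity)]

/-- A dyadic interval other than `I` and no longer than `I` lies in one half of `I` or is disjoint
from `I`. -/
lemma normalized_haar_congr {I J : DyadicInterval} (h : J.scale ≤ I.scale) (hne : J ≠ I) {x y : ℝ}
    (hx : x ∈ J.toSet) (hy : y ∈ J.toSet) : normalized haar I x = normalized haar I y := by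
  by_cases hxI : x ∈ I.toSet
  · have hlt : J.scale < I.scale := lt_of_le_of_ne h fun heq => hne (eq_of_mem_of_scale_eq hx hxI heq)
    rw [← I.leftHalf_union_rightHalf] at hxI
    rcases hxI with hxI | hxI
    · have hsub : J.toSet ⊆ I.leftHalf.toSet :=
        subset_of_mem_of_scale_le hx hxI (by simp only [leftHalf]; omega)
      rw [normalized_haar_of_mem_left hxI, normalized_haar_of_mem_left (hsub hy)]
    · have hsub : J.toSet ⊆ I.rightHalf.toSet :=
        subset_of_mem_of_scale_le hx hxI (by simp only [rightHalf]; omega)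
      rw [normalized_haar_of_mem_right hxI, normalized_haar_of_mem_right (hsub hy)]
  · have hyI : y ∉ I.toSet := fun hyI => hxI (subset_of_mem_of_scale_le hy hyI h hx)
    rw [normalized_haar_of_notMem hxI, normalized_haar_of_notMem hyI]

lemma two_thirds_le_dec {I : DyadicInterval} {x : ℝ} (hx : x ∈ I.toSet) : 2 / 3 ≤ I.dec x := by
  have h1 := I.abs_sub_center_le_half hx
  rw [dec, ← one_div, le_div_iff₀ (I.dec_denom_pos x)]
  have h2 : |x - I.center| / I.length ≤ 1 / 2 := by
    rw [div_le_iff₀ I.length_pos]; linarith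
  linarith

lemma norm_le_of_supported {ψ : DyadicInterval → ℝ → ℂ} {I : DyadicInterval} {x : ℝ}
    (h : ‖ψ I x‖ ≤ I.toSet.indicator (fun _ => (I.length)⁻¹) x) :
    ‖ψ I x‖ ≤ 5 / I.length * I.dec x ^ 3 := by
  have hl := I.length_pos
  have hd := (I.dec_pos x).le
  refine h.trans (Set.indicator_apply_le' (fun hx => ?_) fun _ => by positivity)
  have h1 := two_thirds_le_dec hx
  have h2 : (2 / 3 : ℝ) ^ 3 ≤ I.dec x ^ 3 := by gcongr
  rw [div_mul_eq_mul_div, inv_eq_one_div]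
  gcongr
  linarith

/-- The jumps are harmless since regularity is tested on dyadic intervals only. An interval `J ≠ I`
with `|J| ≤ |I|` sees no jump, and for `J = I` the variation `2 / |I|` is allowed because `5 * (2 /
3) ^ 2 ≥ 2`. -/
lemma goodFamily_normalized_haar : GoodFamily 5 (normalized haar) where
  nonneg := by norm_num
  measurable := measurable_normalized_haar
  size I x := by
    refine norm_le_of_supported ?_
    by_cases hx : x ∈ I.toSet
    · rw [Set.indicator_of_mem hx, norm_normalized_haar_of_mem hx]
    · rw [Set.indicator_of_notMem hx, normalized_haar_of_notMem hx, norm_zero]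
  regular I J hJI x hx y hy := by
    have hI := I.length_pos
    have hJ := J.length_pos
    by_cases hne : J = I
    · subst hne
      have h1 := two_thirds_le_dec hx
      have h2 : (2 / 3 : ℝ) ^ 2 ≤ J.dec x ^ 2 := by gcongr
      refine (norm_sub_le _ _).trans ?_
      rw [norm_normalized_haar_of_mem hx, norm_normalized_haar_of_mem hy]
      rw [show 5 * J.length / J.length ^ 2 * J.dec x ^ 2 = (J.length)⁻¹ * (5 * J.dec x ^ 2) by
        field_simp]
      have : 0 < (J.length)⁻¹ := by positivity
      nlinarith
    · rw [normalized_haar_congr (length_le_iff.1 hJI) hne hx hy, sub_self, norm_zero]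
      positivity

lemma norm_haar_of_mem {I : DyadicInterval} {x : ℝ} (hx : x ∈ I.toSet) :
    ‖haar I x‖ = I.length ^ (-(1 / 2 : ℝ)) := by
  have hl := I.length_pos
  have hr : 0 < I.length ^ (-(1 / 2 : ℝ)) := Real.rpow_pos_of_pos hl _
  rw [haar, norm_mul, Complex.norm_real, Real.norm_of_nonneg hr.le, ← toSet_leftHalf,
    ← toSet_rightHalf]
  rw [← I.leftHalf_union_rightHalf] at hx
  rcases hx with hx | hx
  · rw [Set.indicator_of_mem hx,
      Set.indicator_of_notMem (Set.disjoint_left.1 I.disjoint_halves hx)]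
    simp
  · rw [Set.indicator_of_mem hx,
      Set.indicator_of_notMem (Set.disjoint_right.1 I.disjoint_halves hx)]
    simp

lemma haar_of_notMem {I : DyadicInterval} {x : ℝ} (hx : x ∉ I.toSet) : haar I x = 0 := by
  rw [haar, ← toSet_leftHalf, ← toSet_rightHalf,
    Set.indicator_of_notMem fun h => hx (I.leftHalf_subset h),
    Set.indicator_of_notMem fun h => hx (I.rightHalf_subset h)]
  simp

lemma normalized_absHaar (I : DyadicInterval) :
    normalized absHaar I = I.toSet.indicator fun _ => (((I.length)⁻¹ : ℝ) : ℂ) := by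
  funext x
  by_cases hx : x ∈ I.toSet
  · have h : I.length ^ (-(1 / 2 : ℝ)) * I.length ^ (-(1 / 2 : ℝ)) = (I.length)⁻¹ := by
      rw [← Real.rpow_add I.length_pos]
      norm_num
      exact Real.rpow_neg_one _
    rw [Set.indicator_of_mem hx, normalized, absHaar, norm_haar_of_mem hx, ← Complex.ofReal_mul, h]
  · rw [Set.indicator_of_notMem hx, normalized, absHaar, haar_of_notMem hx]
    simp

lemma goodFamily_normalized_absHaar : GoodFamily 5 (normalized absHaar) where
  nonneg := by norm_num
  measurable I := by
    rw [normalized_absHaar]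
    exact measurable_const.indicator I.measurableSet_toSet
  size I x := by
    have hl := I.length_pos
    refine norm_le_of_supported ?_
    rw [normalized_absHaar]
    by_cases hx : x ∈ I.toSet
    · rw [Set.indicator_of_mem hx, Set.indicator_of_mem hx, Complex.norm_real,
        Real.norm_of_nonneg (by positivity)]
    · rw [Set.indicator_of_notMem hx, Set.indicator_of_notMem hx, norm_zero]
  regular I J hJI x hx y hy := by
    have hI := I.length_pos
    have hJ := J.length_pos
    have : x ∈ I.toSet ↔ y ∈ I.toSet :=
      ⟨fun h => subset_of_mem_of_scale_le hx h (length_le_iff.1 hJI) hy,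
        fun h => subset_of_mem_of_scale_le hy h (length_le_iff.1 hJI) hx⟩
    have heq : normalized absHaar I x = normalized absHaar I y := by
      rw [normalized_absHaar]
      by_cases h : x ∈ I.toSet
      · rw [Set.indicator_of_mem h, Set.indicator_of_mem (this.1 h)]
      · rw [Set.indicator_of_notMem h, Set.indicator_of_notMem fun h' => h (this.2 h')]
    rw [heq, sub_self, norm_zero]
    positivity

/-- The coefficients of a function with respect to the normalized Haar functions. -/
lemma pairing_normalized_haar {f : ℝ → ℂ} {I : DyadicInterval} (hf : IntegrableOn f I.toSet) :
    pairing f (normalized haar I) = ((I.length)⁻¹ : ℝ) *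
      ((∫ x in I.leftHalf.toSet, f x) - ∫ x in I.rightHalf.toSet, f x) := by
  rw [← integral_indicator (measurableSet_toSet _), ← integral_indicator (measurableSet_toSet _),
    ← integral_sub, ← integral_const_mul, pairing]
  · refine integral_congr_ae (Eventually.of_forall fun x => ?_)
    simp only [normalized_haar_apply, map_mul, Complex.conj_ofReal, map_sub]
    by_cases h1 : x ∈ I.leftHalf.toSet <;> by_cases h2 : x ∈ I.rightHalf.toSet <;>
      simp [h1, h2, mul_comm]
  · exact (integrable_indicator_iff (measurableSet_toSet _)).2 (hf.mono_set I.leftHalf_subset)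
  · exact (integrable_indicator_iff (measurableSet_toSet _)).2 (hf.mono_set I.rightHalf_subset)

lemma integral_normalized_haar (I : DyadicInterval) : ∫ x, normalized haar I x = 0 := by
  have h := pairing_normalized_haar (f := fun _ => 1) (I := I)
    (integrableOn_const (by simp))
  rw [setIntegral_const, setIntegral_const, measureReal_def, measureReal_def, volume_toSet,
    volume_toSet, length_leftHalf, length_rightHalf, sub_self, mul_zero, pairing] at h
  simp only [one_mul] at h
  rw [integral_conj] at h
  exact (map_eq_zero _).1 h

lemma pairing_eq_zero_of_const {f : ℝ → ℂ} {J : DyadicInterval}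
    (h : ∀ x ∈ J.toSet, ∀ y ∈ J.toSet, f x = f y) : pairing f (normalized haar J) = 0 := by
  have : pairing f (normalized haar J) =
      ∫ x, f J.left * (starRingEnd ℂ) (normalized haar J x) := by
    refine integral_congr_ae (Eventually.of_forall fun x => ?_)
    by_cases hx : x ∈ J.toSet
    · simp only [h x hx _ J.left_mem]
    · simp only [normalized_haar_of_notMem hx, map_zero, mul_zero]
  rw [this, integral_const_mul, integral_conj, integral_normalized_haar, map_zero, mul_zero]

/-- By orthogonality only `J = I` contributes. As input for Schur's test this yields Bessel's
inequality with constant 1, and its dual for finite Haar sums. -/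
lemma tsum_pairing_normalized_haar_le (I : DyadicInterval) :
    ∑' J : DyadicInterval, ENNReal.ofReal J.length *
      ENNReal.ofReal ‖pairing (normalized haar J) (normalized haar I)‖ ≤ (1 : ℝ≥0) := by
  have hl := I.length_pos
  rw [tsum_eq_single I]
  · rw [← ENNReal.ofReal_mul hl.le, ENNReal.coe_one, ENNReal.ofReal_le_one]
    have h1 : ‖pairing (normalized haar I) (normalized haar I)‖ ≤ (I.length)⁻¹ := by
      have h2 : ‖pairing (normalized haar I) (normalized haar I)‖ₑ ≤
          ENNReal.ofReal (I.length)⁻¹ := by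
        refine (enorm_pairing_le _ _).trans ?_
        calc ∫⁻ x, ‖normalized haar I x‖ₑ * ‖normalized haar I x‖ₑ
            ≤ ∫⁻ x, I.toSet.indicator (fun _ => ENNReal.ofReal ((I.length)⁻¹ * (I.length)⁻¹)) x := by
              refine lintegral_mono fun x => ?_
              by_cases hx : x ∈ I.toSet
              · simp only [Set.indicator_of_mem hx]
                rw [ENNReal.ofReal_mul (by positivity)]
                exact mul_le_mul' (enorm_le_ofReal (norm_normalized_haar_of_mem hx).le)
                  (enorm_le_ofReal (norm_normalized_haar_of_mem hx).le)
              · simp [normalized_haar_of_notMem hx]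
          _ = _ := by
              rw [lintegral_indicator_const I.measurableSet_toSet, volume_toSet,
                ← ENNReal.ofReal_mul (by positivity)]
              congr 1
              field_simp
      rw [← ofReal_norm, ENNReal.ofReal_le_ofReal_iff (by positivity)] at h2
      exact h2
    calc I.length * ‖pairing (normalized haar I) (normalized haar I)‖
        ≤ I.length * (I.length)⁻¹ := by gcongr
      _ = 1 := mul_inv_cancel₀ hl.ne'
  · intro J hne
    have : ‖pairing (normalized haar J) (normalized haar I)‖ = 0 := by
      rcases le_total I.scale J.scale with h | h
      · rw [pairing_eq_zero_of_const fun x hx y hy => normalized_haar_congr h hne.symm hx hy, norm_zero]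
      · rw [norm_pairing_comm,
          pairing_eq_zero_of_const fun x hx y hy => normalized_haar_congr h hne hx hy, norm_zero]
    rw [this]
    simp

lemma squareBounded_normalized_haar : SquareBounded 1 (normalized haar) :=
  squareBounded_of_tsum_le goodFamily_normalized_haar.memLp_two tsum_pairing_normalized_haar_le

lemma enorm_pairing_haar (f : ℝ → ℂ) (I : DyadicInterval) :
    ‖pairing f (haar I)‖ₑ ^ 2 = ENNReal.ofReal I.length * coef f (normalized haar) I ^ 2 := by
  have hl := I.length_pos
  have h1 : pairing f (normalized haar I) =
      ((I.length ^ (-(1 / 2 : ℝ)) : ℝ) : ℂ) * pairing f (haar I) := by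
    unfold pairing normalized
    rw [← integral_const_mul]
    refine integral_congr_ae (Eventually.of_forall fun x => ?_)
    simp only [map_mul, Complex.conj_ofReal]
    ring
  rw [coef, h1, enorm_mul, mul_pow, ← mul_assoc]
  have h2 : ENNReal.ofReal I.length * ‖((I.length ^ (-(1 / 2 : ℝ)) : ℝ) : ℂ)‖ₑ ^ 2 = 1 := by
    rw [← ofReal_norm, Complex.norm_real, Real.norm_of_nonneg (by positivity),
      ← ENNReal.ofReal_pow (by positivity), ← ENNReal.ofReal_mul hl.le, ← Real.rpow_natCast,
      ← Real.rpow_mul hl.le]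
    norm_num
    rw [Real.rpow_neg_one, mul_inv_cancel₀ hl.ne']
  rw [h2, one_mul]

lemma dyadicSquare_eq (f : ℝ → ℂ) : dyadicSquare f = squareFn (coef f (normalized haar)) := by
  funext x
  unfold dyadicSquare squareFn fullSq
  congr 1
  refine tsum_congr fun I => ?_
  congr 1
  funext _
  rw [enorm_pairing_haar, mul_comm, ENNReal.mul_div_cancel_right (ofReal_length_ne_zero I)
    ENNReal.ofReal_ne_top]

end Paraproduct

/-! ### Atomic decomposition of finite Haar sums. -/

namespace Paraproduct

open DyadicInterval

lemma tsum_zpow_lt_le (g : ℝ≥0∞) :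
    ∑' k : ℤ, (if (2 : ℝ≥0∞) ^ k < g then (2 : ℝ≥0∞) ^ (k + 1) else 0) ≤ 4 * g := by
  rcases eq_or_ne g 0 with rfl | h0
  · simp
  rcases eq_or_ne g ∞ with rfl | htop
  · simp
  obtain ⟨k₀, hk1, hk2⟩ := ENNReal.exists_mem_Ioc_zpow (x := g) (y := 2) h0 htop (by norm_num) (by simp)
  have hinj : Function.Injective fun n : ℕ => k₀ - (n : ℤ) := fun a b h => by
    simp only at h; omega
  have hsupp : Function.support (fun k : ℤ => if (2 : ℝ≥0∞) ^ k < g then (2 : ℝ≥0∞) ^ (k + 1) else 0) ⊆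
      Set.range fun n : ℕ => k₀ - (n : ℤ) := by
    intro k hk
    have hlt : (2 : ℝ≥0∞) ^ k < g := by
      by_contra hcon
      exact hk (if_neg hcon)
    have hle : k ≤ k₀ := by
      by_contra hcon
      refine absurd (hlt.trans_le hk2) (not_lt.2 (ENNReal.zpow_le_of_le (by norm_num) (by omega)))
    exact ⟨(k₀ - k).toNat, by simp only; omega⟩
  rw [← hinj.tsum_eq hsupp]
  calc ∑' n : ℕ, (if (2 : ℝ≥0∞) ^ (k₀ - (n : ℤ)) < g then (2 : ℝ≥0∞) ^ (k₀ - (n : ℤ) + 1) else 0)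
      ≤ ∑' n : ℕ, 2 * 2 ^ k₀ * (2⁻¹ : ℝ≥0∞) ^ n := by
        refine ENNReal.tsum_le_tsum fun n => ?_
        split_ifs
        · rw [show k₀ - (n : ℤ) + 1 = 1 + k₀ + -(n : ℤ) by ring,
            ENNReal.zpow_add (by simp) (by simp), ENNReal.zpow_add (by simp) (by simp), zpow_one,
            ENNReal.zpow_neg, zpow_natCast, ENNReal.inv_pow]
        · exact zero_le
    _ = 4 * 2 ^ k₀ := by
        rw [ENNReal.tsum_mul_left, ENNReal.tsum_geometric, ENNReal.one_sub_inv_two, inv_inv]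
        ring
    _ ≤ 4 * g := by gcongr

/-- The square root of the sum of the squares of a sequence over the intervals containing `J`. -/
noncomputable def upFn (t : DyadicInterval → ℝ≥0∞) (J : DyadicInterval) : ℝ≥0∞ :=
  (∑' J' : DyadicInterval, {J' : DyadicInterval | J.toSet ⊆ J'.toSet}.indicator
    (fun J' => t J' ^ 2) J') ^ (1 / 2 : ℝ)

lemma upFn_sq (t : DyadicInterval → ℝ≥0∞) (J : DyadicInterval) : upFn t J ^ 2 =
    ∑' J' : DyadicInterval, {J' : DyadicInterval | J.toSet ⊆ J'.toSet}.indicator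
      (fun J' => t J' ^ 2) J' :=
  ENNReal.rpow_half_sq _

lemma le_upFn (t : DyadicInterval → ℝ≥0∞) (J : DyadicInterval) : t J ≤ upFn t J := by
  rw [← ENNReal.pow_le_pow_left_iff two_ne_zero, upFn_sq]
  refine le_trans ?_ (ENNReal.le_tsum J)
  rw [Set.indicator_of_mem (Set.mem_ofPred_eq ▸ (subset_rfl : J.toSet ⊆ J.toSet))]

lemma upFn_le_squareFn (t : DyadicInterval → ℝ≥0∞) {J : DyadicInterval} {x : ℝ} (hx : x ∈ J.toSet) :
    upFn t J ≤ squareFn t x := by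
  rw [← ENNReal.pow_le_pow_left_iff two_ne_zero, upFn_sq, squareFn_sq]
  refine ENNReal.tsum_le_tsum fun J' => Set.indicator_apply_le' (fun h => ?_) fun _ => zero_le
  rw [Set.indicator_of_mem (h hx)]

lemma sum_sq_le_upFn (t : DyadicInterval → ℝ≥0∞) {S : Finset DyadicInterval} {x : ℝ}
    (hx : ∀ J ∈ S, x ∈ J.toSet) (hne : S.Nonempty) : ∃ J ∈ S, ∑ J' ∈ S, t J' ^ 2 ≤ upFn t J ^ 2 := by
  obtain ⟨J, hJ, hmin⟩ := S.exists_min_image (fun J => J.scale) hne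
  refine ⟨J, hJ, ?_⟩
  rw [upFn_sq]
  refine le_trans (le_of_eq ?_) (ENNReal.sum_le_tsum S)
  refine Finset.sum_congr rfl fun J' hJ' => ?_
  rw [Set.indicator_of_mem]
  exact subset_of_mem_of_scale_le (hx J hJ) (hx J' hJ') (hmin J' hJ')

/-- The members of `S` that contain `x` form a chain. All of them contain its smallest member, whose
`upFn` thus bounds the whole sum of squares. -/
lemma sum_indicator_le {t : DyadicInterval → ℝ≥0∞} {S : Finset DyadicInterval} {Q : DyadicInterval}
    {A : ℝ≥0∞} (hQ : ∀ J ∈ S, J.toSet ⊆ Q.toSet) (hA : ∀ J ∈ S, upFn t J ≤ A) (x : ℝ) :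
    ∑ J ∈ S, J.toSet.indicator (fun _ => t J ^ 2) x ≤ Q.toSet.indicator (fun _ => A ^ 2) x := by
  classical
  have h1 : ∑ J ∈ S, J.toSet.indicator (fun _ => t J ^ 2) x =
      ∑ J ∈ S.filter (fun J => x ∈ J.toSet), t J ^ 2 := by
    rw [Finset.sum_filter]
    rfl
  rw [h1]
  rcases (S.filter fun J => x ∈ J.toSet).eq_empty_or_nonempty with h | h
  · rw [h]; simp
  · obtain ⟨J, hJ, hle⟩ := sum_sq_le_upFn t (fun J hJ => (Finset.mem_filter.1 hJ).2) h
    have hJ := Finset.mem_filter.1 hJ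
    rw [Set.indicator_of_mem (hQ J hJ.1 hJ.2)]
    exact hle.trans (pow_le_pow_left' (hA J hJ.1) 2)

/-- `upFn t J` is the part of the square function seen on reaching `J` from above. Each `J` in `F`
with nonzero `upFn` gets a level `k`, with `2 ^ k < upFn t J ≤ 2 ^ (k + 1)`, and a top: the largest
member of `F` containing `J` whose `upFn` already exceeds `2 ^ k`. The terms with the same level and
top `Q` form a function of integral zero supported in `Q`, with squared L² norm at most `|Q| 4 ^ (k
+ 1)`. Its contribution is `O(2 ^ (k + 1) |Q|)`, and these quantities add up to at most four times
the integral of the square function. -/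
lemma exists_lintegral_functional_haar_le (K : ℝ) (B : ℝ≥0) : ∃ C : ℝ≥0,
    ∀ ψ : DyadicInterval → ℝ → ℂ, GoodFamily K ψ → ∀ Φ, SlotFunctional Φ → L2Bounded B Φ ψ →
    ∀ (c : DyadicInterval → ℂ) (F : Finset DyadicInterval),
    ∫⁻ x, Φ (fun I => ‖∑ J ∈ F, ((J.length : ℂ) * c J) * pairing (normalized haar J) (ψ I)‖ₑ) x ≤
      C * ∫⁻ x, squareFn (fun J => ‖c J‖ₑ) x := by
  classical
  obtain ⟨C, hC⟩ := exists_lintegral_functional_le K B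
  refine ⟨4 * C + 1, fun ψ hψ Φ hΦ hB c F => ?_⟩
  set t : DyadicInterval → ℝ≥0∞ := fun J => ‖c J‖ₑ with ht
  by_cases htop : ∫⁻ x, squareFn t x = ∞
  · rw [htop, ENNReal.mul_top (ENNReal.coe_ne_zero.2 (by positivity))]
    exact le_top
  have hup : ∀ J, upFn t J ≠ ∞ := by
    intro J hJ
    refine htop (top_le_iff.1 ?_)
    calc ∞ = ∫⁻ x in J.toSet, ∞ := by
          rw [setLIntegral_const, volume_toSet, ENNReal.top_mul (ofReal_length_ne_zero J)]
      _ ≤ ∫⁻ x in J.toSet, squareFn t x := by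
          refine setLIntegral_mono (slotFunctional_squareFn.measurable t) fun x hx => ?_
          rw [← hJ]
          exact upFn_le_squareFn t hx
      _ ≤ _ := setLIntegral_le_lintegral _ _
  have hlev : ∀ J, ∃ k : ℤ, upFn t J ≠ 0 → (2 : ℝ≥0∞) ^ k < upFn t J ∧
      upFn t J ≤ (2 : ℝ≥0∞) ^ (k + 1) := by
    intro J
    by_cases h0 : upFn t J = 0
    · exact ⟨0, fun h => absurd h0 h⟩
    · obtain ⟨k, hk1, hk2⟩ := ENNReal.exists_mem_Ioc_zpow (x := upFn t J) (y := 2) h0 (hup J)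
        (by norm_num) (by simp)
      exact ⟨k, fun _ => ⟨hk1, hk2⟩⟩
  choose level hlevel using hlev
  have htp : ∀ J, ∃ Q : DyadicInterval, J ∈ F → upFn t J ≠ 0 → Q ∈ F ∧ J.toSet ⊆ Q.toSet ∧
      (2 : ℝ≥0∞) ^ level J < upFn t Q ∧
      ∀ Q' ∈ F, J.toSet ⊆ Q'.toSet → (2 : ℝ≥0∞) ^ level J < upFn t Q' → Q'.scale ≤ Q.scale := by
    intro J
    by_cases hJ : J ∈ F ∧ upFn t J ≠ 0
    · obtain ⟨Q, hQ, hmax⟩ := (F.filter fun Q => J.toSet ⊆ Q.toSet ∧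
        (2 : ℝ≥0∞) ^ level J < upFn t Q).exists_max_image (fun Q => Q.scale)
        ⟨J, Finset.mem_filter.2 ⟨hJ.1, subset_rfl, (hlevel J hJ.2).1⟩⟩
      have hQ' := Finset.mem_filter.1 hQ
      exact ⟨Q, fun _ _ => ⟨hQ'.1, hQ'.2.1, hQ'.2.2, fun Q' h1 h2 h3 =>
        hmax Q' (Finset.mem_filter.2 ⟨h1, h2, h3⟩)⟩⟩
    · exact ⟨J, fun h1 h2 => absurd ⟨h1, h2⟩ hJ⟩
  choose top htop' using htp
  set G := F.filter fun J => upFn t J ≠ 0 with hG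
  set key : DyadicInterval → ℤ × DyadicInterval := fun J => (level J, top J) with hkey
  set KS := G.image key with hKS
  set a : ℤ × DyadicInterval → ℝ → ℂ := fun κ x =>
    ∑ J ∈ G.filter (fun J => key J = κ), ((J.length : ℂ) * c J) * normalized haar J x with ha
  have hηi := goodFamily_normalized_haar.integrable
  have hpair : ∀ κ I, pairing (a κ) (ψ I) = ∑ J ∈ G.filter (fun J => key J = κ),
      ((J.length : ℂ) * c J) * pairing (normalized haar J) (ψ I) := by
    intro κ I
    unfold pairing
    simp only [ha, Finset.sum_mul, mul_assoc]
    rw [integral_finsetSum]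
    · simp_rw [integral_const_mul]
    · intro J _
      exact ((hψ.integrable_mul_conj (hηi J) I).const_mul _).const_mul _
  -- Intervals with `upFn` zero have coefficient zero and drop out; the remaining ones are grouped
  -- by level and top.
  have hdecomp : ∀ I, ‖∑ J ∈ F, ((J.length : ℂ) * c J) * pairing (normalized haar J) (ψ I)‖ₑ ≤
      ∑' κ : KS, coef (a κ.1) ψ I := by
    intro I
    have h1 : ∑ J ∈ F, ((J.length : ℂ) * c J) * pairing (normalized haar J) (ψ I) =
        ∑ J ∈ G, ((J.length : ℂ) * c J) * pairing (normalized haar J) (ψ I) := by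
      rw [hG, Finset.sum_filter_of_ne]
      intro J _ hne h0
      have h2 := le_upFn t J
      rw [h0, nonpos_iff_eq_zero, ht] at h2
      exact hne (by simp [enorm_eq_zero.1 h2])
    rw [h1, ← Finset.sum_fiberwise_of_maps_to (s := G) (t := KS) (g := key)
      (fun J hJ => Finset.mem_image_of_mem key hJ)]
    simp_rw [← hpair]
    refine (enorm_sum_le _ _).trans (le_of_eq ?_)
    rw [← Finset.tsum_subtype]
    rfl
  have hatom : ∀ κ : KS, ∫⁻ x, Φ (coef (a κ.1) ψ) x ≤
      C * ((2 : ℝ≥0∞) ^ (κ.1.1 + 1) * ENNReal.ofReal κ.1.2.length) := by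
    rintro ⟨⟨k, Q⟩, hκ⟩
    simp only
    have hmem : ∀ J ∈ G.filter (fun J => key J = (k, Q)), J.toSet ⊆ Q.toSet ∧
        upFn t J ≤ (2 : ℝ≥0∞) ^ (k + 1) := by
      intro J hJ
      rw [Finset.mem_filter, hG, Finset.mem_filter] at hJ
      obtain ⟨⟨hJF, hJ0⟩, hJk⟩ := hJ
      have h1 := htop' J hJF hJ0
      have h2 := hlevel J hJ0
      simp only [hkey, Prod.mk.injEq] at hJk
      rw [hJk.1] at h2
      rw [hJk.2] at h1
      exact ⟨h1.2.1, h2.2⟩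
    have hL2 : ∫⁻ x, ‖a (k, Q) x‖ₑ ^ 2 ≤ ENNReal.ofReal Q.length * ((2 : ℝ≥0∞) ^ (k + 1)) ^ 2 := by
      refine (lintegral_sum_sq_le goodFamily_normalized_haar.memLp_two
        tsum_pairing_normalized_haar_le _ c).trans ?_
      rw [ENNReal.coe_one, one_mul]
      calc ∑ J ∈ G.filter (fun J => key J = (k, Q)), ENNReal.ofReal J.length * ‖c J‖ₑ ^ 2
          = ∫⁻ x, ∑ J ∈ G.filter (fun J => key J = (k, Q)),
              J.toSet.indicator (fun _ => t J ^ 2) x := by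
            rw [lintegral_finsetSum _ fun J _ =>
              measurable_const.indicator J.measurableSet_toSet]
            refine Finset.sum_congr rfl fun J _ => ?_
            rw [lintegral_indicator_const J.measurableSet_toSet, volume_toSet, mul_comm]
        _ ≤ ∫⁻ x, Q.toSet.indicator (fun _ => ((2 : ℝ≥0∞) ^ (k + 1)) ^ 2) x :=
            lintegral_mono fun x => sum_indicator_le (fun J hJ => (hmem J hJ).1)
              (fun J hJ => (hmem J hJ).2) x
        _ = _ := by
            rw [lintegral_indicator_const Q.measurableSet_toSet, volume_toSet, mul_comm]
    have hzt : (2 : ℝ≥0∞) ^ (k + 1) ≠ ∞ := ENNReal.zpow_ne_top (by simp) (by simp) _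
    refine hC ψ hψ Φ hΦ hB Q.left Q.length Q.toSet Q.length_pos Set.Ico_subset_Icc_self
      (hψ.regularOn Q) _ ?_ ?_ ?_ _ (ENNReal.mul_ne_top hzt ENNReal.ofReal_ne_top) ?_
    · exact memLp_finsetSum _ fun J _ =>
        (goodFamily_normalized_haar.memLp_two J).const_mul _
    · intro x hx
      refine Finset.sum_eq_zero fun J hJ => ?_
      rw [normalized_haar_of_notMem fun h => hx ((hmem J hJ).1 h), mul_zero]
    · simp only [ha]
      rw [integral_finsetSum _ fun J _ => (hηi J).const_mul _]
      refine Finset.sum_eq_zero fun J _ => ?_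
      rw [integral_const_mul, integral_normalized_haar, mul_zero]
    · refine (mul_le_mul' le_rfl hL2).trans (le_of_eq ?_)
      ring
  -- Two tops of the same level that contain `x` coincide by maximality. Hence the sum runs over
  -- distinct powers `2 ^ k` below the square function at `x`, and is a geometric series.
  have hpt : ∀ x, ∑' κ : KS, κ.1.2.toSet.indicator (fun _ => (2 : ℝ≥0∞) ^ (κ.1.1 + 1)) x ≤
      4 * squareFn t x := by
    intro x
    have hprop : ∀ κ ∈ KS, κ.2 ∈ F ∧ (2 : ℝ≥0∞) ^ κ.1 < upFn t κ.2 ∧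
        ∀ Q' ∈ F, κ.2.toSet ⊆ Q'.toSet → (2 : ℝ≥0∞) ^ κ.1 < upFn t Q' → Q'.scale ≤ κ.2.scale := by
      intro κ hκ
      obtain ⟨J, hJ, rfl⟩ := Finset.mem_image.1 hκ
      rw [hG, Finset.mem_filter] at hJ
      have h1 := htop' J hJ.1 hJ.2
      exact ⟨h1.1, h1.2.2.1, fun Q' h2 h3 h4 => h1.2.2.2 Q' h2 (h1.2.1.trans h3) h4⟩
    rw [Finset.tsum_subtype KS fun κ => κ.2.toSet.indicator (fun _ => (2 : ℝ≥0∞) ^ (κ.1 + 1)) x]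
    have h1 : ∑ κ ∈ KS, κ.2.toSet.indicator (fun _ => (2 : ℝ≥0∞) ^ (κ.1 + 1)) x =
        ∑ κ ∈ KS.filter (fun κ => x ∈ κ.2.toSet), (2 : ℝ≥0∞) ^ (κ.1 + 1) := by
      rw [Finset.sum_filter]
      rfl
    have hinj : Set.InjOn Prod.fst
        ((KS.filter (fun κ => x ∈ κ.2.toSet) : Finset (ℤ × DyadicInterval)) :
          Set (ℤ × DyadicInterval)) := by
      have key' : ∀ κ ∈ KS, ∀ κ' ∈ KS, x ∈ κ.2.toSet → x ∈ κ'.2.toSet → κ.1 = κ'.1 →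
          κ.2.scale ≤ κ'.2.scale → κ = κ' := by
        intro κ hκ κ' hκ' hx hx' heq hs
        have h2 := (hprop κ hκ).2.2 κ'.2 (hprop κ' hκ').1 (subset_of_mem_of_scale_le hx hx' hs)
          (heq ▸ (hprop κ' hκ').2.1)
        exact Prod.ext heq (eq_of_mem_of_scale_eq hx hx' (le_antisymm hs h2))
      intro κ hκ κ' hκ' heq
      have hκ := Finset.mem_filter.1 (Finset.mem_coe.1 hκ)
      have hκ' := Finset.mem_filter.1 (Finset.mem_coe.1 hκ')
      rcases le_total κ.2.scale κ'.2.scale with hs | hs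
      · exact key' κ hκ.1 κ' hκ'.1 hκ.2 hκ'.2 heq hs
      · exact (key' κ' hκ'.1 κ hκ.1 hκ'.2 hκ.2 heq.symm hs).symm
    rw [h1, ← Finset.sum_image (f := fun k : ℤ => (2 : ℝ≥0∞) ^ (k + 1)) hinj]
    refine le_trans ?_ (tsum_zpow_lt_le (squareFn t x))
    refine le_trans (Finset.sum_le_sum fun k hk => ?_) (ENNReal.sum_le_tsum _)
    obtain ⟨κ, hκ, rfl⟩ := Finset.mem_image.1 hk
    have hκ := Finset.mem_filter.1 hκ
    rw [if_pos ((hprop κ hκ.1).2.1.trans_le (upFn_le_squareFn t hκ.2))]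
  calc ∫⁻ x, Φ (fun I => ‖∑ J ∈ F, ((J.length : ℂ) * c J) * pairing (normalized haar J) (ψ I)‖ₑ) x
      ≤ ∫⁻ x, ∑' κ : KS, Φ (coef (a κ.1) ψ) x :=
        lintegral_mono fun x => (hΦ.mono hdecomp x).trans (hΦ.tsum_le _ x)
    _ = ∑' κ : KS, ∫⁻ x, Φ (coef (a κ.1) ψ) x :=
        lintegral_tsum fun κ => (hΦ.measurable _).aemeasurable
    _ ≤ ∑' κ : KS, C * ((2 : ℝ≥0∞) ^ (κ.1.1 + 1) * ENNReal.ofReal κ.1.2.length) :=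
        ENNReal.tsum_le_tsum hatom
    _ = C * ∫⁻ x, ∑' κ : KS, κ.1.2.toSet.indicator (fun _ => (2 : ℝ≥0∞) ^ (κ.1.1 + 1)) x := by
        rw [ENNReal.tsum_mul_left, lintegral_tsum fun κ =>
          (measurable_const.indicator (measurableSet_toSet _)).aemeasurable]
        congr 1
        refine tsum_congr fun κ => ?_
        rw [lintegral_indicator_const (measurableSet_toSet _), volume_toSet]
    _ ≤ C * ∫⁻ x, 4 * squareFn t x := mul_le_mul' le_rfl (lintegral_mono hpt)
    _ = 4 * C * ∫⁻ x, squareFn t x := by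
        rw [lintegral_const_mul' _ _ (by simp)]; ring
    _ ≤ _ := by
        refine mul_le_mul' ?_ le_rfl
        push_cast
        exact le_self_add

end Paraproduct

/-! ### Haar expansions of integrable functions; the dyadic Hardy space. -/

namespace Paraproduct

open DyadicInterval

/-- The pairing of the conditional expectations of two functions on a dyadic interval. -/
noncomputable def meanPairing (f g : ℝ → ℂ) (J : DyadicInterval) : ℂ :=
  ((J.length)⁻¹ : ℝ) * ((∫ x in J.toSet, f x) * (starRingEnd ℂ) (∫ x in J.toSet, g x))

lemma pairing_conj_symm (f g : ℝ → ℂ) : pairing f g = (starRingEnd ℂ) (pairing g f) := by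
  rw [pairing, pairing, ← integral_conj]
  refine integral_congr_ae (Eventually.of_forall fun x => ?_)
  simp only [map_mul, RCLike.conj_conj]
  rw [mul_comm]

lemma setIntegral_halves {f : ℝ → ℂ} {J : DyadicInterval} (hf : IntegrableOn f J.toSet) :
    ∫ x in J.toSet, f x = (∫ x in J.leftHalf.toSet, f x) + ∫ x in J.rightHalf.toSet, f x := by
  rw [← J.leftHalf_union_rightHalf]
  exact setIntegral_union J.disjoint_halves (measurableSet_toSet _)
    (hf.mono_set J.leftHalf_subset) (hf.mono_set J.rightHalf_subset)

/-- A Haar term is a martingale difference: it changes the pairing of the averages on `J` into that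
of the averages on its halves. Sums over consecutive scales therefore telescope. -/
lemma haar_pairing_eq {f g : ℝ → ℂ} {J : DyadicInterval} (hf : IntegrableOn f J.toSet)
    (hg : IntegrableOn g J.toSet) :
    ((J.length : ℂ) * pairing f (normalized haar J)) * pairing (normalized haar J) g =
      meanPairing f g J.leftHalf + meanPairing f g J.rightHalf - meanPairing f g J := by
  have hl : (J.length : ℂ) ≠ 0 := by exact_mod_cast J.length_pos.ne'
  rw [pairing_conj_symm _ g, pairing_normalized_haar hf, pairing_normalized_haar hg]
  unfold meanPairing
  rw [setIntegral_halves hf, setIntegral_halves hg, length_leftHalf, length_rightHalf]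
  simp only [map_mul, map_sub, map_add, Complex.conj_ofReal]
  push_cast
  field_simp
  ring

/-- The dyadic intervals of scale `m - a` in `[-2 ^ m, 2 ^ m)`. -/
noncomputable def grid (m a : ℕ) : Finset DyadicInterval :=
  (Finset.Ico (-2 ^ a : ℤ) (2 ^ a)).map ⟨fun j => ⟨m - a, j⟩, fun i j h => by simpa using h⟩

lemma sum_grid (m a : ℕ) (h : DyadicInterval → ℂ) :
    ∑ J ∈ grid m a, h J = ∑ j ∈ Finset.Ico (-2 ^ a : ℤ) (2 ^ a), h ⟨m - a, j⟩ := by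
  rw [grid, Finset.sum_map]
  rfl

lemma mem_grid {m a : ℕ} {J : DyadicInterval} (h : J ∈ grid m a) : J.scale = m - a := by
  obtain ⟨j, -, rfl⟩ := Finset.mem_map.1 h
  rfl

lemma sum_Ico_two_mul (N : ℤ) (h : ℤ → ℂ) :
    ∑ j ∈ Finset.Ico (-(2 * N)) (2 * N), h j =
      ∑ j ∈ Finset.Ico (-N) N, (h (2 * j) + h (2 * j + 1)) := by
  have : ∑ p ∈ Finset.Ico (-N) N ×ˢ Finset.range 2, h (2 * p.1 + p.2) =
      ∑ j ∈ Finset.Ico (-(2 * N)) (2 * N), h j := by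
    refine Finset.sum_nbij' (fun p => 2 * p.1 + p.2) (fun j => (j / 2, (j % 2).toNat)) ?_ ?_ ?_ ?_ ?_
    · rintro ⟨i, e⟩ hp
      simp only [Finset.mem_product, Finset.mem_Ico, Finset.mem_range] at *
      omega
    · intro j hj
      simp only [Finset.mem_product, Finset.mem_Ico, Finset.mem_range] at *
      omega
    · rintro ⟨i, e⟩ hp
      simp only [Finset.mem_product, Finset.mem_Ico, Finset.mem_range, Prod.mk.injEq] at *
      omega
    · intro j hj
      simp only
      omega
    · intro p _
      rfl
  rw [← this, Finset.sum_product]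
  refine Finset.sum_congr rfl fun j _ => ?_
  simp [Finset.sum_range_succ]

lemma sum_grid_succ (m a : ℕ) (h : DyadicInterval → ℂ) :
    ∑ J ∈ grid m (a + 1), h J = ∑ J ∈ grid m a, (h J.leftHalf + h J.rightHalf) := by
  rw [sum_grid, sum_grid, show (-2 ^ (a + 1) : ℤ) = -(2 * 2 ^ a) by ring,
    show (2 ^ (a + 1) : ℤ) = 2 * 2 ^ a by ring, sum_Ico_two_mul]
  refine Finset.sum_congr rfl fun j _ => ?_
  have : ((m : ℤ) - ((a + 1 : ℕ) : ℤ)) = (m : ℤ) - a - 1 := by push_cast; ring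
  rw [this]
  rfl

open scoped Classical in
/-- The dyadic intervals in `[-2 ^ m, 2 ^ m)` with scales in `(-m, m]`. -/
noncomputable def gridUnion (m : ℕ) : Finset DyadicInterval :=
  (Finset.range (2 * m)).biUnion (grid m)

lemma sum_gridUnion {f g : ℝ → ℂ} (hf : Integrable f) (hg : Integrable g) (m : ℕ) :
    ∑ J ∈ gridUnion m, ((J.length : ℂ) * pairing f (normalized haar J)) *
      pairing (normalized haar J) g =
      ∑ J ∈ grid m (2 * m), meanPairing f g J - ∑ J ∈ grid m 0, meanPairing f g J := by
  classical
  rw [gridUnion, Finset.sum_biUnion]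
  · rw [← Finset.sum_range_sub fun a => ∑ J ∈ grid m a, meanPairing f g J]
    refine Finset.sum_congr rfl fun a _ => ?_
    rw [sum_grid_succ, ← Finset.sum_sub_distrib]
    exact Finset.sum_congr rfl fun J _ => haar_pairing_eq hf.integrableOn hg.integrableOn
  · intro a _ b _ hab
    refine Finset.disjoint_left.2 fun J ha hb => hab ?_
    have h1 := mem_grid ha
    have h2 := mem_grid hb
    omega

lemma norm_setIntegral_le_integral {f : ℝ → ℂ} (hf : Integrable f) (s : Set ℝ) :
    ‖∫ x in s, f x‖ ≤ ∫ x, ‖f x‖ :=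
  (norm_integral_le_integral_norm _).trans (setIntegral_le_integral hf.norm
    (Eventually.of_forall fun _ => norm_nonneg _))

/-- There are two intervals of length `2 ^ m`, and the integrals over them are bounded by the L¹
norms, so the sum is `O(2 ^ (-m))`. -/
lemma tendsto_sum_grid_zero {f g : ℝ → ℂ} (hf : Integrable f) (hg : Integrable g) :
    Tendsto (fun m : ℕ => ∑ J ∈ grid m 0, meanPairing f g J) atTop (𝓝 0) := by
  set A := (∫ x, ‖f x‖) * ∫ x, ‖g x‖ with hA
  refine squeeze_zero_norm (a := fun m : ℕ => (2⁻¹ : ℝ) ^ m * (2 * A)) (fun m => ?_) ?_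
  · refine (norm_sum_le _ _).trans ?_
    have hcard : (grid m 0).card = 2 := by simp [grid]
    have : ∀ J ∈ grid m 0, ‖meanPairing f g J‖ ≤ (2⁻¹ : ℝ) ^ m * A := by
      intro J hJ
      have hs := mem_grid hJ
      have hlen : (J.length)⁻¹ = (2⁻¹ : ℝ) ^ m := by
        rw [length, hs]
        simp
      rw [meanPairing, norm_mul, norm_mul, RCLike.norm_conj, Complex.norm_real, hlen,
        Real.norm_of_nonneg (by positivity), hA]
      gcongr
      · exact norm_setIntegral_le_integral hf _
      · exact norm_setIntegral_le_integral hg _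
    refine (Finset.sum_le_sum this).trans (le_of_eq ?_)
    rw [Finset.sum_const, hcard]
    simp only [nsmul_eq_mul]
    push_cast
    ring
  · have := (tendsto_pow_atTop_nhds_zero_of_lt_one (r := (2⁻¹ : ℝ)) (by norm_num)
      (by norm_num)).mul_const (2 * A)
    rwa [zero_mul] at this

lemma iUnion_grid (m : ℕ) : ⋃ J ∈ grid m (2 * m), J.toSet = Set.Ico (-2 ^ m : ℝ) (2 ^ m) := by
  have hscale : (m : ℤ) - ((2 * m : ℕ) : ℤ) = -(m : ℤ) := by push_cast; ring
  have h2 : (2 : ℝ) ^ (-(m : ℤ)) = (2 ^ m)⁻¹ := by rw [zpow_neg, zpow_natCast]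
  have hpos : (0 : ℝ) < 2 ^ m := by positivity
  have hpow : ((2 : ℝ) ^ (2 * m)) = 2 ^ m * 2 ^ m := by rw [two_mul, pow_add]
  ext x
  simp only [Set.mem_iUnion, exists_prop]
  have key : ∀ j : ℤ, x ∈ (⟨(m : ℤ) - ((2 * m : ℕ) : ℤ), j⟩ : DyadicInterval).toSet ↔
      (j : ℝ) ≤ x * 2 ^ m ∧ x * 2 ^ m < j + 1 := by
    intro j
    simp only [toSet, left, length, Set.mem_Ico, hscale, h2]
    rw [← div_eq_mul_inv, div_le_iff₀ hpos, ← one_div, ← add_div, lt_div_iff₀ hpos]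
  constructor
  · rintro ⟨J, hJ, hx⟩
    obtain ⟨j, hj, rfl⟩ := Finset.mem_map.1 hJ
    have hx := (key j).1 hx
    rw [Finset.mem_Ico] at hj
    have h1 : -(2 ^ m * 2 ^ m : ℝ) ≤ j := by rw [← hpow]; exact_mod_cast hj.1
    have h3 : (j : ℝ) + 1 ≤ 2 ^ m * 2 ^ m := by rw [← hpow]; exact_mod_cast hj.2
    constructor
    · refine le_of_mul_le_mul_right ?_ hpos
      linarith [hx.1]
    · refine lt_of_mul_lt_mul_right ?_ hpos.le
      linarith [hx.2]
  · intro hx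
    refine ⟨⟨(m : ℤ) - ((2 * m : ℕ) : ℤ), ⌊x * 2 ^ m⌋⟩, Finset.mem_map.2 ⟨⌊x * 2 ^ m⌋, ?_, rfl⟩,
      (key _).2 ⟨Int.floor_le _, Int.lt_floor_add_one _⟩⟩
    rw [Finset.mem_Ico, Int.le_floor, Int.floor_lt]
    push_cast
    rw [hpow]
    constructor
    · nlinarith [hx.1]
    · nlinarith [hx.2]

section

variable {K : ℝ} {ψ : DyadicInterval → ℝ → ℂ}

/-- Pairing averages on `J` amounts to replacing `g` by its mean there, which moves it by no more
than its oscillation. -/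
lemma norm_meanPairing_sub_le {f g : ℝ → ℂ} (hf : Integrable f) (hg : Integrable g)
    (hfg : Integrable fun x => f x * (starRingEnd ℂ) (g x)) {J : DyadicInterval} {ε : ℝ}
    (hosc : ∀ x ∈ J.toSet, ∀ y ∈ J.toSet, ‖g x - g y‖ ≤ ε) :
    ‖meanPairing f g J - ∫ x in J.toSet, f x * (starRingEnd ℂ) (g x)‖ ≤
      ∫ x in J.toSet, ‖f x‖ * ε := by
  have hl := J.length_pos
  have hvol : volume.real J.toSet = J.length := by
    rw [measureReal_def, volume_toSet, ENNReal.toReal_ofReal hl.le]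
  set μ : ℂ := ((J.length)⁻¹ : ℝ) * ∫ x in J.toSet, g x with hμ
  have h1 : meanPairing f g J = ∫ x in J.toSet, f x * (starRingEnd ℂ) μ := by
    rw [integral_mul_const, meanPairing, hμ, map_mul, Complex.conj_ofReal]
    ring
  have h2 : ∀ x ∈ J.toSet, ‖μ - g x‖ ≤ ε := by
    intro x hx
    have h3 : μ - g x = ((J.length)⁻¹ : ℝ) * ∫ y in J.toSet, (g y - g x) := by
      rw [integral_sub hg.integrableOn (integrableOn_const (by simp)), setIntegral_const, hvol, hμ,
        mul_sub, Complex.real_smul, ← mul_assoc, ← Complex.ofReal_mul, inv_mul_cancel₀ hl.ne',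
        Complex.ofReal_one, one_mul]
    rw [h3, norm_mul, Complex.norm_real, Real.norm_of_nonneg (by positivity), inv_mul_le_iff₀ hl,
      mul_comm, ← hvol]
    exact norm_setIntegral_le_of_norm_le_const (by simp) fun y hy => hosc y hy x hx
  rw [h1, ← integral_sub (hf.integrableOn.mul_const _) hfg.integrableOn]
  refine norm_integral_le_of_norm_le (hf.norm.integrableOn.mul_const _) ?_
  filter_upwards [ae_restrict_mem J.measurableSet_toSet] with x hx
  rw [← mul_sub, norm_mul, ← map_sub, RCLike.norm_conj]
  exact mul_le_mul_of_nonneg_left (h2 x hx) (norm_nonneg _)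

lemma pairwiseDisjoint_grid (m a : ℕ) :
    (grid m a : Set DyadicInterval).PairwiseDisjoint fun J => J.toSet := by
  intro J hJ J' hJ' hne
  refine Set.disjoint_left.2 fun x hx hx' => hne (eq_of_mem_of_scale_eq hx hx' ?_)
  rw [mem_grid hJ, mem_grid hJ']

/-- On the finest intervals of the grid `ψ I` varies by `O(2 ^ (-m))`, and these intervals exhaust
the line. -/
lemma GoodFamily.tendsto_sum_grid (hψ : GoodFamily K ψ) {f : ℝ → ℂ} (hf : Integrable f)
    (I : DyadicInterval) :
    Tendsto (fun m : ℕ => ∑ J ∈ grid m (2 * m), meanPairing f (ψ I) J) atTop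
      (𝓝 (pairing f (ψ I))) := by
  have hIl := I.length_pos
  have hK := hψ.nonneg
  have hfg := hψ.integrable_mul_conj hf I
  have h1 : Tendsto (fun m : ℕ => ∫ x in Set.Ico (-2 ^ m : ℝ) (2 ^ m),
      f x * (starRingEnd ℂ) (ψ I x)) atTop (𝓝 (pairing f (ψ I))) := by
    have hp := tendsto_pow_atTop_atTop_of_one_lt (one_lt_two (α := ℝ))
    have : AECover volume atTop fun m : ℕ => Set.Ico (-2 ^ m : ℝ) (2 ^ m) :=
      aecover_Ico (tendsto_neg_atTop_atBot.comp hp) hp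
    exact this.integral_tendsto_of_countably_generated hfg
  have h2 : Tendsto (fun m : ℕ => ∑ J ∈ grid m (2 * m), meanPairing f (ψ I) J -
      ∫ x in Set.Ico (-2 ^ m : ℝ) (2 ^ m), f x * (starRingEnd ℂ) (ψ I x)) atTop (𝓝 0) := by
    have hlim : Tendsto (fun m : ℕ => (∫ x, ‖f x‖) * (K / I.length ^ 2) * (2⁻¹ : ℝ) ^ m) atTop
        (𝓝 0) := by
      have := (tendsto_pow_atTop_nhds_zero_of_lt_one (r := (2⁻¹ : ℝ)) (by norm_num)
        (by norm_num)).const_mul ((∫ x, ‖f x‖) * (K / I.length ^ 2))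
      rwa [mul_zero] at this
    refine squeeze_zero_norm' ?_ hlim
    -- Regularity of `ψ I` is available only on intervals no longer than `I`, that is, for `-m ≤
    -- I.scale`.
    filter_upwards [eventually_ge_atTop I.scale.natAbs] with m hm
    rw [← iUnion_grid, integral_biUnion_finset _ (fun J _ => J.measurableSet_toSet)
      (pairwiseDisjoint_grid m (2 * m)) fun J _ => hfg.integrableOn, ← Finset.sum_sub_distrib]
    set ε := K / I.length ^ 2 * (2⁻¹ : ℝ) ^ m with hε
    have hterm : ∀ J ∈ grid m (2 * m), ‖meanPairing f (ψ I) J -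
        ∫ x in J.toSet, f x * (starRingEnd ℂ) (ψ I x)‖ ≤ ∫ x in J.toSet, ‖f x‖ * ε := by
      intro J hJ
      have hs : J.scale = -(m : ℤ) := by rw [mem_grid hJ]; push_cast; ring
      have hle : J.length ≤ I.length := length_le_iff.2 (by rw [hs]; omega)
      have hlen : J.length = (2⁻¹ : ℝ) ^ m := by
        rw [length, hs, zpow_neg, zpow_natCast, inv_pow]
      refine norm_meanPairing_sub_le hf (hψ.integrable I) hfg fun x hx y hy => ?_
      refine (hψ.regular I J hle x hx y hy).trans ?_
      have hd : I.dec x ^ 2 ≤ 1 := pow_le_one₀ (I.dec_pos x).le (I.dec_le_one x)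
      rw [hlen, hε]
      calc K * (2⁻¹ : ℝ) ^ m / I.length ^ 2 * I.dec x ^ 2
          ≤ K * (2⁻¹ : ℝ) ^ m / I.length ^ 2 * 1 := by gcongr
        _ = _ := by ring
    refine (norm_sum_le _ _).trans ((Finset.sum_le_sum hterm).trans ?_)
    rw [← integral_biUnion_finset _ (fun J _ => J.measurableSet_toSet)
      (pairwiseDisjoint_grid m (2 * m)) fun J _ => (hf.norm.mul_const _).integrableOn]
    refine (setIntegral_le_integral (hf.norm.mul_const _) (Eventually.of_forall fun x => ?_)).trans
      (le_of_eq ?_)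
    · simp only [Pi.zero_apply]; positivity
    · rw [integral_mul_const, hε]; ring
  have := h2.add h1
  simpa using this

/-- Convergence of each single coefficient along the partial Haar sums of `f` is enough: the
functional is lower semicontinuous, Fatou's lemma applies, and the partial sums are bounded
uniformly by the integral of the dyadic square function. -/
lemma exists_majorized_dyadicHardy (K : ℝ) (B : ℝ≥0) : ∃ C : ℝ≥0,
    ∀ ψ : DyadicInterval → ℝ → ℂ, GoodFamily K ψ → ∀ f : ℝ → ℂ, Integrable f →
      Majorized (coef f ψ) (SquareBounded B ψ) 1 (C * dyadicHardyNorm f) := by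
  obtain ⟨B', hB'⟩ := exists_majorized_of_functional K B
  obtain ⟨C, hC⟩ := exists_lintegral_functional_haar_le K B'
  refine ⟨C, fun ψ hψ f hf => hB' ψ hψ _ _ fun Φ hΦ hL2 => ?_⟩
  set c : DyadicInterval → ℂ := fun J => pairing f (normalized haar J) with hc
  set t : ℕ → DyadicInterval → ℝ≥0∞ := fun m I =>
    ‖∑ J ∈ gridUnion m, ((J.length : ℂ) * c J) * pairing (normalized haar J) (ψ I)‖ₑ with ht
  have hlim : ∀ I, Tendsto (fun m => t m I) atTop (𝓝 (coef f ψ I)) := by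
    intro I
    have h1 := (hψ.tendsto_sum_grid hf I).sub (tendsto_sum_grid_zero hf (hψ.integrable I))
    rw [sub_zero] at h1
    have h2 := (continuous_enorm.tendsto _).comp h1
    refine h2.congr fun m => ?_
    simp only [Function.comp, ht, hc]
    rw [sum_gridUnion hf (hψ.integrable I)]
  calc ∫⁻ x, Φ (coef f ψ) x ≤ ∫⁻ x, liminf (fun m => Φ (t m) x) atTop :=
        lintegral_mono fun x => hΦ.le_liminf hlim x
    _ ≤ liminf (fun m => ∫⁻ x, Φ (t m) x) atTop :=
        lintegral_liminf_le fun m => hΦ.measurable _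
    _ ≤ liminf (fun _ : ℕ => C * ∫⁻ x, squareFn (coef f (normalized haar)) x) atTop :=
        liminf_le_liminf (Eventually.of_forall fun m => hC ψ hψ Φ hΦ hL2 c (gridUnion m))
    _ = C * ∫⁻ x, squareFn (coef f (normalized haar)) x := liminf_const _
    _ ≤ _ := by
        refine mul_le_mul' le_rfl ?_
        rw [dyadicHardyNorm, dyadicSquare_eq, eLpNorm_one_eq_lintegral_enorm (f := squareFn _)]
        exact le_add_self

end

end Paraproduct

/-! ### Adapted functions as good and almost orthogonal families. -/

namespace Paraproduct

open DyadicInterval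

lemma DyadicInterval.dec_le_mul (I : DyadicInterval) (x y : ℝ) :
    I.dec x ≤ (1 + |x - y| / I.length) * I.dec y := by
  have hl := I.length_pos
  have h1 := abs_sub_le y x I.center
  rw [abs_sub_comm y x] at h1
  have h2 : |y - I.center| / I.length ≤ |x - y| / I.length + |x - I.center| / I.length := by
    rw [← add_div]; gcongr
  have h3 : 0 ≤ |x - y| / I.length * (|x - I.center| / I.length) := by positivity
  rw [dec, dec, ← div_eq_mul_inv, le_div_iff₀ (I.dec_denom_pos y), ← div_eq_inv_mul,
    div_le_iff₀ (I.dec_denom_pos x)]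
  nlinarith

section Adapted

variable {K : ℝ} {φ : DyadicInterval → ℝ → ℂ}

lemma norm_normalized_le {N : ℕ} {I : DyadicInterval} (h : IsAdapted K N I (φ I)) (x : ℝ) :
    ‖normalized φ I x‖ ≤ |K| / I.length * I.dec x ^ N := by
  have hl := I.length_pos
  have hr : 0 < I.length ^ (-(1 / 2 : ℝ)) := Real.rpow_pos_of_pos hl _
  have hrr : I.length ^ (-(1 / 2 : ℝ)) * I.length ^ (-(1 / 2 : ℝ)) = (I.length)⁻¹ := by
    rw [← Real.rpow_add hl]
    norm_num
    exact Real.rpow_neg_one _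
  have hd := (I.dec_pos x).le
  rw [normalized, norm_mul, Complex.norm_real, Real.norm_of_nonneg hr.le]
  have h1 := h.norm_le x
  rw [zpow_neg, zpow_natCast, ← inv_pow] at h1
  calc I.length ^ (-(1 / 2 : ℝ)) * ‖φ I x‖
      ≤ I.length ^ (-(1 / 2 : ℝ)) * (|K| * I.length ^ (-(1 / 2 : ℝ)) * I.dec x ^ N) := by
        refine mul_le_mul_of_nonneg_left (h1.trans ?_) hr.le
        rw [← dec]
        gcongr
        exact le_abs_self K
    _ = (I.length ^ (-(1 / 2 : ℝ)) * I.length ^ (-(1 / 2 : ℝ))) * |K| * I.dec x ^ N := by ring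
    _ = _ := by rw [hrr]; ring

lemma differentiable_normalized {N : ℕ} {I : DyadicInterval} (h : IsAdapted K N I (φ I)) :
    Differentiable ℝ (normalized φ I) :=
  h.differentiable.const_mul _

lemma norm_deriv_normalized_le {N : ℕ} {I : DyadicInterval} (h : IsAdapted K N I (φ I)) (x : ℝ) :
    ‖deriv (normalized φ I) x‖ ≤ |K| / I.length ^ 2 * I.dec x ^ N := by
  have hl := I.length_pos
  have hr : 0 < I.length ^ (-(1 / 2 : ℝ)) := Real.rpow_pos_of_pos hl _
  have hr3 : 0 < I.length ^ (-(3 / 2 : ℝ)) := Real.rpow_pos_of_pos hl _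
  have hrr : I.length ^ (-(1 / 2 : ℝ)) * I.length ^ (-(3 / 2 : ℝ)) = (I.length ^ 2)⁻¹ := by
    rw [← Real.rpow_add hl, ← Real.rpow_natCast, ← Real.rpow_neg hl.le]
    norm_num
  have hd := (I.dec_pos x).le
  have hder : deriv (normalized φ I) x =
      ((I.length ^ (-(1 / 2 : ℝ)) : ℝ) : ℂ) * deriv (φ I) x :=
    deriv_const_mul _ (h.differentiable x)
  rw [hder, norm_mul, Complex.norm_real, Real.norm_of_nonneg hr.le]
  have h1 := h.norm_deriv_le x
  rw [zpow_neg, zpow_natCast, ← inv_pow] at h1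
  calc I.length ^ (-(1 / 2 : ℝ)) * ‖deriv (φ I) x‖
      ≤ I.length ^ (-(1 / 2 : ℝ)) * (|K| * I.length ^ (-(3 / 2 : ℝ)) * I.dec x ^ N) := by
        refine mul_le_mul_of_nonneg_left (h1.trans ?_) hr.le
        rw [← dec]
        gcongr
        exact le_abs_self K
    _ = (I.length ^ (-(1 / 2 : ℝ)) * I.length ^ (-(3 / 2 : ℝ))) * |K| * I.dec x ^ N := by ring
    _ = _ := by rw [hrr]; ring

/-- Mean value inequality. Along the segment, of length at most `|I|`, the weight changes by at most
a factor 2, which gives the 4 for its square. -/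
lemma norm_normalized_sub_le {I : DyadicInterval} (h : IsAdapted K 5 I (φ I)) {x y r : ℝ}
    (hxy : |y - x| ≤ r) (hr : r ≤ I.length) :
    ‖normalized φ I x - normalized φ I y‖ ≤ 4 * |K| * r / I.length ^ 2 * I.dec x ^ 2 := by
  have hl := I.length_pos
  have hd := (I.dec_pos x).le
  have hr0 : 0 ≤ r := (abs_nonneg _).trans hxy
  have hbound : ∀ z ∈ Set.uIcc x y, ‖deriv (normalized φ I) z‖ ≤
      4 * |K| / I.length ^ 2 * I.dec x ^ 2 := by
    intro z hz
    refine (norm_deriv_normalized_le h z).trans ?_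
    have h1 : |z - x| ≤ I.length := (Set.abs_sub_left_of_mem_uIcc hz).trans (hxy.trans hr)
    have h2 := I.dec_le_two_mul h1
    have hz0 := (I.dec_pos z).le
    calc |K| / I.length ^ 2 * I.dec z ^ 5 ≤ |K| / I.length ^ 2 * I.dec z ^ 2 := by
          gcongr _ * ?_
          exact pow_le_pow_of_le_one hz0 (I.dec_le_one z) (by norm_num)
      _ ≤ |K| / I.length ^ 2 * (2 * I.dec x) ^ 2 := by gcongr
      _ = _ := by ring
  have := (convex_uIcc x y).norm_image_sub_le_of_norm_deriv_le
    (fun z _ => (differentiable_normalized h) z) hbound Set.left_mem_uIcc Set.right_mem_uIcc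
  rw [norm_sub_rev]
  refine this.trans ?_
  rw [Real.norm_eq_abs]
  calc 4 * |K| / I.length ^ 2 * I.dec x ^ 2 * |y - x|
      ≤ 4 * |K| / I.length ^ 2 * I.dec x ^ 2 * r := by gcongr
    _ = _ := by ring

lemma regularOn_normalized (h : ∀ I, IsAdapted K 5 I (φ I)) (u r : ℝ) :
    RegularOn (4 * |K|) (normalized φ) (Set.Icc u (u + r)) r := by
  intro I hI x hx y hy
  refine norm_normalized_sub_le (h I) ?_ hI
  rw [abs_le]
  constructor <;> linarith [hx.1, hx.2, hy.1, hy.2]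

lemma goodFamily_normalized (h : ∀ I, IsAdapted K 5 I (φ I)) :
    GoodFamily (4 * |K|) (normalized φ) where
  nonneg := by positivity
  measurable I := (differentiable_normalized (h I)).continuous.measurable
  size I x := by
    have hl := I.length_pos
    have hd := (I.dec_pos x).le
    refine (norm_normalized_le (h I) x).trans ?_
    gcongr ?_ / _ * ?_
    · linarith [abs_nonneg K]
    · exact pow_le_pow_of_le_one hd (I.dec_le_one x) (by norm_num)
  regular I J hJI x hx y hy := by
    refine norm_normalized_sub_le (h I) ?_ hJI
    rw [abs_sub_comm]
    exact J.abs_sub_le_of_mem hx hy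

lemma integral_normalized (h : HasMeanZero φ) (I : DyadicInterval) :
    ∫ x, normalized φ I x = 0 := by
  simp only [normalized]
  rw [integral_const_mul, h I, mul_zero]

/-- Let `ρ` be the distance from `x` to the center of `J` in units of `|I|`. For `ρ ≤ 1` the mean
value inequality gives a bound linear in `ρ`. For `ρ > 1` the sizes of both values are used, and
moving the weight from `x` to the center costs `O(ρ ^ 2)`. Both `ρ` and `ρ ^ 2` are at most `(|J| /
|I|)` times the inverse square of the weight of `J`. -/
lemma norm_normalized_sub_center_le {I J : DyadicInterval} (h : IsAdapted K 5 I (φ I))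
    (hJI : J.length ≤ I.length) (x : ℝ) :
    ‖normalized φ I x - normalized φ I J.center‖ ≤
      5 * |K| / I.length * I.dec J.center ^ 2 * (J.length / I.length) * (J.dec x ^ 2)⁻¹ := by
  have hI := I.length_pos
  have hJ := J.length_pos
  have hdJ := J.dec_pos x
  have hdc := (I.dec_pos J.center).le
  set ρ := |x - J.center| / I.length with hρ
  have hρ0 : 0 ≤ ρ := by positivity
  set q := J.length / I.length with hq
  have hq0 : 0 ≤ q := by positivity
  have hq1 : q ≤ 1 := (div_le_one hI).2 hJI
  set e := (J.dec x)⁻¹ with he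
  have he1 : 1 ≤ e := (one_le_inv₀ hdJ).2 (J.dec_le_one x)
  have hρe : ρ ≤ q * e := by
    rw [hρ, hq, div_mul_eq_mul_div]
    have := J.abs_sub_center_le x
    gcongr
  have hρ1 : ρ ≤ q * e ^ 2 := hρe.trans (by gcongr; exact le_self_pow₀ he1 two_ne_zero)
  have hρ2 : ρ ^ 2 ≤ q * e ^ 2 := by
    calc ρ ^ 2 ≤ (q * e) ^ 2 := by gcongr
      _ = q * (q * e ^ 2) := by ring
      _ ≤ 1 * (q * e ^ 2) := by gcongr
      _ = _ := one_mul _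
  set D := |K| / I.length * I.dec J.center ^ 2 with hD
  have hD0 : 0 ≤ D := by positivity
  rw [← inv_pow, ← he, show 5 * |K| / I.length * I.dec J.center ^ 2 * q * e ^ 2 =
    5 * (D * (q * e ^ 2)) by rw [hD]; ring]
  rcases le_or_gt ρ 1 with h1 | h1
  · have hle : |x - J.center| ≤ I.length := by rwa [hρ, div_le_one hI] at h1
    have := norm_normalized_sub_le h (x := J.center) (y := x) le_rfl hle
    rw [norm_sub_rev]
    refine this.trans ?_
    rw [show 4 * |K| * |x - J.center| / I.length ^ 2 * I.dec J.center ^ 2 = 4 * (D * ρ) by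
      rw [hD, hρ]; field_simp]
    have : D * ρ ≤ D * (q * e ^ 2) := by gcongr
    have : 0 ≤ D * ρ := by positivity
    linarith
  · have hb : ∀ z, ‖normalized φ I z‖ ≤ |K| / I.length * I.dec z ^ 2 := by
      intro z
      refine (norm_normalized_le h z).trans ?_
      gcongr _ * ?_
      exact pow_le_pow_of_le_one (I.dec_pos z).le (I.dec_le_one z) (by norm_num)
    have hx : ‖normalized φ I x‖ ≤ 4 * (D * ρ ^ 2) := by
      refine (hb x).trans ?_
      have h2 := I.dec_le_mul x J.center
      have h3 : I.dec x ≤ 2 * ρ * I.dec J.center :=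
        h2.trans (by gcongr; rw [← hρ]; linarith)
      have h4 := (I.dec_pos x).le
      calc |K| / I.length * I.dec x ^ 2 ≤ |K| / I.length * (2 * ρ * I.dec J.center) ^ 2 := by
            gcongr
        _ = _ := by rw [hD]; ring
    have hc : ‖normalized φ I J.center‖ ≤ D * ρ :=
      (hb _).trans (le_mul_of_one_le_right hD0 h1.le)
    refine (norm_sub_le _ _).trans ?_
    have h5 : D * ρ ^ 2 ≤ D * (q * e ^ 2) := by gcongr
    have h6 : D * ρ ≤ D * (q * e ^ 2) := by gcongr
    linarith

/-- The function on `J` has integral zero, so the value of the one on `I` at the center of `J` can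
be subtracted. The resulting inverse square of the weight of `J` is paid for by four powers of decay
on `J`, and an integrable square remains. -/
lemma exists_almostOrthogonal_normalized (K : ℝ) : ∃ K' : ℝ, ∀ φ : DyadicInterval → ℝ → ℂ,
    (∀ I, IsAdapted K 5 I (φ I)) → HasMeanZero φ → AlmostOrthogonal K' (normalized φ) := by
  obtain ⟨C, hC⟩ := exists_lintegral_dec_sq_le
  refine ⟨5 * |K| ^ 2 * C, fun φ h h0 I J hJI => ?_⟩
  have hI := I.length_pos
  have hJ := J.length_pos
  have hg := goodFamily_normalized h
  have hdc := (I.dec_pos J.center).le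
  have h1 : pairing (normalized φ J) (normalized φ I) = ∫ x, normalized φ J x *
      (starRingEnd ℂ) (normalized φ I x - normalized φ I J.center) := by
    simp_rw [map_sub, mul_sub]
    rw [integral_sub (hg.integrable_mul_conj (hg.integrable J) I) ((hg.integrable J).mul_const _),
      integral_mul_const, integral_normalized h0, zero_mul, sub_zero]
    rfl
  set D := 5 * |K| ^ 2 / I.length ^ 2 * I.dec J.center ^ 2 with hD
  have hD0 : 0 ≤ D := by positivity
  have h2 : ‖pairing (normalized φ J) (normalized φ I)‖ₑ ≤ ENNReal.ofReal (D * (C * J.length)) := by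
    rw [h1]
    refine (enorm_integral_le_lintegral_enorm _).trans ?_
    calc ∫⁻ x, ‖normalized φ J x * (starRingEnd ℂ) (normalized φ I x - normalized φ I J.center)‖ₑ
        ≤ ∫⁻ x, ENNReal.ofReal D * ENNReal.ofReal (J.dec x ^ 2) := by
          refine lintegral_mono fun x => ?_
          rw [← ENNReal.ofReal_mul hD0]
          refine enorm_le_ofReal ?_
          have hd := J.dec_pos x
          rw [norm_mul, RCLike.norm_conj]
          calc ‖normalized φ J x‖ * ‖normalized φ I x - normalized φ I J.center‖
              ≤ (|K| / J.length * J.dec x ^ 4) * (5 * |K| / I.length * I.dec J.center ^ 2 *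
                  (J.length / I.length) * (J.dec x ^ 2)⁻¹) := by
                gcongr
                · refine (norm_normalized_le (h J) x).trans ?_
                  gcongr _ * ?_
                  exact pow_le_pow_of_le_one hd.le (J.dec_le_one x) (by norm_num)
                · exact norm_normalized_sub_center_le (h I) hJI x
            _ = _ := by rw [hD]; field_simp
      _ ≤ ENNReal.ofReal D * (C * ENNReal.ofReal J.length) := by
          rw [lintegral_const_mul' _ _ ENNReal.ofReal_ne_top]
          exact mul_le_mul' le_rfl (hC J)
      _ = _ := by
          rw [ENNReal.ofReal_mul hD0, ENNReal.ofReal_mul C.coe_nonneg, ENNReal.ofReal_coe_nnreal]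
  rw [← ofReal_norm, ENNReal.ofReal_le_ofReal_iff (by positivity)] at h2
  refine h2.trans (le_of_eq ?_)
  rw [hD]
  ring

lemma exists_squareBounded_normalized (K : ℝ) : ∃ B : ℝ≥0, ∀ φ : DyadicInterval → ℝ → ℂ,
    (∀ I, IsAdapted K 5 I (φ I)) → HasMeanZero φ → SquareBounded B (normalized φ) := by
  obtain ⟨K', hK'⟩ := exists_almostOrthogonal_normalized K
  obtain ⟨A, hA⟩ := exists_tsum_almostOrthogonal_le K'
  exact ⟨A, fun φ h h0 => squareBounded_of_tsum_le (goodFamily_normalized h).memLp_two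
    (hA _ (hK' φ h h0))⟩

end Adapted

end Paraproduct

/-! ### Assembly of the slot estimates. -/

namespace Paraproduct

open DyadicInterval

lemma sublinearOp_eq {n : ℕ} (φ : Fin n → DyadicInterval → ℝ → ℂ) (f : Fin n → ℝ → ℂ) :
    sublinearOp φ f = fun x => ∑' I : DyadicInterval,
      I.toSet.indicator (fun _ => ∏ j, coef (f j) (normalized (φ j)) I) x := by
  funext x
  unfold sublinearOp
  refine tsum_congr fun I => ?_
  congr 1
  funext _
  have hl := I.length_pos
  have hr : 0 < I.length ^ (-(1 / 2 : ℝ)) := Real.rpow_pos_of_pos hl _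
  have h1 : ∀ j, coef (f j) (normalized (φ j)) I =
      ENNReal.ofReal (I.length ^ (-(1 / 2 : ℝ)) * ‖pairing (f j) (φ j I)‖) := by
    intro j
    have h2 : pairing (f j) (normalized (φ j) I) =
        ((I.length ^ (-(1 / 2 : ℝ)) : ℝ) : ℂ) * pairing (f j) (φ j I) := by
      unfold pairing normalized
      rw [← integral_const_mul]
      refine integral_congr_ae (Eventually.of_forall fun x => ?_)
      simp only [map_mul, Complex.conj_ofReal]
      ring
    rw [coef, h2, ← ofReal_norm, norm_mul, Complex.norm_real, Real.norm_of_nonneg hr.le]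
  simp_rw [h1]
  rw [← ENNReal.ofReal_prod_of_nonneg fun j _ => by positivity, Finset.prod_mul_distrib,
    Finset.prod_const, Finset.card_univ, Fintype.card_fin, ← Real.rpow_natCast,
    ← Real.rpow_mul hl.le]
  congr 3
  ring

/-- The coefficients with respect to the family `ψ` have majorants adapted to the space `X`. -/
def SlotBound (ψ : DyadicInterval → ℝ → ℂ) (X : Space) (C : ℝ≥0) (sq : Prop) : Prop :=
  ∀ f : ℝ → ℂ, X.Mem f →
    (X ≠ .lebesgue 1 → Majorized (coef f ψ) sq X.exponent (C * X.norm f)) ∧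
    (X = .lebesgue 1 → ∀ N, C * X.norm f ≤ N → N ≠ 0 → N ≠ ∞ → WeakMajorized (coef f ψ) sq 1 N)

lemma SlotBound.weak {ψ : DyadicInterval → ℝ → ℂ} {X : Space} {C : ℝ≥0} {sq : Prop}
    (h : SlotBound ψ X C sq) (hX : 1 ≤ X.exponent) {f : ℝ → ℂ} (hf : X.Mem f) {N : ℝ≥0∞}
    (hN : C * X.norm f ≤ N) (hN0 : N ≠ 0) (hNt : N ≠ ∞) :
    WeakMajorized (coef f ψ) sq X.exponent N := by
  by_cases hX1 : X = .lebesgue 1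
  · have := (h f hf).2 hX1 N hN hN0 hNt
    rwa [hX1]
  · exact (((h f hf).1 hX1).mono hN).weak hX hN0 hNt

lemma Space.Mem.norm_ne_top {X : Space} {f : ℝ → ℂ} (h : X.Mem f) : X.norm f ≠ ∞ := by
  cases X with
  | lebesgue p => exact h.2.ne
  | hardy => exact h.2.ne
  | dyadicHardy => exact h.2.ne
  | bmo => exact h.2.ne
  | dyadicBMO => exact h.2.ne

lemma targetExponent_le_one {n : ℕ} {X : Fin n → Space} (h : ∃ j, X j = .lebesgue 1) :
    targetExponent X ≤ 1 := by
  obtain ⟨j, hj⟩ := h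
  rw [targetExponent, ENNReal.inv_le_one]
  refine le_trans ?_ (Finset.single_le_sum (f := fun j => (X j).exponent⁻¹)
    (fun _ _ => zero_le) (Finset.mem_univ j))
  simp only [hj, Space.exponent, inv_one, le_refl]

lemma exists_bounds_of_slotBound {n : ℕ} (hn : 0 < n) (X : Fin n → Space)
    (hX : ∀ j, 1 ≤ (X j).exponent) (hs : targetExponent X < ∞) (C₀ : Fin n → ℝ≥0) :
    ∃ C : ℝ≥0, ∀ (φ : Fin n → DyadicInterval → ℝ → ℂ) (sq : Fin n → Prop) (a b : Fin n), a ≠ b →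
      sq a → sq b → (∀ j, SlotBound (normalized (φ j)) (X j) (C₀ j) (sq j)) → Bounds φ X C := by
  obtain ⟨C₁, hC₁⟩ := exists_eLpNorm_le_of_isMajorant hX (s := targetExponent X) rfl hs.ne
  -- The weak type lemma requires `s ≤ 1`, which an L¹ slot guarantees; without such a slot the
  -- constant is a dummy.
  have hw : ∃ C₂ : ℝ≥0, 0 < C₂ ∧ ((∃ j, X j = .lebesgue 1) →
      ∀ (t : Fin n → DyadicInterval → ℝ≥0∞) (m : Fin n → ℝ → ℝ≥0∞) (a b : Fin n), a ≠ b →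
      (∀ j I, t j I ≠ ∞) → (∀ j, IsMajorant (t j) (m j)) →
      IsSquareMajorant (t a) (m a) → IsSquareMajorant (t b) (m b) →
      ∀ A : Fin n → ℝ≥0∞, (∀ j, A j ≠ 0) → (∀ j, A j ≠ ∞) →
      (∀ j, WeakBound (m j) (X j).exponent (A j)) →
      WeakBound (fun x => ∑' I : DyadicInterval, I.toSet.indicator (fun _ => ∏ j, t j I) x)
        (targetExponent X) (C₂ * ∏ j, A j)) := by
    by_cases h1 : ∃ j, X j = .lebesgue 1
    · obtain ⟨C₂, h2, h3⟩ := exists_weakBound_of_isMajorant hn hX (s := targetExponent X) rfl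
        (targetExponent_le_one h1)
      exact ⟨C₂, h2, fun _ => h3⟩
    · exact ⟨1, one_pos, fun h => absurd h h1⟩
  obtain ⟨C₂, hC₂0, hC₂⟩ := hw
  refine ⟨(C₁ + C₂) * ∏ j, C₀ j, fun φ sq a b hab ha hb hslot f hf => ⟨fun hne => ?_, fun hex => ?_⟩⟩
  · choose m hm1 hm2 hm3 using fun j => (hslot j (f j) (hf j)).1 (hne j)
    rw [sublinearOp_eq]
    refine (hC₁ _ m a b hab (fun j I => coef_ne_top _ _ _) hm1 (hm2 a ha) (hm2 b hb)).trans ?_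
    calc (C₁ : ℝ≥0∞) * ∏ j, eLpNorm (m j) (X j).exponent volume
        ≤ C₁ * ∏ j, C₀ j * (X j).norm (f j) :=
          mul_le_mul' le_rfl (Finset.prod_le_prod' fun j _ => hm3 j)
      _ = C₁ * (∏ j, (C₀ j : ℝ≥0∞)) * ∏ j, (X j).norm (f j) := by
          rw [Finset.prod_mul_distrib, mul_assoc]
      _ ≤ _ := by
          push_cast
          gcongr
          exact le_self_add
  · have hNt : ∀ j, (X j).norm (f j) ≠ ∞ := fun j => (hf j).norm_ne_top
    set N : Fin n → ℝ≥0 := fun j => ((X j).norm (f j)).toNNReal with hN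
    have hNN : ∀ j, (X j).norm (f j) = N j := fun j => (ENNReal.coe_toNNReal (hNt j)).symm
    -- Weak bounds with constant zero cannot be converted into a weak norm. Each constant is
    -- enlarged by `ε`, and `ε` tends to 0 at the end.
    have hε : ∀ ε : ℝ≥0, 0 < ε → weakNorm (sublinearOp φ f) (targetExponent X) ≤
        ((C₂ * ∏ j, (C₀ j * N j + ε) : ℝ≥0) : ℝ≥0∞) := by
      intro ε hε
      have hA0 : ∀ j, ((C₀ j * N j + ε : ℝ≥0) : ℝ≥0∞) ≠ 0 := fun j =>
        ENNReal.coe_ne_zero.2 (by positivity)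
      choose m hm1 hm2 hm3 using fun j => (hslot j).weak (hX j) (hf j)
        (N := ((C₀ j * N j + ε : ℝ≥0) : ℝ≥0∞))
        (by rw [hNN j]; push_cast; exact le_self_add) (hA0 j) ENNReal.coe_ne_top
      have h1 := hC₂ hex (fun j => coef (f j) (normalized (φ j))) m a b hab
        (fun j I => coef_ne_top _ _ _) hm1 (hm2 a ha) (hm2 b hb) _ hA0
        (fun j => ENNReal.coe_ne_top) hm3
      rw [sublinearOp_eq]
      have h2 : (C₂ : ℝ≥0∞) * ∏ j, ((C₀ j * N j + ε : ℝ≥0) : ℝ≥0∞) =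
          ((C₂ * ∏ j, (C₀ j * N j + ε) : ℝ≥0) : ℝ≥0∞) := by
        push_cast; rfl
      rw [h2] at h1
      refine weakNorm_le_of_weakBound (targetExp_ne_zero hX) hs.ne ?_ ENNReal.coe_ne_top h1
      exact ENNReal.coe_ne_zero.2 (mul_ne_zero hC₂0.ne'
        (Finset.prod_ne_zero_iff.2 fun j _ => by positivity))
    have hcont : Continuous fun ε : ℝ≥0 => ((C₂ * ∏ j, (C₀ j * N j + ε) : ℝ≥0) : ℝ≥0∞) :=
      ENNReal.continuous_coe.comp (by fun_prop)
    have hlim : Tendsto (fun ε : ℝ≥0 => ((C₂ * ∏ j, (C₀ j * N j + ε) : ℝ≥0) : ℝ≥0∞)) (𝓝[>] 0)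
        (𝓝 ((C₂ * ∏ j, (C₀ j * N j + 0) : ℝ≥0) : ℝ≥0∞)) :=
      (hcont.tendsto 0).mono_left nhdsWithin_le_nhds
    refine (ge_of_tendsto hlim (eventually_nhdsWithin_of_forall fun ε h => hε ε h)).trans ?_
    simp_rw [hNN, add_zero]
    rw [Finset.prod_mul_distrib, ← mul_assoc]
    push_cast
    gcongr
    exact le_add_self

/-- Each extra condition serves one space: regularity on all intervals for atoms in arbitrary
position, integral zero for subtracting means in BMO, and the Haar functions because the dyadic BMO
seminorm sees only Haar coefficients. -/
lemma exists_slotBound (K : ℝ) (B : ℝ≥0) (X : Space) (hX : 1 ≤ X.exponent) : ∃ C : ℝ≥0,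
    ∀ φ : DyadicInterval → ℝ → ℂ, GoodFamily K (normalized φ) →
      (X = .hardy → ∀ u r : ℝ, RegularOn K (normalized φ) (Set.Icc u (u + r)) r) →
      (X = .bmo → ∀ I, ∫ x, normalized φ I x = 0) → (X = .dyadicBMO → φ = haar) →
      SlotBound (normalized φ) X C (SquareBounded B (normalized φ)) := by
  cases X with
  | lebesgue p =>
    by_cases hp : p = 1
    · subst hp
      obtain ⟨C, hC⟩ := exists_weakMajorized_one K B
      exact ⟨C, fun φ hφ _ _ _ f hf => ⟨fun h => absurd rfl h, fun _ => hC _ hφ f hf.1⟩⟩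
    · obtain ⟨C, hC⟩ := exists_majorized_lebesgue K B (lt_of_le_of_ne hX (Ne.symm hp))
      refine ⟨C, fun φ hφ _ _ _ f hf => ⟨fun _ => hC _ hφ f hf.1, fun h => ?_⟩⟩
      exact absurd (Space.lebesgue.inj h) hp
  | hardy =>
    obtain ⟨C, hC⟩ := exists_majorized_hardy K B
    exact ⟨C, fun φ hφ hr _ _ f hf => ⟨fun _ => hC _ hφ (hr rfl) f (memLp_one_iff_integrable.1 hf.1),
      fun h => by cases h⟩⟩
  | dyadicHardy =>
    obtain ⟨C, hC⟩ := exists_majorized_dyadicHardy K B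
    exact ⟨C, fun φ hφ _ _ _ f hf => ⟨fun _ => hC _ hφ f (memLp_one_iff_integrable.1 hf.1),
      fun h => by cases h⟩⟩
  | bmo =>
    obtain ⟨C, hC⟩ := exists_majorized_bmo K B
    exact ⟨C, fun φ hφ _ h0 _ f hf => ⟨fun _ => hC _ hφ (h0 rfl) f hf.1, fun h => by cases h⟩⟩
  | dyadicBMO =>
    refine ⟨2, fun φ _ _ _ hh f hf => ⟨fun _ => ?_, fun h => by cases h⟩⟩
    rw [hh rfl]
    refine majorized_of_tsum_le _ fun J => ?_
    have h1 : ((ENNReal.ofReal J.length)⁻¹ * ∑' I : {I : DyadicInterval // I.toSet ⊆ J.toSet},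
        ‖pairing f (haar I.1)‖ₑ ^ 2) ^ (1 / 2 : ℝ) ≤ dyadicBMONorm f :=
      le_iSup (fun J : DyadicInterval => ((ENNReal.ofReal J.length)⁻¹ *
        ∑' I : {I : DyadicInterval // I.toSet ⊆ J.toSet},
          ‖pairing f (haar I.1)‖ₑ ^ 2) ^ (1 / 2 : ℝ)) J
    have h2 := pow_le_pow_left' h1 2
    rw [ENNReal.rpow_half_sq, ENNReal.inv_mul_le_iff (ofReal_length_ne_zero J)
      ENNReal.ofReal_ne_top] at h2
    simp_rw [enorm_pairing_haar] at h2
    exact h2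

lemma exists_bounds_adapted {n : ℕ} (hn : 0 < n) (X : Fin n → Space)
    (hX : ∀ j, 1 ≤ (X j).exponent) (hs : targetExponent X < ∞) (hX' : ∀ j, X j ≠ .dyadicBMO) (K : ℝ) :
    ∃ C : ℝ≥0, ∀ φ : Fin n → DyadicInterval → ℝ → ℂ, (∀ j I, IsAdapted K 5 I (φ j I)) →
      (∃ a b, a ≠ b ∧ HasMeanZero (φ a) ∧ HasMeanZero (φ b)) →
      (∀ j, X j = .bmo → HasMeanZero (φ j)) → Bounds φ X C := by
  obtain ⟨B, hB⟩ := exists_squareBounded_normalized K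
  choose C₀ hC₀ using fun j => exists_slotBound (4 * |K|) B (X j) (hX j)
  obtain ⟨C, hC⟩ := exists_bounds_of_slotBound hn X hX hs C₀
  refine ⟨C, fun φ hφ hab hbmo => ?_⟩
  obtain ⟨a, b, hne, ha, hb⟩ := hab
  exact hC φ _ a b hne (hB _ (hφ a) ha) (hB _ (hφ b) hb) fun j =>
    hC₀ j (φ j) (goodFamily_normalized (hφ j)) (fun _ => regularOn_normalized (hφ j))
      (fun h => integral_normalized (hbmo j h)) (fun h => absurd h (hX' j))

lemma exists_bounds_haar {n : ℕ} (hn : 0 < n) (X : Fin n → Space)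
    (hX : ∀ j, 1 ≤ (X j).exponent) (hs : targetExponent X < ∞)
    (hX' : ∀ j, X j ≠ .hardy ∧ X j ≠ .bmo) :
    ∃ C : ℝ≥0, ∀ φ : Fin n → DyadicInterval → ℝ → ℂ, (∀ j, φ j = haar ∨ φ j = absHaar) →
      (∃ a b, a ≠ b ∧ φ a = haar ∧ φ b = haar) → (∀ j, X j = .dyadicBMO → φ j = haar) →
      Bounds φ X C := by
  choose C₀ hC₀ using fun j => exists_slotBound 5 1 (X j) (hX j)
  obtain ⟨C, hC⟩ := exists_bounds_of_slotBound hn X hX hs C₀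
  refine ⟨C, fun φ hφ hab hbmo => ?_⟩
  obtain ⟨a, b, hne, ha, hb⟩ := hab
  refine hC φ _ a b hne (ha ▸ squareBounded_normalized_haar) (hb ▸ squareBounded_normalized_haar)
    fun j => hC₀ j (φ j) ?_ (fun h => absurd h (hX' j).1) (fun h => absurd h (hX' j).2) (hbmo j)
  rcases hφ j with h | h <;> rw [h]
  · exact goodFamily_normalized_haar
  · exact goodFamily_normalized_absHaar

end Paraproduct

/-! ### An odd bump and the adapted functions built from it. -/

namespace Paraproduct

open DyadicInterval

/-- An odd continuously differentiable function supported in `[-1, 1]`. -/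
noncomputable def bump (u : ℝ) : ℝ := max 0 (1 - u ^ 2) ^ 2 * u

lemma hasDerivAt_max_zero_sq (t : ℝ) : HasDerivAt (fun t : ℝ => max 0 t ^ 2) (2 * max 0 t) t := by
  rcases lt_trichotomy t 0 with h | rfl | h
  · rw [max_eq_left h.le, mul_zero]
    refine (hasDerivAt_const t (0 : ℝ)).congr_of_eventuallyEq ?_
    filter_upwards [Iio_mem_nhds h] with y hy
    rw [max_eq_left (le_of_lt hy)]
    norm_num
  · rw [max_self, mul_zero, hasDerivAt_iff_isLittleO]
    have h1 : (fun y : ℝ => max 0 y ^ 2 - max 0 0 ^ 2 - (y - 0) • (0 : ℝ)) =O[𝓝 0]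
        fun y : ℝ => y ^ 2 := by
      refine Asymptotics.IsBigO.of_bound 1 (Eventually.of_forall fun y => ?_)
      simp only [max_self, smul_zero, sub_zero, norm_pow, one_mul]
      norm_num
      rcases le_total y 0 with hy | hy
      · rw [max_eq_left hy]; norm_num; positivity
      · rw [max_eq_right hy]
    refine h1.trans_isLittleO ?_
    simpa using Asymptotics.isLittleO_pow_id (𝕜 := ℝ) (n := 2) (by norm_num)
  · rw [max_eq_right h.le]
    have h1 : HasDerivAt (fun y : ℝ => y ^ 2) (2 * t) t := by simpa using hasDerivAt_pow 2 t
    refine h1.congr_of_eventuallyEq ?_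
    filter_upwards [Ioi_mem_nhds h] with y hy
    rw [max_eq_right (le_of_lt hy)]

lemma hasDerivAt_bump (u : ℝ) : HasDerivAt bump
    (2 * max 0 (1 - u ^ 2) * (-(2 * u)) * u + max 0 (1 - u ^ 2) ^ 2) u := by
  have h1 : HasDerivAt (fun u : ℝ => 1 - u ^ 2) (-(2 * u)) u := by
    have := (hasDerivAt_pow 2 u).const_sub 1
    simpa using this
  have h2 := (hasDerivAt_max_zero_sq (1 - u ^ 2)).comp u h1
  refine ((h2.mul (hasDerivAt_id u)).congr_deriv (by simp)).congr_of_eventuallyEq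
    (Eventually.of_forall fun _ => rfl)

lemma continuous_bump : Continuous bump := by
  unfold bump
  fun_prop

lemma bump_eq_zero {u : ℝ} (h : 1 ≤ |u|) : bump u = 0 := by
  have : 1 - u ^ 2 ≤ 0 := by
    have := one_le_sq_iff_one_le_abs u |>.2 h
    linarith
  rw [bump, max_eq_left this]
  ring

lemma max_zero_le_one (u : ℝ) : max 0 (1 - u ^ 2) ≤ 1 := max_le zero_le_one (by nlinarith [sq_nonneg u])

lemma abs_bump_le (u : ℝ) : |bump u| ≤ 1 := by
  rcases le_or_gt 1 |u| with h | h
  · rw [bump_eq_zero h]; norm_num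
  · rw [bump, abs_mul, abs_of_nonneg (by positivity)]
    have h1 := max_zero_le_one u
    have h2 : 0 ≤ max 0 (1 - u ^ 2) := le_max_left _ _
    exact mul_le_one₀ (pow_le_one₀ h2 h1) (abs_nonneg u) h.le

lemma deriv_bump_eq_zero {u : ℝ} (h : 1 < |u|) : deriv bump u = 0 := by
  have : 1 - u ^ 2 ≤ 0 := by
    have := one_le_sq_iff_one_le_abs u |>.2 h.le
    linarith
  rw [(hasDerivAt_bump u).deriv, max_eq_left this]
  ring

lemma abs_deriv_bump_le (u : ℝ) : |deriv bump u| ≤ 5 := by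
  rcases lt_or_ge 1 |u| with h | h
  · rw [deriv_bump_eq_zero h]; norm_num
  · rw [(hasDerivAt_bump u).deriv]
    have h1 := max_zero_le_one u
    have h2 : 0 ≤ max 0 (1 - u ^ 2) := le_max_left _ _
    have h3 : u ^ 2 ≤ 1 := (sq_le_one_iff_abs_le_one u).2 h
    have h4 := sq_nonneg u
    set M := max 0 (1 - u ^ 2)
    rw [abs_le]
    constructor <;> nlinarith [mul_nonneg h2 h4, mul_le_mul h1 h3 h4 zero_le_one]

lemma bump_neg (u : ℝ) : bump (-u) = -bump u := by
  rw [bump, bump, neg_sq]; ring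

lemma integral_bump : ∫ u, bump u = 0 := by
  have h1 := integral_neg_eq_self bump volume
  simp_rw [bump_neg, integral_neg] at h1
  linarith

lemma hasCompactSupport_bump : HasCompactSupport bump :=
  HasCompactSupport.of_support_subset_isCompact (isCompact_Icc (a := -1) (b := 1)) fun u hu => by
    by_contra hcon
    refine hu (bump_eq_zero ?_)
    by_contra hlt
    push Not at hlt
    exact hcon ⟨by linarith [(abs_lt.1 hlt).1], by linarith [(abs_lt.1 hlt).2]⟩

lemma bump_half_ne_zero : bump (1 / 2) ≠ 0 := by
  rw [bump]
  norm_num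

lemma integral_bump_sq_pos : 0 < ∫ u, bump u ^ 2 := by
  refine Continuous.integral_pos_of_hasCompactSupport_nonneg_nonzero (x := 1 / 2)
    (continuous_bump.pow 2) ?_ (fun u => sq_nonneg _) (pow_ne_zero 2 bump_half_ne_zero)
  exact hasCompactSupport_bump.comp_left (g := fun y => y ^ 2) (by norm_num)

lemma integral_abs_bump_pos : 0 < ∫ u, |bump u| := by
  refine Continuous.integral_pos_of_hasCompactSupport_nonneg_nonzero (x := 1 / 2)
    continuous_bump.abs ?_ (fun u => abs_nonneg _) (abs_ne_zero.2 bump_half_ne_zero)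
  exact hasCompactSupport_bump.comp_left (g := fun y => |y|) (by norm_num)

/-- The constant which normalizes the bump functions in `L²`. -/
noncomputable def bumpConst : ℝ := 2 / Real.sqrt (∫ u, bump u ^ 2)

lemma bumpConst_pos : 0 < bumpConst := div_pos two_pos (Real.sqrt_pos.2 integral_bump_sq_pos)

/-- The value 4 compensates the dilation by `4 / |I|` in `wave`. -/
lemma bumpConst_sq : bumpConst ^ 2 * ∫ u, bump u ^ 2 = 4 := by
  have h := integral_bump_sq_pos
  rw [bumpConst, div_pow, Real.sq_sqrt h.le]
  field_simp
  norm_num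

/-- The functions obtained from the bump function by dilations and translations. -/
noncomputable def wave (b : ℝ) (I : DyadicInterval) (x : ℝ) : ℂ :=
  ((bumpConst * I.length ^ (-(1 / 2 : ℝ)) * bump (4 / I.length * (x - I.left) - b) : ℝ) : ℂ)

lemma integral_comp_affine (g : ℝ → ℝ) (I : DyadicInterval) (b : ℝ) :
    ∫ x, g (4 / I.length * (x - I.left) - b) = I.length / 4 * ∫ u, g u := by
  have hl := I.length_pos
  rw [integral_sub_right_eq_self (fun x => g (4 / I.length * x - b)) I.left,
    Measure.integral_comp_mul_left (fun y => g (y - b)), integral_sub_right_eq_self g b, inv_div,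
    abs_of_pos (by positivity), smul_eq_mul]

section Wave

variable (b : ℝ) (I : DyadicInterval)

lemma integral_wave : ∫ x, wave b I x = 0 := by
  have h : ∫ x, bumpConst * I.length ^ (-(1 / 2 : ℝ)) *
      bump (4 / I.length * (x - I.left) - b) = 0 := by
    rw [integral_const_mul, integral_comp_affine bump, integral_bump, mul_zero, mul_zero]
  exact (integral_ofReal (𝕜 := ℂ)).trans ((congrArg Complex.ofReal h).trans Complex.ofReal_zero)

lemma norm_wave (x : ℝ) : ‖wave b I x‖ =
    bumpConst * I.length ^ (-(1 / 2 : ℝ)) * |bump (4 / I.length * (x - I.left) - b)| := by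
  have hr : 0 < I.length ^ (-(1 / 2 : ℝ)) := Real.rpow_pos_of_pos I.length_pos _
  have hc := bumpConst_pos
  rw [wave, Complex.norm_real, Real.norm_eq_abs, abs_mul, abs_of_pos (by positivity)]

lemma hasCompactSupport_comp_affine {g : ℝ → ℝ} (hg : HasCompactSupport g) :
    HasCompactSupport fun x => g (4 / I.length * (x - I.left) - b) := by
  have hl := I.length_pos
  have h4 : (4 / I.length) ≠ 0 := by positivity
  exact hg.comp_homeomorph (((Homeomorph.subRight I.left).trans
    (Homeomorph.mulLeft₀ _ h4)).trans (Homeomorph.subRight b))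

lemma eLpNorm_wave : eLpNorm (wave b I) 2 volume = 1 := by
  have hl := I.length_pos
  have hr : 0 < I.length ^ (-(1 / 2 : ℝ)) := Real.rpow_pos_of_pos hl _
  have hrr : (I.length ^ (-(1 / 2 : ℝ))) ^ 2 = (I.length)⁻¹ := by
    rw [← Real.rpow_natCast, ← Real.rpow_mul hl.le]
    norm_num
    exact Real.rpow_neg_one _
  have h1 : ∫⁻ x, ‖wave b I x‖ₑ ^ (2 : ℝ) = 1 := by
    have h2 : ∀ x, ‖wave b I x‖ₑ ^ (2 : ℝ) = ENNReal.ofReal (bumpConst ^ 2 * (I.length)⁻¹ *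
        bump (4 / I.length * (x - I.left) - b) ^ 2) := by
      intro x
      rw [← ofReal_norm, ENNReal.rpow_two, ← ENNReal.ofReal_pow (norm_nonneg _), norm_wave, mul_pow,
        mul_pow, sq_abs, hrr]
    simp_rw [h2]
    rw [← ofReal_integral_eq_lintegral_ofReal]
    · rw [integral_const_mul, integral_comp_affine (fun u => bump u ^ 2)]
      have : bumpConst ^ 2 * (I.length)⁻¹ * (I.length / 4 * ∫ u, bump u ^ 2) =
          (bumpConst ^ 2 * ∫ u, bump u ^ 2) / 4 := by
        field_simp
      rw [this, bumpConst_sq]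
      norm_num
    · refine Continuous.integrable_of_hasCompactSupport ?_ ?_
      · have := continuous_bump
        fun_prop
      · refine HasCompactSupport.mul_left ?_
        exact hasCompactSupport_comp_affine b I (g := fun u => bump u ^ 2)
          (hasCompactSupport_bump.comp_left (g := fun y => y ^ 2) (by norm_num))
    · exact Eventually.of_forall fun x => by
        have := bumpConst_pos
        simp only [Pi.zero_apply]
        positivity
  rw [eLpNorm_eq_lintegral_rpow_enorm_toReal (by simp) (by simp)]
  simp only [ENNReal.toReal_ofNat]
  rw [h1]
  simp

variable {b I}

lemma hasDerivAt_wave (x : ℝ) : HasDerivAt (wave b I)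
    ((bumpConst * I.length ^ (-(1 / 2 : ℝ)) *
      (deriv bump (4 / I.length * (x - I.left) - b) * (4 / I.length)) : ℝ) : ℂ) x := by
  have h1 : HasDerivAt (fun x => 4 / I.length * (x - I.left) - b) (4 / I.length) x := by
    have := (((hasDerivAt_id x).sub_const I.left).const_mul (4 / I.length)).sub_const b
    simpa using this
  have h2 := (hasDerivAt_bump (4 / I.length * (x - I.left) - b)).differentiableAt.hasDerivAt.comp x h1
  exact (h2.const_mul _).ofReal_comp

/-- For these `b` the support of `wave b I` lies within distance `|I|` of the center of `I`, where
the decay factor is at least `2 ^ (-N)`. Decay of any order therefore costs only a constant. The 20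
is the bound 5 for the derivative of the bump times the dilation factor 4. -/
lemma isAdapted_wave (hb1 : 1 / 2 ≤ b) (hb3 : b ≤ 3) (N : ℕ) :
    IsAdapted (20 * bumpConst * 2 ^ N) N I (wave b I) := by
  have hl := I.length_pos
  have hc := bumpConst_pos
  have hr : 0 < I.length ^ (-(1 / 2 : ℝ)) := Real.rpow_pos_of_pos hl _
  have hr3 : I.length ^ (-(3 / 2 : ℝ)) = I.length ^ (-(1 / 2 : ℝ)) * (I.length)⁻¹ := by
    rw [← Real.rpow_neg_one, ← Real.rpow_add hl]
    norm_num
  have hw : ∀ x, |4 / I.length * (x - I.left) - b| ≤ 1 →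
      1 ≤ (2 : ℝ) ^ N * (1 + |x - I.center| / I.length) ^ (-(N : ℤ)) := by
    intro x hx
    have h1 : |x - I.center| / I.length ≤ 1 := by
      rw [div_le_one hl, abs_le, center]
      have h2 : 4 / I.length * (x - I.left) = 4 * ((x - I.left) / I.length) := by ring
      rw [h2, abs_le] at hx
      have h3 : (x - I.left) / I.length ≤ 1 := by linarith [hx.2]
      have h4 : -(1 / 2) ≤ (x - I.left) / I.length := by linarith [hx.1]
      rw [div_le_one hl] at h3
      rw [le_div_iff₀ hl] at h4
      constructor <;> linarith
    have h0 : 0 ≤ |x - I.center| / I.length := by positivity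
    rw [zpow_neg, zpow_natCast, ← div_eq_mul_inv, one_le_div (by positivity)]
    exact pow_le_pow_left₀ (by positivity) (by linarith) N
  refine ⟨fun x => (hasDerivAt_wave x).differentiableAt, (eLpNorm_wave b I).le, fun x => ?_,
    fun x => ?_⟩
  · rw [norm_wave]
    have hnn : 0 ≤ (1 + |x - I.center| / I.length) ^ (-(N : ℤ)) := zpow_nonneg (by positivity) _
    rcases le_or_gt |4 / I.length * (x - I.left) - b| 1 with h | h
    · calc bumpConst * I.length ^ (-(1 / 2 : ℝ)) * |bump (4 / I.length * (x - I.left) - b)|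
          ≤ bumpConst * I.length ^ (-(1 / 2 : ℝ)) * 1 := by gcongr; exact abs_bump_le _
        _ ≤ 20 * (bumpConst * I.length ^ (-(1 / 2 : ℝ))) * 1 := by
            have : 0 < bumpConst * I.length ^ (-(1 / 2 : ℝ)) := by positivity
            linarith
        _ ≤ 20 * (bumpConst * I.length ^ (-(1 / 2 : ℝ))) *
              ((2 : ℝ) ^ N * (1 + |x - I.center| / I.length) ^ (-(N : ℤ))) := by
            gcongr
            exact hw x h
        _ = _ := by ring
    · rw [bump_eq_zero h.le, abs_zero, mul_zero]
      positivity
  · rw [(hasDerivAt_wave x).deriv, Complex.norm_real, Real.norm_eq_abs, abs_mul,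
      abs_of_pos (mul_pos hc hr), abs_mul, abs_of_pos (show 0 < 4 / I.length by positivity), hr3]
    have hnn : 0 ≤ (1 + |x - I.center| / I.length) ^ (-(N : ℤ)) := zpow_nonneg (by positivity) _
    rcases le_or_gt |4 / I.length * (x - I.left) - b| 1 with h | h
    · calc bumpConst * I.length ^ (-(1 / 2 : ℝ)) *
            (|deriv bump (4 / I.length * (x - I.left) - b)| * (4 / I.length))
          ≤ bumpConst * I.length ^ (-(1 / 2 : ℝ)) * (5 * (4 / I.length)) := by
            gcongr; exact abs_deriv_bump_le _
        _ = 20 * bumpConst * (I.length ^ (-(1 / 2 : ℝ)) * (I.length)⁻¹) * 1 := by ring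
        _ ≤ 20 * bumpConst * (I.length ^ (-(1 / 2 : ℝ)) * (I.length)⁻¹) *
              ((2 : ℝ) ^ N * (1 + |x - I.center| / I.length) ^ (-(N : ℤ))) := by
            gcongr
            exact hw x h
        _ = _ := by ring
    · rw [deriv_bump_eq_zero h, abs_zero, zero_mul, mul_zero]
      positivity

end Wave

end Paraproduct

/-! ### Test functions on the shells and their norms. -/

namespace Paraproduct

open DyadicInterval

/-- The dyadic interval `[2 ^ (-l - 1), 2 ^ (-l))`. -/
def shell (l : ℕ) : DyadicInterval := ⟨-l - 1, 1⟩

/-- The dyadic interval `[0, 2 ^ (-k))`. -/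
def base (k : ℕ) : DyadicInterval := ⟨-k, 0⟩

lemma length_base (k : ℕ) : (base k).length = ((2 : ℝ) ^ k)⁻¹ := by
  rw [length, base, zpow_neg, zpow_natCast]

lemma left_base (k : ℕ) : (base k).left = 0 := by
  rw [left, base, Int.cast_zero, zero_mul]

lemma rightHalf_base (k : ℕ) : (base k).rightHalf = shell k := by
  simp [rightHalf, base, shell]

lemma length_shell (l : ℕ) : (shell l).length = ((2 : ℝ) ^ l)⁻¹ / 2 := by
  rw [← rightHalf_base, length_rightHalf, length_base]

lemma left_shell (l : ℕ) : (shell l).left = (shell l).length := by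
  rw [left, shell, Int.cast_one, one_mul]

lemma shell_subset_base (k : ℕ) : (shell k).toSet ⊆ (base k).toSet := by
  rw [← rightHalf_base]
  exact (base k).rightHalf_subset

lemma shell_injective {l l' : ℕ} {x : ℝ} (h : x ∈ (shell l).toSet) (h' : x ∈ (shell l').toSet) :
    l = l' := by
  wlog hlt : l ≤ l' generalizing l l'
  · exact (this h' h (le_of_not_ge hlt)).symm
  by_contra hne
  have hlt' : l + 1 ≤ l' := by omega
  have h1 : x < (base l').length := by
    have := (shell_subset_base l' h').2
    rwa [left_base, zero_add] at this
  have h2 := h.1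
  rw [left_shell, length_shell] at h2
  rw [length_base] at h1
  have h3 : ((2 : ℝ) ^ l')⁻¹ ≤ ((2 : ℝ) ^ (l + 1))⁻¹ := by
    gcongr
    norm_num
  rw [pow_succ, mul_inv] at h3
  linarith

/-- The sum of the functions `2 ^ (l e) |I|^(1/2) h_I` over the first `m` shells. -/
noncomputable def testFn (e : ℝ) (m : ℕ) (x : ℝ) : ℂ :=
  ∑ l ∈ Finset.range m, (((2 : ℝ) ^ (l * e) * (shell l).length : ℝ) : ℂ) * normalized haar (shell l) x

variable {e : ℝ} {m : ℕ}

lemma testFn_of_mem {l : ℕ} (hl : l < m) {x : ℝ} (hx : x ∈ (shell l).toSet) : testFn e m x =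
    (((2 : ℝ) ^ (l * e) * (shell l).length : ℝ) : ℂ) * normalized haar (shell l) x := by
  refine Finset.sum_eq_single_of_mem l (Finset.mem_range.2 hl) fun l' _ hne => ?_
  rw [normalized_haar_of_notMem fun h => hne (shell_injective h hx), mul_zero]

lemma norm_testFn_of_mem {l : ℕ} (hl : l < m) {x : ℝ} (hx : x ∈ (shell l).toSet) :
    ‖testFn e m x‖ = (2 : ℝ) ^ (l * e) := by
  have hlen := (shell l).length_pos
  rw [testFn_of_mem hl hx, norm_mul, norm_normalized_haar_of_mem hx, Complex.norm_real,
    Real.norm_of_nonneg (by positivity)]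
  field_simp

lemma testFn_eq_zero {x : ℝ} (h : ∀ l < m, x ∉ (shell l).toSet) : testFn e m x = 0 :=
  Finset.sum_eq_zero fun l hl => by
    rw [normalized_haar_of_notMem (h l (Finset.mem_range.1 hl)), mul_zero]

lemma integrable_testFn : Integrable (testFn e m) :=
  integrable_finsetSum _ fun l _ => (goodFamily_normalized_haar.integrable (shell l)).const_mul _

lemma enorm_testFn_rpow_le {p : ℝ} (hp : 0 < p) (x : ℝ) : ‖testFn (1 / p) m x‖ₑ ^ p ≤
    ∑ l ∈ Finset.range m, (shell l).toSet.indicator (fun _ => ENNReal.ofReal (2 ^ l)) x := by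
  by_cases h : ∃ l < m, x ∈ (shell l).toSet
  · obtain ⟨l, hl, hx⟩ := h
    refine le_trans (le_of_eq ?_) (Finset.single_le_sum (fun _ _ => zero_le)
      (Finset.mem_range.2 hl))
    rw [Set.indicator_of_mem hx, ← ofReal_norm, norm_testFn_of_mem hl hx,
      ENNReal.ofReal_rpow_of_nonneg (by positivity) hp.le, ← Real.rpow_mul two_pos.le, mul_assoc,
      one_div_mul_cancel hp.ne', mul_one, Real.rpow_natCast]
  · push Not at h
    rw [testFn_eq_zero h, enorm_zero, ENNReal.zero_rpow_of_pos hp]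
    exact zero_le

lemma ofReal_two_pow_mul_volume_shell (l : ℕ) :
    ENNReal.ofReal (2 ^ l) * volume (shell l).toSet = ENNReal.ofReal (1 / 2) := by
  rw [volume_toSet, length_shell, ← ENNReal.ofReal_mul (by positivity)]
  congr 1
  field_simp

/-- The shells are disjoint and the `p`-th power of the modulus is `2 ^ l` on the shell of length `2
^ (-l - 1)`, so each contributes `1 / 2`. For `p = ∞` the exponent `1 / p.toReal` is `1 / 0 = 0`,
and the function is bounded by 1. -/
lemma eLpNorm_testFn_le {p : ℝ≥0∞} (hp : 1 ≤ p) :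
    eLpNorm (testFn (1 / p.toReal) m) p volume ≤ ENNReal.ofReal ((m : ℝ) ^ (1 / p.toReal)) := by
  rcases eq_or_ne p ∞ with rfl | hpt
  · rw [eLpNorm_exponent_top, ENNReal.toReal_top, div_zero, Real.rpow_zero, ENNReal.ofReal_one]
    refine eLpNormEssSup_le_of_ae_enorm_bound (Eventually.of_forall fun x => ?_)
    by_cases h : ∃ l < m, x ∈ (shell l).toSet
    · obtain ⟨l, hl, hx⟩ := h
      rw [← ofReal_norm, norm_testFn_of_mem hl hx]
      simp
    · push Not at h
      rw [testFn_eq_zero h, enorm_zero]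
      exact zero_le
  · have hp0 : 0 < p.toReal := ENNReal.toReal_pos (one_pos.trans_le hp).ne' hpt
    rw [eLpNorm_eq_lintegral_rpow_enorm_toReal (one_pos.trans_le hp).ne' hpt,
      ← ENNReal.ofReal_rpow_of_nonneg (by positivity) (by positivity)]
    refine ENNReal.rpow_le_rpow ?_ (by positivity)
    refine (lintegral_mono (enorm_testFn_rpow_le hp0)).trans ?_
    rw [lintegral_finsetSum _ fun l _ => measurable_const.indicator (measurableSet_toSet _)]
    calc ∑ l ∈ Finset.range m, ∫⁻ x, (shell l).toSet.indicator
          (fun _ => ENNReal.ofReal (2 ^ l)) x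
        ≤ ∑ l ∈ Finset.range m, 1 := by
          refine Finset.sum_le_sum fun l _ => ?_
          rw [lintegral_indicator_const (measurableSet_toSet _), ofReal_two_pow_mul_volume_shell]
          exact ENNReal.ofReal_le_one.2 (by norm_num)
      _ = ENNReal.ofReal m := by simp

lemma testFn_one (x : ℝ) :
    testFn 1 m x = ∑ l ∈ Finset.range m, (1 / 2 : ℂ) * normalized haar (shell l) x := by
  refine Finset.sum_congr rfl fun l _ => ?_
  congr 1
  rw [length_shell, mul_one, Real.rpow_natCast,
    show (2 : ℝ) ^ l * (((2 : ℝ) ^ l)⁻¹ / 2) = 1 / 2 by field_simp]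
  norm_num

lemma isAtom_normalized_haar (I : DyadicInterval) : IsAtom (normalized haar I) := by
  refine ⟨measurable_normalized_haar I, I.left, I.left + I.length, by linarith [I.length_pos],
    fun x hx => normalized_haar_of_notMem fun h => hx (Set.Ico_subset_Icc_self h), fun x => ?_,
    integral_normalized_haar I⟩
  rw [add_sub_cancel_left, one_div]
  by_cases hx : x ∈ I.toSet
  · exact (norm_normalized_haar_of_mem hx).le
  · rw [normalized_haar_of_notMem hx, norm_zero]
    exact (inv_pos.2 I.length_pos).le

/-- For exponent 1 the test function is half the sum of `m` normalized Haar functions, each of which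
is an atom. -/
lemma hardyNorm_testFn_le : hardyNorm (testFn 1 m) ≤ ENNReal.ofReal m := by
  set c : ℕ → ℂ := fun k => if k < m then 1 / 2 else 0 with hc
  have hlim : Tendsto (fun M : ℕ => eLpNorm (fun x => testFn 1 m x -
      ∑ k ∈ Finset.range M, c k * normalized haar (shell k) x) 1 volume) atTop (𝓝 0) := by
    refine tendsto_const_nhds.congr' ?_
    filter_upwards [eventually_ge_atTop m] with M hM
    have h : (fun x => testFn 1 m x - ∑ k ∈ Finset.range M, c k * normalized haar (shell k) x) =
        0 := by
      funext x
      rw [testFn_one, Pi.zero_apply, sub_eq_zero]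
      refine (Finset.sum_congr rfl fun k hk => ?_).trans (Finset.sum_subset
        (Finset.range_subset_range.2 hM) fun k _ hk => ?_)
      · rw [hc]; simp only [if_pos (Finset.mem_range.1 hk)]
      · rw [hc]; simp only [if_neg fun h => hk (Finset.mem_range.2 h), zero_mul]
    rw [h, eLpNorm_zero]
  refine iInf₂_le_of_le c (fun k => normalized haar (shell k))
    (iInf₂_le_of_le (fun k => isAtom_normalized_haar _) hlim ?_)
  rw [tsum_eq_sum (s := Finset.range m) fun k hk => by
    rw [hc]; simp only [if_neg fun h => hk (Finset.mem_range.2 h), enorm_zero]]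
  calc ∑ k ∈ Finset.range m, ‖c k‖ₑ ≤ ∑ k ∈ Finset.range m, 1 := by
        refine Finset.sum_le_sum fun k hk => ?_
        rw [hc]
        simp only [if_pos (Finset.mem_range.1 hk)]
        rw [← ofReal_norm]
        exact ENNReal.ofReal_le_one.2 (by norm_num)
    _ = ENNReal.ofReal m := by simp

lemma coef_testFn_one_le (J : DyadicInterval) : coef (testFn 1 m) (normalized haar) J ≤
    ∑ l ∈ Finset.range m, ENNReal.ofReal ‖pairing (normalized haar J) (normalized haar (shell l))‖ := by
  have h : pairing (testFn 1 m) (normalized haar J) = ∑ l ∈ Finset.range m,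
      (1 / 2 : ℂ) * pairing (normalized haar (shell l)) (normalized haar J) := by
    unfold pairing
    simp_rw [testFn_one, Finset.sum_mul, mul_assoc]
    rw [integral_finsetSum]
    · simp_rw [integral_const_mul]
    · exact fun l _ => ((goodFamily_normalized_haar.memLp_two (shell l)).integrable_mul
        (goodFamily_normalized_haar.memLp_two J).star).const_mul _
  rw [coef, h]
  refine (enorm_sum_le _ _).trans (Finset.sum_le_sum fun l _ => ?_)
  rw [← ofReal_norm, norm_mul, norm_pairing_comm]
  refine ENNReal.ofReal_le_ofReal ?_
  norm_num
  linarith [norm_nonneg (pairing (normalized haar J) (normalized haar (shell l)))]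

/-- The square function is bounded by the ℓ¹ sum, whose integral splits into `m` row sums of the
Haar Gram matrix, each at most 1. -/
lemma dyadicHardyNorm_testFn_le : dyadicHardyNorm (testFn 1 m) ≤ ENNReal.ofReal (2 * m) := by
  have h1 : eLpNorm (testFn 1 m) 1 volume ≤ ENNReal.ofReal m := by
    have := eLpNorm_testFn_le (p := 1) (m := m) le_rfl
    simpa using this
  have h2 : eLpNorm (dyadicSquare (testFn 1 m)) 1 volume ≤ ENNReal.ofReal m := by
    rw [eLpNorm_one_eq_lintegral_enorm, dyadicSquare_eq]
    simp only [enorm_eq_self]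
    refine (lintegral_mono fun x => slotFunctional_squareFn.le_fullSum _ x).trans ?_
    have h3 := setLIntegral_fullSum (coef (testFn 1 m) (normalized haar)) (E := ∅)
    simp only [Set.compl_empty, Measure.restrict_univ, Set.sdiff_empty, volume_toSet] at h3
    rw [h3]
    calc ∑' J : DyadicInterval, coef (testFn 1 m) (normalized haar) J * ENNReal.ofReal J.length
        ≤ ∑' J : DyadicInterval, ∑ l ∈ Finset.range m, ENNReal.ofReal J.length *
            ENNReal.ofReal ‖pairing (normalized haar J) (normalized haar (shell l))‖ := by
          refine ENNReal.tsum_le_tsum fun J => ?_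
          rw [← Finset.mul_sum, mul_comm]
          exact mul_le_mul' le_rfl (coef_testFn_one_le J)
      _ = ∑ l ∈ Finset.range m, ∑' J : DyadicInterval, ENNReal.ofReal J.length *
            ENNReal.ofReal ‖pairing (normalized haar J) (normalized haar (shell l))‖ :=
          Summable.tsum_finsetSum fun _ _ => ENNReal.summable
      _ ≤ ∑ l ∈ Finset.range m, 1 :=
          Finset.sum_le_sum fun l _ => by exact_mod_cast tsum_pairing_normalized_haar_le (shell l)
      _ = ENNReal.ofReal m := by simp
  rw [two_mul, ENNReal.ofReal_add (by positivity) (by positivity)]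
  exact add_le_add h1 h2

lemma bmoNorm_le_of_norm_le_one {f : ℝ → ℂ} (hf : LocallyIntegrable f) (h : ∀ x, ‖f x‖ₑ ≤ 1) :
    bmoNorm f ≤ 2 := by
  refine iSup_le fun u => iSup₂_le fun v huv => ?_
  have hpos : 0 < v - u := sub_pos.2 huv
  have hpos' : ENNReal.ofReal (v - u) ≠ 0 := (ENNReal.ofReal_pos.2 hpos).ne'
  have h1 : ∫⁻ x in Set.Icc u v, ‖f x - 0‖ₑ ≤ ENNReal.ofReal (v - u) := by
    refine (lintegral_mono fun x => ?_).trans (setLIntegral_one (Set.Icc u v)).le |>.trans ?_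
    · rw [sub_zero]; exact h x
    · rw [Real.volume_Icc]
  have h2 : ‖⨍ y in Set.Icc u v, f y‖ₑ ≤ 1 := by
    have := enorm_mean_sub_le hf huv 0
    rw [sub_zero] at this
    refine this.trans ?_
    rw [ENNReal.inv_mul_le_iff hpos' ENNReal.ofReal_ne_top, mul_one]
    exact h1
  rw [ENNReal.inv_mul_le_iff hpos' ENNReal.ofReal_ne_top]
  calc ∫⁻ x in Set.Icc u v, ‖f x - ⨍ y in Set.Icc u v, f y‖ₑ
      ≤ ∫⁻ _ in Set.Icc u v, 2 := lintegral_mono fun x => by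
        refine enorm_sub_le.trans ((add_le_add (h x) h2).trans (le_of_eq (by norm_num)))
    _ = _ := by rw [setLIntegral_const, Real.volume_Icc, mul_comm]

lemma Space.norm_testFn_le {X : Space} (hX : X ≠ .dyadicBMO) (h1 : 1 ≤ X.exponent) (m : ℕ) :
    X.norm (testFn (1 / X.exponent.toReal) m) ≤
      ENNReal.ofReal (2 * (m : ℝ) ^ (1 / X.exponent.toReal)) := by
  have h2 : ENNReal.ofReal ((m : ℝ) ^ (1 / X.exponent.toReal)) ≤
      ENNReal.ofReal (2 * (m : ℝ) ^ (1 / X.exponent.toReal)) :=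
    ENNReal.ofReal_le_ofReal (le_mul_of_one_le_left (by positivity) one_le_two)
  cases X with
  | lebesgue p => exact (eLpNorm_testFn_le h1).trans h2
  | hardy =>
    refine le_trans ?_ h2
    simpa [Space.exponent, Space.norm] using hardyNorm_testFn_le (m := m)
  | dyadicHardy => simpa [Space.exponent, Space.norm] using dyadicHardyNorm_testFn_le (m := m)
  | bmo =>
    have h3 := eLpNorm_testFn_le (p := ∞) (m := m) le_top
    simp only [Space.exponent, Space.norm, ENNReal.toReal_top, div_zero, Real.rpow_zero, mul_one]
    refine (bmoNorm_le_of_norm_le_one integrable_testFn.locallyIntegrable fun x => ?_).trans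
      (by simp)
    by_cases h : ∃ l < m, x ∈ (shell l).toSet
    · obtain ⟨l, hl, hx⟩ := h
      rw [← ofReal_norm, norm_testFn_of_mem hl hx]
      simp
    · push Not at h
      rw [testFn_eq_zero h, enorm_zero]
      exact zero_le
  | dyadicBMO => exact absurd rfl hX

lemma Space.mem_testFn {X : Space} (hX : X ≠ .dyadicBMO) (h1 : 1 ≤ X.exponent) (m : ℕ) :
    X.Mem (testFn (1 / X.exponent.toReal) m) := by
  have h2 := (Space.norm_testFn_le hX h1 m).trans_lt ENNReal.ofReal_lt_top
  cases X with
  | lebesgue p => exact ⟨integrable_testFn.aestronglyMeasurable, h2⟩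
  | hardy => exact ⟨memLp_one_iff_integrable.2 integrable_testFn, h2⟩
  | dyadicHardy => exact ⟨memLp_one_iff_integrable.2 integrable_testFn, h2⟩
  | bmo => exact ⟨integrable_testFn.locallyIntegrable, h2⟩
  | dyadicBMO => exact absurd rfl hX

end Paraproduct

/-! ### Failure of the strong type inequality with an L¹ slot. -/

namespace Paraproduct

open DyadicInterval

lemma normalized_wave (b : ℝ) (I : DyadicInterval) (x : ℝ) : normalized (wave b) I x =
    ((bumpConst * (I.length)⁻¹ * bump (4 / I.length * (x - I.left) - b) : ℝ) : ℂ) := by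
  have h : I.length ^ (-(1 / 2 : ℝ)) * I.length ^ (-(1 / 2 : ℝ)) = (I.length)⁻¹ := by
    rw [← Real.rpow_add I.length_pos]
    norm_num
    exact Real.rpow_neg_one _
  rw [normalized, wave, ← Complex.ofReal_mul, ← h]
  congr 1
  ring

/-- On `base k`, `wave 3` is supported in the right half, which is the `k`-th shell, and is odd
about its center. The Haar function of the shell changes sign at the same point, so the product has
constant sign and no cancellation occurs. -/
lemma testFn_mul_wave {e : ℝ} {m k : ℕ} (hk : k < m) (x : ℝ) :
    testFn e m x * (starRingEnd ℂ) (normalized (wave 3) (base k) x) =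
      ((-((2 : ℝ) ^ (k * e) * bumpConst * ((base k).length)⁻¹) *
        |bump (4 / (base k).length * (x - (base k).left) - 3)| : ℝ) : ℂ) := by
  rw [normalized_wave, Complex.conj_ofReal]
  have hl := (base k).length_pos
  set I := base k with hI
  have hlen : (shell k).length = I.length / 2 := by rw [← rightHalf_base, length_rightHalf]
  have hleft : (shell k).left = I.left + I.length / 2 := by
    rw [left_shell, hlen, hI, left_base, zero_add]
  by_cases hx : x ∈ (shell k).toSet
  · rw [testFn_of_mem hk hx]
    have hx' := hx
    rw [← leftHalf_union_rightHalf] at hx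
    have h4 : 4 / I.length * (x - I.left) = 4 * ((x - I.left) / I.length) := by ring
    rcases hx with hx | hx
    · rw [normalized_haar_of_mem_left hx]
      rw [toSet_leftHalf, center, hleft, hlen] at hx
      have h3 : (x - I.left) / I.length ≤ 3 / 4 := by
        rw [div_le_iff₀ hl]; linarith [hx.2]
      have hb : bump (4 / I.length * (x - I.left) - 3) ≤ 0 :=
        mul_nonpos_of_nonneg_of_nonpos (by positivity) (by rw [h4]; linarith)
      rw [abs_of_nonpos hb, hlen, ← Complex.ofReal_mul, ← Complex.ofReal_mul]
      congr 1
      field_simp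
    · rw [normalized_haar_of_mem_right hx]
      rw [toSet_rightHalf, center, hleft, hlen] at hx
      have h3 : 3 / 4 ≤ (x - I.left) / I.length := by
        rw [le_div_iff₀ hl]; linarith [hx.1]
      have hb : 0 ≤ bump (4 / I.length * (x - I.left) - 3) :=
        mul_nonneg (by positivity) (by rw [h4]; linarith)
      rw [abs_of_nonneg hb, hlen, ← Complex.ofReal_neg, ← Complex.ofReal_mul, ← Complex.ofReal_mul]
      congr 1
      field_simp
  · have hb : bump (4 / I.length * (x - I.left) - 3) = 0 := by
      refine bump_eq_zero ?_
      by_contra hcon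
      push Not at hcon
      rw [abs_lt] at hcon
      have h4 : 4 / I.length * (x - I.left) = 4 * ((x - I.left) / I.length) := by ring
      rw [h4] at hcon
      refine hx ⟨?_, ?_⟩
      · have : 1 / 2 ≤ (x - I.left) / I.length := by linarith [hcon.1]
        rw [le_div_iff₀ hl] at this
        rw [hleft]; linarith
      · have : (x - I.left) / I.length < 1 := by linarith [hcon.2]
        rw [div_lt_iff₀ hl] at this
        rw [hleft, hlen]; linarith
    rw [hb]
    simp

lemma coef_testFn_wave {e : ℝ} {m k : ℕ} (hk : k < m) :
    coef (testFn e m) (normalized (wave 3)) (base k) =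
      ENNReal.ofReal (bumpConst * (∫ u, |bump u|) / 4 * (2 : ℝ) ^ (k * e)) := by
  have hl := (base k).length_pos
  have hc := bumpConst_pos
  have hint := integral_abs_bump_pos
  have h : pairing (testFn e m) (normalized (wave 3) (base k)) =
      ((-(bumpConst * (∫ u, |bump u|) / 4 * (2 : ℝ) ^ (k * e)) : ℝ) : ℂ) := by
    unfold pairing
    simp_rw [testFn_mul_wave hk]
    refine (integral_ofReal (𝕜 := ℂ)).trans (congrArg Complex.ofReal ?_)
    refine (integral_const_mul _ _).trans ?_
    rw [integral_comp_affine fun u => |bump u|]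
    field_simp
  rw [coef, h, ← ofReal_norm, Complex.norm_real, norm_neg, Real.norm_of_nonneg (by positivity)]

/-- The normalized characteristic function of a dyadic interval. -/
noncomputable def meanFn (Q : DyadicInterval) : ℝ → ℂ :=
  Q.toSet.indicator fun _ => (((Q.length)⁻¹ : ℝ) : ℂ)

lemma eLpNorm_meanFn (Q : DyadicInterval) : eLpNorm (meanFn Q) 1 volume = 1 := by
  have hl := Q.length_pos
  rw [meanFn, eLpNorm_indicator_const (measurableSet_toSet _) one_ne_zero ENNReal.one_ne_top,
    volume_toSet, ← ofReal_norm, Complex.norm_real, Real.norm_of_nonneg (by positivity)]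
  simp only [ENNReal.toReal_one, div_one, ENNReal.rpow_one]
  rw [← ENNReal.ofReal_mul (by positivity), inv_mul_cancel₀ hl.ne', ENNReal.ofReal_one]

lemma memLp_meanFn (Q : DyadicInterval) : MemLp (meanFn Q) 1 volume :=
  ⟨(measurable_const.indicator (measurableSet_toSet _)).aestronglyMeasurable, by
    rw [eLpNorm_meanFn]; exact ENNReal.one_lt_top⟩

/-- `wave (1 / 2)` does not vanish at the left end point of its interval, which is 0 for every `base
k`. The mean over an interval at most `1 / 16` as long acts as a point mass there for all `k < m` at
once: the argument of the bump stays in `[-1/2, -1/4]`, where the bump is at most `-1/8`. -/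
lemma le_coef_meanFn_wave {m k : ℕ} (hk : k < m) : ENNReal.ofReal (bumpConst / 8 * 2 ^ k) ≤
    coef (meanFn (base (m + 4))) (normalized (wave (1 / 2))) (base k) := by
  have hc := bumpConst_pos
  set Q := base (m + 4) with hQ
  set I := base k with hI
  have hl := I.length_pos
  have hq := Q.length_pos
  have hIl : (I.length)⁻¹ = 2 ^ k := by rw [hI, length_base, inv_inv]
  have hQI : 16 * Q.length ≤ I.length := by
    rw [hQ, hI, length_base, length_base, pow_add, mul_inv]
    have : ((2 : ℝ) ^ m)⁻¹ ≤ ((2 : ℝ) ^ k)⁻¹ := by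
      gcongr
      norm_num
    linarith
  set g : ℝ → ℝ := fun x => (Q.length)⁻¹ * (bumpConst * (I.length)⁻¹ *
    -bump (4 / I.length * (x - I.left) - 1 / 2)) with hg
  have hcont : Continuous g := by
    have := continuous_bump
    rw [hg]
    fun_prop
  have hgQ : ∀ x ∈ Q.toSet, (Q.length)⁻¹ * (bumpConst * (I.length)⁻¹ * (1 / 8)) ≤ g x := by
    intro x hx
    rw [toSet, hQ, left_base, ← hQ, zero_add] at hx
    have h0 : 0 ≤ x / I.length := div_nonneg hx.1 hl.le
    have h1 : x / I.length ≤ 1 / 16 := by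
      rw [div_le_iff₀ hl]; linarith [hx.2]
    have hu : 4 / I.length * (x - I.left) - 1 / 2 = 4 * (x / I.length) - 1 / 2 := by
      rw [hI, left_base]; ring
    have hb : 1 / 8 ≤ -bump (4 / I.length * (x - I.left) - 1 / 2) := by
      rw [hu, bump]
      set v := 4 * (x / I.length) - 1 / 2 with hv
      have hv1 : -(1 / 2) ≤ v := by linarith
      have hv2 : v ≤ -(1 / 4) := by linarith
      have hsq : v ^ 2 ≤ 1 / 4 := by nlinarith
      rw [max_eq_right (by linarith)]
      have h34 : (9 / 16 : ℝ) ≤ (1 - v ^ 2) ^ 2 := by nlinarith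
      nlinarith
    simp only [hg]
    gcongr
  have hpair : pairing (meanFn Q) (normalized (wave (1 / 2)) I) =
      ((-∫ x in Q.toSet, g x : ℝ) : ℂ) := by
    rw [← integral_neg, ← integral_indicator (measurableSet_toSet _)]
    refine Eq.trans ?_ (integral_ofReal (𝕜 := ℂ))
    refine integral_congr_ae (Eventually.of_forall fun x => ?_)
    simp only [meanFn, normalized_wave, Complex.conj_ofReal]
    by_cases hx : x ∈ Q.toSet
    · rw [Set.indicator_of_mem hx, Set.indicator_of_mem hx, ← Complex.ofReal_mul]
      refine congrArg Complex.ofReal (Eq.trans ?_ (rfl : -g x = _))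
      simp only [hg]
      ring
    · rw [Set.indicator_of_notMem hx, Set.indicator_of_notMem hx, zero_mul]
      exact Complex.ofReal_zero.symm
  have hlow : bumpConst / 8 * 2 ^ k ≤ ∫ x in Q.toSet, g x := by
    have h1 : ∫ _ in Q.toSet, (Q.length)⁻¹ * (bumpConst * (I.length)⁻¹ * (1 / 8)) ≤
        ∫ x in Q.toSet, g x := by
      refine setIntegral_mono_on (integrableOn_const (by simp)) ?_ (measurableSet_toSet _) hgQ
      exact (hcont.continuousOn.integrableOn_Icc (a := Q.left) (b := Q.left + Q.length)).mono_set
        Set.Ico_subset_Icc_self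
    refine le_trans (le_of_eq ?_) h1
    rw [setIntegral_const, measureReal_def, volume_toSet, ENNReal.toReal_ofReal hq.le, smul_eq_mul,
      ← hIl]
    field_simp
  rw [coef, hpair, ← ofReal_norm, Complex.norm_real, norm_neg]
  exact ENNReal.ofReal_le_ofReal (hlow.trans (le_abs_self _))

/-- If `g` is at least `A 2 ^ (k / s)` on the `k`-th shell for `k < m`, then its norm in `L^s`
is at least `A (m / 2) ^ (1 / s)`. -/
lemma le_eLpNorm_of_le_on_shells {g : ℝ → ℝ≥0∞} {s : ℝ≥0∞} (hs0 : s ≠ 0) (hs : s ≠ ∞) {A : ℝ}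
    (hA : 0 ≤ A) {m : ℕ} (h : ∀ k < m, ∀ x ∈ (shell k).toSet,
      ENNReal.ofReal (A * (2 : ℝ) ^ (k * (1 / s.toReal))) ≤ g x) :
    ENNReal.ofReal (A * ((m : ℝ) / 2) ^ (1 / s.toReal)) ≤ eLpNorm g s volume := by
  have hsp : 0 < s.toReal := ENNReal.toReal_pos hs0 hs
  have hpt : ∀ k < m, ∀ x ∈ (shell k).toSet,
      ENNReal.ofReal (A ^ s.toReal) * ENNReal.ofReal (2 ^ k) ≤ g x ^ s.toReal := by
    intro k hk x hx
    refine le_trans (le_of_eq ?_) (ENNReal.rpow_le_rpow (h k hk x hx) hsp.le)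
    rw [ENNReal.ofReal_rpow_of_nonneg (by positivity) hsp.le, Real.mul_rpow hA (by positivity),
      ← Real.rpow_mul two_pos.le, mul_assoc, one_div_mul_cancel hsp.ne', mul_one,
      Real.rpow_natCast, ENNReal.ofReal_mul (by positivity)]
  have hint : ENNReal.ofReal (A ^ s.toReal * (m / 2)) ≤ ∫⁻ x, g x ^ s.toReal := by
    calc ENNReal.ofReal (A ^ s.toReal * (m / 2))
        = ∑ k ∈ Finset.range m, ENNReal.ofReal (A ^ s.toReal) *
            (ENNReal.ofReal (2 ^ k) * volume (shell k).toSet) := by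
          simp_rw [ofReal_two_pow_mul_volume_shell]
          rw [Finset.sum_const, Finset.card_range, nsmul_eq_mul,
            ← ENNReal.ofReal_mul (by positivity), ← ENNReal.ofReal_natCast,
            ← ENNReal.ofReal_mul (by positivity)]
          congr 1
          ring
      _ = ∑ k ∈ Finset.range m, ∫⁻ _ in (shell k).toSet,
            ENNReal.ofReal (A ^ s.toReal) * ENNReal.ofReal (2 ^ k) := by
          simp_rw [setLIntegral_const, mul_assoc]
      _ ≤ ∑ k ∈ Finset.range m, ∫⁻ x in (shell k).toSet, g x ^ s.toReal :=
          Finset.sum_le_sum fun k hk =>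
            setLIntegral_mono' (measurableSet_toSet _) (hpt k (Finset.mem_range.1 hk))
      _ = ∫⁻ x in ⋃ k ∈ Finset.range m, (shell k).toSet, g x ^ s.toReal := by
          refine (lintegral_biUnion_finset ?_ (fun _ _ => measurableSet_toSet _) _).symm
          exact fun k _ l _ hne => Set.disjoint_left.2 fun x hx hx' => hne (shell_injective hx hx')
      _ ≤ ∫⁻ x, g x ^ s.toReal := setLIntegral_le_lintegral _ _
  rw [eLpNorm_eq_lintegral_rpow_enorm_toReal hs0 hs]
  simp only [enorm_eq_self]
  refine le_trans (le_of_eq ?_) (ENNReal.rpow_le_rpow hint (by positivity))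
  rw [ENNReal.ofReal_rpow_of_nonneg (by positivity) (by positivity),
    Real.mul_rpow (by positivity) (by positivity), ← Real.rpow_mul hA, mul_one_div_cancel hsp.ne',
    Real.rpow_one]

open Classical in
/-- The families of functions for which the strong type inequality fails. -/
noncomputable def waveFamily {n : ℕ} (X : Fin n → Space) (j : Fin n) : DyadicInterval → ℝ → ℂ :=
  if X j = .lebesgue 1 then wave (1 / 2) else wave 3

lemma exists_waveFamily_eq {n : ℕ} (X : Fin n → Space) (j : Fin n) :
    ∃ b : ℝ, 1 / 2 ≤ b ∧ b ≤ 3 ∧ waveFamily X j = wave b := by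
  unfold waveFamily
  split_ifs
  · exact ⟨1 / 2, le_rfl, by norm_num, rfl⟩
  · exact ⟨3, by norm_num, le_rfl, rfl⟩

open Classical in
/-- The functions for which the strong type inequality fails. -/
noncomputable def testFamily {n : ℕ} (X : Fin n → Space) (m : ℕ) (j : Fin n) : ℝ → ℂ :=
  if X j = .lebesgue 1 then meanFn (base (m + 4)) else testFn (1 / (X j).exponent.toReal) m

section Family

variable {n : ℕ} {X : Fin n → Space}

lemma mem_testFamily (hX : ∀ j, X j ≠ .dyadicBMO) (h1 : ∀ j, 1 ≤ (X j).exponent) (m : ℕ)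
    (j : Fin n) : (X j).Mem (testFamily X m j) := by
  unfold testFamily
  split_ifs with h
  · rw [h]
    exact memLp_meanFn _
  · exact Space.mem_testFn (hX j) (h1 j) m

open Classical in
lemma norm_testFamily_le (hX : ∀ j, X j ≠ .dyadicBMO) (h1 : ∀ j, 1 ≤ (X j).exponent) (m : ℕ)
    (j : Fin n) : (X j).norm (testFamily X m j) ≤ ENNReal.ofReal (2 * (m : ℝ) ^
      (if X j = .lebesgue 1 then 0 else 1 / (X j).exponent.toReal)) := by
  unfold testFamily
  split_ifs with h
  · rw [h]
    refine (eLpNorm_meanFn _).le.trans ?_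
    rw [Real.rpow_zero]
    norm_num
  · exact Space.norm_testFn_le (hX j) (h1 j) m

lemma exists_le_coef_testFamily (X : Fin n → Space) : ∃ c : ℝ, 0 < c ∧
    ∀ (m k : ℕ), k < m → ∀ j,
      ENNReal.ofReal (c * (2 : ℝ) ^ (k * (1 / (X j).exponent.toReal))) ≤
        coef (testFamily X m j) (normalized (waveFamily X j)) (base k) := by
  have hb := bumpConst_pos
  have hi := integral_abs_bump_pos
  refine ⟨min (bumpConst / 8) (bumpConst * (∫ u, |bump u|) / 4), lt_min (by positivity)
    (by positivity), fun m k hk j => ?_⟩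
  unfold testFamily waveFamily
  split_ifs with h
  · refine le_trans (ENNReal.ofReal_le_ofReal ?_) (le_coef_meanFn_wave hk)
    rw [h, Space.exponent, ENNReal.toReal_one, div_one, mul_one, Real.rpow_natCast]
    exact mul_le_mul_of_nonneg_right (min_le_left _ _) (by positivity)
  · rw [coef_testFn_wave hk]
    exact ENNReal.ofReal_le_ofReal (mul_le_mul_of_nonneg_right (min_le_right _ _) (by positivity))

/-- On the `k`-th shell the term of `base k` alone suffices. Its factors are at least of order `2 ^
(k / p_j)`, the exponents add up to `k / s`, and each of the `m` shells contributes equally to the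
lower bound. -/
lemma exists_le_eLpNorm_testFamily (X : Fin n → Space) (h1 : ∀ j, 1 ≤ (X j).exponent)
    (hs : targetExponent X < ∞) : ∃ c : ℝ, 0 < c ∧ ∀ m : ℕ,
      ENNReal.ofReal (c * ((m : ℝ) / 2) ^ (1 / (targetExponent X).toReal)) ≤
        eLpNorm (sublinearOp (waveFamily X) (testFamily X m)) (targetExponent X) volume := by
  obtain ⟨c, hc, h⟩ := exists_le_coef_testFamily X
  refine ⟨c ^ n, by positivity, fun m => le_eLpNorm_of_le_on_shells (targetExp_ne_zero h1) hs.ne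
    (by positivity) fun k hk x hx => ?_⟩
  rw [sublinearOp_eq]
  refine le_trans ?_ (ENNReal.le_tsum (base k))
  rw [Set.indicator_of_mem (shell_subset_base k hx)]
  refine le_trans (le_of_eq ?_) (Finset.prod_le_prod' fun j _ => h m k hk j)
  rw [← ENNReal.ofReal_prod_of_nonneg fun j _ => by positivity, Finset.prod_mul_distrib,
    Finset.prod_const, Finset.card_univ, Fintype.card_fin,
    ← Real.rpow_sum_of_pos two_pos, ← Finset.mul_sum]
  rw [one_div_toReal_eq_sum h1]

/-- An L¹ slot contributes a norm bounded independently of `m`, where its exponent alone would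
permit a factor `m`. One such slot lowers the total exponent from `1 / s` to at most `1 / s - 1`. -/
lemma prod_norm_testFamily_le (hX : ∀ j, X j ≠ .dyadicBMO) (h1 : ∀ j, 1 ≤ (X j).exponent)
    (hex : ∃ j, X j = .lebesgue 1) {m : ℕ} (hm : 1 ≤ m) :
    ∏ j, (X j).norm (testFamily X m j) ≤
      ENNReal.ofReal (2 ^ n * (m : ℝ) ^ (1 / (targetExponent X).toReal - 1)) := by
  classical
  obtain ⟨i, hi⟩ := hex
  have hm' : (1 : ℝ) ≤ m := by exact_mod_cast hm
  refine (Finset.prod_le_prod' fun j _ => norm_testFamily_le hX h1 m j).trans ?_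
  rw [← ENNReal.ofReal_prod_of_nonneg fun j _ => by positivity, Finset.prod_mul_distrib,
    Finset.prod_const, Finset.card_univ, Fintype.card_fin,
    ← Real.rpow_sum_of_pos (by positivity), targetExponent, one_div_toReal_eq_sum h1]
  refine ENNReal.ofReal_le_ofReal (mul_le_mul_of_nonneg_left
    (Real.rpow_le_rpow_of_exponent_le hm' ?_) (by positivity))
  rw [← Finset.add_sum_erase _ _ (Finset.mem_univ i), ← Finset.add_sum_erase _ _ (Finset.mem_univ i),
    if_pos hi, hi, Space.exponent, ENNReal.toReal_one, div_one, zero_add, add_sub_cancel_left]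
  refine Finset.sum_le_sum fun j _ => ?_
  split_ifs
  · positivity
  · exact le_rfl

/-- The lower bound for the left side and the upper bound for the product of norms have a ratio
proportional to `m`, so a large `m` defeats any `C`. -/
lemma exists_lt_eLpNorm_testFamily (hX : ∀ j, X j ≠ .dyadicBMO) (h1 : ∀ j, 1 ≤ (X j).exponent)
    (hs : targetExponent X < ∞) (hex : ∃ j, X j = .lebesgue 1) (C : ℝ≥0) : ∃ m : ℕ,
    C * ∏ j, (X j).norm (testFamily X m j) <
      eLpNorm (sublinearOp (waveFamily X) (testFamily X m)) (targetExponent X) volume := by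
  obtain ⟨c, hc, h⟩ := exists_le_eLpNorm_testFamily X h1 hs
  set σ := 1 / (targetExponent X).toReal with hσ
  obtain ⟨m, hm⟩ := exists_nat_gt (C * 2 ^ n * 2 ^ σ / c)
  have hm0 : (0 : ℝ) < m := lt_of_le_of_lt (by positivity) hm
  have hm1 : 1 ≤ m := Nat.one_le_iff_ne_zero.2 fun h0 => by simp [h0] at hm0
  refine ⟨m, lt_of_le_of_lt (mul_le_mul' le_rfl (prod_norm_testFamily_le hX h1 hex hm1))
    (lt_of_lt_of_le ?_ (h m))⟩
  rw [← ENNReal.ofReal_coe_nnreal, ← ENNReal.ofReal_mul C.coe_nonneg, ← hσ,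
    ENNReal.ofReal_lt_ofReal_iff (by positivity), Real.rpow_sub hm0, Real.rpow_one,
    Real.div_rpow hm0.le two_pos.le]
  rw [div_lt_iff₀ hc] at hm
  have hmσ : 0 < (m : ℝ) ^ σ := by positivity
  have h2σ : 0 < (2 : ℝ) ^ σ := by positivity
  rw [show C * (2 ^ n * ((m : ℝ) ^ σ / m)) = (C * 2 ^ n * 2 ^ σ) * ((m : ℝ) ^ σ / (m * 2 ^ σ)) by
    field_simp, show c * ((m : ℝ) ^ σ / 2 ^ σ) = (m * c) * ((m : ℝ) ^ σ / (m * 2 ^ σ)) by field_simp]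
  exact mul_lt_mul_of_pos_right hm (by positivity)

/-- The strong type inequality fails if one of the spaces is `L¹`. -/
lemma exists_not_strong_type (hX : ∀ j, X j ≠ .dyadicBMO) (h1 : ∀ j, 1 ≤ (X j).exponent)
    (hs : targetExponent X < ∞) (hex : ∃ j, X j = .lebesgue 1) :
    ∃ φ : Fin n → DyadicInterval → ℝ → ℂ,
      (∀ N : ℕ, ∃ K : ℝ, ∀ j I, IsAdapted K N I (φ j I)) ∧
      (∀ j I, eLpNorm (φ j I) 2 volume = 1) ∧
      (∀ j, HasMeanZero (φ j)) ∧
      ∀ C : ℝ≥0, ∃ f : Fin n → ℝ → ℂ, (∀ j, (X j).Mem (f j)) ∧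
        C * ∏ j, (X j).norm (f j) < eLpNorm (sublinearOp φ f) (targetExponent X) volume := by
  choose b hb1 hb3 hb using exists_waveFamily_eq X
  refine ⟨waveFamily X, fun N => ⟨20 * bumpConst * 2 ^ N, fun j I => ?_⟩, fun j I => ?_,
    fun j I => ?_, fun C => ?_⟩
  · rw [hb]
    exact isAdapted_wave (hb1 j) (hb3 j) N
  · rw [hb]
    exact eLpNorm_wave _ _
  · rw [hb]
    exact integral_wave _ _
  · obtain ⟨m, hm⟩ := exists_lt_eLpNorm_testFamily hX h1 hs hex C
    exact ⟨testFamily X m, mem_testFamily hX h1 m, hm⟩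

end Family

end Paraproduct

theorem theorem2p2 (n : ℕ) (hn : 3 ≤ n) (X : Fin n → Space)
    (hX : ∀ j, 1 ≤ (X j).exponent) (hs : targetExponent X < ∞) :
    -- families of adapted functions
    ((∀ j, X j ≠ .dyadicBMO) →
      -- strong type without an `L¹` slot, weak type with an `L¹` slot
      (∃ N : ℕ, ∀ K : ℝ, ∃ C : ℝ≥0, ∀ φ : Fin n → DyadicInterval → ℝ → ℂ,
        (∀ j I, IsAdapted K N I (φ j I)) →
        (∃ a b, a ≠ b ∧ HasMeanZero (φ a) ∧ HasMeanZero (φ b)) →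
        (∀ j, X j = .bmo → HasMeanZero (φ j)) →
        Bounds φ X C) ∧
      -- the strong type inequality is not true in general with an `L¹` slot
      ((∃ j, X j = .lebesgue 1) →
        ∃ φ : Fin n → DyadicInterval → ℝ → ℂ,
          (∀ N : ℕ, ∃ K : ℝ, ∀ j I, IsAdapted K N I (φ j I)) ∧
          (∀ j I, eLpNorm (φ j I) 2 volume = 1) ∧
          (∀ j, HasMeanZero (φ j)) ∧
          ∀ C : ℝ≥0, ∃ f : Fin n → ℝ → ℂ, (∀ j, (X j).Mem (f j)) ∧
            C * ∏ j, (X j).norm (f j) <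
              eLpNorm (sublinearOp φ f) (targetExponent X) volume)) ∧
    -- Haar functions and dyadic spaces
    ((∀ j, X j ≠ .hardy ∧ X j ≠ .bmo) →
      ∃ C : ℝ≥0, ∀ φ : Fin n → DyadicInterval → ℝ → ℂ,
        (∀ j, φ j = haar ∨ φ j = absHaar) →
        (∃ a b, a ≠ b ∧ φ a = haar ∧ φ b = haar) →
        (∀ j, X j = .dyadicBMO → φ j = haar) →
        Bounds φ X C) := by
  exact ⟨fun hX' => ⟨⟨5, exists_bounds_adapted (by omega) X hX hs hX'⟩,
      exists_not_strong_type hX' hX hs⟩,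
    exists_bounds_haar (by omega) X hX hs⟩
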